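/- **Exponential formula.** Let $\Omega\subset\mathbb R^d$ be open and convex, let $B_1,\dots,B_d$ and $v$ be smooth functions on $\Omega$ with values in the complex $m\times m$ matrices, and let $x,y\in\Omega$, $\xi=x-y$. Repeated Greek indices are summed. Put $D_\mu=\partial_\mu+B_\mu$, $F_{\mu\nu}=[D_\mu,D_\nu]$, $\nabla_\mu G=\partial_\mu G+[B_\mu,G]$, and let $$\Phi(x,y)=1+\sum_{k\ge1}(-1)^k\int_{1\ge s_1\ge\dots\ge s_k\ge0}(x-y)^{\mu_1}\cdots(x-y)^{\mu_k}\,B_{\mu_1}(z(s_1))\cdots B_{\mu_k}(z(s_k))\,ds,\qquad z(s)=(1-s)y+sx,$$ be the ordered exponential along the segment from $y$ to $x$. The connection and the potential in the Fock--Schwinger gauge based at $y$ are the functions of $\xi=x-y$ $$f_\mu(\xi)=\Phi(y,x)\big(\partial_{x^\mu}+B_\mu(x)\big)\Phi(x,y),\qquad V(\xi)=\Phi(y,x)\,v(x)\,\Phi(x,y),\tag{a}$$ and the heat coefficients in this gauge are $a_0=1$, $a_n(\xi)=-\int_0^1 s^{n-1}(A\,a_{n-1})(s\xi)\,ds$ for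 $n\ge1$, with $A=-(\partial_\mu+f_\mu)(\partial_\mu+f_\mu)-V$. For $\tau>0$ let $g(s,t)=\frac{2}{\tau}\min(s,t)\,(\tau-\max(s,t))$ be the Green's function of $-\frac12\frac{d^2}{ds^2}$ on $[0,\tau]$ with Dirichlet boundary conditions, let $b(\eta)=\frac12\int_0^\tau\!\int_0^\tau\eta_\mu(s)g(s,t)\eta_\mu(t)\,ds\,dt$, and let $$M(t)=-f_\mu\Big(\frac{\delta}{\delta\eta(t)}+\frac{t\xi}{\tau}\Big)\Big(\frac{d}{dt}\frac{\delta}{\delta\eta_\mu(t)}+\frac{\xi^\mu}{\tau}\Big)+V\Big(\frac{\delta}{\delta\eta(t)}+\frac{t\xi}{\tau}\Big),$$ where $h(\frac{\delta}{\delta\eta(t)}+p)=\sum_j\frac1{j!}(\partial_{\mu_1}\cdots\partial_{\mu_j}h)(p)\frac{\delta}{\delta\eta_{\mu_1}(t)}\cdots\frac{\delta}{\delta\eta_{\mu_j}(t)}$. Then, as formal power series in $\tau$, $$P_t\,e^{\int_0^\tau dt\,M(t)}\,e^{b(\eta)}\Big|_{\eta=0}=\sum_{k=0}^\infty\tau^k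 a_k(\xi).$$ Precisely: let $\rho\ge0$ be smooth and compactly supported on $\mathbb R$ with $\int\rho=1$, put $\delta_\varepsilon(s)=\varepsilon^{-1}\rho(s/\varepsilon)$, and let $M_\varepsilon(t)$ be the operator obtained from $M(t)$ when $\delta/\delta\eta_\mu(t)$ is replaced by the derivative of a functional in the direction $s\mapsto\delta_\varepsilon(s-t)e_\mu$ (so that $\delta\eta_\mu(s)/\delta\eta_\nu(t)=\delta_{\mu\nu}\delta_\varepsilon(s-t)$). For $n,j\ge0$ put $$T^\varepsilon_{n,j}(\tau)=\int_{\tau\ge t_1\ge\dots\ge t_n\ge0}M_\varepsilon(t_1)\cdots M_\varepsilon(t_n)\,\frac{b(\eta)^j}{j!}\Big|_{\eta=0}\,dt .$$ There are matrices $c_{njk}$, independent of $\tau$ and $\rho$, which vanish unless $j\le k\le n+j$ and $n\le 2k$, such that $\lim_{\varepsilon\to+0}T^\varepsilon_{n,j}(\tau)=\sum_k\tau^k c_{njk}$ for all $n,j$, all $\tau>0$ and all $\rho$, and such that $\sum_{n,j}c_{njk}=a_k(\xi)$ for every $k\ge0$. The same holds when (a) is replaced by the covariant Taylor series $$f_\mu(\xi)=\xi^\nu\partial_\nu\sum_{k\ge1}\frac{\xi^{\mu_1}\cdots\xi^{\mu_k}}{(k+1)!}\nabla_{\mu_1}\cdots\nabla_{\mu_{k-1}}F_{\mu_k\mu}(y),\qquad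 V(\xi)=\sum_{k\ge0}\frac{\xi^{\mu_1}\cdots\xi^{\mu_k}}{k!}\nabla_{\mu_1}\cdots\nabla_{\mu_k}v(y),$$ provided that the two series converge (absolutely, summed in $k$) to smooth functions on some open convex set that contains $0$ and $x-y$. -/

import Mathlib

open Filter Topology MeasureTheory
open scoped ContDiff Nat

attribute [local instance] Matrix.linftyOpNormedRing Matrix.linftyOpNormedAlgebra

noncomputable section

namespace HeatExp

/-- Euclidean space `ℝ^d`. -/
abbrev Sp (d : ℕ) : Type := EuclideanSpace ℝ (Fin d)

/-- Complex `m × m` matrices (the norm only serves to speak of limits, derivatives, integrals). -/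
abbrev Mat (m : ℕ) : Type := Matrix (Fin m) (Fin m) ℂ

variable {d m : ℕ}

/-- The `μ`-th standard basis vector. -/
def e (μ : Fin d) : Sp d := EuclideanSpace.single μ 1

/-- The partial derivative `∂_μ ψ`. -/
def pd (μ : Fin d) (ψ : Sp d → Mat m) (x : Sp d) : Mat m := fderiv ℝ ψ x (e μ)

/-! ### The ordered exponential along a segment and the Fock-Schwinger gauge -/

/-- The terms of the ordered exponential along `z(s) = (1-s) y + s x`, up to parameter `s`:
`(-1)^k ∫_0^s dz^{μ₁}(s₁) … ∫_0^{s_{k-1}} dz^{μ_k}(s_k) B_{μ₁}(z(s₁)) … B_{μ_k}(z(s_k))`,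
where `dz^μ(s) = (x - y)^μ ds`. -/
def wilsonTerm (B : Fin d → Sp d → Mat m) (x y : Sp d) : ℕ → ℝ → Mat m
  | 0, _ => 1
  | k + 1, s => -∫ r in (0 : ℝ)..s,
      (∑ μ, (x - y) μ • B μ ((1 - r) • y + r • x)) * wilsonTerm B x y k r

/-- The path-ordered exponential `Φ(x, y)` of the connection `B` along the segment
from `y` to `x`. -/
def wilson (B : Fin d → Sp d → Mat m) (x y : Sp d) : Mat m :=
  ∑' k, wilsonTerm B x y k 1

/-- The connection in the Fock-Schwinger gauge based at `y`, as a function of `ξ = x - y`: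
`f_μ^{FS}(x - y, y) = Φ(y, x) (∂_{x^μ} Φ(x, y) + B_μ(x) Φ(x, y))`. -/
def gaugeConn (B : Fin d → Sp d → Mat m) (y : Sp d) (μ : Fin d) (ξ : Sp d) : Mat m :=
  wilson B y (y + ξ) *
    (pd μ (fun x => wilson B x y) (y + ξ) + B μ (y + ξ) * wilson B (y + ξ) y)

/-- The potential in the Fock-Schwinger gauge based at `y`, as a function of `ξ = x - y`:
`V(x - y, y) = Φ(y, x) v(x) Φ(x, y)`. -/
def gaugePot (B : Fin d → Sp d → Mat m) (v : Sp d → Mat m) (y ξ : Sp d) : Mat m :=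
  wilson B y (y + ξ) * v (y + ξ) * wilson B (y + ξ) y

/-! ### The covariant Taylor series -/

/-- The field strength `F_{μν} = [D_μ, D_ν] = ∂_μ B_ν - ∂_ν B_μ + [B_μ, B_ν]`. -/
def fieldStrength (B : Fin d → Sp d → Mat m) (μ ν : Fin d) (x : Sp d) : Mat m :=
  pd μ (B ν) x - pd ν (B μ) x + (B μ x * B ν x - B ν x * B μ x)

/-- The adjoint covariant derivative `∇_μ G = ∂_μ G + [B_μ, G]`. -/
def nabla (B : Fin d → Sp d → Mat m) (μ : Fin d) (G : Sp d → Mat m) (x : Sp d) : Mat m :=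
  pd μ G x + (B μ x * G x - G x * B μ x)

/-- `∇_{α₁} … ∇_{α_k} G`. -/
def nablaIter (B : Fin d → Sp d → Mat m) :
    (k : ℕ) → (Fin k → Fin d) → (Sp d → Mat m) → Sp d → Mat m
  | 0, _, G => G
  | k + 1, α, G => nabla B (α 0) (nablaIter B k (Fin.tail α) G)

/-- The term with `k + 1` powers of `ξ` in the series of `f_μ(ξ, y)`:
`ξ^{μ₁} … ξ^{μ_{k+1}} / (k+2)! · ∇_{μ₁} … ∇_{μ_k} F_{μ_{k+1} μ}(y)`. -/
def radialTerm (B : Fin d → Sp d → Mat m) (y : Sp d) (μ : Fin d) (ξ : Sp d) (k : ℕ) : Mat m :=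
  (((k + 2)! : ℕ) : ℝ)⁻¹ • ∑ α : Fin (k + 1) → Fin d, (∏ i, ξ (α i)) •
    nablaIter B k (fun i => α i.castSucc) (fieldStrength B (α (Fin.last k)) μ) y

/-- `f_μ(ξ, y)`, the sum of its series. -/
def radialConn (B : Fin d → Sp d → Mat m) (y : Sp d) (μ : Fin d) (ξ : Sp d) : Mat m :=
  ∑' k, radialTerm B y μ ξ k

/-- `f_μ^{FS}(ξ, y) = ξ^ν ∂_ν f_μ(ξ, y)`, with `f_μ` given by its series. -/
def seriesConn (B : Fin d → Sp d → Mat m) (y : Sp d) (μ : Fin d) (ξ : Sp d) : Mat m :=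
  ∑ ν, ξ ν • pd ν (radialConn B y μ) ξ

/-- The term with `k` powers of `ξ` in the series of `V(ξ, y)`:
`ξ^{μ₁} … ξ^{μ_k} / k! · ∇_{μ₁} … ∇_{μ_k} v(y)`. -/
def potTerm (B : Fin d → Sp d → Mat m) (v : Sp d → Mat m) (y ξ : Sp d) (k : ℕ) : Mat m :=
  ((k ! : ℕ) : ℝ)⁻¹ • ∑ α : Fin k → Fin d, (∏ i, ξ (α i)) • nablaIter B k α v y

/-- `V(ξ, y)`, given by its series. -/
def seriesPot (B : Fin d → Sp d → Mat m) (v : Sp d → Mat m) (y ξ : Sp d) : Mat m :=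
  ∑' k, potTerm B v y ξ k

/-! ### The heat coefficients

Below `f` and `V` stand for the functions `ξ ↦ f^{FS}(ξ, y)` and `ξ ↦ V(ξ, y)`. -/

/-- `(∂ + f)_μ ψ`. -/
def covD (f : Fin d → Sp d → Mat m) (μ : Fin d) (ψ : Sp d → Mat m) (ξ : Sp d) : Mat m :=
  pd μ ψ ξ + f μ ξ * ψ ξ

/-- The Laplace operator `-(∂ + f)_μ (∂ + f)^μ - V`. -/
def lap (f : Fin d → Sp d → Mat m) (V : Sp d → Mat m) (ψ : Sp d → Mat m) (ξ : Sp d) : Mat m :=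
  -(∑ μ, covD f μ (covD f μ ψ) ξ) - V ξ * ψ ξ

/-- The heat coefficients as functions of `ξ = x - y`:
`a_0 = 1`, `a_n(ξ) = -∫_0^1 ds s^{n-1} (A a_{n-1})(s ξ)`. Iterating and substituting
`s_j = s s' s'' …` turns this into the ordered integral
`(-1)^n ∫_0^1 ds_n … ∫_0^{s₂} ds_1 A(s_n ξ) … A(s_1 ξ) · 1`. -/
def heatCoeff (f : Fin d → Sp d → Mat m) (V : Sp d → Mat m) : ℕ → Sp d → Mat m
  | 0, _ => 1
  | n + 1, ξ => -∫ s in (0 : ℝ)..1, s ^ n • lap f V (heatCoeff f V n) (s • ξ)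

/-! ### Green's function, sources and functional derivatives -/

/-- Green's function of `-½ d²/ds²` on `[0, τ]` with Dirichlet boundary conditions. -/
def green (τ s t : ℝ) : ℝ :=
  if s ≤ t then 2 * s / τ * (τ - t) else 2 * t / τ * (τ - s)

/-- A source `η = (η_1, …, η_d)`. Only smooth sources enter below, since all functionals are
evaluated at finite linear combinations of smooth functions. -/
abbrev Source (d : ℕ) : Type := ℝ → Sp d

/-- Matrix-valued functionals of the source. -/
abbrev Functional (d m : ℕ) : Type := Source d → Mat m

/-- `b(η) = ½ ∫_0^τ ∫_0^τ ds dt η_μ(s) g(s,t) η^μ(t)`. -/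
def bFun (τ : ℝ) (η : Source d) : ℝ :=
  1 / 2 * ∫ s in (0 : ℝ)..τ, ∫ t in (0 : ℝ)..τ, ∑ μ, η s μ * green τ s t * η t μ

/-- A mollifier: smooth, compactly supported, nonnegative, of integral one. -/
structure IsMollifier (ρ : ℝ → ℝ) : Prop where
  smooth : ContDiff ℝ ∞ ρ
  compact : HasCompactSupport ρ
  nonneg : ∀ s, 0 ≤ ρ s
  integral_eq_one : ∫ s, ρ s = 1

/-- The approximate delta function `δ_ε(s) = ε⁻¹ ρ(s/ε)`. -/
def approxDelta (ρ : ℝ → ℝ) (ε s : ℝ) : ℝ := ε⁻¹ * ρ (s / ε)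

/-- The functional derivative `δ/δη_μ(t)`, regularised: the derivative of the functional in the
direction `s ↦ δ_ε(s - t) e_μ`; thus `δη_μ(s)/δη_ν(t) = δ_{μν} δ_ε(s - t)`. -/
def funDeriv (ρ : ℝ → ℝ) (ε : ℝ) (μ : Fin d) (t : ℝ) (P : Functional d m) : Functional d m :=
  fun η => lineDeriv ℝ P η (fun s => approxDelta ρ ε (s - t) • e μ)

/-- `d/dt δ/δη_μ(t)`, regularised. -/
def dtFunDeriv (ρ : ℝ → ℝ) (ε : ℝ) (μ : Fin d) (t : ℝ) (P : Functional d m) :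
    Functional d m :=
  fun η => deriv (fun r => funDeriv ρ ε μ r P η) t

/-- `δ/δη_{α₁}(t) … δ/δη_{α_j}(t)`, regularised. -/
def funDerivIter (ρ : ℝ → ℝ) (ε t : ℝ) :
    (j : ℕ) → (Fin j → Fin d) → Functional d m → Functional d m
  | 0, _, P => P
  | j + 1, α, P => funDeriv ρ ε (α 0) t (funDerivIter ρ ε t j (Fin.tail α) P)

/-- The operator `h(δ/δη(t) + p)`, through the Taylor expansion of `h` at `p`:
`Σ_j 1/j! (∂_{α₁} … ∂_{α_j} h)(p) δ/δη_{α₁}(t) … δ/δη_{α_j}(t)`. On a polynomial functional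
only finitely many terms are nonzero. -/
def taylorOp (ρ : ℝ → ℝ) (ε t : ℝ) (h : Sp d → Mat m) (p : Sp d) (P : Functional d m) :
    Functional d m :=
  fun η => ∑' j : ℕ, ((j ! : ℕ) : ℝ)⁻¹ • ∑ α : Fin j → Fin d,
    iteratedFDeriv ℝ j h p (fun i => e (α i)) * funDerivIter ρ ε t j α P η

/-- The operator
`M(δ/δη, ξ, t, τ) = -f_μ(δ/δη(t) + tξ/τ) (d/dt δ/δη_μ(t) + ξ^μ/τ) + V(δ/δη(t) + tξ/τ)`,
regularised. -/
def opM (f : Fin d → Sp d → Mat m) (V : Sp d → Mat m) (ρ : ℝ → ℝ) (ε : ℝ) (ξ : Sp d) (τ t : ℝ)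
    (P : Functional d m) : Functional d m :=
  fun η =>
    -(∑ μ, taylorOp ρ ε t (f μ) ((t / τ) • ξ)
        (fun η' => dtFunDeriv ρ ε μ t P η' + (ξ μ / τ) • P η') η)
      + taylorOp ρ ε t V ((t / τ) • ξ) P η

/-- The product `M(t₁) M(t₂) … M(t_n)` applied to a functional. -/
def opMProd (f : Fin d → Sp d → Mat m) (V : Sp d → Mat m) (ρ : ℝ → ℝ) (ε : ℝ) (ξ : Sp d)
    (τ : ℝ) : (n : ℕ) → (Fin n → ℝ) → Functional d m → Functional d m
  | 0, _, P => P
  | n + 1, t, P => opM f V ρ ε ξ τ (t 0) (opMProd f V ρ ε ξ τ n (Fin.tail t) P)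

/-- The ordered times `τ ≥ t₁ ≥ t₂ ≥ … ≥ t_n ≥ 0`. -/
def orderedTimes (τ : ℝ) (n : ℕ) : Set (Fin n → ℝ) :=
  {t | Antitone t ∧ ∀ i, t i ∈ Set.Icc 0 τ}

/-- The term of order `n` of the path-ordered exponential `P_t exp ∫_0^τ dt M`, applied to the
term of order `j` of `e^{b(η)}` and evaluated at `η = 0`, regularised:
`∫_{τ ≥ t₁ ≥ … ≥ t_n ≥ 0} M(t₁) … M(t_n) b(η)^j / j!` at `η = 0`. -/
def expTerm (f : Fin d → Sp d → Mat m) (V : Sp d → Mat m) (ρ : ℝ → ℝ) (ε : ℝ) (ξ : Sp d) (τ : ℝ)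
    (n j : ℕ) : Mat m :=
  ∫ t in orderedTimes τ n,
    opMProd f V ρ ε ξ τ n t (fun η => (bFun τ η ^ j / (j ! : ℕ)) • (1 : Mat m)) 0

/-- `P_t exp(∫_0^τ dt M(δ/δη, ξ, t, τ)) e^{b(η)}` at `η = 0` equals `Σ_k τ^k a_k` as a formal
series in `τ`: as the regularisation is removed, every term of the double expansion (order `n`
in `M`, order `j` in `b`) tends to a polynomial `Σ_k τ^k c_{njk}` in `τ`, for each `k` only
finitely many `c_{njk}` are nonzero, and they add up to `a_k`. The coefficients depend neither
on `τ` nor on the mollifier. -/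
def OrderedExpEqSeries (f : Fin d → Sp d → Mat m) (V : Sp d → Mat m) (ξ : Sp d)
    (a : ℕ → Mat m) : Prop :=
  ∃ c : ℕ → ℕ → ℕ → Mat m,
    (∀ n j k, c n j k ≠ 0 → j ≤ k ∧ k ≤ n + j ∧ n ≤ 2 * k) ∧
    (∀ τ : ℝ, 0 < τ → ∀ ρ : ℝ → ℝ, IsMollifier ρ → ∀ n j : ℕ,
      Tendsto (fun ε => expTerm f V ρ ε ξ τ n j) (𝓝[>] 0)
        (𝓝 (∑ k ∈ Finset.range (n + j + 1), τ ^ k • c n j k))) ∧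
    (∀ k, ∑ n ∈ Finset.range (2 * k + 1), ∑ j ∈ Finset.range (k + 1), c n j k = a k)

end HeatExp

end

noncomputable section

set_option linter.unusedSectionVars false

namespace HeatExp

section Generic

variable {d : ℕ} {𝔸 : Type} [NormedRing 𝔸] [NormedAlgebra ℝ 𝔸]

/-! ### Integrals depending smoothly on a parameter -/

section Parametric

variable {E M : Type} [NormedAddCommGroup E] [NormedSpace ℝ E] [FiniteDimensional ℝ E]
  [NormedAddCommGroup M] [NormedSpace ℝ M]

/-! The formula is a Feynman-Kac formula, treated order by order and without a measure on paths. The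
factor `e^b` generates the moments of a Brownian bridge on `[0, τ]` with covariance `g`. The
operator `M(t)` evaluates the vertex `V(x) - v_μ f_μ(x)` at the position and the velocity, at time
`t`, of the bridge added to the straight path `tξ/τ`.

Wick's theorem holds exactly before the regularisation is removed. Moving the multiplication by `b`
to the left of a product of vertices produces all contractions, and what is not contracted vanishes
at `η = 0`. Hence the integrand of order `(n, j)` is a divided power of a quadratic contraction
operator, applied to the product of the vertices along the straight path (`vopProd_mulQ_pow_apply`,
`opMProd_eq`). The covariances of positions and velocities are found by writing the Green form as an
`L²` product of primitives (`integral_mul_integral_green`, `IsBump.greenB_dir`).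

As `ε → 0` the covariances converge off coinciding times, except for the kernel in the covariance of
two velocities that tends to `2δ(t - s)`. A vertex is at most linear in its velocity. So the
divergent self-contractions drop out, no vertex takes part in two singular contractions, and where
velocity-position contractions have no limit they do not contribute. On ordered times only
neighbouring times can meet, and they meet at an end of the interval of integration. There half of
the `2δ` counts, for every mollifier, and each contact has weight one
(`IsBump.integral_contactK_self`, `RegFam.tendsto_simplexInt`). The limit is the iterated integral
`pathInt`.

This integral is evaluated by splitting off the largest time. By the Markov property of the bridge
(`limQuad_succ`) the later vertices depend on the earlier ones only through a position, and
integrating that position out is a heat flow. The velocity contractions of the first vertex give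
`(2t/τ) ∂_μ f_μ - (∂_μ f_μ)`. The background velocity `ξ/τ`, through the gauge condition `ξ^μ f_μ =
0` and the commutator of the coordinates with powers of the Laplacian, gives the missing `(2(τ -
t)/τ) ∂_μ f_μ`. The sum is free of `τ` (`wick_succ`). Contacts add `f_μ f_μ`. Altogether these terms
are `(∂ + f)² + V` minus the flat Laplacian, and the Laplacian comes from the heat flow.

Performing the time integrals yields explicit coefficients `Sm.coef` (`pathInt_wick`). They obey the
transport equation `Sm.euler_coef`. Summed over `n` and `j` it reads `(k + 1 + ξ·∂) a_{k+1} = -A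
a_k`, and its only solution smooth at the origin is the radial mean that defines the heat
coefficients (`Sm.coefSum_succ`).

It remains to reach this situation from the hypotheses. The gauge condition holds for (a) because
`Φ` is transported along the ray (`fderiv_wilson_left`), and for the covariant Taylor series because
`F` is antisymmetric (`sum_smul_radialTerm`). Both sides depend only on germs along the segment from
`0` to `ξ`, so cutoffs reduce everything to globally smooth data. The ordered exponential of smooth
data is smooth, since its directional derivatives are components of ordered exponentials over dual
numbers (`volt_jet`). -/

theorem hasFDerivAt_parametric_integral {h : E → ℝ → M}
    (hh : ContDiff ℝ 1 (Function.uncurry h)) (q : E) :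
    HasFDerivAt (fun q => ∫ u in (0 : ℝ)..1, h q u)
      (∫ u in (0 : ℝ)..1, fderiv ℝ (fun q => h q u) q) q := by
  have hd : ∀ p u, HasFDerivAt (fun q => h q u)
      ((fderiv ℝ (Function.uncurry h) (p, u)).comp (ContinuousLinearMap.inl ℝ E ℝ)) p := by
    intro p u
    have h1 : HasFDerivAt (fun q : E => (q, u)) (ContinuousLinearMap.inl ℝ E ℝ) p :=
      hasFDerivAt_prodMk_left p u
    exact ((hh.differentiable (by simp)).differentiableAt.hasFDerivAt (x := (p, u))).comp p h1
  have hc : Continuous fun z : E × ℝ =>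
      (fderiv ℝ (Function.uncurry h) z).comp (ContinuousLinearMap.inl ℝ E ℝ) :=
    (hh.continuous_fderiv (by simp)).clm_comp continuous_const
  have : ProperSpace E := FiniteDimensional.proper_real E
  -- Compactness of the closed ball times `[0, 1]` supplies the constant that dominates the
  -- derivative.
  obtain ⟨C, hC⟩ := (((isCompact_closedBall q 1).prod
    (isCompact_Icc (a := (0 : ℝ)) (b := 1))).image hc).isBounded.exists_norm_le
  have key := intervalIntegral.hasFDerivAt_integral_of_dominated_of_fderiv_le (𝕜 := ℝ)
    (μ := volume) (a := 0) (b := 1) (F := h) (x₀ := q) (s := Metric.ball q 1)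
    (F' := fun p u => (fderiv ℝ (Function.uncurry h) (p, u)).comp
      (ContinuousLinearMap.inl ℝ E ℝ)) (bound := fun _ => C)
    (Metric.ball_mem_nhds q one_pos)
    (Eventually.of_forall fun p => (Continuous.aestronglyMeasurable
      (hh.continuous.comp (Continuous.prodMk_right p))))
    (Continuous.intervalIntegrable (hh.continuous.comp (Continuous.prodMk_right q)) _ _)
    (Continuous.aestronglyMeasurable (hc.comp (Continuous.prodMk_right q)))
    (Eventually.of_forall fun u hu p hp => hC _ ⟨(p, u), ⟨Metric.ball_subset_closedBall hp, by
      rw [Set.uIoc_of_le zero_le_one] at hu; exact ⟨hu.1.le, hu.2⟩⟩, rfl⟩)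
    (by simp)
    (Eventually.of_forall fun u _ p _ => hd p u)
  have e : (fun u => fderiv ℝ (fun q => h q u) q) = fun u =>
      (fderiv ℝ (Function.uncurry h) (q, u)).comp (ContinuousLinearMap.inl ℝ E ℝ) := by
    funext u; exact (hd q u).fderiv
  rw [e]; exact key

omit [FiniteDimensional ℝ E] in
theorem contDiff_fderiv_left {h : E → ℝ → M} (hh : ContDiff ℝ ∞ (Function.uncurry h)) :
    ContDiff ℝ ∞ (Function.uncurry fun q u => fderiv ℝ (fun q => h q u) q) := by
  have hd : (Function.uncurry fun q u => fderiv ℝ (fun q => h q u) q) = fun z : E × ℝ =>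
      (fderiv ℝ (Function.uncurry h) z).comp (ContinuousLinearMap.inl ℝ E ℝ) := by
    funext ⟨p, u⟩
    have h1 : HasFDerivAt (fun q : E => (q, u)) (ContinuousLinearMap.inl ℝ E ℝ) p :=
      hasFDerivAt_prodMk_left p u
    exact (((hh.differentiable (by simp)).differentiableAt.hasFDerivAt
      (x := (p, u))).comp p h1).fderiv
  rw [hd]
  exact (hh.fderiv_right (by simp)).clm_comp contDiff_const

theorem fderiv_parametric_integral {h : E → ℝ → M} (hh : ContDiff ℝ ∞ (Function.uncurry h))
    (q : E) : fderiv ℝ (fun q => ∫ u in (0 : ℝ)..1, h q u) q =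
      ∫ u in (0 : ℝ)..1, fderiv ℝ (fun q => h q u) q :=
  (hasFDerivAt_parametric_integral (hh.of_le (by simp)) q).fderiv

theorem contDiff_parametric_integral {h : E → ℝ → M}
    (hh : ContDiff ℝ ∞ (Function.uncurry h)) :
    ContDiff ℝ ∞ fun q => ∫ u in (0 : ℝ)..1, h q u := by
  rw [contDiff_infty]
  intro n
  -- The target space varies in the induction: the derivative is an integral of the same kind with
  -- values in the continuous linear maps.
  induction n generalizing M with
  | zero =>
    rw [Nat.cast_zero, contDiff_zero]
    exact continuous_iff_continuousAt.2 fun q =>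
      (hasFDerivAt_parametric_integral (hh.of_le (by simp)) q).continuousAt
  | succ n ih =>
    rw [Nat.cast_succ, contDiff_succ_iff_fderiv]
    refine ⟨fun q => (hasFDerivAt_parametric_integral
      (hh.of_le (by simp)) q).differentiableAt, by simp, ?_⟩
    rw [show (fderiv ℝ fun q => ∫ u in (0 : ℝ)..1, h q u) = fun q =>
      ∫ u in (0 : ℝ)..1, fderiv ℝ (fun q => h q u) q from
      funext (fderiv_parametric_integral hh)]
    exact ih (contDiff_fderiv_left hh)

/-- Used to turn a variable end point into a parameter of the integrand, so that smoothness in the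
end point reduces to integrals over a fixed interval. -/
theorem integral_zero_to_eq_smul (τ : ℝ) (χ : ℝ → M) :
    ∫ u in (0 : ℝ)..τ, χ u = τ • ∫ u in (0 : ℝ)..1, χ (τ * u) := by
  rw [intervalIntegral.smul_integral_comp_mul_left]; simp

theorem contDiff_integral_zero_to {h : E → ℝ → M} (hh : ContDiff ℝ ∞ (Function.uncurry h))
    {b : E → ℝ} (hb : ContDiff ℝ ∞ b) :
    ContDiff ℝ ∞ fun q => ∫ u in (0 : ℝ)..b q, h q u := by
  have : (fun q => ∫ u in (0 : ℝ)..b q, h q u) =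
      fun q => b q • ∫ u in (0 : ℝ)..1, h q (b q * u) := by
    funext q; exact integral_zero_to_eq_smul _ _
  rw [this]
  refine hb.smul (contDiff_parametric_integral (h := fun q u => h q (b q * u)) ?_)
  exact hh.comp (contDiff_fst.prodMk ((hb.comp contDiff_fst).mul contDiff_snd))

theorem fderiv_integral_zero_to {h : E → ℝ → M} (hh : ContDiff ℝ ∞ (Function.uncurry h))
    (b : ℝ) (q : E) : fderiv ℝ (fun q => ∫ u in (0 : ℝ)..b, h q u) q =
      ∫ u in (0 : ℝ)..b, fderiv ℝ (fun q => h q u) q := by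
  have hh' : ContDiff ℝ ∞ (Function.uncurry fun q u => h q (b * u)) :=
    hh.comp (contDiff_fst.prodMk (contDiff_const.mul contDiff_snd))
  rw [integral_zero_to_eq_smul b fun u => fderiv ℝ (fun q => h q u) q,
    ← fderiv_parametric_integral hh']
  simp_rw [integral_zero_to_eq_smul b]
  exact fderiv_fun_const_smul
    ((contDiff_parametric_integral hh').contDiffAt.differentiableAt (by simp)) b

end Parametric

/-! ### The algebra of smooth functions -/

variable (d 𝔸) in
/-- The smooth functions on `ℝ^d`. -/
def Sm : Subalgebra ℝ (Sp d → 𝔸) where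
  carrier := {ψ | ContDiff ℝ ∞ ψ}
  mul_mem' {f g} hf hg := show ContDiff ℝ ∞ (f * g) from
    ContDiff.mul (show ContDiff ℝ ∞ f from hf) (show ContDiff ℝ ∞ g from hg)
  add_mem' {f g} hf hg := show ContDiff ℝ ∞ (f + g) from
    ContDiff.add (show ContDiff ℝ ∞ f from hf) (show ContDiff ℝ ∞ g from hg)
  algebraMap_mem' r := show ContDiff ℝ ∞ fun _ : Sp d => algebraMap ℝ (𝔸) r from
    contDiff_const

namespace Sm

theorem contDiff (ψ : Sm d 𝔸) : ContDiff ℝ ∞ (ψ : Sp d → 𝔸) := ψ.2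

theorem differentiableAt (ψ : Sm d 𝔸) (x : Sp d) : DifferentiableAt ℝ (ψ : Sp d → 𝔸) x :=
  ((Sm.contDiff ψ).differentiable (by simp)).differentiableAt

theorem ext {ψ χ : Sm d 𝔸} (h : ∀ x, ψ.1 x = χ.1 x) : ψ = χ := Subtype.ext (funext h)

/-- Evaluation at a point. -/
def ev (x : Sp d) : Sm d 𝔸 →ₗ[ℝ] 𝔸 where
  toFun ψ := ψ.1 x
  map_add' _ _ := rfl
  map_smul' _ _ := rfl

theorem ev_apply (x : Sp d) (ψ : Sm d 𝔸) : ev x ψ = ψ.1 x := rfl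

/-- The derivative in a fixed direction. -/
def dir (v : Sp d) : Sm d 𝔸 →ₗ[ℝ] Sm d 𝔸 where
  toFun ψ := ⟨fun x => fderiv ℝ ψ.1 x v, show ContDiff ℝ ∞ _ from
    ((Sm.contDiff ψ).fderiv_right (m := ∞) (by simp)).clm_apply contDiff_const⟩
  map_add' ψ χ := by
    refine Sm.ext fun x => ?_
    change fderiv ℝ (ψ.1 + χ.1) x v = fderiv ℝ ψ.1 x v + fderiv ℝ χ.1 x v
    rw [fderiv_add (Sm.differentiableAt ψ x) (Sm.differentiableAt χ x)]; rfl
  map_smul' c ψ := by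
    refine Sm.ext fun x => ?_
    change fderiv ℝ (c • ψ.1) x v = c • fderiv ℝ ψ.1 x v
    rw [fderiv_const_smul (Sm.differentiableAt ψ x)]; rfl

/-- The partial derivative. -/
def pdL (μ : Fin d) : Sm d 𝔸 →ₗ[ℝ] Sm d 𝔸 := dir (e μ)

theorem pdL_apply (μ : Fin d) (ψ : Sm d 𝔸) (x : Sp d) : (pdL μ ψ).1 x = fderiv ℝ ψ.1 x (e μ) := rfl

theorem dir_mul (v : Sp d) (ψ χ : Sm d 𝔸) : dir v (ψ * χ) = dir v ψ * χ + ψ * dir v χ := by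
  refine Sm.ext fun x => ?_
  change fderiv ℝ (ψ.1 * χ.1) x v = fderiv ℝ ψ.1 x v * χ.1 x + ψ.1 x * fderiv ℝ χ.1 x v
  rw [fderiv_mul' (Sm.differentiableAt ψ x) (Sm.differentiableAt χ x)]
  simp [add_comm]

/-- Symmetry of the second derivative. The commutative algebra of slot derivatives and all Taylor
recursions rest on it. -/
theorem dir_comm (v w : Sp d) (ψ : Sm d 𝔸) : dir v (dir w ψ) = dir w (dir v ψ) := by
  refine Sm.ext fun x => ?_
  have hd : DifferentiableAt ℝ (fderiv ℝ ψ.1) x :=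
    (((Sm.contDiff ψ).fderiv_right (m := ∞) (by simp)).differentiable (by simp)).differentiableAt
  have h1 : ∀ u u' : Sp d, fderiv ℝ (fun x => fderiv ℝ ψ.1 x u) x u' =
      fderiv ℝ (fderiv ℝ ψ.1) x u' u := by
    intro u u'
    rw [fderiv_clm_apply hd (by fun_prop)]; simp
  change fderiv ℝ (fun x => fderiv ℝ ψ.1 x w) x v = fderiv ℝ (fun x => fderiv ℝ ψ.1 x v) x w
  rw [h1, h1]
  exact ((Sm.contDiff ψ).contDiffAt.isSymmSndFDerivAt
    (by simpa using WithTop.coe_le_coe.2 (le_top (a := (2 : ℕ∞))))) v w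

theorem pdL_mul (μ : Fin d) (ψ χ : Sm d 𝔸) : pdL μ (ψ * χ) = pdL μ ψ * χ + ψ * pdL μ χ :=
  dir_mul _ _ _

theorem pdL_comm (μ ν : Fin d) (ψ : Sm d 𝔸) : pdL μ (pdL ν ψ) = pdL ν (pdL μ ψ) :=
  dir_comm _ _ _

@[simp] theorem pdL_one (μ : Fin d) : pdL μ (1 : Sm d 𝔸) = 0 := by
  refine Sm.ext fun x => ?_
  change fderiv ℝ (fun _ => (1 : 𝔸)) x _ = 0
  simp

/-- The flat Laplace operator. -/
def lapl : Module.End ℝ (Sm d 𝔸) := ∑ μ, pdL μ ^ 2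

theorem lapl_apply (ψ : Sm d 𝔸) : lapl ψ = ∑ μ, pdL μ (pdL μ ψ) := by
  simp [lapl, LinearMap.sum_apply, pow_two]

/-- Multiplication by the coordinate `ξ_μ`. -/
def coord (μ : Fin d) : Sm d 𝔸 :=
  ⟨fun x => (x μ) • (1 : 𝔸), by
    have h : ContDiff ℝ ∞ fun x : Sp d => x μ :=
      (EuclideanSpace.proj (𝕜 := ℝ) μ).contDiff
    exact h.smul contDiff_const⟩

theorem pdL_coord (μ ν : Fin d) : pdL μ (coord ν : Sm d 𝔸) = if μ = ν then 1 else 0 := by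
  refine Sm.ext fun x => ?_
  change fderiv ℝ (fun x : Sp d => (x ν) • (1 : 𝔸)) x (e μ) = _
  have h : HasFDerivAt (fun x : Sp d => x ν) (EuclideanSpace.proj (𝕜 := ℝ) ν : Sp d →L[ℝ] ℝ) x :=
    (EuclideanSpace.proj (𝕜 := ℝ) ν : Sp d →L[ℝ] ℝ).hasFDerivAt
  rw [(h.smul_const (1 : 𝔸)).fderiv]
  by_cases hμ : μ = ν
  · subst hμ; simp [e]
  · rw [if_neg hμ]; simp [e, Ne.symm hμ]

/-- The dilation `ψ ↦ ψ(s ·)`. -/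
def dil (s : ℝ) : Sm d 𝔸 →ₐ[ℝ] Sm d 𝔸 where
  toFun ψ := ⟨fun x => ψ.1 (s • x), (Sm.contDiff ψ).comp (contDiff_const_smul s)⟩
  map_one' := rfl
  map_mul' _ _ := rfl
  map_zero' := rfl
  map_add' _ _ := rfl
  commutes' _ := rfl

theorem dil_apply (s : ℝ) (ψ : Sm d 𝔸) (x : Sp d) : (dil s ψ).1 x = ψ.1 (s • x) := rfl

theorem dir_dil (s : ℝ) (v : Sp d) (ψ : Sm d 𝔸) : dir v (dil s ψ) = s • dil s (dir v ψ) := by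
  refine Sm.ext fun x => ?_
  change fderiv ℝ (fun x => ψ.1 (s • x)) x v = s • fderiv ℝ ψ.1 (s • x) v
  have h : HasFDerivAt (fun x : Sp d => s • x) (s • ContinuousLinearMap.id ℝ (Sp d)) x :=
    (hasFDerivAt_id x).const_smul s
  have := ((Sm.differentiableAt ψ (s • x)).hasFDerivAt.comp x h).fderiv
  erw [this]; simp

theorem pdL_dil (s : ℝ) (μ : Fin d) (ψ : Sm d 𝔸) : pdL μ (dil s ψ) = s • dil s (pdL μ ψ) :=
  dir_dil _ _ _

end Sm

namespace Sm

/-! ### Weighted radial means -/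

variable [CompleteSpace 𝔸]

/-- The weights `s^K (1-s)^i / i!`. -/
def radW (K i : ℕ) (s : ℝ) : ℝ := s ^ K * (1 - s) ^ i / (i ! : ℕ)

theorem contDiff_radW (K i : ℕ) : ContDiff ℝ ∞ (radW K i) := by
  unfold radW; fun_prop

theorem continuous_radW (K i : ℕ) : Continuous (radW K i) := (contDiff_radW K i).continuous

omit [CompleteSpace 𝔸] in
theorem contDiff_radW_smul (K i : ℕ) (ψ : Sm d 𝔸) :
    ContDiff ℝ ∞ (Function.uncurry fun (x : Sp d) (s : ℝ) => radW K i s • ψ.1 (s • x)) :=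
  ((contDiff_radW K i).comp contDiff_snd).smul
    ((Sm.contDiff ψ).comp (contDiff_snd.smul contDiff_fst))

omit [CompleteSpace 𝔸] in
theorem continuous_radW_smul (K i : ℕ) (ψ : Sm d 𝔸) (x : Sp d) :
    Continuous fun s : ℝ => radW K i s • ψ.1 (s • x) :=
  (contDiff_radW_smul K i ψ).continuous.comp (Continuous.prodMk_right x)

/-- The radial mean `ξ ↦ ∫_0^1 s^K (1-s)^i / i! ψ(s ξ) ds`. -/
def rad (K i : ℕ) : Sm d 𝔸 →ₗ[ℝ] Sm d 𝔸 where
  toFun ψ := ⟨fun x => ∫ s in (0 : ℝ)..1, radW K i s • ψ.1 (s • x),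
    contDiff_parametric_integral (contDiff_radW_smul K i ψ)⟩
  map_add' ψ χ := by
    refine Sm.ext fun x => ?_
    change (∫ s in (0 : ℝ)..1, radW K i s • (ψ.1 (s • x) + χ.1 (s • x))) =
      (∫ s in (0 : ℝ)..1, radW K i s • ψ.1 (s • x)) + ∫ s in (0 : ℝ)..1, radW K i s • χ.1 (s • x)
    simp_rw [smul_add]
    exact intervalIntegral.integral_add
      ((continuous_radW_smul K i ψ x).intervalIntegrable _ _)
      ((continuous_radW_smul K i χ x).intervalIntegrable _ _)
  map_smul' c ψ := by
    refine Sm.ext fun x => ?_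
    change (∫ s in (0 : ℝ)..1, radW K i s • (c • ψ.1 (s • x))) =
      c • ∫ s in (0 : ℝ)..1, radW K i s • ψ.1 (s • x)
    simp_rw [smul_comm _ c]
    exact intervalIntegral.integral_smul _ _

theorem rad_apply (K i : ℕ) (ψ : Sm d 𝔸) (x : Sp d) :
    (rad K i ψ).1 x = ∫ s in (0 : ℝ)..1, radW K i s • ψ.1 (s • x) := rfl

theorem fderiv_rad (K i : ℕ) (ψ : Sm d 𝔸) (x v : Sp d) :
    fderiv ℝ (rad K i ψ).1 x v =
      ∫ s in (0 : ℝ)..1, radW K i s • s • fderiv ℝ ψ.1 (s • x) v := by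
  have h := fderiv_parametric_integral (contDiff_radW_smul K i ψ) x
  have h2 := contDiff_fderiv_left (contDiff_radW_smul K i ψ)
  change fderiv ℝ (fun x => ∫ s in (0 : ℝ)..1, radW K i s • ψ.1 (s • x)) x v = _
  have h4 : Continuous fun s => fderiv ℝ (fun x => radW K i s • ψ.1 (s • x)) x :=
    h2.continuous.comp (Continuous.prodMk_right x)
  rw [h, ContinuousLinearMap.intervalIntegral_apply (h4.intervalIntegrable 0 1)]
  refine intervalIntegral.integral_congr fun s _ => ?_
  have h3 : fderiv ℝ (fun x => radW K i s • ψ.1 (s • x)) x =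
      radW K i s • fderiv ℝ (dil s ψ).1 x :=
    fderiv_fun_const_smul (Sm.differentiableAt (dil s ψ) x) _
  change fderiv ℝ (fun x => radW K i s • ψ.1 (s • x)) x v = _
  rw [h3]
  change radW K i s • (dir v (dil s ψ)).1 x = _
  rw [dir_dil]; rfl

theorem pdL_rad (K i : ℕ) (μ : Fin d) (ψ : Sm d 𝔸) :
    pdL μ (rad K i ψ) = rad (K + 1) i (pdL μ ψ) := by
  refine Sm.ext fun x => ?_
  rw [pdL_apply, fderiv_rad, rad_apply]
  refine intervalIntegral.integral_congr fun s _ => ?_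
  change radW K i s • s • (pdL μ ψ).1 (s • x) = radW (K + 1) i s • (pdL μ ψ).1 (s • x)
  rw [smul_smul]; congr 1; unfold radW; ring

theorem lapl_rad (K i : ℕ) (ψ : Sm d 𝔸) : lapl (rad K i ψ) = rad (K + 2) i (lapl ψ) := by
  simp [lapl_apply, pdL_rad]

/-- The Euler operator `ξ_μ ∂_μ`. -/
def eul : Sm d 𝔸 →ₗ[ℝ] Sm d 𝔸 where
  toFun ψ := ⟨fun x => fderiv ℝ ψ.1 x x, show ContDiff ℝ ∞ _ from
    ((Sm.contDiff ψ).fderiv_right (m := ∞) (by simp)).clm_apply contDiff_id⟩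
  map_add' ψ χ := by
    refine Sm.ext fun x => ?_
    have h := congrArg (fun χ' : Sm d 𝔸 => χ'.1 x) ((dir x).map_add ψ χ)
    exact h
  map_smul' c ψ := by
    refine Sm.ext fun x => ?_
    have h := congrArg (fun χ' : Sm d 𝔸 => χ'.1 x) ((dir x).map_smul c ψ)
    exact h

theorem hasDerivAt_radial (ψ : Sm d 𝔸) (x : Sp d) (s : ℝ) :
    HasDerivAt (fun s : ℝ => ψ.1 (s • x)) (fderiv ℝ ψ.1 (s • x) x) s := by
  have h : HasDerivAt (fun s : ℝ => s • x) x s := by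
    simpa using (hasDerivAt_id s).smul_const x
  exact (Sm.differentiableAt ψ (s • x)).hasFDerivAt.comp_hasDerivAt s h

theorem continuous_fderiv_radial (ψ : Sm d 𝔸) (x : Sp d) :
    Continuous fun s : ℝ => fderiv ℝ ψ.1 (s • x) x := by
  have := (Sm.contDiff (dir x ψ)).continuous
  exact this.comp (continuous_id.smul continuous_const)

/-- The fundamental theorem of calculus for `s ↦ w(s) ψ(sx)`; every identity for radial means is a
choice of the weight `w`. -/
theorem integral_radial_deriv (w w' : ℝ → ℝ) (hw : ∀ s, HasDerivAt w (w' s) s)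
    (hw' : Continuous w') (ψ : Sm d 𝔸) (x : Sp d) :
    ∫ s in (0 : ℝ)..1, (w s • fderiv ℝ ψ.1 (s • x) x + w' s • ψ.1 (s • x)) =
      w 1 • ψ.1 x - w 0 • ψ.1 0 := by
  have hc : Continuous w := continuous_iff_continuousAt.2 fun s => (hw s).continuousAt
  have h := intervalIntegral.integral_eq_sub_of_hasDerivAt (a := 0) (b := 1)
    (fun s _ => (hw s).smul (hasDerivAt_radial ψ x s))
    (((hc.smul (continuous_fderiv_radial ψ x)).add (hw'.smul
      ((Sm.contDiff ψ).continuous.comp (continuous_id.smul continuous_const)))).intervalIntegrable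
        _ _)
  simpa using h

/-- Under the integral, `K + 1 + ξ·∂` acts as `s^{-K} (d/ds) s^{K+1}`. Integration by parts leaves
the boundary value at `s = 1` when `i = 0`. For `i > 0` the boundary values vanish and the
derivative falls on `(1-s)^i / i!`, which lowers `i`. -/
theorem euler_rad (K i : ℕ) (ψ : Sm d 𝔸) :
    ((K + 1 : ℕ) : ℝ) • rad K i ψ + eul (rad K i ψ) =
      if i = 0 then ψ else rad (K + 1) (i - 1) ψ := by
  refine Sm.ext fun x => ?_
  change ((K + 1 : ℕ) : ℝ) • (rad K i ψ).1 x + fderiv ℝ (rad K i ψ).1 x x = _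
  have hf : Continuous fun s : ℝ => radW K i s • s • fderiv ℝ ψ.1 (s • x) x :=
    (continuous_radW K i).smul (continuous_id.smul (continuous_fderiv_radial ψ x))
  rw [fderiv_rad, rad_apply, ← intervalIntegral.integral_smul, ← intervalIntegral.integral_add
    (Continuous.intervalIntegrable (u := fun s : ℝ => ((K + 1 : ℕ) : ℝ) • radW K i s • ψ.1 (s • x))
      ((continuous_radW_smul K i ψ x).const_smul _) _ _)
    (hf.intervalIntegrable _ _)]
  rcases i with - | i
  · have h := integral_radial_deriv (fun s => s ^ (K + 1))
      (fun s => ((K + 1 : ℕ) : ℝ) * s ^ K) (fun s => by simpa using hasDerivAt_pow (K + 1) s)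
      (by fun_prop) ψ x
    rw [if_pos rfl]
    simp only [one_pow, one_smul, ne_eq, Nat.add_eq_zero_iff, one_ne_zero, and_false,
      not_false_eq_true, zero_pow, zero_smul, sub_zero] at h
    rw [← h]
    refine intervalIntegral.integral_congr fun s _ => ?_
    simp only [smul_smul, radW]
    rw [add_comm]; congr 2 <;> simp <;> ring
  · have h := integral_radial_deriv (radW (K + 1) (i + 1))
      (fun s => ((K + 1 : ℕ) : ℝ) * radW K (i + 1) s - radW (K + 1) i s) (fun s => by
        have h1 := ((hasDerivAt_pow (K + 1) s).mul
          (((hasDerivAt_id s).const_sub 1).pow (i + 1))).div_const (((i + 1)! : ℕ) : ℝ)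
        have hi : ((i ! : ℕ) : ℝ) ≠ 0 := by positivity
        refine h1.congr_deriv ?_
        simp only [radW, Nat.factorial_succ, id]
        push_cast
        rw [Pi.pow_apply]
        field_simp
        ring)
      ((continuous_const.mul (continuous_radW _ _)).sub (continuous_radW _ _)) ψ x
    rw [if_neg (by simp)]
    rw [show radW (K + 1) (i + 1) 1 = 0 by simp [radW],
      show radW (K + 1) (i + 1) 0 = 0 by simp [radW], zero_smul, zero_smul, sub_zero] at h
    change _ = (rad (K + 1) i ψ).1 x
    rw [rad_apply, ← sub_eq_zero, ← intervalIntegral.integral_sub, ← h]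
    · refine intervalIntegral.integral_congr fun s _ => ?_
      simp only [smul_smul, sub_smul]
      rw [show radW (K + 1) (i + 1) s = radW K (i + 1) s * s by unfold radW; ring]
      abel
    · exact (((continuous_radW_smul K (i + 1) ψ x).const_smul _).add hf).intervalIntegrable _ _
    · exact (continuous_radW_smul (K + 1) i ψ x).intervalIntegrable _ _

/-- Along a ray `s^{K+1} ψ(sx)` has derivative `s^K χ(sx)` and vanishes at `s = 0`. Smoothness at
the origin thus excludes homogeneous solutions and makes the Euler equation uniquely solvable. -/
theorem eq_rad_of_euler (K : ℕ) {ψ χ : Sm d 𝔸}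
    (h : ((K + 1 : ℕ) : ℝ) • ψ + eul ψ = χ) : ψ = rad K 0 χ := by
  refine Sm.ext fun x => ?_
  have h1 := integral_radial_deriv (fun s => s ^ (K + 1))
      (fun s => ((K + 1 : ℕ) : ℝ) * s ^ K) (fun s => by simpa using hasDerivAt_pow (K + 1) s)
      (by fun_prop) ψ x
  simp only [one_pow, one_smul, ne_eq, Nat.add_eq_zero_iff, one_ne_zero, and_false,
      not_false_eq_true, zero_pow, zero_smul, sub_zero] at h1
  rw [← h1, rad_apply, ← h]
  refine intervalIntegral.integral_congr fun s _ => ?_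
  change _ = radW K 0 s • (((K + 1 : ℕ) : ℝ) • ψ.1 (s • x) + fderiv ℝ ψ.1 (s • x) (s • x))
  rw [map_smul]
  simp only [radW, smul_add, smul_smul]
  rw [add_comm]; congr 2 <;> simp <;> ring

/-! ### The coefficients of the double expansion -/

/-- Left multiplication. -/
abbrev mulL (ψ : Sm d 𝔸) : Sm d 𝔸 →ₗ[ℝ] Sm d 𝔸 := LinearMap.mulLeft ℝ ψ

/-- The first-order operator `2 ∂_α f_α - (∂_α f_α)`. -/
def opN (f : Fin d → Sm d 𝔸) : Sm d 𝔸 →ₗ[ℝ] Sm d 𝔸 :=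
  ∑ α, ((2 : ℝ) • pdL α ∘ₗ mulL (f α) - mulL (pdL α (f α)))

/-- Multiplication by `f_α f_α`. -/
def opQ (f : Fin d → Sm d 𝔸) : Sm d 𝔸 →ₗ[ℝ] Sm d 𝔸 := mulL (∑ α, f α * f α)

/-- The source of the transport equation, for `prev = c_{n-1}` and `cur = c_n`. -/
def src (f : Fin d → Sm d 𝔸) (V : Sm d 𝔸) (prev cur : ℕ → ℕ → Sm d 𝔸) : ℕ → ℕ → Sm d 𝔸
  | 0, k => mulL V (cur 0 k)
  | j + 1, k => mulL V (cur (j + 1) k) + opN f (cur j k) + opQ f (prev j k)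

/-- The pair `(c_{n-1}, c_n)` of coefficients. -/
def coefPair (f : Fin d → Sm d 𝔸) (V : Sm d 𝔸) :
    ℕ → (ℕ → ℕ → Sm d 𝔸) × (ℕ → ℕ → Sm d 𝔸)
  | 0 => (0, fun j K => if j = 0 ∧ K = 0 then 1 else 0)
  | n + 1 => ((coefPair f V n).2, fun j K => match K with
    | 0 => 0
    | K + 1 => ∑ i ∈ Finset.range (j + 1), if i ≤ K then
        rad K i ((lapl ^ i) (src f V (coefPair f V n).1 (coefPair f V n).2 (j - i) (K - i)))
      else 0)

/-- The coefficient `c_{njK}` of `τ^K` in the term of order `n` in `M` and `j` in `b`. -/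
def coef (f : Fin d → Sm d 𝔸) (V : Sm d 𝔸) (n : ℕ) : ℕ → ℕ → Sm d 𝔸 := (coefPair f V n).2

/-- The coefficients `c_{n-1}`, with `c_{-1} = 0`. -/
def coefPrev (f : Fin d → Sm d 𝔸) (V : Sm d 𝔸) (n : ℕ) : ℕ → ℕ → Sm d 𝔸 := (coefPair f V n).1

variable (f : Fin d → Sm d 𝔸) (V : Sm d 𝔸)

theorem coefPrev_zero : coefPrev f V 0 = 0 := rfl

theorem coefPrev_succ (n : ℕ) : coefPrev f V (n + 1) = coef f V n := rfl

theorem coef_zero (j K : ℕ) : coef f V 0 j K = if j = 0 ∧ K = 0 then 1 else 0 := rfl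

theorem coef_succ_zero (n j : ℕ) : coef f V (n + 1) j 0 = 0 := rfl

theorem coef_succ_succ (n j K : ℕ) : coef f V (n + 1) j (K + 1) =
    ∑ i ∈ Finset.range (j + 1), if i ≤ K then
      rad K i ((lapl ^ i) (src f V (coefPrev f V n) (coef f V n) (j - i) (K - i))) else 0 := rfl

/-- One step of the recursion raises `(n, j, K)` by `(1, 0, 1)` through `V`, by `(1, 1, 1)` through
`opN`, by `(2, 1, 1)` through `opQ`, and the heat flow of order `i` adds `(0, i, i)`. All three
inequalities are preserved by these moves. The statement for `c_{n-1}` is carried along because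
`opQ` reaches back two orders. -/
theorem coef_ne_zero_aux (n : ℕ) :
    (∀ j K, coefPrev f V n j K ≠ 0 → j ≤ K ∧ K + 1 ≤ n + j ∧ n ≤ 2 * K + 1) ∧
    ∀ j K, coef f V n j K ≠ 0 → j ≤ K ∧ K ≤ n + j ∧ n ≤ 2 * K := by
  induction n with
  | zero =>
    refine ⟨fun j K h => absurd rfl h, fun j K h => ?_⟩
    rw [coef_zero] at h
    have := (ite_ne_right_iff.1 h).1
    omega
  | succ n ih =>
    refine ⟨fun j K h => ?_, fun j K h => ?_⟩
    · have := ih.2 j K h; omega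
    rcases K with - | K
    · exact absurd rfl h
    rw [coef_succ_succ] at h
    obtain ⟨i, hi, h⟩ := Finset.exists_ne_zero_of_sum_ne_zero h
    rw [Finset.mem_range] at hi
    obtain ⟨hiK, h⟩ := ite_ne_right_iff.1 h
    have hs : src f V (coefPrev f V n) (coef f V n) (j - i) (K - i) ≠ 0 := fun h0 => h (by
      rw [h0, map_zero, map_zero])
    obtain ⟨l, hl⟩ : ∃ l, l = j - i := ⟨_, rfl⟩
    obtain ⟨k, hk⟩ : ∃ k, k = K - i := ⟨_, rfl⟩
    rw [← hl, ← hk] at hs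
    rcases l with - | l
    · have := ih.2 0 k (fun h0 => hs (by simp [src, h0]))
      omega
    · by_cases h1 : coef f V n (l + 1) k = 0
      · by_cases h2 : coef f V n l k = 0
        · have := ih.1 l k (fun h0 => hs (by simp [src, h0, h1, h2]))
          omega
        · have := ih.2 l k h2
          omega
      · have := ih.2 _ _ h1
        omega

theorem coef_ne_zero {n j K : ℕ} (h : coef f V n j K ≠ 0) :
    j ≤ K ∧ K ≤ n + j ∧ n ≤ 2 * K := (coef_ne_zero_aux f V n).2 j K h

/-- The source of the transport equation of `c_n`. -/
def srcN : ℕ → ℕ → ℕ → Sm d 𝔸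
  | 0 => 0
  | n + 1 => src f V (coefPrev f V n) (coef f V n)

/-- The transport equation of the coefficients. -/
theorem euler_coef (n j K : ℕ) :
    ((K + 1 : ℕ) : ℝ) • coef f V n j (K + 1) + eul (coef f V n j (K + 1)) =
      (if j = 0 then 0 else lapl (coef f V n (j - 1) K)) + srcN f V n j K := by
  rcases n with - | n
  · have h1 : lapl (1 : Sm d 𝔸) = 0 := by simp [lapl_apply]
    simp only [coef_zero, srcN]
    split_ifs <;> simp_all
  · rw [coef_succ_succ, map_sum, Finset.smul_sum, ← Finset.sum_add_distrib,
      Finset.sum_range_succ']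
    -- The term `i = 0` returns the source itself. By `euler_rad` and `lapl_rad` the terms `i ≥ 1`
    -- reassemble into the Laplacian of the coefficient with `j` and `K` lowered by one.
    simp only [Nat.zero_le, if_true, pow_zero, Module.End.one_apply, euler_rad, Nat.sub_zero]
    congr 1
    rcases j with - | j
    · simp
    rw [if_neg (by simp)]
    rcases K with - | K
    · simp [coef_succ_zero]
    rw [Nat.add_sub_cancel, coef_succ_succ, map_sum]
    refine Finset.sum_congr rfl fun i _ => ?_
    by_cases h : i ≤ K
    · rw [if_pos (by omega), if_pos h, euler_rad, if_neg (by simp), lapl_rad, pow_succ', Nat.add_sub_cancel,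
        Nat.add_sub_add_right, Nat.add_sub_add_right]
      rfl
    · rw [if_neg (by omega), if_neg h]; simp

/-- The operator `(∂ + f)_μ (∂ + f)_μ + V`. -/
def opA : Sm d 𝔸 →ₗ[ℝ] Sm d 𝔸 := lapl + mulL V + opN f + opQ f

/-- The sum of the coefficients of `τ^K`. -/
def coefSum (K : ℕ) : Sm d 𝔸 :=
  ∑ n ∈ Finset.range (2 * K + 1), ∑ j ∈ Finset.range (K + 1), coef f V n j K

/-- By the support bounds the ranges may be enlarged freely, which absorbs the index shifts of the
transport equation. -/
theorem coefSum_eq {N J K : ℕ} (hN : 2 * K + 1 ≤ N) (hJ : K + 1 ≤ J) :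
    coefSum f V K = ∑ n ∈ Finset.range N, ∑ j ∈ Finset.range J, coef f V n j K := by
  have h1 : ∀ n, ∑ j ∈ Finset.range (K + 1), coef f V n j K =
      ∑ j ∈ Finset.range J, coef f V n j K := fun n =>
    Finset.sum_subset (Finset.range_mono hJ) fun j _ hj => by
      by_contra h; have := coef_ne_zero f V h; simp at hj; omega
  rw [coefSum]
  simp_rw [h1]
  refine Finset.sum_subset (Finset.range_mono hN) fun n _ hn => Finset.sum_eq_zero fun j _ => ?_
  by_contra h; have := coef_ne_zero f V h; simp at hn; omega

theorem coefSum_zero : coefSum f V 0 = 1 := by simp [coefSum, coef_zero]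

/-- The transport equations are summed over `n` and `j`. The four kinds of terms differ only by
shifts of these indices, so their operators add up to `opA` on the same sum; uniqueness for the
Euler equation concludes. -/
theorem coefSum_succ (K : ℕ) : coefSum f V (K + 1) = rad K 0 (opA f V (coefSum f V K)) := by
  refine eq_rad_of_euler K ?_
  have hA : ∀ (O : Sm d 𝔸 →ₗ[ℝ] Sm d 𝔸) N J, 2 * K + 1 ≤ N → K + 1 ≤ J → O (coefSum f V K) =
      ∑ n ∈ Finset.range N, ∑ j ∈ Finset.range J, O (coef f V n j K) := by
    intro O N J hN hJ
    rw [coefSum_eq f V hN hJ]; simp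
  simp only [opA, LinearMap.add_apply]
  -- Each range is what remains of `n < 2K + 3`, `j < K + 2` after the shift that belongs to the
  -- operator: `j` by one for the Laplacian, `n` by one for `V`, both by one for `opN`, `n` by two
  -- and `j` by one for `opQ`.
  rw [hA lapl (2 * K + 3) (K + 1) (by omega) le_rfl, hA (mulL V) (2 * K + 2) (K + 2) (by omega)
    (by omega), hA (opN f) (2 * K + 2) (K + 1) (by omega) le_rfl, hA (opQ f) (2 * K + 1) (K + 1)
    le_rfl le_rfl, coefSum_eq f V (N := 2 * K + 3) (J := K + 2) (by omega) (by omega)]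
  simp only [map_sum, Finset.smul_sum, ← Finset.sum_add_distrib, euler_coef]
  simp only [Finset.sum_add_distrib]
  rw [add_assoc, add_assoc]
  congr 1
  · refine Finset.sum_congr rfl fun n _ => ?_
    rw [Finset.sum_range_succ']; simp
  · rw [Finset.sum_range_succ']
    simp only [srcN]
    have h1 : ∀ n, ∑ j ∈ Finset.range (K + 2), src f V (coefPrev f V n) (coef f V n) j K =
        ∑ j ∈ Finset.range (K + 2), mulL V (coef f V n j K) +
        (∑ j ∈ Finset.range (K + 1), opN f (coef f V n j K) +
          ∑ j ∈ Finset.range (K + 1), opQ f (coefPrev f V n j K)) := by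
      intro n
      rw [Finset.sum_range_succ', Finset.sum_range_succ' (fun j => mulL V (coef f V n j K))]
      simp only [src, Finset.sum_add_distrib]
      abel
    simp only [h1, Finset.sum_add_distrib]
    rw [Finset.sum_range_succ' (fun n => ∑ j ∈ Finset.range (K + 1),
      opQ f (coefPrev f V n j K))]
    simp [coefPrev_zero, coefPrev_succ]

end Sm

/-! ### Divided powers -/

section DividedPowers

variable {R : Type} [CommRing R] [Algebra ℝ R]

/-- The divided power `a^j / j!`. -/
def dp (j : ℕ) (a : R) : R := ((j ! : ℕ) : ℝ)⁻¹ • a ^ j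

@[simp] theorem dp_zero (a : R) : dp 0 a = 1 := by simp [dp]

theorem dp_zero_right (j : ℕ) : dp j (0 : R) = if j = 0 then 1 else 0 := by
  rcases j with - | j <;> simp [dp]

theorem dp_add (j : ℕ) (a b : R) :
    dp j (a + b) = ∑ i ∈ Finset.range (j + 1), dp i a * dp (j - i) b := by
  simp only [dp, add_pow, Finset.smul_sum]
  refine Finset.sum_congr rfl fun i hi => ?_
  have hij : i ≤ j := Nat.lt_succ_iff.1 (Finset.mem_range.1 hi)
  rw [smul_mul_smul_comm, mul_comm, ← nsmul_eq_mul, ← Nat.cast_smul_eq_nsmul ℝ, smul_smul,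
    Nat.cast_choose ℝ hij]
  congr 1
  have h3 : ((j ! : ℕ) : ℝ) ≠ 0 := by positivity
  field_simp

theorem dp_smul (j : ℕ) (r : ℝ) (a : R) : dp j (r • a) = r ^ j • dp j a := by
  simp only [dp, smul_pow, smul_smul, mul_comm]

/-- Applied with `b` proportional to the velocity derivatives of one slot: then `b²` acts as zero
and the divided power is affine in `b`. -/
theorem exists_dp_add (j : ℕ) (a b : R) :
    ∃ c, dp (j + 1) (a + b) = dp (j + 1) a + b * dp j a + b ^ 2 * c := by
  refine ⟨∑ i ∈ Finset.range j, (((i + 2)! : ℕ) : ℝ)⁻¹ • b ^ i * dp (j - 1 - i) a, ?_⟩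
  rw [add_comm a b, dp_add, Finset.sum_range_succ', Finset.sum_range_succ', Finset.mul_sum]
  have h1 : dp 1 b = b := by simp [dp]
  have h2 : ∀ i, dp (i + 1 + 1) b * dp (j + 1 - (i + 1 + 1)) a =
      b ^ 2 * ((((i + 2)! : ℕ) : ℝ)⁻¹ • b ^ i * dp (j - 1 - i) a) := by
    intro i
    rw [show j + 1 - (i + 1 + 1) = j - 1 - i by omega]
    simp only [dp, Algebra.smul_def]
    ring
  simp only [h2, zero_add, h1, dp_zero, Nat.sub_zero, Nat.add_sub_cancel, one_mul]
  ring

end DividedPowers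

/-! ### Vertices and functionals of vertices -/

variable (d 𝔸) in
/-- A vertex `(f, V)`, thought of as the function `(x, v) ↦ V(x) - v_μ f_μ(x)`. -/
abbrev Vert : Type := (Fin d → Sm d 𝔸) × Sm d 𝔸

namespace Vert

/-- The derivative of a vertex in the position. -/
def dx (α : Fin d) : Vert d 𝔸 →ₗ[ℝ] Vert d 𝔸 where
  toFun F := (fun μ => Sm.pdL α (F.1 μ), Sm.pdL α F.2)
  map_add' F G := by ext1 <;> simp [Pi.add_def]
  map_smul' c F := by ext1 <;> simp [Pi.smul_def]

/-- The derivative of a vertex in the velocity. -/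
def dv (α : Fin d) : Vert d 𝔸 →ₗ[ℝ] Vert d 𝔸 where
  toFun F := (0, -F.1 α)
  map_add' F G := by ext1 <;> simp [add_comm]
  map_smul' c F := by ext1 <;> simp

theorem dx_apply (α : Fin d) (F : Vert d 𝔸) :
    dx α F = (fun μ => Sm.pdL α (F.1 μ), Sm.pdL α F.2) := rfl

theorem dv_apply (α : Fin d) (F : Vert d 𝔸) : dv α F = (0, -F.1 α) := rfl

/-- Either derivative. -/
def der : Fin d ⊕ Fin d → Vert d 𝔸 →ₗ[ℝ] Vert d 𝔸
  | Sum.inl α => dx α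
  | Sum.inr α => dv α

theorem der_comm (a b : Fin d ⊕ Fin d) (F : Vert d 𝔸) : der a (der b F) = der b (der a F) := by
  rcases a with α | α <;> rcases b with β | β <;>
    simp [der, dx_apply, dv_apply, Sm.pdL_comm α β, Pi.zero_def]

end Vert

/-- The commutative algebra of formal derivatives in the slots. -/
abbrev DOp (d : ℕ) : Type := MvPolynomial (ℕ × (Fin d ⊕ Fin d)) ℝ

namespace DOp

/-- The derivative in the position of slot `i`. -/
abbrev x (i : ℕ) (α : Fin d) : DOp d := MvPolynomial.X (i, Sum.inl α)

/-- The derivative in the velocity of slot `i`. -/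
abbrev w (i : ℕ) (α : Fin d) : DOp d := MvPolynomial.X (i, Sum.inr α)

section Act

variable (𝔸) (M : Type) [AddCommGroup M] [Module ℝ M]

/-- A derivative in one slot as an operator on functionals of sequences of vertices. -/
def slot (a : ℕ × (Fin d ⊕ Fin d)) : Module.End ℝ ((ℕ → Vert d 𝔸) → M) where
  toFun Φ F := Φ (Function.update F a.1 (Vert.der a.2 (F a.1)))
  map_add' _ _ := rfl
  map_smul' _ _ := rfl

theorem slot_comm (a b : ℕ × (Fin d ⊕ Fin d)) :
    slot 𝔸 M a * slot 𝔸 M b = slot 𝔸 M b * slot 𝔸 M a := by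
  ext Φ F
  change Φ _ = Φ _
  congr 1
  rcases a with ⟨i, a⟩
  rcases b with ⟨l, b⟩
  by_cases h : i = l
  · subst h; simp [Vert.der_comm a b]
  · dsimp only
    rw [Function.update_of_ne (Ne.symm h), Function.update_of_ne h, Function.update_comm h]

/-- The commutative algebra generated by the slot derivatives. -/
def slotAlg : Subalgebra ℝ (Module.End ℝ ((ℕ → Vert d 𝔸) → M)) :=
  Algebra.adjoin ℝ (Set.range (slot 𝔸 M))

/-- Evaluating polynomials needs a commutative target. Endomorphisms do not form one, but the
subalgebra generated by the commuting slot derivatives does. -/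
instance : IsMulCommutative (slotAlg (d := d) 𝔸 M) :=
  Algebra.isMulCommutative_adjoin ℝ (by rintro _ ⟨a, rfl⟩ _ ⟨b, rfl⟩; exact slot_comm 𝔸 M a b)

variable {𝔸 M}

open scoped IsMulCommutative in
/-- The action of formal derivatives on functionals of vertices. -/
def act : DOp d →ₐ[ℝ] Module.End ℝ ((ℕ → Vert d 𝔸) → M) :=
  (slotAlg 𝔸 M).val.comp (MvPolynomial.aeval fun a =>
    (⟨slot 𝔸 M a, Algebra.subset_adjoin ⟨a, rfl⟩⟩ : slotAlg 𝔸 M))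

theorem act_X (a : ℕ × (Fin d ⊕ Fin d)) (Φ : (ℕ → Vert d 𝔸) → M) (F : ℕ → Vert d 𝔸) :
    act (MvPolynomial.X a) Φ F = Φ (Function.update F a.1 (Vert.der a.2 (F a.1))) := by
  simp [act]; rfl

theorem act_x (i : ℕ) (α : Fin d) (Φ : (ℕ → Vert d 𝔸) → M) (F : ℕ → Vert d 𝔸) :
    act (x i α) Φ F = Φ (Function.update F i (Vert.dx α (F i))) := act_X _ _ _

theorem act_w (i : ℕ) (α : Fin d) (Φ : (ℕ → Vert d 𝔸) → M) (F : ℕ → Vert d 𝔸) :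
    act (w i α) Φ F = Φ (Function.update F i (Vert.dv α (F i))) := act_X _ _ _

theorem act_mul (p q : DOp d) (Φ : (ℕ → Vert d 𝔸) → M) :
    act (p * q) Φ = act p (act q Φ) := by rw [map_mul]; rfl

theorem act_add (p q : DOp d) (Φ : (ℕ → Vert d 𝔸) → M) :
    act (p + q) Φ = act p Φ + act q Φ := by rw [map_add]; rfl

theorem act_smul (r : ℝ) (p : DOp d) (Φ : (ℕ → Vert d 𝔸) → M) :
    act (r • p) Φ = r • act p Φ := by rw [map_smul]; rfl

theorem act_sum {ι : Type} (s : Finset ι) (p : ι → DOp d) (Φ : (ℕ → Vert d 𝔸) → M) :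
    act (∑ i ∈ s, p i) Φ = ∑ i ∈ s, act (p i) Φ := by rw [map_sum, LinearMap.sum_apply]

theorem act_one (Φ : (ℕ → Vert d 𝔸) → M) : act (1 : DOp d) Φ = Φ := by rw [map_one]; rfl

theorem act_zero (Φ : (ℕ → Vert d 𝔸) → M) : act (0 : DOp d) Φ = 0 := by rw [map_zero]; rfl

/-- Formal derivatives commute with linear maps of the values. -/
theorem act_post {M' : Type} [AddCommGroup M'] [Module ℝ M'] (O : M →ₗ[ℝ] M') (p : DOp d)
    (Φ : (ℕ → Vert d 𝔸) → M) : act p (fun F => O (Φ F)) = fun F => O (act p Φ F) := by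
  induction p using MvPolynomial.induction_on generalizing Φ with
  | C r =>
    rw [show (MvPolynomial.C r : DOp d) = r • 1 by
      rw [← MvPolynomial.C_mul', mul_one], act_smul, act_smul, act_one, act_one]
    funext F; simp
  | add p q hp hq => funext F; simp [hp, hq]
  | mul_X p a hp =>
    rw [act_mul, act_mul]
    have : act (MvPolynomial.X a : DOp d) (fun F => O (Φ F)) =
        fun F => O (act (MvPolynomial.X a) Φ F) := by funext F; simp only [act_X]
    rw [this, hp]

/-- The functional does not depend on slot `i`. -/
def Indep (i : ℕ) (Φ : (ℕ → Vert d 𝔸) → M) : Prop := ∀ F v, Φ (Function.update F i v) = Φ F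

/-- The functional vanishes when the vertex in slot `i` vanishes. -/
def Vanish (i : ℕ) (Φ : (ℕ → Vert d 𝔸) → M) : Prop := ∀ F, F i = 0 → Φ F = 0

theorem Vanish.act {i : ℕ} {Φ : (ℕ → Vert d 𝔸) → M} (h : Vanish i Φ) (p : DOp d) :
    Vanish i (act p Φ) := by
  induction p using MvPolynomial.induction_on generalizing Φ with
  | C r =>
    rw [show (MvPolynomial.C r : DOp d) = r • 1 by
      rw [← MvPolynomial.C_mul', mul_one], act_smul, act_one]
    intro F hF; simp [h F hF]
  | add p q hp hq => intro F hF; simp [hp h F hF, hq h F hF]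
  | mul_X p a hp =>
    rw [act_mul]
    refine hp fun F hF => ?_
    rw [act_X]
    refine h _ ?_
    by_cases ha : i = a.1
    · subst ha; simp [hF]
    · rw [Function.update_of_ne ha, hF]

theorem Indep.act {i : ℕ} {Φ : (ℕ → Vert d 𝔸) → M} (h : Indep i Φ) (p : DOp d) :
    Indep i (act p Φ) := by
  induction p using MvPolynomial.induction_on generalizing Φ with
  | C r =>
    rw [show (MvPolynomial.C r : DOp d) = r • 1 by
      rw [← MvPolynomial.C_mul', mul_one], act_smul, act_one]
    intro F v; simp [h F v]
  | add p q hp hq => intro F v; simp [hp h F v, hq h F v]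
  | mul_X p a hp =>
    rw [act_mul]
    refine hp fun F v => ?_
    rw [act_X, act_X]
    by_cases ha : i = a.1
    · subst ha; simp only [Function.update_idem]; rw [h, h]
    · rw [Function.update_comm ha, h, Function.update_of_ne (Ne.symm ha)]

/-- A vertex is at most linear in its velocity. -/
theorem act_w_mul_w {i : ℕ} {Φ : (ℕ → Vert d 𝔸) → M} (h : Vanish i Φ) (α β : Fin d)
    (p : DOp d) : act (w i α * w i β * p) Φ = 0 := by
  rw [mul_assoc, act_mul, act_mul]
  funext F
  rw [act_w, act_w]
  exact h.act p _ (by simp [Vert.dv_apply])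

/-- The velocity derivative of a vertex without velocity is the zero vertex. This removes the terms
that have no limit at coinciding times. -/
theorem act_w_of_fst_eq_zero {i : ℕ} {Φ : (ℕ → Vert d 𝔸) → M} (h : Vanish i Φ) (α : Fin d)
    (p : DOp d) {F : ℕ → Vert d 𝔸} (hF : (F i).1 = 0) : act (w i α * p) Φ F = 0 := by
  rw [act_mul, act_w]
  exact h.act p _ (by simp [Vert.dv_apply, hF])

end Act

/-- The formal derivatives in slots other than `k` . -/
def off (k : ℕ) : Subalgebra ℝ (DOp d) := Algebra.adjoin ℝ {p | ∃ a, a.1 ≠ k ∧ p = MvPolynomial.X a}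

theorem X_mem_off {k : ℕ} {a : ℕ × (Fin d ⊕ Fin d)} (h : a.1 ≠ k) :
    MvPolynomial.X a ∈ off (d := d) k := Algebra.subset_adjoin ⟨a, h, rfl⟩

/-- Derivatives in other slots leave the vertex in slot `k` alone, so a left factor depending on
that slot is a constant for them. This is what allows vertices to be peeled off an ordered
noncommutative product. -/
theorem act_head_mul {A : Type} [Ring A] [Algebra ℝ A] {k : ℕ} {p : DOp d} (hp : p ∈ off k)
    (h : Vert d 𝔸 → A) (Φ : (ℕ → Vert d 𝔸) → A) :
    act p (fun F => h (F k) * Φ F) = fun F => h (F k) * act p Φ F := by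
  induction hp using Algebra.adjoin_induction generalizing Φ with
  | mem p hp =>
    obtain ⟨a, ha, rfl⟩ := hp
    funext F
    simp only [act_X, Function.update_of_ne (Ne.symm ha)]
  | algebraMap r =>
    funext F
    simp [Algebra.algebraMap_eq_smul_one]
  | add p q _ _ hp hq => funext F; simp [hp, hq, mul_add]
  | mul p q _ _ hp hq => simp only [act_mul, hp, hq]

end DOp

open DOp

/-! ### The product of vertices along the straight path -/

/-- The vertex as a function of `q`, at position `a q` and velocity `b q`. -/
def Vert.val (a b : ℝ) : Vert d 𝔸 →ₗ[ℝ] Sm d 𝔸 where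
  toFun F := Sm.dil a F.2 - b • ∑ μ, Sm.coord μ * Sm.dil a (F.1 μ)
  map_add' F G := by
    simp only [Prod.fst_add, Prod.snd_add, Pi.add_apply, map_add, mul_add,
      Finset.sum_add_distrib, smul_add]
    abel
  map_smul' c F := by
    simp only [Prod.smul_fst, Prod.smul_snd, Pi.smul_apply, map_smul, mul_smul_comm,
      ← Finset.smul_sum, smul_sub, RingHom.id_apply, smul_comm b c]

theorem Vert.val_apply (a b : ℝ) (F : Vert d 𝔸) :
    Vert.val a b F = Sm.dil a F.2 - b • ∑ μ, Sm.coord μ * Sm.dil a (F.1 μ) := rfl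

/-- The end point `q` enters the position with factor `a` and the velocity with factor `b`; the
derivative of the explicit coordinate is the velocity derivative of the vertex. -/
theorem Vert.pdL_val (a b : ℝ) (α : Fin d) (F : Vert d 𝔸) :
    Sm.pdL α (Vert.val a b F) =
      a • Vert.val a b (Vert.dx α F) + b • Vert.val a b (Vert.dv α F) := by
  simp only [Vert.val_apply, Vert.dx_apply, Vert.dv_apply, map_sub, map_smul, map_sum,
    Sm.pdL_mul, Sm.pdL_coord, Sm.pdL_dil, ite_mul, one_mul, zero_mul, Finset.sum_add_distrib,
    Finset.sum_ite_eq, Finset.mem_univ, if_true, mul_smul_comm, ← Finset.smul_sum, smul_add,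
    smul_sub, map_neg, Pi.zero_apply, map_zero, mul_zero, Finset.sum_const_zero, smul_zero,
    sub_zero, smul_neg, smul_comm b a]
  abel

/-- The ordered product of the vertices in the slots `k, …, k + n - 1` at the times `t`, along
the path from `0` to `q` in time `τ`, as a function of `q`. -/
def prodV (τ : ℝ) : (k n : ℕ) → (Fin n → ℝ) → (ℕ → Vert d 𝔸) → Sm d 𝔸
  | _, 0, _ => fun _ => 1
  | k, n + 1, t => fun F => Vert.val (t 0 / τ) (1 / τ) (F k) * prodV τ (k + 1) n (Fin.tail t) F

theorem prodV_indep (τ : ℝ) (k n : ℕ) (t : Fin n → ℝ) {j : ℕ} (hj : j < k) :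
    Indep j (prodV (𝔸 := 𝔸) (d := d) τ k n t) := by
  induction n generalizing k with
  | zero => intro F v; rfl
  | succ n ih =>
    intro F v
    simp only [prodV]
    rw [ih (k + 1) _ (by omega) F v, Function.update_of_ne (by omega)]

theorem prodV_vanish (τ : ℝ) (k n : ℕ) (t : Fin n → ℝ) {j : ℕ} (hj : k ≤ j) (hj' : j < k + n) :
    Vanish j (prodV (𝔸 := 𝔸) (d := d) τ k n t) := by
  induction n generalizing k with
  | zero => omega
  | succ n ih =>
    intro F hF
    simp only [prodV]
    by_cases h : j = k
    · subst h; rw [hF]; simp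
    · rw [ih (k + 1) _ (by omega) (by omega) F hF, mul_zero]

/-- The derivative with respect to the end of the path. -/
def endD (τ : ℝ) (k n : ℕ) (t : Fin n → ℝ) (α : Fin d) : DOp d :=
  ∑ i : Fin n, ((t i / τ) • x (k + i) α + (1 / τ) • w (k + i) α)

theorem endD_succ (τ : ℝ) (k n : ℕ) (t : Fin (n + 1) → ℝ) (α : Fin d) :
    endD τ k (n + 1) t α = ((t 0 / τ) • x k α + (1 / τ) • w k α) +
      endD τ (k + 1) n (Fin.tail t) α := by
  simp only [endD, Fin.sum_univ_succ, Fin.val_zero, Fin.val_succ, Nat.add_zero, Fin.tail]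
  congr 1
  exact Finset.sum_congr rfl fun i _ => by rw [show k + (i.val + 1) = k + 1 + i by omega]

theorem endD_mem_off (τ : ℝ) {j k : ℕ} (n : ℕ) (t : Fin n → ℝ) (α : Fin d) (h : j < k) :
    endD τ k n t α ∈ off j :=
  Subalgebra.sum_mem _ fun i _ => Subalgebra.add_mem _
    (Subalgebra.smul_mem _ (X_mem_off (by dsimp only; omega)) _)
    (Subalgebra.smul_mem _ (X_mem_off (by dsimp only; omega)) _)

theorem pdL_prodV (τ : ℝ) (k n : ℕ) (t : Fin n → ℝ) (α : Fin d) :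
    (fun F => Sm.pdL α (prodV (𝔸 := 𝔸) τ k n t F)) = act (endD τ k n t α) (prodV τ k n t) := by
  induction n generalizing k with
  | zero => simp [prodV, endD]; rfl
  | succ n ih =>
    funext F
    have h1 : act (x k α) (prodV (𝔸 := 𝔸) τ k (n + 1) t) F =
        Vert.val (t 0 / τ) (1 / τ) (Vert.dx α (F k)) * prodV τ (k + 1) n (Fin.tail t) F := by
      rw [act_x]; simp only [prodV, Function.update_self]
      rw [prodV_indep τ (k + 1) n _ (Nat.lt_succ_self k)]
    have h2 : act (w k α) (prodV (𝔸 := 𝔸) τ k (n + 1) t) F =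
        Vert.val (t 0 / τ) (1 / τ) (Vert.dv α (F k)) * prodV τ (k + 1) n (Fin.tail t) F := by
      rw [act_w]; simp only [prodV, Function.update_self]
      rw [prodV_indep τ (k + 1) n _ (Nat.lt_succ_self k)]
    have h3 := congrFun (act_head_mul (endD_mem_off τ n (Fin.tail t) α (Nat.lt_succ_self k))
      (Vert.val (t 0 / τ) (1 / τ)) (prodV (𝔸 := 𝔸) τ (k + 1) n (Fin.tail t))) F
    rw [endD_succ, act_add, act_add, act_smul, act_smul]
    simp only [Pi.add_apply, Pi.smul_apply, h1, h2]
    change _ = _ + act _ (fun F => Vert.val (t 0 / τ) (1 / τ) (F k) *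
      prodV τ (k + 1) n (Fin.tail t) F) F
    rw [h3, ← ih]
    simp only [prodV]
    rw [Sm.pdL_mul, Vert.pdL_val, add_mul, smul_mul_assoc, smul_mul_assoc]

/-! ### The regular contractions -/

/-- Contractions `δ/δη_α(t_i) δ/δη_α(t_l)`. -/
def xx (i l : ℕ) : DOp d := ∑ α, x i α * x l α

/-- Contractions of the velocity in slot `i` with the position in slot `l`. -/
def wx (i l : ℕ) : DOp d := ∑ α, w i α * x l α

/-- Contractions of two velocities. -/
def ww (i l : ℕ) : DOp d := ∑ α, w i α * w l α

/-- A quadratic contraction operator in the slots `k, …, k + n - 1`. -/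
def quad (k n : ℕ) (X Y Z : Fin n → Fin n → ℝ) : DOp d :=
  ∑ i : Fin n, ∑ l : Fin n, ((X i l / 2) • xx (k + i) (k + l) + Y i l • wx (k + i) (k + l) +
    (Z i l / 2) • ww (k + i) (k + l))

theorem quad_mem_off {j k : ℕ} (n : ℕ) (X Y Z : Fin n → Fin n → ℝ) (h : j < k) :
    quad k n X Y Z ∈ off (d := d) j := by
  have hx : ∀ (i : Fin n) (a : Fin d ⊕ Fin d), MvPolynomial.X (k + i.val, a) ∈ off (d := d) j :=
    fun i a => X_mem_off (by dsimp only; omega)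
  refine Subalgebra.sum_mem _ fun i _ => Subalgebra.sum_mem _ fun l _ =>
    Subalgebra.add_mem _ (Subalgebra.add_mem _ ?_ ?_) ?_ <;>
  exact Subalgebra.smul_mem _ (Subalgebra.sum_mem _ fun α _ =>
    Subalgebra.mul_mem _ (hx _ _) (hx _ _)) _

/-- The limit of the contraction of positions, for ordered times. -/
def limX {n : ℕ} (τ : ℝ) (t : Fin n → ℝ) (i l : Fin n) : ℝ :=
  2 * t (max i l) - 2 * t i * t l / τ

/-- The limit of the contraction of the velocity in slot `i` with the position in slot `l`, for
ordered times. -/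
def limY {n : ℕ} (τ : ℝ) (t : Fin n → ℝ) (i l : Fin n) : ℝ :=
  (if l < i then 2 else if i = l then 1 else 0) - 2 * t l / τ

/-- The limit of the regular contractions. -/
def limQuad (k n : ℕ) (τ : ℝ) (t : Fin n → ℝ) : DOp d :=
  quad k n (limX τ t) (limY τ t) fun _ _ => -2 / τ

/-- The derivative with respect to the position at the largest time. -/
def totD (k n : ℕ) (t : Fin (n + 1) → ℝ) (α : Fin d) : DOp d :=
  x k α + endD (t 0) (k + 1) n (Fin.tail t) α

/-- The path is linear in its end point, so the Laplacian in the end point is a contraction with a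
rank-one covariance. This kernel is the difference of bridge covariances with different final times,
up to a factor. -/
theorem sum_endD_sq {τ : ℝ} (k n : ℕ) (t : Fin n → ℝ) :
    ∑ α : Fin d, endD τ k n t α ^ 2 = quad k n (fun i l => 2 * t i * t l / τ ^ 2)
      (fun _ l => 2 * t l / τ ^ 2) fun _ _ => 2 / τ ^ 2 := by
  simp only [endD, pow_two (Finset.sum _ _), Finset.sum_mul_sum]
  rw [Finset.sum_comm]
  simp_rw [Finset.sum_comm (γ := Fin d)]
  have h : ∀ i l : Fin n, ∑ α : Fin d, ((t i / τ) • x (k + i) α + (1 / τ) • w (k + i) α) *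
      ((t l / τ) • x (k + l) α + (1 / τ) • w (k + l) α) =
      (t i * t l / τ ^ 2) • xx (k + i) (k + l) + (t l / τ ^ 2) • wx (k + i) (k + l) +
      (t i / τ ^ 2) • wx (k + l) (k + i) + (1 / τ ^ 2) • ww (k + i) (k + l) := by
    intro i l
    simp only [xx, wx, ww, Finset.smul_sum, ← Finset.sum_add_distrib]
    refine Finset.sum_congr rfl fun α _ => ?_
    simp only [add_mul, mul_add, smul_mul_smul_comm]
    rw [mul_comm (x (k + i) α) (w (k + l) α)]
    rw [show t i / τ * (t l / τ) = t i * t l / τ ^ 2 by ring,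
      show t i / τ * (1 / τ) = t i / τ ^ 2 by ring,
      show 1 / τ * (t l / τ) = t l / τ ^ 2 by ring, show 1 / τ * (1 / τ) = 1 / τ ^ 2 by ring]
    abel
  simp only [h, Finset.sum_add_distrib, quad]
  rw [Finset.sum_comm (f := fun (i l : Fin n) => (t i / τ ^ 2) • wx (d := d) (k + l) (k + i))]
  simp only [← Finset.sum_add_distrib]
  refine Finset.sum_congr rfl fun i _ => Finset.sum_congr rfl fun l _ => ?_
  rw [show 2 * t i * t l / τ ^ 2 / 2 = t i * t l / τ ^ 2 by ring,
    show 2 / τ ^ 2 / 2 = 1 / τ ^ 2 by ring, show 2 * t l / τ ^ 2 = t l / τ ^ 2 + t l / τ ^ 2 by ring,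
    add_smul]
  abel

theorem quad_add (k n : ℕ) (X Y Z X' Y' Z' : Fin n → Fin n → ℝ) :
    quad (d := d) k n X Y Z + quad k n X' Y' Z' =
      quad k n (fun i l => X i l + X' i l) (fun i l => Y i l + Y' i l)
        fun i l => Z i l + Z' i l := by
  simp only [quad, ← Finset.sum_add_distrib]
  refine Finset.sum_congr rfl fun i _ => Finset.sum_congr rfl fun l _ => ?_
  rw [add_div, add_div, add_smul, add_smul, add_smul]
  abel

theorem smul_quad (r : ℝ) (k n : ℕ) (X Y Z : Fin n → Fin n → ℝ) :
    r • quad (d := d) k n X Y Z =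
      quad k n (fun i l => r * X i l) (fun i l => r * Y i l) fun i l => r * Z i l := by
  simp only [quad, Finset.smul_sum, smul_add, smul_smul]
  refine Finset.sum_congr rfl fun i _ => Finset.sum_congr rfl fun l _ => ?_
  rw [mul_div_assoc, mul_div_assoc]

theorem xx_comm (i l : ℕ) : xx (d := d) i l = xx l i :=
  Finset.sum_congr rfl fun _ _ => mul_comm _ _

theorem ww_comm (i l : ℕ) : ww (d := d) i l = ww l i :=
  Finset.sum_congr rfl fun _ _ => mul_comm _ _

/-- The contractions on `[0, τ]`, conditioned on the position at the largest time. -/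
theorem limQuad_succ (k n : ℕ) {τ : ℝ} (hτ : τ ≠ 0) (t : Fin (n + 1) → ℝ) (ht : t 0 ≠ 0) :
    limQuad (d := d) k (n + 1) τ t = limQuad (k + 1) n (t 0) (Fin.tail t) +
      (t 0 * (τ - t 0) / τ) • ∑ α, totD k n t α ^ 2 +
      (∑ α, w k α * (x k α - (2 * t 0 / τ) • totD k n t α) - (1 / τ) • ww k k) := by
  obtain ⟨T, hT⟩ : ∃ T : Fin n → ℝ, T = Fin.tail t := ⟨_, rfl⟩
  obtain ⟨s, hs⟩ : ∃ s : ℝ, s = t 0 := ⟨_, rfl⟩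
  have hsucc : ∀ i : Fin n, t i.succ = T i := fun i => by rw [hT]; rfl
  have hk : ∀ i : Fin n, k + (i.val + 1) = k + 1 + i := fun i => by omega
  have e1 : ∑ α : Fin d, totD k n t α ^ 2 = xx k k +
      ∑ i : Fin n, ((2 * T i / s) • xx k (k + 1 + i) + (2 / s) • wx (k + 1 + i) k) +
      ∑ α : Fin d, endD s (k + 1) n T α ^ 2 := by
    simp only [totD, ← hT, ← hs, add_sq, Finset.sum_add_distrib]
    congr 1
    · congr 1
      · simp [xx, pow_two]
      · simp only [endD, xx, wx, Finset.mul_sum, Finset.smul_sum, ← Finset.sum_add_distrib]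
        rw [Finset.sum_comm]
        refine Finset.sum_congr rfl fun i _ => Finset.sum_congr rfl fun α _ => ?_
        rw [mul_add, mul_smul_comm, mul_smul_comm,
          show (2 * T i / s) = 2 * (T i / s) by ring, show (2 / s) = 2 * (1 / s) by ring,
          mul_smul, mul_smul, two_smul ℝ, two_smul ℝ, ← smul_add, ← smul_add]
        congr 2 <;> ring
  have e2 : ∑ α : Fin d, w k α * (x k α - (2 * s / τ) • totD k n t α) =
      (1 - 2 * s / τ) • wx k k -
      ∑ i : Fin n, ((2 * T i / τ) • wx k (k + 1 + i) + (2 / τ) • ww k (k + 1 + i)) := by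
    simp only [totD, ← hT, ← hs, endD, wx, ww, Finset.mul_sum, Finset.smul_sum,
      ← Finset.sum_add_distrib, mul_sub, smul_add, mul_add, mul_smul_comm, smul_smul, sub_smul,
      one_smul, Finset.sum_sub_distrib]
    simp only [Finset.sum_add_distrib]
    rw [Finset.sum_comm, Finset.sum_comm (t := (Finset.univ : Finset (Fin n))) (f := fun (α : Fin d) (i : Fin n) =>
      (2 * s / τ * (1 / s)) • (w k α * w (k + 1 + i.val) α))]
    rw [← hs] at ht
    have a1 : ∀ i : Fin n, 2 * s / τ * (T i / s) = 2 * T i / τ := fun i => by field_simp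
    have a2 : 2 * s / τ * (1 / s) = 2 / τ := by field_simp
    simp only [a1, a2]
    abel
  rw [e1, ← hs, e2, ← hT, smul_add, smul_add, sum_endD_sq, smul_quad, limQuad, limQuad]
  -- Split off the row and the column of slot `k`. As `t 0` is the largest time, the minimum with
  -- any later time is the later one, and the step in the velocity contraction takes the value `2`
  -- in row `i + 1`, column `0`, and `0` in the transposed place.
  have e3 : quad (d := d) k (n + 1) (limX τ t) (limY τ t) (fun _ _ => -2 / τ) =
      ((s - s ^ 2 / τ) • xx k k + (1 - 2 * s / τ) • wx k k - (1 / τ) • ww k k) +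
      ∑ i : Fin n, ((2 * T i - 2 * s * T i / τ) • xx k (k + 1 + i) +
        (2 - 2 * s / τ) • wx (k + 1 + i) k - (2 * T i / τ) • wx k (k + 1 + i)
        - (2 / τ) • ww k (k + 1 + i)) +
      quad (k + 1) n (limX τ T) (limY τ T) (fun _ _ => -2 / τ) := by
    simp only [quad, Fin.sum_univ_succ, Fin.val_zero, Fin.val_succ, Nat.add_zero, hk]
    have b1 : limX τ t 0 0 / 2 = s - s ^ 2 / τ := by simp only [limX, max_self, ← hs]; ring
    have b2 : limY τ t 0 0 = 1 - 2 * s / τ := by simp [limY, ← hs]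
    have b3 : ∀ i : Fin n, limX τ t 0 i.succ / 2 = T i - s * T i / τ := fun i => by
      simp only [limX, ← hs, hsucc, max_eq_right (Fin.zero_le _)]; ring
    have b4 : ∀ i : Fin n, limX τ t i.succ 0 / 2 = T i - s * T i / τ := fun i => by
      simp only [limX, ← hs, hsucc, max_eq_left (Fin.zero_le _)]; ring
    have b5 : ∀ i : Fin n, limY τ t 0 i.succ = -(2 * T i / τ) := fun i => by
      simp [limY, hsucc, (Fin.succ_ne_zero i).symm]
    have b6 : ∀ i : Fin n, limY τ t i.succ 0 = 2 - 2 * s / τ := fun i => by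
      simp [limY, ← hs, Fin.succ_pos]
    have b7 : ∀ i l : Fin n, limX τ t i.succ l.succ = limX τ T i l := fun i l => by
      simp only [limX, hsucc]
      congr 3
      rcases le_total i l with h | h
      · rw [max_eq_right h, max_eq_right (Fin.succ_le_succ_iff.2 h), hsucc]
      · rw [max_eq_left h, max_eq_left (Fin.succ_le_succ_iff.2 h), hsucc]
    have b8 : ∀ i l : Fin n, limY τ t i.succ l.succ = limY τ T i l := fun i l => by
      simp [limY, hsucc]
    simp only [b1, b2, b3, b4, b5, b6, b7, b8]
    have c1 : ∀ i : Fin n, (2 * T i - 2 * s * T i / τ) • xx (d := d) k (k + 1 + i) =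
        (T i - s * T i / τ) • xx k (k + 1 + i) + (T i - s * T i / τ) • xx k (k + 1 + i) :=
      fun i => by rw [← add_smul]; congr 1; ring
    have c2 : ∀ i : Fin n, (2 / τ) • ww (d := d) k (k + 1 + i) =
        (1 / τ) • ww k (k + 1 + i) + (1 / τ) • ww k (k + 1 + i) :=
      fun i => by rw [← add_smul]; congr 1; ring
    simp only [c1, c2, fun i : Fin n => xx_comm (d := d) (k + 1 + i) k,
      fun i : Fin n => ww_comm (d := d) (k + 1 + i) k, show (-2 : ℝ) / τ / 2 = -(1 / τ) by ring,
      neg_smul, Finset.sum_add_distrib, Finset.sum_sub_distrib, Finset.sum_neg_distrib]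
    abel
  -- Replacing the final time `τ` by `s` changes the bridge covariance by `2 T_i T_l (1/s - 1/τ)`,
  -- where `1/s - 1/τ = (s(τ - s)/τ)/s²`.
  have e4 : quad (d := d) (k + 1) n (limX τ T) (limY τ T) (fun _ _ => -2 / τ) =
      quad (k + 1) n (limX s T) (limY s T) (fun _ _ => -2 / s) +
      quad (k + 1) n (fun i l => s * (τ - s) / τ * (2 * T i * T l / s ^ 2))
        (fun i l => s * (τ - s) / τ * (2 * T l / s ^ 2))
        (fun i l => s * (τ - s) / τ * (2 / s ^ 2)) := by
    rw [← hs] at ht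
    rw [quad_add]
    congr 1
    · funext i l; simp only [limX]; field_simp; ring
    · funext i l; simp only [limY]; field_simp; ring
    · funext i l; field_simp; ring
  rw [e3, e4, Finset.smul_sum]
  rw [← hs] at ht
  have e5 : ∀ i : Fin n, (s * (τ - s) / τ) • ((2 * T i / s) • xx (d := d) k (k + 1 + i) +
      (2 / s) • wx (k + 1 + i) k) = (2 * T i - 2 * s * T i / τ) • xx k (k + 1 + i) +
        (2 - 2 * s / τ) • wx (k + 1 + i) k := by
    intro i
    rw [smul_add, smul_smul, smul_smul]
    congr 2 <;> field_simp
  simp only [e5, Finset.sum_sub_distrib, Finset.sum_add_distrib]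
  rw [show s * (τ - s) / τ = s - s ^ 2 / τ by field_simp]
  abel

/-! ### Commutators of the Laplacian with the coordinates, and the radial gauge condition. -/

namespace Sm

theorem val_eq_ev (ψ : Sm d 𝔸) (x : Sp d) : ψ.1 x = ev x ψ := rfl

theorem lapl_coord_mul (μ : Fin d) (ψ : Sm d 𝔸) :
    lapl (coord μ * ψ) = coord μ * lapl ψ + (2 : ℝ) • pdL μ ψ := by
  simp only [lapl_apply, pdL_mul, pdL_coord, map_add, ite_mul, one_mul, zero_mul,
    Finset.sum_add_distrib, Finset.mul_sum]
  have h1 : ∀ ν : Fin d, pdL ν (if ν = μ then ψ else 0) = if ν = μ then pdL μ ψ else 0 := by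
    intro ν; split_ifs with h
    · rw [h]
    · simp
  simp only [h1, Finset.sum_ite_eq', Finset.mem_univ, if_true]
  rw [two_smul]; abel

/-- Iterates `[Δ, ξ_μ] = 2∂_μ`, using that `∂_μ` commutes with `Δ`. At `i = 0` the truncated
exponent is harmless because its coefficient is zero. -/
theorem lapl_pow_coord_mul (i : ℕ) (μ : Fin d) (ψ : Sm d 𝔸) :
    (lapl ^ i) (coord μ * ψ) =
      coord μ * (lapl ^ i) ψ + (2 * i : ℝ) • pdL μ ((lapl ^ (i - 1)) ψ) := by
  induction i generalizing ψ with
  | zero => simp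
  | succ i ih =>
    have hc : ∀ (l : ℕ) (χ : Sm d 𝔸), (lapl ^ l) (pdL μ χ) = pdL μ ((lapl ^ l) χ) := by
      intro l
      induction l with
      | zero => intro χ; rfl
      | succ l ihl =>
        intro χ
        rw [pow_succ, Module.End.mul_apply, Module.End.mul_apply, ← ihl]
        congr 1
        simp only [lapl_apply, map_sum]
        exact Finset.sum_congr rfl fun ν _ => by rw [pdL_comm ν μ, pdL_comm ν μ]
    rw [pow_succ, Module.End.mul_apply, lapl_coord_mul, map_add, map_smul, ih, hc,
      Module.End.mul_apply, Nat.add_sub_cancel]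
    rcases i with - | i
    · simp
    · have h : (lapl ^ (i + 1 - 1)) (lapl ψ) = (lapl ^ (i + 1)) ψ := by
        rw [Nat.add_sub_cancel, pow_succ, Module.End.mul_apply]
      rw [h, add_assoc, ← add_smul]
      congr 2
      push_cast; ring

theorem lapl_pow_pdL (i : ℕ) (μ : Fin d) (ψ : Sm d 𝔸) :
    (lapl ^ i) (pdL μ ψ) = pdL μ ((lapl ^ i) ψ) := by
  have : Commute (lapl : Module.End ℝ (Sm d 𝔸)) (pdL μ) := by
    refine LinearMap.ext fun χ => ?_
    simp only [Module.End.mul_apply, lapl_apply, map_sum]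
    exact Finset.sum_congr rfl fun ν _ => by rw [pdL_comm ν μ, pdL_comm ν μ]
  exact LinearMap.congr_fun (this.pow_left i) ψ

/-- The radial gauge condition, after powers of the Laplace operator. -/
theorem sum_smul_lapl_pow {h : Fin d → Sm d 𝔸} (hh : ∑ μ, coord μ * h μ = 0) (i : ℕ)
    (y : Sp d) : ∑ μ, y μ • ((lapl ^ i) (h μ)).1 y =
      -((2 * i : ℝ) • (∑ μ, (lapl ^ (i - 1)) (pdL μ (h μ))).1 y) := by
  have h1 : ∑ μ, coord μ * (lapl ^ i) (h μ) + (2 * i : ℝ) • ∑ μ, pdL μ ((lapl ^ (i - 1)) (h μ))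
      = 0 := by
    rw [Finset.smul_sum, ← Finset.sum_add_distrib]
    simp only [← lapl_pow_coord_mul, ← map_sum, hh, map_zero]
  have h2 := congrArg (ev y) h1
  rw [map_add, map_smul, map_sum, map_zero] at h2
  simp only [lapl_pow_pdL]
  rw [eq_neg_iff_add_eq_zero, ← h2]
  congr 1
  refine Finset.sum_congr rfl fun μ _ => ?_
  change _ = (y μ • (1 : 𝔸)) * ((lapl ^ i) (h μ)).1 y
  simp

end Sm

/-- The sum of all contractions of order `j`. -/
def wick (τ : ℝ) (k n : ℕ) (t : Fin n → ℝ) (j : ℕ) (F : ℕ → Vert d 𝔸) : Sm d 𝔸 :=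
  act (dp j (limQuad k n τ t)) (prodV τ k n t) F

/-- The first-order operator with which a vertex acts. -/
def headSrc (F : Vert d 𝔸) (Y : ℕ → Sm d 𝔸) : ℕ → Sm d 𝔸
  | 0 => F.2 * Y 0
  | l + 1 => F.2 * Y (l + 1) + Sm.opN F.1 (Y l)

/-! ### Splitting off the vertex at the largest time. -/

section Peel

variable (τ : ℝ) (k n : ℕ) (t : Fin (n + 1) → ℝ)

/-- A function of the vertex in slot `k` times the contractions of the later slots. -/
def headMul (h : Vert d 𝔸 → Sm d 𝔸) (l : ℕ) (F : ℕ → Vert d 𝔸) : Sm d 𝔸 :=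
  h (F k) * wick (t 0) (k + 1) n (Fin.tail t) l F

theorem act_headMul (h : Vert d 𝔸 → Sm d 𝔸) (l : ℕ) :
    act (dp l (limQuad (k + 1) n (t 0) (Fin.tail t))) (headMul k n t h 0) =
      headMul k n t h l := by
  have hm : dp l (limQuad (k + 1) n (t 0) (Fin.tail t)) ∈ off (d := d) k :=
    Subalgebra.smul_mem _ (Subalgebra.pow_mem _ (quad_mem_off _ _ _ _ (Nat.lt_succ_self k)) _) _
  have := act_head_mul hm h (wick (𝔸 := 𝔸) (t 0) (k + 1) n (Fin.tail t) 0)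
  refine this.trans ?_
  funext F
  have h0 : wick (d := d) (𝔸 := 𝔸) (t 0) (k + 1) n (Fin.tail t) 0 = prodV (t 0) (k + 1) n (Fin.tail t) := by
    funext F; simp [wick]
  rw [h0]; rfl

theorem headMul_zero_apply (h : Vert d 𝔸 → Sm d 𝔸) (F : ℕ → Vert d 𝔸) :
    headMul k n t h 0 F = h (F k) * prodV (t 0) (k + 1) n (Fin.tail t) F := by
  simp [headMul, wick]

/-- The head and the later vertices are functions of the same point, the position at the largest
time. The formal derivative in that position is therefore the partial derivative of the product, and
it commutes with the contractions of the later slots. -/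
theorem act_totD (h : Vert d 𝔸 → Sm d 𝔸) (hh : ∀ α G, h (Vert.dx α G) = Sm.pdL α (h G))
    (α : Fin d) (l : ℕ) : act (totD k n t α) (headMul k n t h l) =
      fun F => Sm.pdL α (headMul k n t h l F) := by
  rw [← act_headMul, ← act_mul, mul_comm, act_mul, ← act_post]
  congr 1
  funext F
  have h1 := congrFun (act_head_mul (endD_mem_off (t 0) n (Fin.tail t) α (Nat.lt_succ_self k))
    h (prodV (𝔸 := 𝔸) (t 0) (k + 1) n (Fin.tail t))) F
  rw [totD, act_add, Pi.add_apply, act_x, headMul_zero_apply, headMul_zero_apply,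
    Function.update_self, prodV_indep _ _ _ _ (Nat.lt_succ_self k), Sm.pdL_mul, hh]
  have h2 : headMul k n t h 0 = fun F => h (F k) * prodV (t 0) (k + 1) n (Fin.tail t) F := by
    funext F; exact headMul_zero_apply k n t h F
  rw [h2, h1, ← pdL_prodV]

theorem act_sum_totD_sq (h : Vert d 𝔸 → Sm d 𝔸)
    (hh : ∀ α G, h (Vert.dx α G) = Sm.pdL α (h G)) (i l : ℕ) :
    act ((∑ α, totD k n t α ^ 2) ^ i) (headMul k n t h l) =
      fun F => (Sm.lapl ^ i) (headMul k n t h l F) := by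
  have h1 : act (∑ α, totD k n t α ^ 2) (headMul k n t h l) =
      fun F => Sm.lapl (headMul k n t h l F) := by
    rw [act_sum]
    funext F
    rw [Sm.lapl_apply, Finset.sum_apply]
    refine Finset.sum_congr rfl fun α _ => ?_
    rw [pow_two, act_mul, act_totD k n t h hh, act_post, act_totD k n t h hh]
  induction i with
  | zero => rw [pow_zero, act_one]; rfl
  | succ i ih =>
    rw [pow_succ', act_mul, ih, act_post, h1]
    funext F
    rw [pow_succ, Module.End.mul_apply]

/-- The sum over the contractions in which the end of the path is integrated out. -/
def heatSum (g : ℝ) (h : Vert d 𝔸 → Sm d 𝔸) (j : ℕ) (F : ℕ → Vert d 𝔸) : Sm d 𝔸 :=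
  ∑ i ∈ Finset.range (j + 1), (g ^ i / (i ! : ℕ)) • (Sm.lapl ^ i) (headMul k n t h (j - i) F)

/-- The contraction of the position at the largest time and those of the later slots commute, so the
divided power of their sum is a convolution. The first factor becomes the heat semigroup at
parameter `g`. -/
theorem act_dp_heat (g : ℝ) (h : Vert d 𝔸 → Sm d 𝔸)
    (hh : ∀ α G, h (Vert.dx α G) = Sm.pdL α (h G)) (j : ℕ) :
    act (dp j (g • ∑ α, totD k n t α ^ 2 + limQuad (k + 1) n (t 0) (Fin.tail t)))
      (headMul k n t h 0) = heatSum k n t g h j := by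
  rw [dp_add, act_sum]
  funext F
  rw [Finset.sum_apply, heatSum]
  refine Finset.sum_congr rfl fun i _ => ?_
  rw [act_mul, act_headMul, dp_smul, dp, smul_smul, act_smul, act_sum_totD_sq k n t h hh]
  rfl

theorem act_w_headMul (μ : Fin d) (h : Vert d 𝔸 → Sm d 𝔸) :
    act (w k μ) (headMul k n t h 0) = headMul k n t (fun G => h (Vert.dv μ G)) 0 := by
  funext F
  rw [act_w, headMul_zero_apply, headMul_zero_apply, Function.update_self,
    prodV_indep _ _ _ _ (Nat.lt_succ_self k)]

theorem act_x_headMul (μ : Fin d) (h : Vert d 𝔸 → Sm d 𝔸) :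
    act (x k μ) (headMul k n t h 0) = headMul k n t (fun G => h (Vert.dx μ G)) 0 := by
  funext F
  rw [act_x, headMul_zero_apply, headMul_zero_apply, Function.update_self,
    prodV_indep _ _ _ _ (Nat.lt_succ_self k)]

theorem headMul_neg (h : Vert d 𝔸 → Sm d 𝔸) :
    headMul k n t (fun G => -h G) 0 = -headMul k n t h 0 := by
  funext F
  exact neg_mul (h (F k)) _

variable {τ k n t}

/-- Both factors contain a velocity derivative in slot `k`, and a vertex tolerates only one. -/
theorem act_w_sum_mul {M : Type} [AddCommGroup M] [Module ℝ M] {Φ : (ℕ → Vert d 𝔸) → M}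
    (hΦ : Vanish k Φ) (b b' : Fin d → DOp d)
    (q : DOp d) : act ((∑ α, w k α * b α) * (∑ α, w k α * b' α) * q) Φ = 0 := by
  rw [Finset.sum_mul_sum, Finset.sum_mul, act_sum]
  refine Finset.sum_eq_zero fun α _ => ?_
  rw [Finset.sum_mul, act_sum]
  refine Finset.sum_eq_zero fun β _ => ?_
  rw [show w k α * b α * (w k β * b' β) * q = w k α * w k β * (b α * b' β * q) by ring]
  exact act_w_mul_w hΦ _ _ _

set_option maxHeartbeats 1600000 in
/-- The vertex at the largest time `t 0` acts as a differential operator on the functions of the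
position at that time, followed by a heat flow. -/
theorem wick_succ (hτ : τ ≠ 0) (ht : t 0 ≠ 0) {F : ℕ → Vert d 𝔸}
    (hF : ∑ μ, Sm.coord μ * (F k).1 μ = 0) (j : ℕ) (ξ : Sp d) :
    (wick τ k (n + 1) t j F).1 ξ =
      ∑ i ∈ Finset.range (j + 1), ((t 0 * (τ - t 0) / τ) ^ i / (i ! : ℕ)) •
        ((Sm.lapl ^ i) (headSrc (F k) (fun l => wick (t 0) (k + 1) n (Fin.tail t) l F)
          (j - i))).1 ((t 0 / τ) • ξ) := by
  obtain ⟨g, hg⟩ : ∃ g, g = t 0 * (τ - t 0) / τ := ⟨_, rfl⟩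
  obtain ⟨A, hA⟩ : ∃ A : DOp d, A = g • ∑ α, totD k n t α ^ 2 +
    limQuad (k + 1) n (t 0) (Fin.tail t) := ⟨_, rfl⟩
  obtain ⟨b, hb⟩ : ∃ b : Fin d → DOp d, b = fun α => x k α - (2 * t 0 / τ) • totD k n t α -
    (1 / τ) • w k α := ⟨_, rfl⟩
  obtain ⟨y, hy⟩ : ∃ y, y = (t 0 / τ) • ξ := ⟨_, rfl⟩
  let hV : Vert d 𝔸 → Sm d 𝔸 := fun G => G.2
  let hf : Fin d → Vert d 𝔸 → Sm d 𝔸 := fun μ G => G.1 μ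
  let hdf : Fin d → Vert d 𝔸 → Sm d 𝔸 := fun μ G => Sm.pdL μ (G.1 μ)
  have hhV : ∀ α G, hV (Vert.dx α G) = Sm.pdL α (hV G) := fun _ _ => rfl
  have hhf : ∀ μ α G, hf μ (Vert.dx α G) = Sm.pdL α (hf μ G) := fun _ _ _ => rfl
  have hhdf : ∀ μ α G, hdf μ (Vert.dx α G) = Sm.pdL α (hdf μ G) := fun _ _ _ => Sm.pdL_comm _ _ _
  let U := headMul k n t hV 0
  have hU : Vanish k U := fun G hG => by
    change (G k).2 * _ = 0
    rw [hG]; simp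
  -- A vertex is affine in its velocity, so `1 + om` inserts the background velocity `ξ/τ` into the
  -- velocity-free head `U`.
  let om : DOp d := ∑ μ, w k μ * ((ξ μ / τ) • 1)
  have hL : limQuad k (n + 1) τ t = A + ∑ α, w k α * b α := by
    rw [limQuad_succ k n hτ t ht, hA, hb, hg, add_comm (limQuad _ _ _ _)]
    congr 1
    simp only [mul_sub, Finset.sum_sub_distrib, ww, Finset.smul_sum, mul_smul_comm]
  have hw : ∀ μ, act (w k μ) U = -headMul k n t (hf μ) 0 := fun μ => by
    rw [act_w_headMul, ← headMul_neg]
    rfl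
  -- The straight path to `ξ` in time `τ` passes through `y` at time `t 0` with the same velocity,
  -- so the later vertices take the same values on both descriptions.
  have hval : ∀ G, (prodV τ k (n + 1) t G).1 ξ = (act (1 + om) U G).1 y := by
    intro G
    have h1 : ∀ m (s : Fin m → ℝ) l, (prodV τ l m s G).1 ξ =
        (prodV (t 0) l m s G).1 y := by
      intro m
      induction m with
      | zero => intro s l; rfl
      | succ m ih =>
        intro s l
        change (Vert.val (s 0 / τ) (1 / τ) (G l)).1 ξ *
          (prodV τ (l + 1) m (Fin.tail s) G).1 ξ =
          (Vert.val (s 0 / t 0) (1 / t 0) (G l)).1 y *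
          (prodV (t 0) (l + 1) m (Fin.tail s) G).1 y
        rw [ih]
        congr 1
        have e1 : (s 0 / τ) • ξ = (s 0 / t 0) • y := by
          rw [hy, smul_smul]; congr 1; field_simp
        rw [Vert.val_apply, Vert.val_apply]
        change (G l).2.1 ((s 0 / τ) • ξ) -
          (1 / τ) • (Sm.ev ξ) (∑ μ, Sm.coord μ * Sm.dil (s 0 / τ) ((G l).1 μ)) =
          (G l).2.1 ((s 0 / t 0) • y) -
          (1 / t 0) • (Sm.ev y) (∑ μ, Sm.coord μ * Sm.dil (s 0 / t 0) ((G l).1 μ))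
        rw [e1, map_sum, map_sum, Finset.smul_sum, Finset.smul_sum]
        congr 1
        refine Finset.sum_congr rfl fun μ _ => ?_
        change (1 / τ) • ((ξ μ • (1 : 𝔸)) * ((G l).1 μ).1 ((s 0 / τ) • ξ)) =
          (1 / t 0) • ((y μ • (1 : 𝔸)) * ((G l).1 μ).1 ((s 0 / t 0) • y))
        rw [e1, smul_mul_assoc, smul_mul_assoc, smul_smul, smul_smul]
        congr 1
        rw [hy]; simp; field_simp
    change (Vert.val (t 0 / τ) (1 / τ) (G k)).1 ξ *
      (prodV τ (k + 1) n (Fin.tail t) G).1 ξ = _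
    rw [h1, act_add, act_one, act_sum, Pi.add_apply, Finset.sum_apply]
    simp only [mul_smul_comm, mul_one, act_smul, hw]
    change _ = Sm.ev y (U G + ∑ μ, (ξ μ / τ) • -headMul k n t (hf μ) 0 G)
    rw [map_add, map_sum, Vert.val_apply]
    change ((G k).2.1 ((t 0 / τ) • ξ) - (1 / τ) • (Sm.ev ξ) (∑ μ, Sm.coord μ *
      Sm.dil (t 0 / τ) ((G k).1 μ))) * _ = (headMul k n t hV 0 G).1 y +
        ∑ μ, ((ξ μ / τ) • -(headMul k n t (hf μ) 0 G).1 y)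
    simp only [headMul_zero_apply]
    rw [map_sum, ← hy, sub_mul, Finset.smul_sum, Finset.sum_mul, sub_eq_add_neg,
      ← Finset.sum_neg_distrib]
    congr 1
    refine Finset.sum_congr rfl fun μ _ => ?_
    change -((1 / τ) • ((ξ μ • (1 : 𝔸)) * ((G k).1 μ).1 ((t 0 / τ) • ξ)) * _) =
      (ξ μ / τ) • -(((G k).1 μ).1 y * (prodV (t 0) (k + 1) n (Fin.tail t) G).1 y)
    rw [← hy]
    simp only [smul_mul_assoc, one_mul, smul_smul, smul_neg]
    congr 2; ring
  have hpost : ∀ p : DOp d, (act p (prodV τ k (n + 1) t) F).1 ξ =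
      (act (p * (1 + om)) U F).1 y := by
    intro p
    have h1 := congrFun (act_post (Sm.ev ξ) p (prodV (𝔸 := 𝔸) τ k (n + 1) t)) F
    have h2 := congrFun (act_post (Sm.ev y) p (act (1 + om) U)) F
    rw [act_mul]
    refine h1.symm.trans (Eq.trans ?_ h2)
    have h3 : (fun G => Sm.ev ξ (prodV τ k (n + 1) t G)) =
        fun G => Sm.ev y (act (1 + om) U G) := funext hval
    rw [h3]
  have hheat : ∀ (h : Vert d 𝔸 → Sm d 𝔸) (_ : ∀ α G, h (Vert.dx α G) = Sm.pdL α (h G)) j,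
      act (dp j A) (headMul k n t h 0) = heatSum k n t g h j := fun h hh j => by
    rw [hA]; exact act_dp_heat k n t g h hh j
  -- The gauge condition kills `y^μ f_μ` before the heat flow. After it only commutators survive: `y
  -- = (t 0/τ) ξ` turns `ξ/τ` into `y/t 0`, and one factor `g` divided by `t 0` leaves `(τ - t
  -- 0)/τ`.
  have hFS : ∀ j, (∑ μ, (ξ μ / τ) • (heatSum k n t g (hf μ) j F).1 y) =
      -∑ i ∈ Finset.range j, (g ^ i / (i ! : ℕ)) • (2 * (τ - t 0) / τ) •
        (∑ μ, (Sm.lapl ^ i) (Sm.pdL μ (headMul k n t (hf μ) (j - 1 - i) F))).1 y := by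
    intro j
    have h1 : ∀ i l : ℕ, ∑ μ, (ξ μ / τ) • ((Sm.lapl ^ i) (headMul k n t (hf μ) l F)).1 y =
        -((2 * i / t 0 : ℝ) • (∑ μ, (Sm.lapl ^ (i - 1)) (Sm.pdL μ (headMul k n t (hf μ) l F))).1 y)
        := by
      intro i l
      have h2 : ∑ μ, Sm.coord μ * headMul k n t (hf μ) l F = 0 := by
        simp only [headMul, ← mul_assoc, ← Finset.sum_mul]
        change (∑ μ, Sm.coord μ * (F k).1 μ) * _ = 0
        rw [hF, zero_mul]
      have h3 := congrArg (fun a => (1 / t 0) • a) (Sm.sum_smul_lapl_pow h2 i y)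
      simp only [smul_neg, smul_smul, Finset.smul_sum] at h3
      rw [show (2 * i / t 0 : ℝ) = 1 / t 0 * (2 * i) by ring, ← h3]
      refine Finset.sum_congr rfl fun μ _ => ?_
      congr 1
      rw [hy]; simp; field_simp
    have h2 : ∀ μ, (heatSum k n t g (hf μ) j F).1 y = ∑ i ∈ Finset.range (j + 1),
        (g ^ i / (i ! : ℕ)) • ((Sm.lapl ^ i) (headMul k n t (hf μ) (j - i) F)).1 y := by
      intro μ
      change Sm.ev y _ = _
      rw [heatSum, map_sum]; rfl
    simp only [h2, Finset.smul_sum]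
    rw [Finset.sum_comm]
    simp only [smul_comm (_ / τ) (_ : ℝ), ← Finset.smul_sum, h1]
    rw [Finset.sum_range_succ', ← Finset.sum_neg_distrib]
    simp only [Nat.cast_zero, mul_zero, zero_div, zero_smul, neg_zero, smul_zero, add_zero]
    refine Finset.sum_congr rfl fun i _ => ?_
    rw [smul_neg, smul_smul, smul_smul, Nat.add_sub_cancel, show j - (i + 1) = j - 1 - i by omega]
    congr 2
    have h3 : ((i ! : ℕ) : ℝ) ≠ 0 := by positivity
    obtain ⟨P, hP⟩ : ∃ P, P = g ^ i := ⟨_, rfl⟩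
    rw [pow_succ, ← hP, hg, Nat.factorial_succ]
    push_cast
    field_simp
  have hom : ∀ j, act (dp j A * om) U = -∑ μ, (ξ μ / τ) • heatSum k n t g (hf μ) j := by
    intro j
    rw [Finset.mul_sum, act_sum, ← Finset.sum_neg_distrib]
    refine Finset.sum_congr rfl fun μ _ => ?_
    rw [mul_smul_comm, mul_one, mul_smul_comm, act_smul, act_mul, hw, map_neg,
      hheat _ (hhf μ), smul_neg]
  -- Of the three parts of `b`, the position derivative gives `-(∂_α f_α)`, the total derivative
  -- gives `(2 t 0/τ) ∂_α f_α`, and the velocity self-contraction vanishes.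
  have hB : ∀ j, act (dp j A * ∑ α, w k α * b α) U =
      ∑ α, ((2 * t 0 / τ) • (fun F => Sm.pdL α (heatSum k n t g (hf α) j F)) -
        heatSum k n t g (hdf α) j) := by
    intro j
    rw [Finset.mul_sum, act_sum]
    refine Finset.sum_congr rfl fun α _ => ?_
    have e1 : dp j A * (w k α * b α) = dp j A * (w k α * x k α) -
        (2 * t 0 / τ) • (dp j A * (totD k n t α * w k α)) -
        (1 / τ) • (w k α * w k α * dp j A) := by
      rw [hb]; simp only [mul_sub, mul_smul_comm]
      rw [mul_comm (dp j A) (w k α * w k α), mul_comm (w k α) (totD k n t α)]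
    have e2 : act (dp j A * (w k α * x k α)) U = -heatSum k n t g (hdf α) j := by
      rw [act_mul, act_mul, act_x_headMul, act_w_headMul]
      have : headMul k n t (fun G => hV (Vert.dx α (Vert.dv α G))) 0 =
          -headMul k n t (hdf α) 0 := by
        rw [← headMul_neg]
        simp only [hV, hdf, Vert.dx_apply, Vert.dv_apply, map_neg]
      rw [this, map_neg, hheat _ (hhdf α)]
    have e3 : act (dp j A * (totD k n t α * w k α)) U =
        -fun F => Sm.pdL α (heatSum k n t g (hf α) j F) := by
      rw [act_mul, act_mul, hw, map_neg, map_neg, act_totD k n t _ (hhf α), act_post,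
        hheat _ (hhf α)]
    have e4 := act_w_mul_w hU α α (dp j A)
    rw [e1, map_sub, map_sub, LinearMap.sub_apply, LinearMap.sub_apply, act_smul, act_smul, e2,
      e3, e4, smul_zero, sub_zero, smul_neg, sub_neg_eq_add, add_comm, ← sub_eq_add_neg]
  have hhS : ∀ (h : Vert d 𝔸 → Sm d 𝔸) (j : ℕ), (heatSum k n t g h j F).1 y = ∑ i ∈ Finset.range (j + 1),
      (g ^ i / (i ! : ℕ)) • ((Sm.lapl ^ i) (headMul k n t h (j - i) F)).1 y := by
    intro h j
    change Sm.ev y _ = _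
    rw [heatSum, map_sum]; rfl
  rw [wick, hpost, hL, ← hg, ← hy]
  have hY : ∀ l, headMul k n t hV l F = (F k).2 * wick (t 0) (k + 1) n (Fin.tail t) l F :=
    fun _ => rfl
  have hN : ∀ l, Sm.opN (F k).1 (wick (t 0) (k + 1) n (Fin.tail t) l F) =
      ∑ α, ((2 : ℝ) • Sm.pdL α (headMul k n t (hf α) l F) - headMul k n t (hdf α) l F) := by
    intro l
    rw [Sm.opN, LinearMap.sum_apply]; rfl
  rcases j with - | j
  · have h1 := congrFun (hom 0) F
    have h2 := hFS 0
    have h3 := hhS hV 0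
    rw [dp_zero, one_mul] at h1
    rw [dp_zero, one_mul, act_add, act_one, Pi.add_apply, h1]
    simp only [Finset.range_zero, Finset.sum_empty, neg_zero] at h2
    have h4 : ((-∑ μ, (ξ μ / τ) • heatSum k n t g (hf μ) 0) F).1 y = 0 := by
      rw [← neg_zero, ← h2]
      rw [Sm.val_eq_ev, Pi.neg_apply, Finset.sum_apply, map_neg, map_sum]; rfl
    change (U F).1 y + ((-∑ μ, (ξ μ / τ) • heatSum k n t g (hf μ) 0) F).1 y = _
    rw [h4]
    simp only [zero_add, Finset.range_one, Finset.sum_singleton, pow_zero, Nat.factorial_zero,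
      Nat.cast_one, div_one, one_smul, add_zero, Nat.sub_zero]
    rfl
  -- Expanding in the velocity derivatives of slot `k`, only the terms with at most one of them
  -- survive: none, one from the contractions, or one from the background velocity.
  · obtain ⟨c, hc⟩ := exists_dp_add j A (∑ α, w k α * b α)
    have e1 : dp (j + 1) (A + ∑ α, w k α * b α) * (1 + om) =
        dp (j + 1) A + dp (j + 1) A * om + dp j A * (∑ α, w k α * b α) +
        (∑ α, w k α * b α) * om * dp j A +
        (∑ α, w k α * b α) * (∑ α, w k α * b α) * (c * (1 + om)) := by
      rw [hc]; ring
    rw [e1, act_add, act_add, act_add, act_add, act_w_sum_mul hU, act_w_sum_mul hU, hom, hB,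
      hheat _ hhV, add_zero, add_zero]
    have e2 : (((heatSum k n t g hV (j + 1) + -∑ μ, (ξ μ / τ) • heatSum k n t g (hf μ) (j + 1) +
        ∑ α, ((2 * t 0 / τ) • (fun F => Sm.pdL α (heatSum k n t g (hf α) j F)) -
          heatSum k n t g (hdf α) j)) : (ℕ → Vert d 𝔸) → Sm d 𝔸) F).1 y =
        (heatSum k n t g hV (j + 1) F).1 y +
        -(∑ μ, (ξ μ / τ) • (heatSum k n t g (hf μ) (j + 1) F).1 y) +
        Sm.ev y (∑ α, ((2 * t 0 / τ) • Sm.pdL α (heatSum k n t g (hf α) j F) -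
          heatSum k n t g (hdf α) j F)) := by
      rw [Sm.val_eq_ev, Pi.add_apply, Pi.add_apply, Pi.neg_apply, Finset.sum_apply, Finset.sum_apply, map_add,
        map_add, map_neg, map_sum]
      rfl
    rw [e2, hFS, neg_neg, hhS, Finset.sum_range_succ, Finset.sum_range_succ (n := j + 1)]
    have e3 : ∀ i ∈ Finset.range (j + 1), (g ^ i / (i ! : ℕ)) • ((Sm.lapl ^ i)
        (headSrc (F k) (fun l => wick (t 0) (k + 1) n (Fin.tail t) l F) (j + 1 - i))).1 y =
        (g ^ i / (i ! : ℕ)) • ((Sm.lapl ^ i) (headMul k n t hV (j + 1 - i) F)).1 y +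
        (g ^ i / (i ! : ℕ)) • Sm.ev y ((Sm.lapl ^ i) (∑ α, ((2 : ℝ) •
          Sm.pdL α (headMul k n t (hf α) (j - i) F) - headMul k n t (hdf α) (j - i) F))) := by
      intro i hi
      rw [Finset.mem_range] at hi
      rw [show j + 1 - i = (j - i) + 1 by omega, headSrc, hN, map_add, Sm.val_eq_ev, map_add, smul_add]
      rfl
    rw [Finset.sum_congr rfl e3, Finset.sum_add_distrib]
    have e4 : headSrc (F k) (fun l => wick (t 0) (k + 1) n (Fin.tail t) l F) (j + 1 - (j + 1)) =
        headMul k n t hV (j + 1 - (j + 1)) F := by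
      rw [Nat.sub_self]; rfl
    have e5 : ∀ α, heatSum k n t g (hf α) j F = ∑ i ∈ Finset.range (j + 1),
        (g ^ i / (i ! : ℕ)) • (Sm.lapl ^ i) (headMul k n t (hf α) (j - i) F) := fun _ => rfl
    have e6 : ∀ α, heatSum k n t g (hdf α) j F = ∑ i ∈ Finset.range (j + 1),
        (g ^ i / (i ! : ℕ)) • (Sm.lapl ^ i) (headMul k n t (hdf α) (j - i) F) := fun _ => rfl
    -- Here `2 t 0/τ + 2(τ - t 0)/τ = 2`: the contraction and the background velocity together
    -- produce a coefficient independent of the final time.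
    have e7 : (∑ i ∈ Finset.range (j + 1), (g ^ i / (i ! : ℕ)) • Sm.ev y ((Sm.lapl ^ i)
        (∑ α, ((2 : ℝ) • Sm.pdL α (headMul k n t (hf α) (j - i) F) -
          headMul k n t (hdf α) (j - i) F)))) =
        (∑ i ∈ Finset.range (j + 1), (g ^ i / (i ! : ℕ)) • (2 * (τ - t 0) / τ) •
          Sm.ev y (∑ μ, (Sm.lapl ^ i) (Sm.pdL μ (headMul k n t (hf μ) (j - i) F)))) +
        Sm.ev y (∑ α, ((2 * t 0 / τ) • Sm.pdL α (heatSum k n t g (hf α) j F) -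
          heatSum k n t g (hdf α) j F)) := by
      simp only [e5, e6, map_sum, map_sub, map_smul, ← Sm.lapl_pow_pdL, Finset.smul_sum]
      simp only [← Finset.sum_sub_distrib]
      rw [Finset.sum_comm (s := (Finset.univ : Finset (Fin d))), ← Finset.sum_add_distrib]
      refine Finset.sum_congr rfl fun i _ => ?_
      rw [← Finset.sum_add_distrib]
      refine Finset.sum_congr rfl fun α _ => ?_
      rw [smul_sub, smul_comm (2 * t 0 / τ) _, ← add_sub_assoc, ← smul_add, ← add_smul]
      congr 3
      field_simp; ring
    rw [e4, e7]
    change _ = _ + ((∑ i ∈ Finset.range (j + 1), (g ^ i / (i ! : ℕ)) • (2 * (τ - t 0) / τ) •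
      (∑ μ, (Sm.lapl ^ i) (Sm.pdL μ (headMul k n t (hf μ) (j - i) F))).1 y) + _) + _
    rw [Nat.add_sub_cancel]
    abel

end Peel

theorem DOp.act_ww_of_ne {M : Type} [AddCommGroup M] [Module ℝ M] {i l : ℕ} (h : i ≠ l)
    (Φ : (ℕ → Vert d 𝔸) → M) (F : ℕ → Vert d 𝔸) : act (ww i l) Φ F =
      ∑ μ, Φ (Function.update (Function.update F i (Vert.dv μ (F i))) l
        (Vert.dv μ (F l))) := by
  rw [ww, act_sum, Finset.sum_apply]
  refine Finset.sum_congr rfl fun μ _ => ?_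
  rw [act_mul, act_w, act_w, Function.update_of_ne h.symm]

theorem DOp.act_ww {M : Type} [AddCommGroup M] [Module ℝ M] (k : ℕ) (Φ : (ℕ → Vert d 𝔸) → M)
    (F : ℕ → Vert d 𝔸) : act (ww k (k + 1)) Φ F =
      ∑ μ, Φ (Function.update (Function.update F k (Vert.dv μ (F k))) (k + 1)
        (Vert.dv μ (F (k + 1)))) := act_ww_of_ne (by omega) Φ F

/-! ### Iterated integrals with contact terms -/

/-- The iterated integral of the functionals `Y 0` over `τ ≥ t₁ ≥ … ≥ t_n ≥ 0`, with a contact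
term for each set of disjoint pairs of consecutive times. -/
def pathInt : (k n : ℕ) → ℝ → (ℕ → (Fin n → ℝ) → (ℕ → Vert d 𝔸) → 𝔸) → (ℕ → Vert d 𝔸) → 𝔸
  | _, 0, _, Y, F => Y 0 Fin.elim0 F
  | k, 1, τ, Y, F => ∫ t in (0 : ℝ)..τ, pathInt (k + 1) 0 t (fun r s => Y r (Fin.cons t s)) F
  | k, n + 2, τ, Y, F => ∫ t in (0 : ℝ)..τ,
      (pathInt (k + 1) (n + 1) t (fun r s => Y r (Fin.cons t s)) F +
        pathInt (k + 2) n t (fun r s => act (ww k (k + 1))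
          (Y (r + 1) (Fin.cons t (Fin.cons t s)))) F)

/-- The part of `pathInt` in which the two largest times coincide. -/
def contactInt (k : ℕ) : (n : ℕ) → ℝ → (ℕ → (Fin (n + 1) → ℝ) → (ℕ → Vert d 𝔸) → 𝔸) →
    (ℕ → Vert d 𝔸) → 𝔸
  | 0, _, _, _ => 0
  | n + 1, t, Y, F => pathInt (k + 2) n t (fun r s => act (ww k (k + 1))
      (Y (r + 1) (Fin.cons t (Fin.cons t s)))) F

theorem pathInt_succ (k n : ℕ) (τ : ℝ) (Y : ℕ → (Fin (n + 1) → ℝ) → (ℕ → Vert d 𝔸) → 𝔸)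
    (F : ℕ → Vert d 𝔸) : pathInt k (n + 1) τ Y F = ∫ t in (0 : ℝ)..τ,
      (pathInt (k + 1) n t (fun r s => Y r (Fin.cons t s)) F + contactInt k n t Y F) := by
  rcases n with - | n
  · simp [pathInt, contactInt]
  · rfl

/-- Contacts inside the integral modify only slots from `k` on, so agreement is needed only at
sequences that coincide with `F` below `k`. This permits use of the actual vertex in a slot already
passed. -/
theorem pathInt_congr {k n : ℕ} (τ : ℝ) {Y Y' : ℕ → (Fin n → ℝ) → (ℕ → Vert d 𝔸) → 𝔸}
    {F : ℕ → Vert d 𝔸} (h : ∀ r s G, (∀ i < k, G i = F i) → Y r s G = Y' r s G) :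
    pathInt k n τ Y F = pathInt k n τ Y' F := by
  induction n using Nat.strong_induction_on generalizing k τ with
  | _ n ih =>
  rcases n with - | n
  · exact h _ _ _ fun _ _ => rfl
  rw [pathInt_succ, pathInt_succ]
  congr 1
  funext t
  congr 1
  · exact ih n (by omega) t fun r s G hG => h _ _ _ fun i hi => hG i (by omega)
  · rcases n with - | n
    · rfl
    · refine ih n (by omega) t fun r s G hG => ?_
      rw [act_ww, act_ww]
      refine Finset.sum_congr rfl fun μ _ => h _ _ _ fun i hi => ?_
      rw [Function.update_of_ne (by omega), Function.update_of_ne (by omega), hG i (by omega)]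

/-! ### Linearity and smooth dependence on parameters of the iterated integral. -/

section Smooth

variable {E : Type} [NormedAddCommGroup E] [NormedSpace ℝ E]

/-- Families of functionals that depend smoothly on a parameter and on the times. -/
def SmoothFam {n : ℕ} (Y : E → ℕ → (Fin n → ℝ) → (ℕ → Vert d 𝔸) → 𝔸) : Prop :=
  ∀ r G, ContDiff ℝ ∞ fun p : E × (Fin n → ℝ) => Y p.1 r p.2 G

theorem contDiff_cons {E' : Type} [NormedAddCommGroup E'] [NormedSpace ℝ E'] {n : ℕ}
    {a : E' → ℝ} {s : E' → Fin n → ℝ} (ha : ContDiff ℝ ∞ a) (hs : ContDiff ℝ ∞ s) :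
    ContDiff ℝ ∞ fun p => (Fin.cons (a p) (s p) : Fin (n + 1) → ℝ) := by
  rw [contDiff_pi]
  intro i
  refine Fin.cases ?_ (fun i => ?_) i
  · exact ha
  · exact (contDiff_apply ℝ ℝ i).comp hs

theorem SmoothFam.cons {n : ℕ} {Y : E → ℕ → (Fin (n + 1) → ℝ) → (ℕ → Vert d 𝔸) → 𝔸}
    (hY : SmoothFam Y) : SmoothFam fun (p : E × ℝ) r s => Y p.1 r (Fin.cons p.2 s) := by
  intro r G
  exact (hY r G).comp ((contDiff_fst.comp contDiff_fst).prodMk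
    (contDiff_cons (contDiff_snd.comp contDiff_fst) contDiff_snd))

theorem SmoothFam.contact {k n : ℕ} {Y : E → ℕ → (Fin (n + 2) → ℝ) → (ℕ → Vert d 𝔸) → 𝔸}
    (hY : SmoothFam Y) : SmoothFam fun (p : E × ℝ) r s => act (ww k (k + 1))
      (Y p.1 (r + 1) (Fin.cons p.2 (Fin.cons p.2 s))) := by
  intro r G
  simp only [act_ww]
  refine ContDiff.sum fun μ _ => ?_
  exact (hY (r + 1) _).comp ((contDiff_fst.comp contDiff_fst).prodMk
    (contDiff_cons (contDiff_snd.comp contDiff_fst)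
      (contDiff_cons (contDiff_snd.comp contDiff_fst) contDiff_snd)))

theorem SmoothFam.const {n : ℕ} {Y : ℕ → (Fin n → ℝ) → (ℕ → Vert d 𝔸) → 𝔸}
    (hY : ∀ r G, ContDiff ℝ ∞ fun s => Y r s G) : SmoothFam fun (_ : E) => Y :=
  fun r G => (hY r G).comp contDiff_snd

theorem contDiff_pathInt [FiniteDimensional ℝ E] {k n : ℕ}
    {Y : E → ℕ → (Fin n → ℝ) → (ℕ → Vert d 𝔸) → 𝔸} (hY : SmoothFam Y) (F : ℕ → Vert d 𝔸) :
    ContDiff ℝ ∞ fun p : E × ℝ => pathInt k n p.2 (Y p.1) F := by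
  induction n using Nat.strong_induction_on generalizing k E with
  | _ n ih =>
  rcases n with - | n
  · exact (hY 0 F).comp (contDiff_fst.prodMk contDiff_const)
  simp only [pathInt_succ]
  refine contDiff_integral_zero_to (h := fun (p : E × ℝ) t =>
    pathInt (k + 1) n t (fun r s => Y p.1 r (Fin.cons t s)) F + contactInt k n t (Y p.1) F)
    ?_ contDiff_snd
  have hπ : ContDiff ℝ ∞ fun q : (E × ℝ) × ℝ => ((q.1.1, q.2), q.2) :=
    ((contDiff_fst.comp contDiff_fst).prodMk contDiff_snd).prodMk contDiff_snd
  refine ContDiff.add ((ih n (by omega) (k := k + 1) hY.cons).comp hπ) ?_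
  rcases n with - | n
  · exact contDiff_const
  · exact (ih n (by omega) (k := k + 2) (hY.contact (k := k))).comp hπ

theorem contDiff_pathInt_cons [FiniteDimensional ℝ E] {k n : ℕ}
    {Y : E → ℕ → (Fin (n + 1) → ℝ) → (ℕ → Vert d 𝔸) → 𝔸} (hY : SmoothFam Y) (F : ℕ → Vert d 𝔸) :
    ContDiff ℝ ∞ fun p : E × ℝ => pathInt (k + 1) n p.2 (fun r s => Y p.1 r (Fin.cons p.2 s)) F :=
  (contDiff_pathInt hY.cons F).comp (contDiff_id.prodMk contDiff_snd)

theorem contDiff_contactInt [FiniteDimensional ℝ E] {k n : ℕ}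
    {Y : E → ℕ → (Fin (n + 1) → ℝ) → (ℕ → Vert d 𝔸) → 𝔸} (hY : SmoothFam Y) (F : ℕ → Vert d 𝔸) :
    ContDiff ℝ ∞ fun p : E × ℝ => contactInt k n p.2 (Y p.1) F := by
  rcases n with - | n
  · exact contDiff_const
  · exact (contDiff_pathInt (hY.contact (k := k)) F).comp (contDiff_id.prodMk contDiff_snd)

theorem continuous_pathInt_cons {k n : ℕ} {Y : ℕ → (Fin (n + 1) → ℝ) → (ℕ → Vert d 𝔸) → 𝔸}
    (hY : ∀ r G, ContDiff ℝ ∞ fun s => Y r s G) (F : ℕ → Vert d 𝔸) :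
    Continuous fun t => pathInt (k + 1) n t (fun r s => Y r (Fin.cons t s)) F :=
  (contDiff_pathInt_cons (E := ℝ) (SmoothFam.const hY) F).continuous.comp
    (continuous_const (y := (0 : ℝ)) |>.prodMk continuous_id)

theorem continuous_contactInt {k n : ℕ} {Y : ℕ → (Fin (n + 1) → ℝ) → (ℕ → Vert d 𝔸) → 𝔸}
    (hY : ∀ r G, ContDiff ℝ ∞ fun s => Y r s G) (F : ℕ → Vert d 𝔸) :
    Continuous fun t => contactInt k n t Y F :=
  (contDiff_contactInt (E := ℝ) (SmoothFam.const hY) F).continuous.comp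
    (continuous_const (y := (0 : ℝ)) |>.prodMk continuous_id)

theorem intervalIntegrable_pathInt {k n : ℕ} {Y : ℕ → (Fin (n + 1) → ℝ) → (ℕ → Vert d 𝔸) → 𝔸}
    (hY : ∀ r G, ContDiff ℝ ∞ fun s => Y r s G) (F : ℕ → Vert d 𝔸) (a b : ℝ) :
    IntervalIntegrable (fun t => pathInt (k + 1) n t (fun r s => Y r (Fin.cons t s)) F +
      contactInt k n t Y F) volume a b :=
  ((continuous_pathInt_cons hY F).add (continuous_contactInt hY F)).intervalIntegrable _ _

theorem contDiff_cons_right {n : ℕ} {Y : (Fin (n + 1) → ℝ) → 𝔸} (hY : ContDiff ℝ ∞ Y) (t : ℝ) :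
    ContDiff ℝ ∞ fun s : Fin n → ℝ => Y (Fin.cons t s) :=
  hY.comp (contDiff_cons contDiff_const contDiff_id)

theorem contDiff_contact_right {k n : ℕ} {Y : (Fin (n + 2) → ℝ) → (ℕ → Vert d 𝔸) → 𝔸}
    (hY : ∀ G, ContDiff ℝ ∞ fun s => Y s G) (t : ℝ) (G : ℕ → Vert d 𝔸) :
    ContDiff ℝ ∞ fun s : Fin n → ℝ => act (ww k (k + 1)) (Y (Fin.cons t (Fin.cons t s))) G := by
  simp only [act_ww]
  exact ContDiff.sum fun μ _ => (hY _).comp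
    (contDiff_cons contDiff_const (contDiff_cons contDiff_const contDiff_id))

theorem pathInt_add {k n : ℕ} (τ : ℝ) {Y Y' : ℕ → (Fin n → ℝ) → (ℕ → Vert d 𝔸) → 𝔸}
    (hY : ∀ r G, ContDiff ℝ ∞ fun s => Y r s G) (hY' : ∀ r G, ContDiff ℝ ∞ fun s => Y' r s G)
    (F : ℕ → Vert d 𝔸) :
    pathInt k n τ (fun r s G => Y r s G + Y' r s G) F = pathInt k n τ Y F + pathInt k n τ Y' F := by
  induction n using Nat.strong_induction_on generalizing k τ with
  | _ n ih =>
  rcases n with - | n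
  · rfl
  rw [pathInt_succ, pathInt_succ, pathInt_succ, ← intervalIntegral.integral_add
    (intervalIntegrable_pathInt hY F _ _) (intervalIntegrable_pathInt hY' F _ _)]
  congr 1
  funext t
  rw [ih n (by omega) t (fun r G => contDiff_cons_right (hY r G) t)
    (fun r G => contDiff_cons_right (hY' r G) t), add_add_add_comm]
  congr 1
  rcases n with - | n
  · simp [contactInt]
  · simp only [contactInt]
    rw [← ih n (by omega) t (fun r G => contDiff_contact_right (hY (r + 1)) t G)
      (fun r G => contDiff_contact_right (hY' (r + 1)) t G)]
    congr 1
    funext r s G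
    exact congrFun (map_add (act (ww k (k + 1))) _ _) G

/-- Together with additivity and differentiation under the integral sign, this allows differential
operators in the end point to be carried through the iterated integral. -/
theorem pathInt_clm [CompleteSpace 𝔸] {k n : ℕ} (τ : ℝ)
    {Y : ℕ → (Fin n → ℝ) → (ℕ → Vert d 𝔸) → 𝔸}
    (hY : ∀ r G, ContDiff ℝ ∞ fun s => Y r s G) (L : 𝔸 →L[ℝ] 𝔸) (F : ℕ → Vert d 𝔸) :
    pathInt k n τ (fun r s G => L (Y r s G)) F = L (pathInt k n τ Y F) := by
  induction n using Nat.strong_induction_on generalizing k τ with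
  | _ n ih =>
  rcases n with - | n
  · rfl
  rw [pathInt_succ, pathInt_succ, ← L.intervalIntegral_comp_comm
    (intervalIntegrable_pathInt hY F _ _)]
  congr 1
  funext t
  rw [ih n (by omega) t (fun r G => contDiff_cons_right (hY r G) t), map_add]
  congr 1
  rcases n with - | n
  · simp [contactInt]
  · simp only [contactInt]
    rw [← ih n (by omega) t (fun r G => contDiff_contact_right (hY (r + 1)) t G)]
    congr 1
    funext r s G
    exact congrFun (act_post L.toLinearMap (ww k (k + 1)) _) G

theorem pathInt_zero {k n : ℕ} (τ : ℝ) (F : ℕ → Vert d 𝔸) :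
    pathInt k n τ (fun _ _ _ => 0) F = 0 := by
  induction n using Nat.strong_induction_on generalizing k τ with
  | _ n ih =>
  rcases n with - | n
  · rfl
  rw [pathInt_succ]
  have : ∀ t, contactInt k n t (fun _ _ _ => 0) F = 0 := by
    intro t
    rcases n with - | n
    · rfl
    · refine Eq.trans ?_ (ih n (by omega) (k := k + 2) t)
      simp only [contactInt]
      congr 1
      funext r s G
      exact congrFun (map_zero (act (M := 𝔸) (ww k (k + 1)))) G
  simp [this, ih n (by omega)]

theorem SmoothFam.fderiv [FiniteDimensional ℝ E] {n : ℕ}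
    {Y : E → ℕ → (Fin n → ℝ) → (ℕ → Vert d 𝔸) → 𝔸} (hY : SmoothFam Y) (v : E) :
    SmoothFam fun p r s G => fderiv ℝ (fun p => Y p r s G) p v := by
  intro r G
  have e : (fun p : E × (Fin n → ℝ) => _root_.fderiv ℝ (fun q => Y q r p.2 G) p.1 v) = fun p =>
      _root_.fderiv ℝ (fun p : E × (Fin n → ℝ) => Y p.1 r p.2 G) p (v, 0) := by
    funext p
    have h1 : HasFDerivAt (fun q : E => (q, p.2)) (ContinuousLinearMap.inl ℝ E (Fin n → ℝ)) p.1 :=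
      hasFDerivAt_prodMk_left p.1 p.2
    have h2 := ((((hY r G).differentiable (by simp)).differentiableAt.hasFDerivAt
      (x := (p.1, p.2))).comp p.1 h1).fderiv
    have h3 := congrArg (fun L : E →L[ℝ] 𝔸 => L v) h2
    exact h3
  rw [e]
  exact ((hY r G).fderiv_right (m := ∞) (by simp)).clm_apply contDiff_const

theorem fderiv_pathInt [FiniteDimensional ℝ E] [CompleteSpace 𝔸] {k n : ℕ} (τ : ℝ)
    {Y : E → ℕ → (Fin n → ℝ) → (ℕ → Vert d 𝔸) → 𝔸} (hY : SmoothFam Y) (F : ℕ → Vert d 𝔸)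
    (p v : E) : fderiv ℝ (fun p => pathInt k n τ (Y p) F) p v =
      pathInt k n τ (fun r s G => fderiv ℝ (fun p => Y p r s G) p v) F := by
  induction n using Nat.strong_induction_on generalizing k τ with
  | _ n ih =>
  rcases n with - | n
  · rfl
  simp only [pathInt_succ]
  have h1 := contDiff_pathInt_cons (k := k) hY F
  have h2 := contDiff_contactInt (k := k) hY F
  have hh : ContDiff ℝ ∞ (Function.uncurry fun (p : E) t => pathInt (k + 1) n t
    (fun r s => Y p r (Fin.cons t s)) F + contactInt k n t (Y p) F) := h1.add h2
  have hi : IntervalIntegrable (fun t => fderiv ℝ (fun p => pathInt (k + 1) n t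
      (fun r s => Y p r (Fin.cons t s)) F + contactInt k n t (Y p) F) p) volume 0 τ :=
    ((contDiff_fderiv_left hh).continuous.comp (Continuous.prodMk_right p)).intervalIntegrable _ _
  rw [fderiv_integral_zero_to hh, ContinuousLinearMap.intervalIntegral_apply hi]
  congr 1
  funext t
  have hl : ContDiff ℝ ∞ fun q : E => (q, t) := contDiff_id.prodMk contDiff_const
  have hd1 : DifferentiableAt ℝ (fun p => pathInt (k + 1) n t
      (fun r s => Y p r (Fin.cons t s)) F) p :=
    ((h1.comp hl).differentiable (by simp)).differentiableAt
  have hd2 : DifferentiableAt ℝ (fun p => contactInt k n t (Y p) F) p :=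
    ((h2.comp hl).differentiable (by simp)).differentiableAt
  rw [fderiv_fun_add hd1 hd2, add_apply]
  have hc : SmoothFam fun (p : E) r s => Y p r (Fin.cons t s) := by
    intro r G
    exact (hY r G).comp (contDiff_fst.prodMk (contDiff_cons contDiff_const contDiff_snd))
  congr 1
  · exact ih n (by omega) t hc
  · rcases n with - | n
    · simp [contactInt]
    · simp only [contactInt]
      have hc' : SmoothFam fun (p : E) r s => act (ww k (k + 1))
          (Y p (r + 1) (Fin.cons t (Fin.cons t s))) := by
        intro r G
        simp only [act_ww]
        exact ContDiff.sum fun μ _ => (hY (r + 1) _).comp (contDiff_fst.prodMk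
          (contDiff_cons contDiff_const (contDiff_cons contDiff_const contDiff_snd)))
      rw [ih n (by omega) t hc']
      congr 1
      funext r s G
      simp only [act_ww]
      have hd : ∀ G, DifferentiableAt ℝ (fun p => Y p (r + 1) (Fin.cons t (Fin.cons t s)) G) p :=
        fun G => (((hY (r + 1) G).comp (contDiff_id.prodMk contDiff_const)).differentiable
          (by simp)).differentiableAt
      rw [fderiv_fun_sum fun μ _ => hd _, sum_apply]

end Smooth

/-! ### Evaluation of the iterated integral of the contractions -/

section Smooth

variable {n : ℕ}

/-- Smooth families of formal derivatives. -/
def SmoothOp (p : (Fin n → ℝ) → DOp d) : Prop :=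
  ∀ 𝒴 : (Fin n → ℝ) → (ℕ → Vert d 𝔸) → Sm d 𝔸,
    (∀ G, ContDiff ℝ ∞ fun q : Sp d × (Fin n → ℝ) => (𝒴 q.2 G).1 q.1) →
    ∀ G, ContDiff ℝ ∞ fun q : Sp d × (Fin n → ℝ) => (act (p q.2) (𝒴 q.2) G).1 q.1

theorem smoothOp_X (a : ℕ × (Fin d ⊕ Fin d)) :
    SmoothOp (𝔸 := 𝔸) fun _ : Fin n → ℝ => (MvPolynomial.X a : DOp d) := by
  intro 𝒴 h G
  simp only [act_X]
  exact h _

theorem SmoothOp.mul {p p' : (Fin n → ℝ) → DOp d} (h : SmoothOp (𝔸 := 𝔸) p)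
    (h' : SmoothOp (𝔸 := 𝔸) p') : SmoothOp (𝔸 := 𝔸) fun s => p s * p' s := by
  intro 𝒴 h𝒴 G
  simp only [act_mul]
  exact h (fun s => act (p' s) (𝒴 s)) (h' 𝒴 h𝒴) G

theorem SmoothOp.add {p p' : (Fin n → ℝ) → DOp d} (h : SmoothOp (𝔸 := 𝔸) p)
    (h' : SmoothOp (𝔸 := 𝔸) p') : SmoothOp (𝔸 := 𝔸) fun s => p s + p' s := by
  intro 𝒴 h𝒴 G
  simp only [act_add]
  exact (h 𝒴 h𝒴 G).add (h' 𝒴 h𝒴 G)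

theorem SmoothOp.smul {p : (Fin n → ℝ) → DOp d} {c : (Fin n → ℝ) → ℝ} (hc : ContDiff ℝ ∞ c)
    (h : SmoothOp (𝔸 := 𝔸) p) : SmoothOp (𝔸 := 𝔸) fun s => c s • p s := by
  intro 𝒴 h𝒴 G
  simp only [act_smul]
  exact (hc.comp contDiff_snd).smul (h 𝒴 h𝒴 G)

theorem SmoothOp.sum {ι : Type} (S : Finset ι) {p : ι → (Fin n → ℝ) → DOp d}
    (h : ∀ i, SmoothOp (𝔸 := 𝔸) (p i)) : SmoothOp (𝔸 := 𝔸) fun s => ∑ i ∈ S, p i s := by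
  intro 𝒴 h𝒴 G
  have : (fun q : Sp d × (Fin n → ℝ) => (act (∑ i ∈ S, p i q.2) (𝒴 q.2) G).1 q.1) =
      fun q => ∑ i ∈ S, (act (p i q.2) (𝒴 q.2) G).1 q.1 := by
    funext q
    rw [act_sum, Finset.sum_apply, Sm.val_eq_ev, map_sum]; rfl
  rw [this]
  exact ContDiff.sum fun i _ => h i 𝒴 h𝒴 G

theorem SmoothOp.pow {p : (Fin n → ℝ) → DOp d} (h : SmoothOp (𝔸 := 𝔸) p) (j : ℕ) :
    SmoothOp (𝔸 := 𝔸) fun s => p s ^ j := by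
  induction j with
  | zero =>
    intro 𝒴 h𝒴 G
    simp only [pow_zero, act_one]
    exact h𝒴 G
  | succ j ih => simp only [pow_succ]; exact ih.mul h

theorem smoothOp_limQuad (k : ℕ) (τ : ℝ) :
    SmoothOp (𝔸 := 𝔸) fun s : Fin n → ℝ => limQuad (d := d) k n τ s := by
  have hs : ∀ i : Fin n, ContDiff ℝ ∞ fun s : Fin n → ℝ => s i := fun i => contDiff_apply ℝ ℝ i
  have hX : ∀ a b, SmoothOp (𝔸 := 𝔸) fun _ : Fin n → ℝ =>
      (MvPolynomial.X a * MvPolynomial.X b : DOp d) := fun a b =>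
    (smoothOp_X a).mul (smoothOp_X b)
  unfold limQuad quad xx wx ww
  refine SmoothOp.sum _ fun i => SmoothOp.sum _ fun l => (SmoothOp.add (SmoothOp.smul ?_ ?_)
    (SmoothOp.smul ?_ ?_)).add (SmoothOp.smul contDiff_const ?_)
  · unfold limX
    exact ((contDiff_const.mul (hs _)).sub
      (((contDiff_const.mul (hs _)).mul (hs _)).div_const _)).div_const _
  · exact SmoothOp.sum _ fun _ => hX _ _
  · unfold limY
    exact contDiff_const.sub ((contDiff_const.mul (hs _)).div_const _)
  · exact SmoothOp.sum _ fun _ => hX _ _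
  · exact SmoothOp.sum _ fun _ => hX _ _

theorem contDiff_prodV (τ : ℝ) (k : ℕ) (G : ℕ → Vert d 𝔸) :
    ContDiff ℝ ∞ fun q : Sp d × (Fin n → ℝ) => (prodV τ k n q.2 G).1 q.1 := by
  induction n generalizing k with
  | zero => exact contDiff_const
  | succ n ih =>
    have h1 : ContDiff ℝ ∞ fun q : Sp d × (Fin (n + 1) → ℝ) => (q.2 0 / τ) • q.1 :=
      (((contDiff_apply ℝ ℝ (0 : Fin (n + 1))).comp contDiff_snd).div_const _).smul contDiff_fst
    have h2 : ContDiff ℝ ∞ fun q : Sp d × (Fin (n + 1) → ℝ) =>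
        (Vert.val (q.2 0 / τ) (1 / τ) (G k)).1 q.1 := by
      have e : (fun q : Sp d × (Fin (n + 1) → ℝ) =>
          (Vert.val (q.2 0 / τ) (1 / τ) (G k)).1 q.1) = fun q =>
          (G k).2.1 ((q.2 0 / τ) • q.1) - (1 / τ) • ∑ μ, (Sm.coord μ : Sm d 𝔸).1 q.1 *
            ((G k).1 μ).1 ((q.2 0 / τ) • q.1) := by
        funext q
        rw [Vert.val_apply, Sm.val_eq_ev, map_sub, map_smul, map_sum]; rfl
      rw [e]
      exact ((Sm.contDiff _).comp h1).sub ((ContDiff.sum fun μ _ =>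
        ((Sm.contDiff _).comp contDiff_fst).mul ((Sm.contDiff _).comp h1)).const_smul _)
    refine h2.mul ((ih (k + 1)).comp (contDiff_fst.prodMk ?_))
    exact contDiff_pi.2 fun i => (contDiff_apply ℝ ℝ i.succ).comp contDiff_snd

theorem contDiff_wick (τ : ℝ) (k j : ℕ) (G : ℕ → Vert d 𝔸) :
    ContDiff ℝ ∞ fun q : Sp d × (Fin n → ℝ) => (wick τ k n q.2 j G).1 q.1 :=
  (SmoothOp.smul contDiff_const ((smoothOp_limQuad k τ).pow j)) _ (contDiff_prodV τ k) G

end Smooth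

/-- The families `𝒴` whose iterated integral is the function `S`. -/
structure PathIntEq (k n : ℕ) (τ : ℝ) (F : ℕ → Vert d 𝔸)
    (𝒴 : ℕ → (Fin n → ℝ) → (ℕ → Vert d 𝔸) → Sm d 𝔸) (S : Sm d 𝔸) : Prop where
  smooth : ∀ r G, ContDiff ℝ ∞ fun q : Sp d × (Fin n → ℝ) => (𝒴 r q.2 G).1 q.1
  eq : ∀ y, pathInt k n τ (fun r s G => (𝒴 r s G).1 y) F = S.1 y

namespace PathIntEq

variable {k n : ℕ} {τ : ℝ} {F : ℕ → Vert d 𝔸}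
  {𝒴 𝒴' : ℕ → (Fin n → ℝ) → (ℕ → Vert d 𝔸) → Sm d 𝔸} {S S' : Sm d 𝔸}

theorem smooth_right (h : PathIntEq k n τ F 𝒴 S) (y : Sp d) (r : ℕ) (G : ℕ → Vert d 𝔸) :
    ContDiff ℝ ∞ fun s => (𝒴 r s G).1 y :=
  (h.smooth r G).comp (contDiff_const.prodMk contDiff_id)

theorem zero : PathIntEq k n τ F (fun _ _ _ => 0) 0 :=
  ⟨fun _ _ => contDiff_const, fun _ => pathInt_zero τ F⟩

theorem add (h : PathIntEq k n τ F 𝒴 S) (h' : PathIntEq k n τ F 𝒴' S') :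
    PathIntEq k n τ F (fun r s G => 𝒴 r s G + 𝒴' r s G) (S + S') := by
  refine ⟨fun r G => (h.smooth r G).add (h'.smooth r G), fun y => ?_⟩
  change _ = S.1 y + S'.1 y
  rw [← h.eq, ← h'.eq, ← pathInt_add τ (h.smooth_right y) (h'.smooth_right y)]
  rfl

theorem sum {ι : Type} (s : Finset ι) {𝒵 : ι → ℕ → (Fin n → ℝ) → (ℕ → Vert d 𝔸) → Sm d 𝔸}
    {T : ι → Sm d 𝔸} (h : ∀ i ∈ s, PathIntEq k n τ F (𝒵 i) (T i)) :
    PathIntEq k n τ F (fun r t G => ∑ i ∈ s, 𝒵 i r t G) (∑ i ∈ s, T i) := by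
  classical
  induction s using Finset.induction_on with
  | empty => exact zero
  | insert a s ha ih =>
    simp only [Finset.sum_insert ha]
    exact (h a (Finset.mem_insert_self a s)).add (ih fun i hi => h i (Finset.mem_insert_of_mem hi))

variable [CompleteSpace 𝔸]

theorem mulL (h : PathIntEq k n τ F 𝒴 S) (ψ : Sm d 𝔸) :
    PathIntEq k n τ F (fun r s G => Sm.mulL ψ (𝒴 r s G)) (Sm.mulL ψ S) := by
  refine ⟨fun r G => ((Sm.contDiff ψ).comp contDiff_fst).mul (h.smooth r G), fun y => ?_⟩
  change _ = ψ.1 y * S.1 y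
  rw [← h.eq]
  exact pathInt_clm τ (h.smooth_right y) (ContinuousLinearMap.mul ℝ 𝔸 (ψ.1 y)) F

theorem smul (h : PathIntEq k n τ F 𝒴 S) (c : ℝ) :
    PathIntEq k n τ F (fun r s G => c • 𝒴 r s G) (c • S) := by
  refine ⟨fun r G => contDiff_const.smul (h.smooth r G), fun y => ?_⟩
  change _ = c • S.1 y
  rw [← h.eq]
  exact pathInt_clm τ (h.smooth_right y) (c • ContinuousLinearMap.id ℝ 𝔸) F

theorem pdL (h : PathIntEq k n τ F 𝒴 S) (μ : Fin d) :
    PathIntEq k n τ F (fun r s G => Sm.pdL μ (𝒴 r s G)) (Sm.pdL μ S) := by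
  have hs : SmoothFam fun (y : Sp d) r s G => (𝒴 r s G).1 y := h.smooth
  refine ⟨hs.fderiv (e μ), fun y => ?_⟩
  change _ = fderiv ℝ S.1 y (e μ)
  rw [← funext h.eq]
  exact (fderiv_pathInt τ hs F y (e μ)).symm

theorem lapl_pow (h : PathIntEq k n τ F 𝒴 S) (i : ℕ) :
    PathIntEq k n τ F (fun r s G => (Sm.lapl ^ i) (𝒴 r s G)) ((Sm.lapl ^ i) S) := by
  induction i with
  | zero => exact h
  | succ i ih =>
    simp only [pow_succ', Module.End.mul_apply]
    simp only [Sm.lapl_apply (d := d)]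
    exact sum _ fun μ _ => (ih.pdL μ).pdL μ

theorem opN (h : PathIntEq k n τ F 𝒴 S) (f : Fin d → Sm d 𝔸) :
    PathIntEq k n τ F (fun r s G => Sm.opN f (𝒴 r s G)) (Sm.opN f S) := by
  have e : ∀ ψ, Sm.opN f ψ = ∑ α, ((2 : ℝ) • Sm.pdL α (Sm.mulL (f α) ψ) +
      (-1 : ℝ) • Sm.mulL (Sm.pdL α (f α)) ψ) := by
    intro ψ
    simp only [Sm.opN, LinearMap.sum_apply, LinearMap.sub_apply, neg_smul, one_smul,
      ← sub_eq_add_neg]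
    rfl
  simp only [e]
  exact sum _ fun α _ => (((h.mulL (f α)).pdL α).smul 2).add ((h.mulL _).smul (-1))

end PathIntEq

/-- The regular contractions of order `j` and lower, by the number of remaining contractions. -/
def wickFam (τ : ℝ) (k n j : ℕ) (r : ℕ) (s : Fin n → ℝ) (G : ℕ → Vert d 𝔸) : Sm d 𝔸 :=
  if r ≤ j then wick τ k n s (j - r) G else 0

theorem wick_indep (τ : ℝ) (k n : ℕ) (t : Fin n → ℝ) (j : ℕ) {i : ℕ} (hi : i < k) :
    Indep i (wick (d := d) (𝔸 := 𝔸) τ k n t j) := (prodV_indep τ k n t hi).act _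

/-- A velocity-free vertex acts by multiplication alone; this is the situation of both vertices in a
contact. -/
theorem headSrc_of_fst_eq_zero {F : Vert d 𝔸} (hF : F.1 = 0) (Y : ℕ → Sm d 𝔸) (l : ℕ) :
    headSrc F Y l = F.2 * Y l := by
  rcases l with - | l
  · rfl
  · simp [headSrc, hF, Sm.opN]

/-! ### The recursion of the contractions under the time integrals. -/

section

variable (f : Fin d → Sm d 𝔸) (V : Sm d 𝔸)

theorem src_eq_zero [CompleteSpace 𝔸] (n j K : ℕ) (h : n + j < K) :
    Sm.src f V (Sm.coefPrev f V n) (Sm.coef f V n) j K = 0 := by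
  have h1 : ∀ j', j' ≤ j → Sm.coef f V n j' K = 0 := fun j' hj' => by
    by_contra h0; have := Sm.coef_ne_zero f V h0; omega
  have h2 : ∀ j', j' + 1 ≤ j → Sm.coefPrev f V n j' K = 0 := fun j' hj' => by
    by_contra h0; have := (Sm.coef_ne_zero_aux f V n).1 _ _ h0; omega
  rcases j with - | j
  · simp [Sm.src, h1 0 le_rfl]
  · simp [Sm.src, h1 (j + 1) le_rfl, h1 j (by omega), h2 j le_rfl]

variable {f V} {k n : ℕ} {F : ℕ → Vert d 𝔸} {τ t : ℝ} {j : ℕ} {ξ : Sp d}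

theorem sum_ite_le_sub {N : Type} [AddCommMonoid N] (r j : ℕ) (a : ℕ → N) :
    (if r ≤ j then ∑ i ∈ Finset.range (j - r + 1), a i else 0) =
      ∑ i ∈ Finset.range (j + 1), if r ≤ j - i then a i else 0 := by
  split_ifs with h
  · rw [← Finset.sum_subset (Finset.range_mono (show j - r + 1 ≤ j + 1 by omega))]
    · refine Finset.sum_congr rfl fun i hi => ?_
      rw [Finset.mem_range] at hi
      rw [if_pos (by omega)]
    · intro i hi hi'
      rw [Finset.mem_range] at hi hi'
      rw [if_neg (by omega)]
  · refine (Finset.sum_eq_zero fun i _ => if_neg (by omega)).symm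

theorem sum_ite_sub {M : Type} [AddCommMonoid M] {i N : ℕ} (hi : i ≤ N) (b : ℕ → M)
    (hb : ∀ K, N ≤ K + i → b K = 0) :
    (∑ K ∈ Finset.range N, if i ≤ K then b (K - i) else 0) = ∑ K ∈ Finset.range N, b K := by
  obtain ⟨m, rfl⟩ := Nat.exists_eq_add_of_le hi
  rw [Finset.sum_range_add, Finset.sum_eq_zero fun K hK => if_neg (by simpa using hK), zero_add,
    ← Finset.sum_subset (Finset.range_mono (show m ≤ i + m by omega))
      fun K _ hK => hb K (by rw [Finset.mem_range] at hK; omega)]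
  simp

theorem wickFam_cons (hτ : τ ≠ 0) (ht : t ≠ 0) {G : ℕ → Vert d 𝔸}
    (hG : ∑ μ, Sm.coord μ * (G k).1 μ = 0) (r : ℕ) (s : Fin n → ℝ) :
    (wickFam τ k (n + 1) j r (Fin.cons t s) G).1 ξ =
      (∑ i ∈ Finset.range (j + 1), ((t * (τ - t) / τ) ^ i / (i ! : ℕ)) • (Sm.lapl ^ i)
        (if r ≤ j - i then headSrc (G k) (fun l => wick t (k + 1) n s l G) (j - i - r)
          else 0)).1 ((t / τ) • ξ) := by
  have h1 : (wickFam τ k (n + 1) j r (Fin.cons t s) G).1 ξ = if r ≤ j then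
      ∑ i ∈ Finset.range (j - r + 1), ((t * (τ - t) / τ) ^ i / (i ! : ℕ)) • ((Sm.lapl ^ i)
        (headSrc (G k) (fun l => wick t (k + 1) n s l G) (j - r - i))).1 ((t / τ) • ξ) else 0 := by
    rw [wickFam]
    split_ifs with h
    · rw [wick_succ hτ (by rwa [Fin.cons_zero]) hG]
      rfl
    · rfl
  rw [h1, sum_ite_le_sub, Sm.val_eq_ev, map_sum]
  refine Finset.sum_congr rfl fun i _ => ?_
  split_ifs with h
  · rw [Nat.sub_right_comm]; rfl
  · rw [map_zero, smul_zero, map_zero]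

/-- A contact replaces both vertices by `(0, -f_μ)`, which satisfy the gauge condition trivially, so
the peeling formula applies twice. The two signs cancel and the product is `f_μ f_μ`. -/
theorem wickFam_contact (hτ : τ ≠ 0) (ht : t ≠ 0) (r : ℕ) (s : Fin n → ℝ) {G : ℕ → Vert d 𝔸}
    (hG : G k = (f, V)) (hG' : G (k + 1) = (f, V)) :
    act (ww k (k + 1)) (fun G => (wickFam τ k (n + 2) j (r + 1) (Fin.cons t (Fin.cons t s)) G).1 ξ)
      G = (∑ i ∈ Finset.range (j + 1), ((t * (τ - t) / τ) ^ i / (i ! : ℕ)) • (Sm.lapl ^ i)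
        (if r + 1 ≤ j - i then Sm.opQ f (wick t (k + 2) n s (j - i - (r + 1)) G)
          else 0)).1 ((t / τ) • ξ) := by
  rw [act_ww, hG, hG']
  have h1 : ∀ μ, ∃ G', G' = (Function.update (Function.update G k (Vert.dv μ (f, V)))
      (k + 1) (Vert.dv μ (f, V))) ∧ G' k = (0, -f μ) ∧ G' (k + 1) = (0, -f μ) ∧
      ∀ l, wick t (k + 2) n s l G' = wick t (k + 2) n s l G := by
    intro μ
    refine ⟨_, rfl, ?_, ?_, fun l => ?_⟩
    · rw [Function.update_of_ne (by omega), Function.update_self]; rfl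
    · rw [Function.update_self]; rfl
    · rw [wick_indep t (k + 2) n s l (Nat.lt_succ_self (k + 1)),
        wick_indep t (k + 2) n s l (show k < k + 2 by omega)]
  have h2 : ∀ μ, (wickFam τ k (n + 2) j (r + 1) (Fin.cons t (Fin.cons t s))
      (Function.update (Function.update G k (Vert.dv μ (f, V))) (k + 1) (Vert.dv μ (f, V)))).1 ξ =
      (∑ i ∈ Finset.range (j + 1), ((t * (τ - t) / τ) ^ i / (i ! : ℕ)) • (Sm.lapl ^ i)
        (if r + 1 ≤ j - i then f μ * f μ * wick t (k + 2) n s (j - i - (r + 1)) G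
          else 0)).1 ((t / τ) • ξ) := by
    intro μ
    obtain ⟨G', e, e1, e2, e3⟩ := h1 μ
    rw [← e, wickFam_cons hτ ht (by rw [e1]; simp)]
    have h3 : ∀ l, headSrc (G' k) (fun l => wick t (k + 1) (n + 1) (Fin.cons t s) l G') l =
        f μ * f μ * wick t (k + 2) n s l G := by
      intro l
      rw [headSrc_of_fst_eq_zero (by rw [e1])]
      -- Between two equal times the parameter `t(t - t)/t` of the heat flow is zero, so only its
      -- term of order zero remains.
      have h4 : wick t (k + 1) (n + 1) (Fin.cons t s) l G' = -f μ * wick t (k + 2) n s l G := by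
        refine Sm.ext fun y => ?_
        rw [wick_succ ht (by rwa [Fin.cons_zero]) (by rw [e2]; simp), Finset.sum_range_succ']
        simp only [Fin.cons_zero, sub_self, mul_zero, zero_div, ne_eq, Nat.add_eq_zero_iff,
          one_ne_zero, and_false, not_false_eq_true, zero_pow, zero_smul, Finset.sum_const_zero,
          zero_add, pow_zero, Nat.factorial_zero, Nat.cast_one, div_one, one_smul, div_self ht,
          Nat.sub_zero]
        rw [headSrc_of_fst_eq_zero (by rw [e2]), e2]
        change (-f μ * wick t (k + 1 + 1) n s l G').1 y = _
        rw [e3]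
      rw [h4, e1, ← mul_assoc]
      congr 1
      exact neg_mul_neg (f μ) (f μ)
    simp only [h3]
  refine (Finset.sum_congr rfl fun μ _ => h2 μ).trans ?_
  simp only [Sm.val_eq_ev, ← map_sum]
  congr 1
  rw [Finset.sum_comm]
  refine Finset.sum_congr rfl fun i _ => ?_
  rw [← Finset.smul_sum, ← map_sum]
  congr 2
  split_ifs with h
  · rw [← Finset.sum_mul]; rfl
  · simp

variable [CompleteSpace 𝔸]

theorem contDiff_wickFam (τ : ℝ) (k n j r : ℕ) (G : ℕ → Vert d 𝔸) :
    ContDiff ℝ ∞ fun q : Sp d × (Fin n → ℝ) => (wickFam τ k n j r q.2 G).1 q.1 := by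
  unfold wickFam
  split_ifs with h
  · exact contDiff_wick τ k (j - r) G
  · exact contDiff_const

/-- The iterated integral of the contractions is the generating function of the coefficients. -/
theorem pathInt_wick (hf : ∑ μ, Sm.coord μ * f μ = 0) (hτ : 0 < τ) (hF : ∀ i, k ≤ i → F i = (f, V))
    (j : ℕ) : PathIntEq k n τ F (wickFam τ k n j)
      (∑ K ∈ Finset.range (n + j + 1), τ ^ K • Sm.coef f V n j K) := by
  -- Strong induction is used because a contact consumes two vertices. The final time varies since
  -- the largest time takes its place for the later vertices.
  induction n using Nat.strong_induction_on generalizing k τ j with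
  | _ n ih =>
  refine ⟨contDiff_wickFam τ k n j, fun ξ => ?_⟩
  rcases n with - | n
  · have h0 : limQuad (d := d) k 0 τ Fin.elim0 = 0 := by simp [limQuad, quad]
    change (wickFam τ k 0 j 0 Fin.elim0 F).1 ξ = _
    rw [wickFam, if_pos (Nat.zero_le j), wick, Nat.sub_zero, h0, dp_zero_right]
    rw [Finset.sum_range_succ', Finset.sum_eq_zero fun K _ => by simp [Sm.coef_zero]]
    simp only [Sm.coef_zero, and_true, pow_zero, one_smul, zero_add]
    split_ifs with h
    · rw [act_one]; rfl
    · rw [act_zero]; rfl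
  obtain ⟨N, hN⟩ : ∃ N, N = n + j + 1 := ⟨_, rfl⟩
  have hC : ∀ {t : ℝ}, 0 < t → ∀ l ≤ j, PathIntEq (k + 1) n t F (wickFam t (k + 1) n l)
      (∑ K ∈ Finset.range N, t ^ K • Sm.coef f V n l K) := by
    intro t ht l hl
    have h1 := ih n (by omega) (k := k + 1) ht (fun i hi => hF i (by omega)) l
    rwa [Finset.sum_subset (Finset.range_mono (show n + l + 1 ≤ N by omega))] at h1
    intro K _ hK
    rw [Finset.mem_range] at hK
    by_contra h0
    have := Sm.coef_ne_zero f V (right_ne_zero_of_smul h0)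
    omega
  -- Without a contact at `t`, the first vertex acts by multiplication with `V` and by `opN` on the
  -- generating function of the later vertices.
  have hA : ∀ {t : ℝ}, 0 < t → pathInt (k + 1) n t
      (fun r s G => (wickFam τ k (n + 1) j r (Fin.cons t s) G).1 ξ) F =
      (∑ i ∈ Finset.range (j + 1), ((t * (τ - t) / τ) ^ i / (i ! : ℕ)) • (Sm.lapl ^ i)
        (∑ K ∈ Finset.range N, t ^ K • (Sm.mulL V (Sm.coef f V n (j - i) K) +
          if j - i = 0 then 0 else Sm.opN f (Sm.coef f V n (j - i - 1) K)))).1 ((t / τ) • ξ) := by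
    intro t ht
    have h1 : ∀ i, PathIntEq (k + 1) n t F (fun r s G => if r ≤ j - i then
        headSrc (f, V) (fun l => wick t (k + 1) n s l G) (j - i - r) else 0)
        (∑ K ∈ Finset.range N, t ^ K • (Sm.mulL V (Sm.coef f V n (j - i) K) +
          if j - i = 0 then 0 else Sm.opN f (Sm.coef f V n (j - i - 1) K))) := by
      intro i
      obtain ⟨l, hl⟩ : ∃ l, l = j - i := ⟨_, rfl⟩
      rw [← hl]
      have h2 := (hC ht l (by omega)).mulL V
      rcases l with - | l
      · convert h2 using 1
        · funext r s G
          rw [wickFam]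
          by_cases hr : r ≤ 0
          · rw [if_pos hr, if_pos hr, Nat.le_zero.1 hr]; rfl
          · rw [if_neg hr, if_neg hr, map_zero]
        · simp [map_sum]
      · have h3 := h2.add ((hC ht l (by omega)).opN f)
        convert h3 using 1
        · funext r s G
          rw [wickFam, wickFam]
          by_cases hr : r ≤ l
          · rw [if_pos hr, if_pos (by omega), if_pos (by omega), show l + 1 - r = l - r + 1 by omega]
            rfl
          · by_cases hr' : r = l + 1
            · subst hr'
              rw [if_pos le_rfl, if_pos le_rfl, if_neg hr, map_zero, add_zero, Nat.sub_self]; rfl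
            · rw [if_neg hr, if_neg (by omega), if_neg (by omega)]; simp
        · simp only [map_sum, map_smul, smul_add, Finset.sum_add_distrib]
          simp
    have h4 := (PathIntEq.sum (Finset.range (j + 1)) fun i _ => ((h1 i).lapl_pow i).smul
      ((t * (τ - t) / τ) ^ i / (i ! : ℕ))).eq ((t / τ) • ξ)
    rw [← h4]
    refine pathInt_congr t fun r s G hG => ?_
    have hGk : G k = (f, V) := (hG k (by omega)).trans (hF k le_rfl)
    rw [wickFam_cons hτ.ne' ht.ne' (by rw [hGk]; exact hf), hGk]
  -- With a contact at `t`, the first two vertices act as `opQ` on the generating function with two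
  -- vertices fewer.
  have hB : ∀ {t : ℝ}, 0 < t → contactInt k n t (fun r s G => (wickFam τ k (n + 1) j r s G).1 ξ) F =
      (∑ i ∈ Finset.range (j + 1), ((t * (τ - t) / τ) ^ i / (i ! : ℕ)) • (Sm.lapl ^ i)
        (∑ K ∈ Finset.range N, t ^ K • (
          if j - i = 0 then 0 else Sm.opQ f (Sm.coefPrev f V n (j - i - 1) K)))).1
            ((t / τ) • ξ) := by
    intro t ht
    rcases n with - | n
    · simp only [contactInt, Sm.coefPrev_zero, Pi.zero_apply, map_zero, ite_self, smul_zero,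
        Finset.sum_const_zero]
      rfl
    have h1 : ∀ i, PathIntEq (k + 2) n t F (fun r s G => if r + 1 ≤ j - i then
        Sm.opQ f (wick t (k + 2) n s (j - i - (r + 1)) G) else 0)
        (∑ K ∈ Finset.range N, t ^ K • (
          if j - i = 0 then 0 else Sm.opQ f (Sm.coefPrev f V (n + 1) (j - i - 1) K))) := by
      intro i
      obtain ⟨l, hl⟩ : ∃ l, l = j - i := ⟨_, rfl⟩
      rw [← hl]
      rcases l with - | l
      · simp only [if_true, smul_zero, Finset.sum_const_zero]
        convert PathIntEq.zero using 1
        funext r s G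
        rw [if_neg (by omega)]
      · have h2 := ih n (by omega) (k := k + 2) ht (fun i hi => hF i (by omega)) l
        rw [Finset.sum_subset (Finset.range_mono (show n + l + 1 ≤ N by omega))] at h2
        · convert h2.mulL (∑ α, f α * f α) using 1
          · funext r s G
            rw [wickFam]
            by_cases hr : r ≤ l
            · rw [if_pos hr, if_pos (by omega), show l + 1 - (r + 1) = l - r by omega]; rfl
            · rw [if_neg hr, if_neg (by omega), map_zero]
          · simp only [map_sum, map_smul, Nat.add_sub_cancel, Sm.coefPrev_succ]
            simp [Sm.opQ]
        · intro K _ hK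
          rw [Finset.mem_range] at hK
          by_contra h0
          have := Sm.coef_ne_zero f V (right_ne_zero_of_smul h0)
          omega
    have h4 := (PathIntEq.sum (Finset.range (j + 1)) fun i _ => ((h1 i).lapl_pow i).smul
      ((t * (τ - t) / τ) ^ i / (i ! : ℕ))).eq ((t / τ) • ξ)
    rw [← h4]
    refine pathInt_congr t fun r s G hG => ?_
    exact wickFam_contact hτ.ne' ht.ne' r s ((hG k (by omega)).trans (hF k le_rfl))
      ((hG (k + 1) (by omega)).trans (hF (k + 1) (by omega)))
  have hsrc : ∀ i K, (Sm.mulL V (Sm.coef f V n (j - i) K) +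
      if j - i = 0 then 0 else Sm.opN f (Sm.coef f V n (j - i - 1) K)) +
      (if j - i = 0 then 0 else Sm.opQ f (Sm.coefPrev f V n (j - i - 1) K)) =
      Sm.src f V (Sm.coefPrev f V n) (Sm.coef f V n) (j - i) K := by
    intro i K
    rcases j - i with - | l
    · simp [Sm.src]
    · simp only [Sm.src, Nat.add_sub_cancel, if_neg (Nat.succ_ne_zero l)]
  have hAB : ∀ t ∈ Set.uIoc 0 τ, pathInt (k + 1) n t
      (fun r s G => (wickFam τ k (n + 1) j r (Fin.cons t s) G).1 ξ) F +
      contactInt k n t (fun r s G => (wickFam τ k (n + 1) j r s G).1 ξ) F =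
      ∑ i ∈ Finset.range (j + 1), ∑ K ∈ Finset.range N,
        ((t * (τ - t) / τ) ^ i / (i ! : ℕ)) • t ^ K • ((Sm.lapl ^ i)
          (Sm.src f V (Sm.coefPrev f V n) (Sm.coef f V n) (j - i) K)).1 ((t / τ) • ξ) := by
    intro t ht
    rw [Set.uIoc_of_le hτ.le] at ht
    rw [hA ht.1, hB ht.1, Sm.val_eq_ev, Sm.val_eq_ev, ← map_add, ← Finset.sum_add_distrib]
    simp only [← smul_add, ← map_add, ← Finset.sum_add_distrib, hsrc]
    simp only [map_sum, map_smul, Finset.smul_sum]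
    rfl
  obtain ⟨T, hT⟩ : ∃ T : ℕ → ℕ → Sm d 𝔸, T = fun i K => (Sm.lapl ^ i)
      (Sm.src f V (Sm.coefPrev f V n) (Sm.coef f V n) (j - i) K) := ⟨_, rfl⟩
  have hT0 : ∀ i K, n + (j - i) < K → T i K = 0 := fun i K h => by
    rw [hT]; dsimp only; rw [src_eq_zero f V _ _ _ h, map_zero]
  have hcont : ∀ i K, Continuous fun t : ℝ =>
      ((t * (τ - t) / τ) ^ i / (i ! : ℕ)) • t ^ K • (T i K).1 ((t / τ) • ξ) := by
    intro i K
    have h1 : Continuous fun t : ℝ => (T i K).1 ((t / τ) • ξ) :=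
      (Sm.contDiff (T i K)).continuous.comp
        ((continuous_id.div_const τ).smul continuous_const)
    have h2 : Continuous fun t : ℝ => (t * (τ - t) / τ) ^ i / (i ! : ℕ) := by fun_prop
    exact h2.smul ((continuous_id.pow K).smul h1)
  -- Scaling `t = τu` separates the power of `τ`. The factor `(u(1 - u))^i u^K / i!` that is left is
  -- the weight of the radial mean `rad (K + i) i`.
  have hint : ∀ i K, ∫ t in (0 : ℝ)..τ,
      ((t * (τ - t) / τ) ^ i / (i ! : ℕ)) • t ^ K • (T i K).1 ((t / τ) • ξ) =
      τ ^ (K + i + 1) • (Sm.rad (K + i) i (T i K)).1 ξ := by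
    intro i K
    rw [integral_zero_to_eq_smul, Sm.rad_apply, ← intervalIntegral.integral_smul,
      ← intervalIntegral.integral_smul]
    refine intervalIntegral.integral_congr fun u _ => ?_
    have hτ' := hτ.ne'
    simp only [smul_smul, Sm.radW]
    rw [show τ * u / τ = u by field_simp]
    congr 1
    rw [show τ * u * (τ - τ * u) / τ = τ * (u * (1 - u)) by field_simp, mul_pow, mul_pow,
      mul_pow]
    ring
  have hAB' : ∀ t ∈ Set.uIoc 0 τ, pathInt (k + 1) n t
      (fun r s G => (wickFam τ k (n + 1) j r (Fin.cons t s) G).1 ξ) F +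
      contactInt k n t (fun r s G => (wickFam τ k (n + 1) j r s G).1 ξ) F =
      ∑ i ∈ Finset.range (j + 1), ∑ K ∈ Finset.range N,
        ((t * (τ - t) / τ) ^ i / (i ! : ℕ)) • t ^ K • (T i K).1 ((t / τ) • ξ) := by
    rw [hT]; exact hAB
  rw [pathInt_succ, intervalIntegral.integral_congr_ae (ae_of_all _ hAB'),
    intervalIntegral.integral_finsetSum fun i _ =>
      (continuous_finsetSum _ fun K _ => hcont i K).intervalIntegrable _ _]
  simp only [intervalIntegral.integral_finsetSum fun K _ => (hcont _ K).intervalIntegrable _ _,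
    hint]
  rw [show n + 1 + j + 1 = N + 1 by omega, Sm.val_eq_ev, map_sum,
    Finset.sum_range_succ' _ N]
  simp only [Sm.coef_succ_succ, Sm.coef_succ_zero, smul_zero, map_zero, add_zero, map_smul,
    map_sum, Finset.smul_sum]
  rw [Finset.sum_comm (s := Finset.range N)]
  refine Finset.sum_congr rfl fun i hi => ?_
  rw [Finset.mem_range] at hi
  -- The exponent moves from `K` to `K + i`. The terms pushed beyond the range are zero by the bound
  -- on the support of the source.
  have h1 := sum_ite_sub (M := 𝔸) (N := N) (i := i) (by omega)
    (fun K => τ ^ (K + i + 1) • Sm.ev ξ (Sm.rad (K + i) i (T i K)))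
    (fun K hK => by rw [hT0 i K (by omega), map_zero, map_zero, smul_zero])
  refine h1.symm.trans (Finset.sum_congr rfl fun K _ => ?_)
  split_ifs with h
  · rw [Nat.sub_add_cancel h, hT]
  · rw [map_zero, smul_zero]

end

/-! ### Elimination of the last time -/

/-- Append a last entry. -/
abbrev snocR {n : ℕ} (t : Fin n → ℝ) (s : ℝ) : Fin (n + 1) → ℝ := Fin.snoc (α := fun _ => ℝ) t s

/-- The last time, or `τ` if there is none. -/
def lastTime (τ : ℝ) : (n : ℕ) → (Fin n → ℝ) → ℝ
  | 0, _ => τ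
  | n + 1, t => t (Fin.last n)

theorem contDiff_snocR {E' : Type} [NormedAddCommGroup E'] [NormedSpace ℝ E'] {n : ℕ}
    {s : E' → Fin n → ℝ} {a : E' → ℝ} (hs : ContDiff ℝ ∞ s) (ha : ContDiff ℝ ∞ a) :
    ContDiff ℝ ∞ fun p => snocR (s p) (a p) := by
  rw [contDiff_pi]
  intro i
  refine Fin.lastCases ?_ (fun i => ?_) i
  · simpa [snocR] using ha
  · simpa [snocR] using contDiff_pi.1 hs i

theorem contDiff_lastTime (τ : ℝ) (n : ℕ) : ContDiff ℝ ∞ (lastTime τ n) := by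
  rcases n with - | n
  · exact contDiff_const
  · exact contDiff_apply ℝ ℝ _

theorem continuous_snocR {X : Type} [TopologicalSpace X] {n : ℕ} {s : X → Fin n → ℝ} {a : X → ℝ}
    (hs : Continuous s) (ha : Continuous a) : Continuous fun p => snocR (s p) (a p) := by
  have := (contDiff_snocR (E' := (Fin n → ℝ) × ℝ) contDiff_fst contDiff_snd).continuous
  exact this.comp (hs.prodMk ha)

/-- The contact of the last two vertices, at the last time. -/
def lastContact (k : ℕ) : (n : ℕ) → (ℕ → (Fin (n + 1) → ℝ) → (ℕ → Vert d 𝔸) → 𝔸) →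
    ℕ → (Fin n → ℝ) → (ℕ → Vert d 𝔸) → 𝔸
  | 0, _ => 0
  | n + 1, Y => fun r t => act (ww (k + n) (k + n + 1)) (Y (r + 1) (snocR t (t (Fin.last n))))

/-- The family of functionals that remains when the last time has been integrated out. -/
def elimLast (k : ℕ) (τ : ℝ) (n : ℕ) (Y : ℕ → (Fin (n + 1) → ℝ) → (ℕ → Vert d 𝔸) → 𝔸)
    (r : ℕ) (t : Fin n → ℝ) (G : ℕ → Vert d 𝔸) : 𝔸 :=
  (∫ s in (0 : ℝ)..lastTime τ n t, Y r (snocR t s) G) + lastContact k n Y r t G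

theorem act_ww_integral {i l : ℕ} (h : i ≠ l) {Z : ℝ → (ℕ → Vert d 𝔸) → 𝔸}
    (hZ : ∀ G, Continuous fun s => Z s G) (a b : ℝ) (G : ℕ → Vert d 𝔸) :
    act (ww i l) (fun G => ∫ s in a..b, Z s G) G = ∫ s in a..b, act (ww i l) (Z s) G := by
  simp only [act_ww_of_ne h]
  exact (intervalIntegral.integral_finsetSum fun μ _ => (hZ _).intervalIntegrable _ _).symm

theorem ww_comm_act {M : Type} [AddCommGroup M] [Module ℝ M] (p q : DOp d)
    (Φ : (ℕ → Vert d 𝔸) → M) : act p (act q Φ) = act q (act p Φ) := by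
  rw [← act_mul, mul_comm, act_mul]

/-- The middle vertex would have to supply its velocity to both contacts. Hence contacts form
disjoint pairs. -/
theorem act_ww_ww_of_vanish {k : ℕ} {Φ : (ℕ → Vert d 𝔸) → 𝔸} (h : Vanish (k + 1) Φ) :
    act (ww k (k + 1)) (act (ww (k + 1) (k + 2)) Φ) = 0 := by
  rw [← act_mul, ww, ww, Finset.sum_mul_sum, act_sum]
  refine Finset.sum_eq_zero fun α _ => ?_
  rw [act_sum]
  refine Finset.sum_eq_zero fun β _ => ?_
  rw [show w k α * w (k + 1) α * (w (k + 1) β * w (k + 2) β) =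
    w (k + 1) α * w (k + 1) β * (w k α * w (k + 2) β) by ring]
  exact act_w_mul_w h _ _ _

/-- The transport equation reads the iterated integral from the largest time, the limit of the
regularisation from the smallest one. Both orders sum over the same disjoint sets of neighbouring
pairs, so they agree by induction once overlapping contacts are known to vanish. -/
theorem pathInt_elimLast {k n : ℕ} (τ : ℝ) {Y : ℕ → (Fin (n + 1) → ℝ) → (ℕ → Vert d 𝔸) → 𝔸}
    (hY : ∀ r G, ContDiff ℝ ∞ fun s => Y r s G)
    (hv : ∀ r s i, k ≤ i → i < k + n + 1 → Vanish i (Y r s)) (F : ℕ → Vert d 𝔸) :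
    pathInt k (n + 1) τ Y F = pathInt k n τ (elimLast k τ n Y) F := by
  induction n using Nat.strong_induction_on generalizing k τ with
  | _ n ih =>
  rcases n with - | n
  · rw [pathInt_succ]
    simp only [contactInt, pathInt, elimLast, lastContact, lastTime, Pi.zero_apply, add_zero]
    refine intervalIntegral.integral_congr fun s _ => ?_
    congr 1
    funext i; fin_cases i; rfl
  rw [pathInt_succ, pathInt_succ (n := n)]
  congr 1
  funext t
  have h1 : pathInt (k + 1) (n + 1) t (fun r s => Y r (Fin.cons t s)) F =
      pathInt (k + 1) n t (elimLast (k + 1) t n fun r s => Y r (Fin.cons t s)) F :=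
    ih n (by omega) t (fun r G => contDiff_cons_right (hY r G) t)
      (fun r s i h h' => hv r _ i (by omega) (by omega))
  rw [h1]
  -- With two times there is one possible contact, which is at once the first and the last.
  rcases n with - | n
  · simp only [contactInt, pathInt, add_zero, elimLast, lastContact, Pi.zero_apply, lastTime]
    congr 1
    · refine intervalIntegral.integral_congr fun s _ => ?_
      congr 1
      funext i; fin_cases i <;> rfl
    · refine congrFun ?_ F
      congr 1
      · congr 1; funext i; fin_cases i <;> rfl
  congr 1
  · congr 1
    funext r s G
    simp only [elimLast, lastContact, lastTime, Fin.cons_snoc_eq_snoc_cons, snocR]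
    rw [show (Fin.cons t s : Fin (n + 2) → ℝ) (Fin.last (n + 1)) = s (Fin.last n) from
      Fin.cons_succ (α := fun _ => ℝ) t s (Fin.last n), show k + 1 + n = k + (n + 1) by omega]
  · simp only [contactInt]
    rw [ih n (by omega) t (fun r G => contDiff_contact_right (hY (r + 1)) t G)
      (fun r s i h h' => (hv (r + 1) _ i (by omega) (by omega)).act _)]
    congr 1
    funext r s G
    have hc : ∀ G, Continuous fun u => Y (r + 1) (snocR (Fin.cons t (Fin.cons t s)) u) G :=
      fun G => ((hY (r + 1) G).comp (contDiff_snocR contDiff_const contDiff_id)).continuous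
    have e1 : elimLast k τ (n + 2) Y (r + 1) (Fin.cons t (Fin.cons t s)) =
        (fun G => ∫ u in (0 : ℝ)..lastTime t n s, Y (r + 1) (snocR (Fin.cons t (Fin.cons t s)) u) G)
        + act (ww (k + (n + 1)) (k + (n + 1) + 1)) (Y (r + 2)
          (snocR (Fin.cons t (Fin.cons t s)) (lastTime t n s))) := by
      have e0 : (Fin.cons t (Fin.cons t s) : Fin (n + 2) → ℝ) (Fin.last (n + 1)) =
          lastTime t n s := by
        rw [← Fin.succ_last, Fin.cons_succ]
        rcases n with - | n
        · rfl
        · rw [← Fin.succ_last, Fin.cons_succ]; rfl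
      funext G
      simp only [elimLast, lastContact, lastTime, e0, Pi.add_apply]
    rw [e1, map_add, Pi.add_apply, act_ww_integral (by omega) hc]
    simp only [elimLast, Fin.cons_snoc_eq_snoc_cons, snocR]
    congr 1
    -- With three times a first contact followed by a last contact shares the middle vertex, hence
    -- is zero. With more times the two contacts are disjoint and commute.
    rcases n with - | n
    · simp only [lastContact, Pi.zero_apply]
      rw [act_ww_ww_of_vanish (hv _ _ _ (by omega) (by omega))]
      rfl
    · simp only [lastContact, lastTime]
      rw [ww_comm_act, show k + 2 + n = k + (n + 1 + 1) by omega]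
      simp only [Fin.cons_snoc_eq_snoc_cons, snocR]

/-! ### Removal of the regularisation -/

/-- The kernels `κ_ε(t, s)` that tend to `2 δ(t - s)`. -/
structure ContactKernel (τ : ℝ) (κ : ℝ → ℝ → ℝ → ℝ) : Prop where
  cont : ∀ ε > 0, Continuous (Function.uncurry (κ ε))
  nonneg : ∀ ε > 0, ∀ t s, 0 ≤ κ ε t s
  mass : ∀ ε > 0, ∀ t, ∀ a ∈ Set.Icc 0 τ, ∫ s in (0 : ℝ)..a, κ ε t s ≤ 2
  off : ∀ δ > 0, ∀ᶠ ε in 𝓝[>] (0 : ℝ), ∀ t s, δ ≤ |t - s| → κ ε t s = 0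
  half : ∀ b ∈ Set.Ioo 0 τ, Tendsto (fun p : ℝ × ℝ => ∫ s in (0 : ℝ)..p.2, κ p.1 p.2 s)
    (𝓝[>] 0 ×ˢ 𝓝 b) (𝓝 1)

/-- Dominated convergence after rescaling to `[0, 1]`. The end point `u = 1` is excluded, because
there the last two times coincide and no limit is available. -/
theorem tendsto_integral_upper {ι : Type} {l : Filter ι} [l.IsCountablyGenerated] {b : ι → ℝ}
    {b₀ C : ℝ} {f : ι → ℝ → 𝔸} {f₀ : ℝ → 𝔸} (hb : Tendsto b l (𝓝 b₀)) (hb0 : ∀ᶠ i in l, 0 ≤ b i)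
    (hf : ∀ᶠ i in l, Continuous (f i)) (hC : ∀ᶠ i in l, ∀ s ∈ Set.Icc 0 (b i), ‖f i s‖ ≤ C)
    (hl : ∀ u ∈ Set.Ioo (0 : ℝ) 1, Tendsto (fun i => f i (b i * u)) l (𝓝 (f₀ (b₀ * u)))) :
    Tendsto (fun i => ∫ s in (0 : ℝ)..b i, f i s) l (𝓝 (∫ s in (0 : ℝ)..b₀, f₀ s)) := by
  rw [integral_zero_to_eq_smul b₀ f₀]
  refine Tendsto.congr (fun i => (integral_zero_to_eq_smul (b i) (f i)).symm) ?_
  refine hb.smul (intervalIntegral.tendsto_integral_filter_of_dominated_convergence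
    (fun _ => C) ?_ ?_ (by simp) ?_)
  · filter_upwards [hf] with i hi
    exact (hi.comp (continuous_const.mul continuous_id)).aestronglyMeasurable
  · filter_upwards [hC, hb0] with i hi hi0
    refine ae_of_all _ fun u hu => hi _ ?_
    rw [Set.uIoc_of_le zero_le_one] at hu
    exact ⟨mul_nonneg hi0 hu.1.le, mul_le_of_le_one_right hi0 hu.2⟩
  · have h1 : ∀ᵐ u : ℝ, u ≠ 1 := by
      simp [ae_iff, measure_singleton]
    filter_upwards [h1] with u hu1 hu
    rw [Set.uIoc_of_le zero_le_one] at hu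
    exact hl u ⟨hu.1, lt_of_le_of_ne hu.2 hu1⟩

namespace ContactKernel

variable {τ : ℝ} {κ : ℝ → ℝ → ℝ → ℝ} (hκ : ContactKernel τ κ)

include hκ

/-- The kernel is nonnegative with mass at most two; the bound on `Z` is needed only where the
kernel does not vanish. -/
theorem norm_integral_smul_le {ε t a C : ℝ} (hε : 0 < ε) (ha : a ∈ Set.Icc 0 τ) {Z : ℝ → 𝔸}
    (hC0 : 0 ≤ C) (hC : ∀ s ∈ Set.Icc 0 a, κ ε t s ≠ 0 → ‖Z s‖ ≤ C) :
    ‖∫ s in (0 : ℝ)..a, κ ε t s • Z s‖ ≤ 2 * C := by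
  have hc : Continuous fun s => κ ε t s := (hκ.cont ε hε).comp (Continuous.prodMk_right t)
  have h1 : ‖∫ s in (0 : ℝ)..a, κ ε t s • Z s‖ ≤ ∫ s in (0 : ℝ)..a, κ ε t s * C := by
    refine intervalIntegral.norm_integral_le_of_norm_le ha.1 (ae_of_all _ fun s hs => ?_)
      ((hc.mul continuous_const).intervalIntegrable _ _)
    rw [norm_smul, Real.norm_of_nonneg (hκ.nonneg ε hε t s)]
    by_cases h0 : κ ε t s = 0
    · simp [h0]
    · exact mul_le_mul_of_nonneg_left (hC s ⟨hs.1.le, hs.2⟩ h0) (hκ.nonneg ε hε t s)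
  rw [intervalIntegral.integral_mul_const] at h1
  exact h1.trans (mul_le_mul_of_nonneg_right (hκ.mass ε hε t a ha) hC0)

variable [CompleteSpace 𝔸]

/-- Up to the end point at which the kernel is centred the mass tends to one, half of the mass of
`2δ`. The kernel concentrates there, so the integral sees only the value `Z₀`. The limit of `Z` must
be joint in the index and in `s`, since `s` approaches `b₀` at an uncontrolled rate. -/
theorem tendsto_contact {ι : Type} {l : Filter ι} {ε b : ι → ℝ} {b₀ : ℝ}
    (hε : Tendsto ε l (𝓝[>] 0)) (hb : Tendsto b l (𝓝 b₀)) (hb₀ : b₀ ∈ Set.Ioo 0 τ)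
    {Z : ι → ℝ → 𝔸} {Z₀ : 𝔸} (hc : ∀ᶠ i in l, Continuous (Z i))
    (hZ : Tendsto (fun q : ι × ℝ => Z q.1 q.2) (l ×ˢ 𝓝 b₀) (𝓝 Z₀)) :
    Tendsto (fun i => ∫ s in (0 : ℝ)..b i, κ (ε i) (b i) s • Z i s) l (𝓝 Z₀) := by
  have hm : Tendsto (fun i => (∫ s in (0 : ℝ)..b i, κ (ε i) (b i) s) • Z₀) l (𝓝 Z₀) := by
    have := ((hκ.half b₀ hb₀).comp (hε.prodMk hb)).smul_const Z₀
    rwa [one_smul] at this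
  have hpos : ∀ᶠ i in l, 0 < ε i := hε.eventually self_mem_nhdsWithin
  have hbI : ∀ᶠ i in l, b i ∈ Set.Ioo 0 τ := hb.eventually (Ioo_mem_nhds hb₀.1 hb₀.2)
  have hd : Tendsto (fun i => ∫ s in (0 : ℝ)..b i, κ (ε i) (b i) s • (Z i s - Z₀)) l (𝓝 0) := by
    rw [Metric.tendsto_nhds]
    intro η hη
    have h1 : ∀ᶠ q : ι × ℝ in l ×ˢ 𝓝 b₀, ‖Z q.1 q.2 - Z₀‖ < η / 4 := by
      filter_upwards [Metric.tendsto_nhds.1 hZ (η / 4) (by positivity)] with q hq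
      rwa [← dist_eq_norm]
    obtain ⟨p, hp, p', hp', hpp⟩ := eventually_prod_iff.1 h1
    obtain ⟨δ, hδ, hδ'⟩ := Metric.eventually_nhds_iff.1 hp'
    have h2 : ∀ᶠ i in l, ∀ t s, δ / 2 ≤ |t - s| → κ (ε i) t s = 0 :=
      hε.eventually (hκ.off (δ / 2) (by positivity))
    have h3 : ∀ᶠ i in l, |b i - b₀| < δ / 2 := by
      filter_upwards [Metric.tendsto_nhds.1 hb (δ / 2) (by positivity)] with i hi
      rwa [← Real.dist_eq]
    filter_upwards [hp, h2, h3, hpos, hbI] with i hi hi2 hi3 hi4 hi5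
    rw [dist_zero_right]
    refine (hκ.norm_integral_smul_le hi4 ⟨hi5.1.le, hi5.2.le⟩ (C := η / 4) (by positivity)
      fun s _ hs => ?_).trans_lt (by linarith)
    have h4 : |b i - s| < δ / 2 := by
      by_contra h; exact hs (hi2 _ _ (not_lt.1 h))
    refine (hpp hi (hδ' ?_)).le
    rw [Real.dist_eq]
    calc |s - b₀| = |(b i - b₀) - (b i - s)| := by congr 1; ring
      _ ≤ |b i - b₀| + |b i - s| := abs_sub _ _
      _ < δ := by linarith
  have := hd.add hm
  rw [zero_add] at this
  refine this.congr' ?_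
  filter_upwards [hpos, hc] with i hi hci
  have hk : Continuous fun s => κ (ε i) (b i) s := (hκ.cont _ hi).comp (Continuous.prodMk_right _)
  rw [← intervalIntegral.integral_smul_const, ← intervalIntegral.integral_add]
  · refine intervalIntegral.integral_congr fun s _ => ?_
    simp only [smul_sub, sub_add_cancel]
  · exact (hk.smul (hci.sub continuous_const)).intervalIntegrable _ _
  · exact (hk.smul continuous_const).intervalIntegrable _ _

end ContactKernel

/-- Times in the open interval such that any two different times are in decreasing order, and
only consecutive times with velocity-free vertices may coincide. -/
def GoodTimes (τ : ℝ) {n : ℕ} (t : Fin n → ℝ) (G : ℕ → Vert d 𝔸) : Prop :=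
  (∀ i, t i ∈ Set.Ioo 0 τ) ∧ ∀ i l : Fin n, i < l → t l < t i ∨
    (t i = t l ∧ l.val = i.val + 1 ∧ (G i).1 = 0 ∧ (G l).1 = 0)

/-- Families of functionals with a limit `Y₀` as `ε → 0`. -/
structure RegFam (τ : ℝ) (n : ℕ) (Y : ℝ → ℕ → (Fin n → ℝ) → (ℕ → Vert d 𝔸) → 𝔸)
    (Y₀ : ℕ → (Fin n → ℝ) → (ℕ → Vert d 𝔸) → 𝔸) : Prop where
  cont : ∀ ε > 0, ∀ r G, Continuous fun t => Y ε r t G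
  bdd : ∀ r G, ∃ C, ∀ᶠ ε in 𝓝[>] (0 : ℝ), ∀ t, (∀ i, t i ∈ Set.Icc 0 τ) → ‖Y ε r t G‖ ≤ C
  vanish : ∀ ε r t i, i < n → Vanish i (Y ε r t)
  smooth : ∀ r G, ContDiff ℝ ∞ fun t => Y₀ r t G
  vanish₀ : ∀ r t i, i < n → Vanish i (Y₀ r t)
  lim : ∀ r t G, GoodTimes τ t G →
    Tendsto (fun p : ℝ × (Fin n → ℝ) => Y p.1 r p.2 G) (𝓝[>] 0 ×ˢ 𝓝 t) (𝓝 (Y₀ r t G))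

/-- The family of functionals that remains when the last time has been integrated out, with the
contact terms regularised. -/
def elimReg (κ : ℝ → ℝ → ℝ → ℝ) (τ : ℝ) (n : ℕ)
    (Y : ℝ → ℕ → (Fin (n + 1) → ℝ) → (ℕ → Vert d 𝔸) → 𝔸) (ε : ℝ) (r : ℕ) (t : Fin n → ℝ)
    (G : ℕ → Vert d 𝔸) : 𝔸 :=
  (∫ s in (0 : ℝ)..lastTime τ n t, Y ε r (snocR t s) G) + ∑ i : Fin n,
    ∫ s in (0 : ℝ)..lastTime τ n t, κ ε (t i) s • act (ww i n) (Y ε (r + 1) (snocR t s)) G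

theorem act_ww_eq_zero_of_fst {i l : ℕ} (h : i ≠ l) {Φ : (ℕ → Vert d 𝔸) → 𝔸} (hΦ : Vanish i Φ)
    {G : ℕ → Vert d 𝔸} (hG : (G i).1 = 0) : act (ww i l) Φ G = 0 := by
  rw [act_ww_of_ne h]
  refine Finset.sum_eq_zero fun μ _ => hΦ _ ?_
  rw [Function.update_of_ne h, Function.update_self, Vert.dv_apply, hG]
  simp

theorem lastTime_mem {τ : ℝ} (hτ : 0 ≤ τ) {n : ℕ} {t : Fin n → ℝ} (ht : ∀ i, t i ∈ Set.Icc 0 τ) :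
    lastTime τ n t ∈ Set.Icc 0 τ := by
  rcases n with - | n
  · exact ⟨hτ, le_rfl⟩
  · exact ht _

theorem snocR_mem {n : ℕ} {t : Fin n → ℝ} {s : ℝ} {S : Set ℝ} (ht : ∀ i, t i ∈ S) (hs : s ∈ S)
    (i : Fin (n + 1)) : snocR t s i ∈ S := by
  refine Fin.lastCases ?_ (fun i => ?_) i
  · simpa [snocR] using hs
  · simpa [snocR] using ht i

/-- A time strictly below the last one creates no new coincidence, so the pointwise limit is
available in the interior of the integration over the last time. -/
theorem GoodTimes.snoc {τ : ℝ} {n : ℕ} {t : Fin n → ℝ} {G : ℕ → Vert d 𝔸} (h : GoodTimes τ t G)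
    {s : ℝ} (hs : 0 < s) (hs' : s < lastTime τ n t) : GoodTimes τ (snocR t s) G := by
  have hsl : ∀ i : Fin n, s < t i := by
    intro i
    rcases n with - | n
    · exact i.elim0
    refine hs'.trans_le ?_
    rcases eq_or_ne i (Fin.last n) with rfl | hi
    · exact le_rfl
    · rcases h.2 i (Fin.last n) (lt_of_le_of_ne (Fin.le_last i) hi) with h1 | h1
      · exact h1.le
      · exact h1.1.ge
  refine ⟨snocR_mem h.1 ⟨hs, ?_⟩, fun i l hil => ?_⟩
  · rcases n with - | n
    · exact hs'
    · exact hs'.trans (h.1 _).2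
  · revert hil
    refine Fin.lastCases ?_ (fun l => ?_) l
    · refine Fin.lastCases (fun hil => absurd hil (lt_irrefl _)) (fun i _ => ?_) i
      left; simpa [snocR] using hsl i
    · refine Fin.lastCases (fun hil => absurd hil (by simp [Fin.le_last])) (fun i hil => ?_) i
      simpa [snocR] using h.2 i l (by simpa using hil)

namespace RegFam

variable {τ : ℝ} {κ : ℝ → ℝ → ℝ → ℝ} {n : ℕ}
  {Y : ℝ → ℕ → (Fin (n + 1) → ℝ) → (ℕ → Vert d 𝔸) → 𝔸}
  {Y₀ : ℕ → (Fin (n + 1) → ℝ) → (ℕ → Vert d 𝔸) → 𝔸}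

theorem continuous_act_ww {X : Type} [TopologicalSpace X] {i l : ℕ} (h : i ≠ l)
    {Z : X → (ℕ → Vert d 𝔸) → 𝔸} (hZ : ∀ G, Continuous fun s => Z s G) (G : ℕ → Vert d 𝔸) :
    Continuous fun s => act (ww i l) (Z s) G := by
  simp only [act_ww_of_ne h]
  exact continuous_finsetSum _ fun μ _ => hZ _

theorem bdd_act_ww (h : RegFam τ (n + 1) Y Y₀) {i l : ℕ} (hil : i ≠ l) (r : ℕ)
    (G : ℕ → Vert d 𝔸) : ∃ C, 0 ≤ C ∧ ∀ᶠ ε in 𝓝[>] (0 : ℝ), ∀ t, (∀ i, t i ∈ Set.Icc 0 τ) →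
      ‖act (ww i l) (Y ε r t) G‖ ≤ C := by
  choose C hC using fun μ => h.bdd r (Function.update (Function.update G i (Vert.dv μ (G i))) l
        (Vert.dv μ (G l)))
  refine ⟨∑ μ, |C μ|, Finset.sum_nonneg fun μ _ => abs_nonneg _, ?_⟩
  filter_upwards [Filter.eventually_all.2 hC] with ε hε t ht
  rw [act_ww_of_ne hil]
  exact (norm_sum_le _ _).trans (Finset.sum_le_sum fun μ _ => (hε μ t ht).trans (le_abs_self _))

theorem continuous_elimReg (hκ : ContactKernel τ κ) (h : RegFam τ (n + 1) Y Y₀) {ε : ℝ}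
    (hε : 0 < ε) (r : ℕ) (G : ℕ → Vert d 𝔸) : Continuous fun t => elimReg κ τ n Y ε r t G := by
  unfold elimReg
  have hl := (contDiff_lastTime τ n).continuous
  have hs : Continuous fun p : (Fin n → ℝ) × ℝ => snocR p.1 p.2 :=
    continuous_snocR continuous_fst continuous_snd
  refine Continuous.add ?_ (continuous_finsetSum _ fun i _ => ?_)
  · exact intervalIntegral.continuous_parametric_intervalIntegral_of_continuous
      (f := fun t s => Y ε r (snocR t s) G) ((h.cont ε hε r G).comp hs) hl
  · refine intervalIntegral.continuous_parametric_intervalIntegral_of_continuous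
      (f := fun (t : Fin n → ℝ) s => κ ε (t i) s • act (ww i n) (Y ε (r + 1) (snocR t s)) G) ?_ hl
    refine Continuous.smul ?_ ?_
    · have hi : Continuous fun p : (Fin n → ℝ) × ℝ => (p.1 i, p.2) :=
        ((continuous_apply i).comp continuous_fst).prodMk continuous_snd
      exact (hκ.cont ε hε).comp hi
    · exact continuous_act_ww i.isLt.ne (Z := fun p : (Fin n → ℝ) × ℝ =>
        Y ε (r + 1) (snocR p.1 p.2)) (fun G => (h.cont ε hε (r + 1) G).comp hs) G

theorem bdd_elimReg (hκ : ContactKernel τ κ) (hτ : 0 < τ) (h : RegFam τ (n + 1) Y Y₀) (r : ℕ)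
    (G : ℕ → Vert d 𝔸) : ∃ C, ∀ᶠ ε in 𝓝[>] (0 : ℝ), ∀ t, (∀ i, t i ∈ Set.Icc 0 τ) →
      ‖elimReg κ τ n Y ε r t G‖ ≤ C := by
  obtain ⟨C₀, hC₀⟩ := h.bdd r G
  choose C hC0 hC using fun i : Fin n => h.bdd_act_ww (i := i) (l := n) i.isLt.ne (r + 1) G
  refine ⟨|C₀| * τ + ∑ i, 2 * C i, ?_⟩
  filter_upwards [hC₀, Filter.eventually_all.2 hC, self_mem_nhdsWithin] with ε h1 h2 hε t ht
  have hl := lastTime_mem hτ.le ht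
  have hm : ∀ s ∈ Set.Icc 0 (lastTime τ n t), ∀ i, snocR t s i ∈ Set.Icc 0 τ := fun s hs =>
    snocR_mem ht ⟨hs.1, hs.2.trans hl.2⟩
  refine (norm_add_le _ _).trans (add_le_add ?_ ((norm_sum_le _ _).trans
    (Finset.sum_le_sum fun i _ => ?_)))
  · refine (intervalIntegral.norm_integral_le_of_norm_le_const (C := |C₀|) fun s hs => ?_).trans ?_
    · rw [Set.uIoc_of_le hl.1] at hs
      exact (h1 _ (hm s ⟨hs.1.le, hs.2⟩)).trans (le_abs_self _)
    · rw [sub_zero, abs_of_nonneg hl.1]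
      exact mul_le_mul_of_nonneg_left hl.2 (abs_nonneg _)
  · exact hκ.norm_integral_smul_le hε hl (hC0 i) fun s hs _ => h2 i _ (hm s hs)

theorem vanish_elimReg (h : RegFam τ (n + 1) Y Y₀) (ε : ℝ) (r : ℕ) (t : Fin n → ℝ) (i : ℕ)
    (hi : i < n) : Vanish i (elimReg κ τ n Y ε r t) := by
  intro G hG
  have h1 : ∀ s, Y ε r (snocR t s) G = 0 := fun s => h.vanish ε r _ i (by omega) G hG
  have h2 : ∀ (l : Fin n) s, act (ww l n) (Y ε (r + 1) (snocR t s)) G = 0 := fun l s =>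
    (h.vanish ε (r + 1) (snocR t s) i (by omega)).act _ G hG
  simp [elimReg, h1, h2]

theorem vanish_elimLast (h : RegFam τ (n + 1) Y Y₀) (r : ℕ) (t : Fin n → ℝ) (i : ℕ)
    (hi : i < n) : Vanish i (elimLast 0 τ n Y₀ r t) := by
  intro G hG
  have h1 : ∀ s, Y₀ r (snocR t s) G = 0 := fun s => h.vanish₀ r _ i (by omega) G hG
  have h2 : lastContact 0 n Y₀ r t G = 0 := by
    rcases n with - | n
    · rfl
    · exact (h.vanish₀ (r + 1) (snocR t _) i (by omega)).act _ G hG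
  simp [elimLast, h1, h2]

theorem contDiff_elimLast (h : RegFam τ (n + 1) Y Y₀) (r : ℕ) (G : ℕ → Vert d 𝔸) :
    ContDiff ℝ ∞ fun t => elimLast 0 τ n Y₀ r t G := by
  unfold elimLast
  refine ContDiff.add ?_ ?_
  · exact contDiff_integral_zero_to (h := fun t s => Y₀ r (snocR t s) G)
      ((h.smooth r G).comp (contDiff_snocR contDiff_fst contDiff_snd)) (contDiff_lastTime τ n)
  · rcases n with - | n
    · exact contDiff_const
    · simp only [lastContact, act_ww]
      exact ContDiff.sum fun μ _ => (h.smooth (r + 1) _).comp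
        (contDiff_snocR contDiff_id (contDiff_apply ℝ ℝ _))

theorem tendsto_snocR {ι : Type} {l : Filter ι} {n : ℕ} {s : ι → Fin n → ℝ} {t : Fin n → ℝ}
    {a : ι → ℝ} {a₀ : ℝ} (hs : Tendsto s l (𝓝 t)) (ha : Tendsto a l (𝓝 a₀)) :
    Tendsto (fun i => snocR (s i) (a i)) l (𝓝 (snocR t a₀)) := by
  have h := (continuous_snocR (X := (Fin n → ℝ) × ℝ) continuous_fst continuous_snd).tendsto (t, a₀)
  rw [nhds_prod_eq] at h
  exact h.comp (hs.prodMk ha)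

theorem tendsto_lastTime (τ : ℝ) (t : Fin n → ℝ) :
    Tendsto (fun p : ℝ × (Fin n → ℝ) => lastTime τ n p.2) (𝓝[>] 0 ×ˢ 𝓝 t)
      (𝓝 (lastTime τ n t)) :=
  ((contDiff_lastTime τ n).continuous.tendsto t).comp tendsto_snd

theorem eventually_pos (t : Fin n → ℝ) :
    ∀ᶠ p : ℝ × (Fin n → ℝ) in 𝓝[>] 0 ×ˢ 𝓝 t, 0 < p.1 :=
  tendsto_fst.eventually self_mem_nhdsWithin

theorem eventually_mem {t : Fin n → ℝ} (ht : ∀ i, t i ∈ Set.Ioo 0 τ) :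
    ∀ᶠ p : ℝ × (Fin n → ℝ) in 𝓝[>] (0 : ℝ) ×ˢ 𝓝 t, ∀ i, p.2 i ∈ Set.Icc 0 τ := by
  have h : ∀ i, ∀ᶠ p : ℝ × (Fin n → ℝ) in 𝓝[>] (0 : ℝ) ×ˢ 𝓝 t, p.2 i ∈ Set.Icc 0 τ := fun i => by
    have h1 : Tendsto (fun p : ℝ × (Fin n → ℝ) => p.2 i) (𝓝[>] (0 : ℝ) ×ˢ 𝓝 t) (𝓝 (t i)) :=
      ((continuous_apply i).tendsto t).comp tendsto_snd
    exact h1.eventually (Icc_mem_nhds (ht i).1 (ht i).2)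
  exact Filter.eventually_all.2 h

theorem tendsto_elim_integral (hτ : 0 < τ) (h : RegFam τ (n + 1) Y Y₀) (r : ℕ) {t : Fin n → ℝ}
    {G : ℕ → Vert d 𝔸} (ht : GoodTimes τ t G) :
    Tendsto (fun p : ℝ × (Fin n → ℝ) => ∫ s in (0 : ℝ)..lastTime τ n p.2, Y p.1 r (snocR p.2 s) G)
      (𝓝[>] 0 ×ˢ 𝓝 t) (𝓝 (∫ s in (0 : ℝ)..lastTime τ n t, Y₀ r (snocR t s) G)) := by
  obtain ⟨C, hC⟩ := h.bdd r G
  have hpos := lastTime_mem (n := n) hτ.le (t := t) fun i => ⟨(ht.1 i).1.le, (ht.1 i).2.le⟩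
  have hl0 : 0 < lastTime τ n t := by
    rcases n with - | n
    · exact hτ
    · exact (ht.1 _).1
  refine tendsto_integral_upper (C := C) (tendsto_lastTime τ t) ?_ ?_ ?_ fun u hu => ?_
  · filter_upwards [eventually_mem ht.1] with p hp
    exact (lastTime_mem hτ.le hp).1
  · filter_upwards [eventually_pos t] with p hp
    exact (h.cont p.1 hp r G).comp (continuous_snocR continuous_const continuous_id)
  · filter_upwards [eventually_mem ht.1, tendsto_fst.eventually hC] with p hp hp1 s hs
    exact hp1 _ (snocR_mem hp ⟨hs.1, hs.2.trans (lastTime_mem hτ.le hp).2⟩)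
  · have hg : GoodTimes τ (snocR t (lastTime τ n t * u)) G :=
      ht.snoc (mul_pos hl0 hu.1) (mul_lt_of_lt_one_right hl0 hu.2)
    exact (h.lim r _ G hg).comp (tendsto_fst.prodMk (tendsto_snocR tendsto_snd
      ((tendsto_lastTime τ t).mul_const u)))

/-! ### Limits of the singular contractions of the last vertex. -/

section Contact

variable {Y : ℝ → ℕ → (Fin (n + 2) → ℝ) → (ℕ → Vert d 𝔸) → 𝔸}
  {Y₀ : ℕ → (Fin (n + 2) → ℝ) → (ℕ → Vert d 𝔸) → 𝔸} [CompleteSpace 𝔸]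

/-- Either `t_i` stays away from the last remaining time, and then the kernel vanishes for all `s`
below that time once `ε` is small, or the two coincide, and then the vertex in slot `i` has no
velocity to contract. -/
theorem tendsto_elim_off (hκ : ContactKernel τ κ) (h : RegFam τ (n + 2) Y Y₀) (r : ℕ)
    {t : Fin (n + 1) → ℝ} {G : ℕ → Vert d 𝔸} (ht : GoodTimes τ t G) (i : Fin n) :
    Tendsto (fun p : ℝ × (Fin (n + 1) → ℝ) => ∫ s in (0 : ℝ)..p.2 (Fin.last n),
      κ p.1 (p.2 i.castSucc) s • act (ww i (n + 1)) (Y p.1 (r + 1) (snocR p.2 s)) G)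
      (𝓝[>] 0 ×ˢ 𝓝 t) (𝓝 0) := by
  rcases ht.2 i.castSucc (Fin.last n) (Fin.castSucc_lt_last i) with h1 | h1
  · obtain ⟨δ, hδ⟩ : ∃ δ, δ = (t i.castSucc - t (Fin.last n)) / 2 := ⟨_, rfl⟩
    have hδ0 : 0 < δ := by rw [hδ]; linarith
    have h2 : Tendsto (fun p : ℝ × (Fin (n + 1) → ℝ) => p.2 i.castSucc - p.2 (Fin.last n))
        (𝓝[>] (0 : ℝ) ×ˢ 𝓝 t) (𝓝 (t i.castSucc - t (Fin.last n))) :=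
      (((continuous_apply i.castSucc).sub (continuous_apply (Fin.last n))).tendsto t).comp
        tendsto_snd
    refine tendsto_const_nhds.congr' ?_
    filter_upwards [h2.eventually (lt_mem_nhds (show δ < _ by rw [hδ]; linarith)),
      tendsto_fst.eventually (hκ.off δ hδ0), eventually_mem ht.1] with p hp hp1 hp2
    rw [intervalIntegral.integral_congr_ae (g := fun _ => 0), intervalIntegral.integral_zero]
    refine ae_of_all _ fun s hs => ?_
    rw [Set.uIoc_of_le (hp2 _).1] at hs
    rw [hp1 _ _ ((show δ ≤ _ by linarith [hs.2]).trans (le_abs_self _)), zero_smul]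
  · refine tendsto_const_nhds.congr fun p => ?_
    have : ∀ s, act (ww i (n + 1)) (Y p.1 (r + 1) (snocR p.2 s)) G = 0 := fun s =>
      act_ww_eq_zero_of_fst (by omega) (h.vanish _ _ _ _ (by omega)) h1.2.2.1
    simp [this]

/-- If the last remaining time is isolated, the contact creates a new admissible coincidence: the
contraction has just removed the velocities of both vertices. If it already coincides with an
earlier one, its vertex has no velocity and both sides vanish. -/
theorem tendsto_elim_last (hκ : ContactKernel τ κ) (h : RegFam τ (n + 2) Y Y₀) (r : ℕ)
    {t : Fin (n + 1) → ℝ} {G : ℕ → Vert d 𝔸} (ht : GoodTimes τ t G) :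
    Tendsto (fun p : ℝ × (Fin (n + 1) → ℝ) => ∫ s in (0 : ℝ)..p.2 (Fin.last n),
      κ p.1 (p.2 (Fin.last n)) s • act (ww n (n + 1)) (Y p.1 (r + 1) (snocR p.2 s)) G)
      (𝓝[>] 0 ×ˢ 𝓝 t) (𝓝 (act (ww n (n + 1)) (Y₀ (r + 1) (snocR t (t (Fin.last n)))) G)) := by
  by_cases hd : ∀ i : Fin n, t (Fin.last n) < t i.castSucc
  · refine hκ.tendsto_contact tendsto_fst (tendsto_lastTime (n := n + 1) τ t) (ht.1 _) ?_ ?_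
    · filter_upwards [eventually_pos t] with p hp
      exact continuous_act_ww (by omega) (Z := fun s => Y p.1 (r + 1) (snocR p.2 s))
        (fun G => (h.cont p.1 hp (r + 1) G).comp (continuous_snocR continuous_const continuous_id))
        G
    · simp only [act_ww]
      refine tendsto_finsetSum _ fun μ _ => ?_
      refine (h.lim (r + 1) (snocR t (t (Fin.last n))) _ ⟨snocR_mem ht.1 (ht.1 _),
        fun i l hil => ?_⟩).comp ((tendsto_fst.comp tendsto_fst).prodMk
          (tendsto_snocR (tendsto_snd.comp tendsto_fst) tendsto_snd))
      revert hil
      refine Fin.lastCases ?_ (fun l => ?_) l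
      · refine Fin.lastCases (fun hil => absurd hil (lt_irrefl _)) (fun i _ => ?_) i
        refine Fin.lastCases ?_ (fun i => ?_) i
        · right
          refine ⟨by simp [snocR], by simp, ?_, ?_⟩
          · simp [Vert.dv_apply]
          · simp [Vert.dv_apply]
        · left
          simpa [snocR] using hd i
      · refine Fin.lastCases (fun hil => absurd hil (by simp [Fin.le_last])) (fun i hil => ?_) i
        have hil' : i < l := by simpa using hil
        rcases ht.2 i l hil' with h3 | ⟨h3, h4, h5, h6⟩
        · left; simpa [snocR] using h3
        · right
          -- An older coincidence cannot involve slot `n`, whose time lies strictly below all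
          -- earlier ones; the updates made by the contraction therefore leave its two vertices
          -- unchanged.
          have hl : l.val ≠ n := fun hl => by
            have hl' : l = Fin.last n := Fin.ext hl
            have h7 := hd ⟨i.val, by omega⟩
            rw [← hl', show Fin.castSucc ⟨i.val, _⟩ = i from Fin.ext rfl, h3] at h7
            exact lt_irrefl _ h7
          have hl1 : l.val ≠ n + 1 := by omega
          have hi : i.val ≠ n := by omega
          have hi1 : i.val ≠ n + 1 := by omega
          refine ⟨by simpa [snocR] using h3, by simpa using h4, ?_, ?_⟩
          · simpa [Function.update_of_ne hi, Function.update_of_ne hi1] using h5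
          · simpa [Function.update_of_ne hl, Function.update_of_ne hl1] using h6
  · push Not at hd
    obtain ⟨i, hi⟩ := hd
    rcases ht.2 i.castSucc (Fin.last n) (Fin.castSucc_lt_last i) with h1 | h1
    · exact absurd h1 (not_lt.2 hi)
    have hG : (G n).1 = 0 := h1.2.2.2
    have h2 : act (ww n (n + 1)) (Y₀ (r + 1) (snocR t (t (Fin.last n)))) G = 0 :=
      act_ww_eq_zero_of_fst (by omega) (h.vanish₀ _ _ _ (by omega)) hG
    rw [h2]
    refine tendsto_const_nhds.congr fun p => ?_
    have : ∀ s, act (ww n (n + 1)) (Y p.1 (r + 1) (snocR p.2 s)) G = 0 := fun s =>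
      act_ww_eq_zero_of_fst (by omega) (h.vanish _ _ _ _ (by omega)) hG
    simp [this]

end Contact

variable [CompleteSpace 𝔸]

/-- The hypotheses on a regularised family are chosen to survive the integration over the last time,
so that the limit can be taken by induction on the number of times. -/
theorem elim (hκ : ContactKernel τ κ) (hτ : 0 < τ) (h : RegFam τ (n + 1) Y Y₀) :
    RegFam τ n (elimReg κ τ n Y) (elimLast 0 τ n Y₀) where
  cont _ hε r G := h.continuous_elimReg hκ hε r G
  bdd r G := h.bdd_elimReg hκ hτ r G
  vanish ε r t i hi := h.vanish_elimReg ε r t i hi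
  smooth r G := h.contDiff_elimLast r G
  vanish₀ r t i hi := h.vanish_elimLast r t i hi
  lim r t G ht := by
    refine (h.tendsto_elim_integral hτ r ht).add ?_
    rcases n with - | n
    · simp only [Finset.univ_eq_empty, Finset.sum_empty]
      exact tendsto_const_nhds
    simp only [Fin.sum_univ_castSucc, lastTime, lastContact, zero_add]
    have h1 := (tendsto_finsetSum Finset.univ fun i _ => h.tendsto_elim_off hκ r ht i).add
      (h.tendsto_elim_last hκ r ht)
    rw [Finset.sum_const_zero, zero_add] at h1
    exact h1

end RegFam

/-! ### The limit of the iterated integrals -/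

/-- The integral over `τ ≥ t₁ ≥ … ≥ t_n ≥ 0`, iterated from the smallest time. -/
def simplexInt (τ : ℝ) : (n : ℕ) → ((Fin n → ℝ) → 𝔸) → 𝔸
  | 0, h => h Fin.elim0
  | n + 1, h => simplexInt τ n fun t => ∫ s in (0 : ℝ)..lastTime τ n t, h (snocR t s)

/-- The singular contractions. -/
def singQuad (κ : ℝ → ℝ → ℝ) (n : ℕ) (t : Fin n → ℝ) : DOp d :=
  ∑ i : Fin n, ∑ l : Fin n, if i < l then κ (t i) (t l) • ww i l else 0

theorem singQuad_snoc (κ : ℝ → ℝ → ℝ) (n : ℕ) (t : Fin n → ℝ) (s : ℝ) :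
    singQuad (d := d) κ (n + 1) (snocR t s) =
      singQuad κ n t + ∑ α, w n α * ∑ i : Fin n, κ (t i) s • w i α := by
  have h1 : ∑ α, w (d := d) n α * ∑ i : Fin n, κ (t i) s • w i α =
      ∑ i : Fin n, κ (t i) s • ww i n := by
    simp only [ww, Finset.mul_sum, Finset.smul_sum]
    rw [Finset.sum_comm]
    refine Finset.sum_congr rfl fun i _ => Finset.sum_congr rfl fun α _ => ?_
    rw [mul_smul_comm, mul_comm]
  rw [h1, singQuad, Fin.sum_univ_castSucc]
  have h2 : ∀ l : Fin (n + 1), ¬ Fin.last n < l := fun l => not_lt.2 (Fin.le_last l)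
  simp only [h2, if_false, Finset.sum_const_zero, add_zero, Fin.sum_univ_castSucc,
    Fin.castSucc_lt_last, if_true, Finset.sum_add_distrib]
  simp [snocR, singQuad]

theorem continuous_act {Z : ℝ → (ℕ → Vert d 𝔸) → 𝔸} (hZ : ∀ G, Continuous fun s => Z s G)
    (p : DOp d) (G : ℕ → Vert d 𝔸) : Continuous fun s => act p (Z s) G := by
  induction p using MvPolynomial.induction_on generalizing Z G with
  | C r =>
    rw [show (MvPolynomial.C r : DOp d) = r • 1 by rw [← MvPolynomial.C_mul', mul_one]]
    simp only [act_smul, act_one, Pi.smul_apply]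
    exact (hZ G).const_smul r
  | add p q hp hq =>
    simp only [act_add, Pi.add_apply]
    exact (hp hZ G).add (hq hZ G)
  | mul_X p c hp =>
    simp only [act_mul]
    exact hp (fun G => by simp only [act_X]; exact hZ _) G

theorem act_integral {Z : ℝ → (ℕ → Vert d 𝔸) → 𝔸} (hZ : ∀ G, Continuous fun s => Z s G)
    (p : DOp d) (a b : ℝ) (G : ℕ → Vert d 𝔸) :
    act p (fun G => ∫ s in a..b, Z s G) G = ∫ s in a..b, act p (Z s) G := by
  induction p using MvPolynomial.induction_on generalizing Z G with
  | C r =>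
    rw [show (MvPolynomial.C r : DOp d) = r • 1 by rw [← MvPolynomial.C_mul', mul_one]]
    simp only [act_smul, act_one, Pi.smul_apply, intervalIntegral.integral_smul]
  | add p q hp hq =>
    simp only [act_add, Pi.add_apply]
    rw [hp hZ, hq hZ, intervalIntegral.integral_add
      ((continuous_act hZ p G).intervalIntegrable _ _)
      ((continuous_act hZ q G).intervalIntegrable _ _)]
  | mul_X p c hp =>
    simp only [act_mul]
    rw [← hp (fun G => by simp only [act_X]; exact hZ _)]
    have h1 : act (MvPolynomial.X c) (fun G => ∫ s in a..b, Z s G) =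
        fun G => ∫ s in a..b, act (MvPolynomial.X c) (Z s) G := by
      funext G; simp only [act_X]
    rw [h1]

/-- The last vertex can enter at most one singular contraction, so the divided power is affine in
the part `W` that involves it. Using `W` once costs one order, which shifts `r` to `r + 1` in the
family. -/
theorem sum_act_dp_snoc (κ : ℝ → ℝ → ℝ) (n R : ℕ) (t : Fin n → ℝ) (s : ℝ)
    {Y : ℕ → (Fin (n + 1) → ℝ) → (ℕ → Vert d 𝔸) → 𝔸} (hR : ∀ r, R ≤ r → Y r = 0)
    (hv : ∀ r t, Vanish n (Y r t)) :
    ∑ r ∈ Finset.range R, act (dp r (singQuad κ (n + 1) (snocR t s))) (Y r (snocR t s)) =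
      ∑ r ∈ Finset.range R, act (dp r (singQuad κ n t)) (Y r (snocR t s) +
        ∑ i : Fin n, κ (t i) s • act (ww i n) (Y (r + 1) (snocR t s))) := by
  obtain ⟨W, hW⟩ : ∃ W : DOp d, W = ∑ α, w n α * ∑ i : Fin n, κ (t i) s • w i α := ⟨_, rfl⟩
  have hW' : ∀ r, act W (Y r (snocR t s)) =
      ∑ i : Fin n, κ (t i) s • act (ww i n) (Y r (snocR t s)) := by
    intro r
    have h1 : W = ∑ i : Fin n, κ (t i) s • ww i n := by
      rw [hW]
      simp only [ww, Finset.mul_sum, Finset.smul_sum]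
      rw [Finset.sum_comm]
      refine Finset.sum_congr rfl fun i _ => Finset.sum_congr rfl fun α _ => ?_
      rw [mul_smul_comm, mul_comm]
    rw [h1, act_sum]
    simp only [act_smul]
  have hdp : ∀ r, act (dp (r + 1) (singQuad κ (n + 1) (snocR t s))) (Y (r + 1) (snocR t s)) =
      act (dp (r + 1) (singQuad κ n t)) (Y (r + 1) (snocR t s)) +
      act (dp r (singQuad κ n t)) (act W (Y (r + 1) (snocR t s))) := by
    intro r
    obtain ⟨c, hc⟩ := exists_dp_add r (singQuad κ n t) W
    rw [singQuad_snoc, ← hW, hc, act_add, act_add, pow_two]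
    have h0 : act (W * W * c) (Y (r + 1) (snocR t s)) = 0 := by
      have hv' : Vanish n (Y (r + 1) (snocR t s)) := hv _ _
      have h1 := act_w_sum_mul hv' (fun α => ∑ i : Fin n, κ (t i) s • w i α)
        (fun α => ∑ i : Fin n, κ (t i) s • w i α) c
      rwa [← hW] at h1
    rw [h0, add_zero, mul_comm W, act_mul]
  rcases R with - | R
  · simp
  rw [Finset.sum_range_succ']
  simp only [hdp, dp_zero, act_one, map_add, Finset.sum_add_distrib, ← hW']
  rw [Finset.sum_range_succ (fun r => act (dp r (singQuad κ n t)) (act W (Y (r + 1) (snocR t s)))),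
    Finset.sum_range_succ' (fun r => act (dp r (singQuad κ n t)) (Y r (snocR t s))),
    hR (R + 1) le_rfl]
  simp only [Pi.zero_apply, map_zero, add_zero, dp_zero, act_one]
  abel

/-- As the regularisation is removed, the singular contractions turn into contact terms. -/
theorem RegFam.tendsto_simplexInt [CompleteSpace 𝔸] {τ : ℝ} {κ : ℝ → ℝ → ℝ → ℝ}
    (hκ : ContactKernel τ κ) (hτ : 0 < τ) {n R : ℕ}
    {Y : ℝ → ℕ → (Fin n → ℝ) → (ℕ → Vert d 𝔸) → 𝔸}
    {Y₀ : ℕ → (Fin n → ℝ) → (ℕ → Vert d 𝔸) → 𝔸} (h : RegFam τ n Y Y₀)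
    (hR : ∀ ε r, R ≤ r → Y ε r = 0) (hR' : 0 < R) (F : ℕ → Vert d 𝔸) :
    Tendsto (fun ε => simplexInt τ n fun t =>
      (∑ r ∈ Finset.range R, act (dp r (singQuad (κ ε) n t)) (Y ε r t)) F)
      (𝓝[>] 0) (𝓝 (pathInt 0 n τ Y₀ F)) := by
  induction n with
  | zero =>
    simp only [simplexInt, pathInt, singQuad, Finset.univ_eq_empty, Finset.sum_empty,
      dp_zero_right]
    have h1 := h.lim 0 Fin.elim0 F ⟨fun i => i.elim0, fun i => i.elim0⟩
    have h2 : Tendsto (fun ε : ℝ => (ε, (Fin.elim0 : Fin 0 → ℝ))) (𝓝[>] 0)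
        (𝓝[>] 0 ×ˢ 𝓝 Fin.elim0) := tendsto_id.prodMk tendsto_const_nhds
    refine (h1.comp h2).congr fun ε => ?_
    obtain ⟨R, rfl⟩ : ∃ R', R = R' + 1 := ⟨R - 1, by omega⟩
    rw [Finset.sum_range_succ', Finset.sum_eq_zero fun r _ => by
      rw [if_neg (Nat.succ_ne_zero r), act_zero]]
    simp
  | succ n ih =>
    -- The limiting integral loses its last time in the same way as the regularised one, with
    -- `elimLast` as the limit of `elimReg`.
    rw [pathInt_elimLast τ h.smooth fun r s i _ hi => h.vanish₀ r s i (by omega)]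
    have hR2 : ∀ ε r, R ≤ r → elimReg κ τ n Y ε r = 0 := fun ε r hr => by
      funext t G
      simp [elimReg, hR ε r hr, hR ε (r + 1) (by omega)]
    refine (ih (h.elim hκ hτ) hR2).congr' ?_
    filter_upwards [self_mem_nhdsWithin] with ε hε
    have hε : 0 < ε := hε
    simp only [simplexInt]
    congr 1
    funext t
    have hc1 : ∀ r G, Continuous fun s => Y ε r (snocR t s) G := fun r G =>
      (h.cont ε hε r G).comp (continuous_snocR continuous_const continuous_id)
    have hk : ∀ i : Fin n, Continuous fun s => κ ε (t i) s := fun i =>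
      (hκ.cont ε hε).comp (Continuous.prodMk_right _)
    have hc2 : ∀ r (i : Fin n) G, Continuous fun s =>
        κ ε (t i) s • act (ww i n) (Y ε (r + 1) (snocR t s)) G := fun r i G =>
      (hk i).smul (RegFam.continuous_act_ww i.isLt.ne (hc1 (r + 1)) G)
    have hc3 : ∀ r G, Continuous fun s => (Y ε r (snocR t s) +
        ∑ i : Fin n, κ ε (t i) s • act (ww i n) (Y ε (r + 1) (snocR t s))) G := fun r G => by
      simp only [Pi.add_apply, Finset.sum_apply, Pi.smul_apply]
      exact (hc1 r G).add (continuous_finsetSum _ fun i _ => hc2 r i G)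
    have he : ∀ r, elimReg κ τ n Y ε r t = fun G => ∫ s in (0 : ℝ)..lastTime τ n t,
        (Y ε r (snocR t s) +
          ∑ i : Fin n, κ ε (t i) s • act (ww i n) (Y ε (r + 1) (snocR t s))) G := by
      intro r
      funext G
      simp only [Pi.add_apply, Finset.sum_apply, Pi.smul_apply]
      rw [intervalIntegral.integral_add ((hc1 r G).intervalIntegrable _ _)
        ((continuous_finsetSum _ fun i _ => hc2 r i G).intervalIntegrable _ _),
        intervalIntegral.integral_finsetSum fun i _ => (hc2 r i G).intervalIntegrable _ _]
      rfl
    simp only [sum_act_dp_snoc _ n R t _ (hR ε) fun r t => h.vanish ε r t n (by omega)]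
    simp only [Finset.sum_apply, he]
    have hcp : ∀ r, Continuous fun s => act (dp r (singQuad (κ ε) n t)) (Y ε r (snocR t s) +
        ∑ i : Fin n, κ ε (t i) s • act (ww i n) (Y ε (r + 1) (snocR t s))) F := fun r => continuous_act (hc3 r) _ _
    rw [intervalIntegral.integral_finsetSum fun r _ => (hcp r).intervalIntegrable _ _]
    exact Finset.sum_congr rfl fun r _ => act_integral (hc3 r) _ _ _ _

/-! ### Regularised covariances -/

/-- A smooth nonnegative function of integral one supported in `[-r, r]`. -/
structure IsBump (D : ℝ → ℝ) (r : ℝ) : Prop where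
  smooth : ContDiff ℝ ∞ D
  pos : 0 < r
  nonneg : ∀ v, 0 ≤ D v
  supp : ∀ v, r ≤ |v| → D v = 0
  mass : ∫ v in -r..r, D v = 1

theorem IsMollifier.exists_isBump {ρ : ℝ → ℝ} (hρ : IsMollifier ρ) :
    ∃ R > 0, ∀ ε > 0, IsBump (approxDelta ρ ε) (R * ε) := by
  obtain ⟨R, hR0, hR⟩ := hρ.compact.isCompact.isBounded.subset_ball_lt 0 0
  have hz : ∀ v, R ≤ |v| → ρ v = 0 := by
    intro v hv
    by_contra h
    have := hR (subset_tsupport ρ h)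
    rw [Metric.mem_ball, dist_zero_right, Real.norm_eq_abs] at this
    linarith
  refine ⟨R, hR0, fun ε hε => ⟨?_, by positivity, ?_, ?_, ?_⟩⟩
  · exact contDiff_const.mul (hρ.smooth.comp (contDiff_id.div_const ε))
  · exact fun v => mul_nonneg (by positivity) (hρ.nonneg _)
  · intro v hv
    rw [approxDelta, hz, mul_zero]
    rw [abs_div, abs_of_pos hε, le_div_iff₀ hε]
    exact hv
  · simp only [approxDelta]
    rw [intervalIntegral.integral_const_mul, intervalIntegral.integral_comp_div _ hε.ne',
      smul_eq_mul, inv_mul_cancel_left₀ hε.ne', neg_div, mul_div_cancel_right₀ _ hε.ne',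
      ← hρ.integral_eq_one, intervalIntegral.integral_of_le (by linarith)]
    refine setIntegral_eq_integral_of_forall_compl_eq_zero fun v hv => ?_
    refine hz v ?_
    by_contra h
    rw [not_le, abs_lt] at h
    exact hv ⟨h.1, h.2.le⟩

/-! ### Masses of a bump on intervals. -/

namespace IsBump

variable {D : ℝ → ℝ} {r : ℝ} (hD : IsBump D r)

include hD

theorem continuous : Continuous D := hD.smooth.continuous

theorem continuous_sub (t : ℝ) : Continuous fun s => D (s - t) :=
  hD.continuous.comp (continuous_id.sub continuous_const)

theorem intervalIntegrable (a b : ℝ) : IntervalIntegrable D volume a b :=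
  hD.continuous.intervalIntegrable a b

theorem integral_eq_zero {a b : ℝ} (h : ∀ v ∈ Set.uIcc a b, r ≤ |v|) : ∫ v in a..b, D v = 0 := by
  rw [intervalIntegral.integral_congr (g := fun _ => 0) fun v hv => hD.supp v (h v hv)]
  simp

theorem integral_eq_zero_of_ge {a b : ℝ} (ha : r ≤ a) (hb : r ≤ b) : ∫ v in a..b, D v = 0 :=
  hD.integral_eq_zero fun _ hv => le_abs.2 (Or.inl ((le_min ha hb).trans hv.1))

theorem integral_eq_zero_of_le {a b : ℝ} (ha : a ≤ -r) (hb : b ≤ -r) : ∫ v in a..b, D v = 0 :=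
  hD.integral_eq_zero fun _ hv => le_abs.2 (Or.inr (le_neg.2 (hv.2.trans (max_le ha hb))))

theorem integral_eq_one {a b : ℝ} (ha : a ≤ -r) (hb : r ≤ b) : ∫ v in a..b, D v = 1 := by
  rw [← intervalIntegral.integral_add_adjacent_intervals (hD.intervalIntegrable a (-r))
    (hD.intervalIntegrable (-r) b), ← intervalIntegral.integral_add_adjacent_intervals
    (hD.intervalIntegrable (-r) r) (hD.intervalIntegrable r b), hD.mass,
    hD.integral_eq_zero_of_ge le_rfl hb, hD.integral_eq_zero_of_le ha le_rfl]
  simp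

theorem integral_nonneg {a b : ℝ} (h : a ≤ b) : 0 ≤ ∫ v in a..b, D v :=
  intervalIntegral.integral_nonneg h fun v _ => hD.nonneg v

theorem integral_le_one {a b : ℝ} (h : a ≤ b) : ∫ v in a..b, D v ≤ 1 := by
  have hr := hD.pos
  rw [← hD.integral_eq_one (min_le_right a (-r)) (le_max_right b r)]
  exact intervalIntegral.integral_mono_interval (min_le_left _ _) h (le_max_left _ _)
    (ae_of_all _ hD.nonneg) (hD.intervalIntegrable _ _)

end IsBump

/-- The integral of `D (· - t)` from `s` to `τ`. -/
def tail (D : ℝ → ℝ) (τ t s : ℝ) : ℝ := ∫ u in s..τ, D (u - t)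

/-- The first moment of `D (· - t)` on `[0, τ]`. -/
def mom (D : ℝ → ℝ) (τ t : ℝ) : ℝ := ∫ u in (0 : ℝ)..τ, u * D (u - t)

/-- Half of the derivative of the solution of `-½ u'' = D (· - t)`. -/
def prim (D : ℝ → ℝ) (τ t s : ℝ) : ℝ := tail D τ t s - mom D τ t / τ

/-- The covariance of positions. -/
def covXX (D : ℝ → ℝ) (τ t t' : ℝ) : ℝ := 2 * ∫ s in (0 : ℝ)..τ, prim D τ t s * prim D τ t' s

/-- The covariance of velocity and position. -/
def covVX (D : ℝ → ℝ) (τ t t' : ℝ) : ℝ := 2 * ∫ s in (0 : ℝ)..τ, D (s - t) * prim D τ t' s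

/-- The regularisation of `2 δ(t - s)`. -/
def contactK (D : ℝ → ℝ) (τ t t' : ℝ) : ℝ := 2 * ∫ s in (0 : ℝ)..τ, D (s - t) * D (s - t')

theorem tail_eq (D : ℝ → ℝ) (τ t s : ℝ) : tail D τ t s = ∫ u in (s - t)..(τ - t), D u := by
  rw [tail, intervalIntegral.integral_comp_sub_right]

namespace IsBump

variable {D : ℝ → ℝ} {r : ℝ} (hD : IsBump D r) {τ : ℝ}

include hD

theorem tail_eq_one {t s : ℝ} (hs : s ≤ t - r) (ht : t + r ≤ τ) : tail D τ t s = 1 := by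
  rw [tail_eq]; exact hD.integral_eq_one (by linarith) (by linarith)

theorem tail_eq_zero {t s : ℝ} (hs : t + r ≤ s) (ht : t + r ≤ τ) : tail D τ t s = 0 := by
  rw [tail_eq]; exact hD.integral_eq_zero_of_ge (by linarith) (by linarith)

theorem tail_nonneg {t s : ℝ} (hs : s ≤ τ) : 0 ≤ tail D τ t s := by
  rw [tail_eq]; exact hD.integral_nonneg (by linarith)

theorem tail_le_one {t s : ℝ} (hs : s ≤ τ) : tail D τ t s ≤ 1 := by
  rw [tail_eq]; exact hD.integral_le_one (by linarith)

theorem hasDerivAt_tail (t s : ℝ) : HasDerivAt (tail D τ t) (-D (s - t)) s :=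
  intervalIntegral.integral_hasDerivAt_left ((hD.continuous_sub t).intervalIntegrable _ _)
    (hD.continuous_sub t).stronglyMeasurable.stronglyMeasurableAtFilter
    (hD.continuous_sub t).continuousAt

theorem continuous_tail : Continuous fun p : ℝ × ℝ => tail D τ p.1 p.2 := by
  have h : ∀ p : ℝ × ℝ, tail D τ p.1 p.2 = (∫ u in (0 : ℝ)..(τ - p.1), D u)
      - ∫ u in (0 : ℝ)..(p.2 - p.1), D u := fun p => by
    rw [tail_eq, intervalIntegral.integral_interval_sub_left (hD.intervalIntegrable _ _)
      (hD.intervalIntegrable _ _)]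
  simp_rw [h]
  have hc : Continuous fun b => ∫ u in (0 : ℝ)..b, D u :=
    intervalIntegral.continuous_primitive (fun a b => hD.intervalIntegrable a b) 0
  exact (hc.comp (by fun_prop)).sub (hc.comp (by fun_prop))

theorem continuous_mom : Continuous (mom D τ) := by
  refine intervalIntegral.continuous_parametric_intervalIntegral_of_continuous' ?_ _ _
  exact continuous_snd.mul (hD.continuous.comp (continuous_snd.sub continuous_fst))

theorem continuous_prim : Continuous fun p : ℝ × ℝ => prim D τ p.1 p.2 :=
  hD.continuous_tail.sub ((hD.continuous_mom.comp continuous_fst).div_const τ)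

theorem continuous_covXX : Continuous fun p : ℝ × ℝ => covXX D τ p.1 p.2 := by
  refine continuous_const.mul
    (intervalIntegral.continuous_parametric_intervalIntegral_of_continuous' ?_ _ _)
  exact (hD.continuous_prim.comp (continuous_fst.fst.prodMk continuous_snd)).mul
    (hD.continuous_prim.comp (continuous_fst.snd.prodMk continuous_snd))

theorem continuous_covVX : Continuous fun p : ℝ × ℝ => covVX D τ p.1 p.2 := by
  refine continuous_const.mul
    (intervalIntegral.continuous_parametric_intervalIntegral_of_continuous' ?_ _ _)
  exact (hD.continuous.comp (continuous_snd.sub continuous_fst.fst)).mul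
    (hD.continuous_prim.comp (continuous_fst.snd.prodMk continuous_snd))

theorem continuous_contactK : Continuous fun p : ℝ × ℝ => contactK D τ p.1 p.2 := by
  refine continuous_const.mul
    (intervalIntegral.continuous_parametric_intervalIntegral_of_continuous' ?_ _ _)
  exact (hD.continuous.comp (continuous_snd.sub continuous_fst.fst)).mul
    (hD.continuous.comp (continuous_snd.sub continuous_fst.snd))

variable (hτ : 0 < τ)

include hτ

theorem mom_mem (t : ℝ) : mom D τ t ∈ Set.Icc 0 τ := by
  refine ⟨intervalIntegral.integral_nonneg hτ.le fun u hu => mul_nonneg hu.1 (hD.nonneg _), ?_⟩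
  calc mom D τ t ≤ ∫ u in (0 : ℝ)..τ, τ * D (u - t) := by
        refine intervalIntegral.integral_mono_on hτ.le
          ((continuous_id.mul (hD.continuous_sub t)).intervalIntegrable _ _)
          ((continuous_const.mul (hD.continuous_sub t)).intervalIntegrable _ _)
          fun u hu => mul_le_mul_of_nonneg_right hu.2 (hD.nonneg _)
    _ = τ * tail D τ t 0 := by rw [intervalIntegral.integral_const_mul, tail]
    _ ≤ τ := mul_le_of_le_one_right hτ.le (hD.tail_le_one hτ.le)

/-- When the support lies inside `[0, τ]` the moment is the mean of a probability density
concentrated within `r` of `t`. -/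
theorem abs_mom_sub_le {t : ℝ} (h : r ≤ t) (h' : t + r ≤ τ) : |mom D τ t - t| ≤ r := by
  have h1 : mom D τ t - t = ∫ u in (0 : ℝ)..τ, (u - t) * D (u - t) := by
    have : t = t * tail D τ t 0 := by rw [hD.tail_eq_one (by linarith) h', mul_one]
    nth_rewrite 2 [this]
    rw [mom, tail, ← intervalIntegral.integral_const_mul, ← intervalIntegral.integral_sub]
    · exact intervalIntegral.integral_congr fun u _ => by ring
    · exact (continuous_id.mul (hD.continuous_sub t)).intervalIntegrable _ _
    · exact (continuous_const.mul (hD.continuous_sub t)).intervalIntegrable _ _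
  rw [h1, ← Real.norm_eq_abs]
  calc ‖∫ u in (0 : ℝ)..τ, (u - t) * D (u - t)‖ ≤ ∫ u in (0 : ℝ)..τ, r * D (u - t) := by
        refine intervalIntegral.norm_integral_le_of_norm_le hτ.le (ae_of_all _ fun u _ => ?_)
          ((continuous_const.mul (hD.continuous_sub t)).intervalIntegrable _ _)
        rw [norm_mul, Real.norm_eq_abs, Real.norm_of_nonneg (hD.nonneg _)]
        rcases le_or_gt r |u - t| with h2 | h2
        · simp [hD.supp _ h2]
        · exact mul_le_mul_of_nonneg_right h2.le (hD.nonneg _)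
    _ = r * tail D τ t 0 := by rw [intervalIntegral.integral_const_mul, tail]
    _ ≤ r := mul_le_of_le_one_right hD.pos.le (hD.tail_le_one hτ.le)

/-- It is a difference of two numbers in `[0, 1]`. Being uniform in the bump, the bound serves as
the majorant for all covariance limits. -/
theorem abs_prim_le {t s : ℝ} (hs : s ≤ τ) : |prim D τ t s| ≤ 1 := by
  have h1 := hD.tail_nonneg (t := t) hs
  have h2 := hD.tail_le_one (t := t) hs
  have h3 := hD.mom_mem hτ t
  have h4 : 0 ≤ mom D τ t / τ := div_nonneg h3.1 hτ.le
  have h5 : mom D τ t / τ ≤ 1 := (div_le_one hτ).2 h3.2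
  rw [prim, abs_le]
  constructor <;> linarith

theorem abs_covXX_le (t t' : ℝ) : |covXX D τ t t'| ≤ 2 * τ := by
  rw [covXX, abs_mul, abs_two]
  refine mul_le_mul_of_nonneg_left ?_ zero_le_two
  have := intervalIntegral.norm_integral_le_of_norm_le_const (a := 0) (b := τ) (C := 1)
    (f := fun s => prim D τ t s * prim D τ t' s) fun s hs => ?_
  · simpa [abs_of_pos hτ] using this
  · rw [Set.uIoc_of_le hτ.le] at hs
    rw [Real.norm_eq_abs, abs_mul]
    exact mul_le_one₀ (hD.abs_prim_le hτ hs.2) (abs_nonneg _) (hD.abs_prim_le hτ hs.2)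

theorem abs_covVX_le (t t' : ℝ) : |covVX D τ t t'| ≤ 2 := by
  rw [covVX, abs_mul, abs_two]
  refine (mul_le_mul_of_nonneg_left (b := |∫ s in (0 : ℝ)..τ, D (s - t) * prim D τ t' s|)
    (c := 1) ?_ zero_le_two).trans (by norm_num)
  rw [← Real.norm_eq_abs]
  calc _ ≤ ∫ s in (0 : ℝ)..τ, D (s - t) := by
        refine intervalIntegral.norm_integral_le_of_norm_le hτ.le (ae_of_all _ fun u hu => ?_)
          ((hD.continuous_sub t).intervalIntegrable _ _)
        rw [norm_mul, Real.norm_of_nonneg (hD.nonneg _), Real.norm_eq_abs]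
        exact mul_le_of_le_one_right (hD.nonneg _) (hD.abs_prim_le hτ hu.2)
    _ ≤ 1 := hD.tail_le_one (t := t) hτ.le

/-- The bump at `t` sees the primitive only within distance `r`. For separated times that primitive
is constant there, so the covariance is exact before the limit. -/
theorem covVX_of_const {t t' c : ℝ} (h : r ≤ t) (h' : t + r ≤ τ)
    (hc : ∀ s, |s - t| < r → prim D τ t' s = c) : covVX D τ t t' = 2 * c := by
  have : ∫ s in (0 : ℝ)..τ, D (s - t) * prim D τ t' s = tail D τ t 0 * c := by
    rw [tail, ← intervalIntegral.integral_mul_const]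
    refine intervalIntegral.integral_congr fun s _ => ?_
    rcases le_or_gt r |s - t| with h2 | h2
    · simp [hD.supp _ h2]
    · simp only [hc s h2]
  rw [covVX, this, hD.tail_eq_one (by linarith) h', one_mul]

theorem covVX_of_lt {t t' : ℝ} (h : r ≤ t) (h' : t + r ≤ t' - r) (h'' : t' + r ≤ τ) :
    covVX D τ t t' = 2 * (1 - mom D τ t' / τ) := by
  have hr := hD.pos
  refine hD.covVX_of_const hτ h (by linarith) fun s hs => ?_
  rw [prim, hD.tail_eq_one (by linarith [(abs_lt.1 hs).2]) h'']

theorem covVX_of_gt {t t' : ℝ} (h : r ≤ t') (h' : t' + r ≤ t - r) (h'' : t + r ≤ τ) :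
    covVX D τ t t' = 2 * (0 - mom D τ t' / τ) := by
  have hr := hD.pos
  refine hD.covVX_of_const hτ (by linarith) h'' fun s hs => ?_
  rw [prim, hD.tail_eq_zero (by linarith [(abs_lt.1 hs).1]) (by linarith)]

/-- The integrand is minus half the derivative of the squared primitive, so only the boundary values
`1 - m/τ` and `-m/τ` enter, with `m` the first moment. This gives the midpoint value of the step
function even for mollifiers that are not symmetric. -/
theorem covVX_self {t : ℝ} (h : r ≤ t) (h' : t + r ≤ τ) :
    covVX D τ t t = 1 - 2 * (mom D τ t / τ) := by
  have hP : ∀ s, HasDerivAt (fun s => prim D τ t s ^ 2) (-(2 * (D (s - t) * prim D τ t s))) s := by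
    intro s
    have h1 : HasDerivAt (prim D τ t) (-D (s - t)) s := (hD.hasDerivAt_tail t s).sub_const _
    refine (h1.pow 2).congr_deriv ?_
    simp only [Nat.cast_ofNat, Nat.add_one_sub_one, pow_one]; ring
  have hc : Continuous fun s => prim D τ t s := hD.continuous_prim.comp (Continuous.prodMk_right t)
  have := intervalIntegral.integral_eq_sub_of_hasDerivAt (a := 0) (b := τ) (fun s _ => hP s)
    ((continuous_const.mul ((hD.continuous_sub t).mul hc)).neg.intervalIntegrable _ _)
  rw [intervalIntegral.integral_neg, intervalIntegral.integral_const_mul] at this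
  have h2 : covVX D τ t t = prim D τ t 0 ^ 2 - prim D τ t τ ^ 2 := by
    rw [covVX]; linarith
  rw [h2, prim, prim, hD.tail_eq_one (by linarith) h', hD.tail_eq_zero h' h']
  ring

theorem contactK_nonneg (t t' : ℝ) : 0 ≤ contactK D τ t t' :=
  mul_nonneg zero_le_two (intervalIntegral.integral_nonneg hτ.le fun _ _ =>
    mul_nonneg (hD.nonneg _) (hD.nonneg _))

theorem contactK_eq_zero {t t' : ℝ} (h : 2 * r ≤ |t - t'|) : contactK D τ t t' = 0 := by
  rw [contactK, intervalIntegral.integral_congr (g := fun _ => 0)]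
  · simp
  · intro s _
    rcases le_or_gt r |s - t| with h2 | h2
    · simp [hD.supp _ h2]
    · rcases le_or_gt r |s - t'| with h3 | h3
      · simp [hD.supp _ h3]
      · exfalso
        have : |t - t'| ≤ |s - t'| + |s - t| := by
          calc |t - t'| = |(s - t') - (s - t)| := by congr 1; ring
            _ ≤ _ := abs_sub _ _
        linarith

/-- Fubini: the integral over `s` only meets the second bump. -/
theorem integral_contactK (t a : ℝ) : ∫ s in (0 : ℝ)..a, contactK D τ t s
    = 2 * ∫ u in (0 : ℝ)..τ, D (u - t) * ∫ v in (u - a)..u, D v := by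
  simp only [contactK]
  rw [intervalIntegral.integral_const_mul, intervalIntegral_intervalIntegral_swap]
  · congr 1
    refine intervalIntegral.integral_congr fun u _ => ?_
    rw [intervalIntegral.integral_const_mul, intervalIntegral.integral_comp_sub_left, sub_zero]
  · have hc : Continuous (Function.uncurry fun s u => D (u - t) * D (u - s)) :=
      (hD.continuous.comp (continuous_snd.sub continuous_const)).mul
        (hD.continuous.comp (continuous_snd.sub continuous_fst))
    exact (hc.continuousOn.integrableOn_compact (isCompact_uIcc.prod isCompact_uIcc)).mono_set
      (Set.prod_mono Set.uIoc_subset_uIcc Set.uIoc_subset_uIcc)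

theorem integral_contactK_le {t a : ℝ} (ha : 0 ≤ a) : ∫ s in (0 : ℝ)..a, contactK D τ t s ≤ 2 := by
  rw [hD.integral_contactK hτ]
  have : ∫ u in (0 : ℝ)..τ, D (u - t) * ∫ v in (u - a)..u, D v ≤ ∫ u in (0 : ℝ)..τ, D (u - t) := by
    have hc : Continuous fun b => ∫ u in (0 : ℝ)..b, D u :=
      intervalIntegral.continuous_primitive (fun a b => hD.intervalIntegrable a b) 0
    have hc' : Continuous fun u => ∫ v in (u - a)..u, D v := by
      have : (fun u => ∫ v in (u - a)..u, D v)
          = fun u => (∫ v in (0 : ℝ)..u, D v) - ∫ v in (0 : ℝ)..(u - a), D v := by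
        funext u
        rw [intervalIntegral.integral_interval_sub_left (hD.intervalIntegrable _ _)
          (hD.intervalIntegrable _ _)]
      rw [this]
      exact hc.sub (hc.comp (by fun_prop))
    refine intervalIntegral.integral_mono_on hτ.le
      (((hD.continuous_sub t).mul hc').intervalIntegrable _ _)
      ((hD.continuous_sub t).intervalIntegrable _ _) fun u _ =>
      mul_le_of_le_one_right (hD.nonneg _) (hD.integral_le_one (by linarith))
  have h2 := hD.tail_le_one (t := t) hτ.le
  rw [tail] at h2
  linarith

/-- On one side of its centre the kernel has mass exactly one. After Fubini the inner integral is
the tail of the same bump, and the integral of a density against its own tail is one half, as in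
`covVX_self`. No symmetry of the mollifier enters, which is why the coefficients do not depend on
it. -/
theorem integral_contactK_self {b : ℝ} (h : 2 * r ≤ b) (h' : b + r ≤ τ) :
    ∫ s in (0 : ℝ)..b, contactK D τ b s = 1 := by
  have hr := hD.pos
  rw [hD.integral_contactK hτ]
  have h1 : ∫ u in (0 : ℝ)..τ, D (u - b) * ∫ v in (u - b)..u, D v
      = ∫ u in (0 : ℝ)..τ, D (u - b) * tail D τ b u := by
    refine intervalIntegral.integral_congr fun u _ => ?_
    rcases le_or_gt r |u - b| with h2 | h2
    · simp [hD.supp _ h2]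
    · congr 1
      have h3 := abs_lt.1 h2
      rw [tail_eq, ← intervalIntegral.integral_add_adjacent_intervals
        (hD.intervalIntegrable (u - b) (τ - b)) (hD.intervalIntegrable (τ - b) u),
        hD.integral_eq_zero_of_ge (a := τ - b) (b := u) (by linarith) (by linarith), add_zero]
  rw [h1]
  have h2 := hD.covVX_self hτ (t := b) (by linarith) h'
  have h3 : covVX D τ b b = 2 * (∫ u in (0 : ℝ)..τ, D (u - b) * tail D τ b u)
      - 2 * (mom D τ b / τ) := by
    have hc : Continuous (tail D τ b) := hD.continuous_tail.comp (Continuous.prodMk_right b)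
    have h4 : ∫ u in (0 : ℝ)..τ, D (u - b) = 1 := hD.tail_eq_one (s := 0) (by linarith) h'
    rw [covVX]
    simp only [prim, mul_sub]
    rw [intervalIntegral.integral_sub, intervalIntegral.integral_mul_const, h4]
    · ring
    · exact ((hD.continuous_sub b).mul hc).intervalIntegrable _ _
    · exact ((hD.continuous_sub b).mul continuous_const).intervalIntegrable _ _
  linarith

end IsBump

theorem eventually_mul_lt {R δ : ℝ} (hδ : 0 < δ) : ∀ᶠ ε in 𝓝[>] (0 : ℝ), R * ε < δ := by
  have : Tendsto (fun ε : ℝ => R * ε) (𝓝[>] 0) (𝓝 (R * 0)) :=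
    ((continuous_const.mul continuous_id).tendsto 0).mono_left nhdsWithin_le_nhds
  rw [mul_zero] at this
  exact this.eventually (gt_mem_nhds hδ)

/-! ### Limits of the covariances as the bumps shrink. -/

section Family

variable {D : ℝ → ℝ → ℝ} {R τ : ℝ} (hD : ∀ ε > 0, IsBump (D ε) (R * ε)) (hτ : 0 < τ)

include hD hτ

theorem contactKernel_contactK : ContactKernel τ fun ε => contactK (D ε) τ := by
  refine ⟨fun ε hε => (hD ε hε).continuous_contactK, fun ε hε => (hD ε hε).contactK_nonneg hτ,
    fun ε hε t a ha => (hD ε hε).integral_contactK_le hτ ha.1, fun δ hδ => ?_, fun b hb => ?_⟩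
  · filter_upwards [eventually_mul_lt (R := R) (half_pos hδ), self_mem_nhdsWithin] with ε h1 hε t s h
    exact (hD ε hε).contactK_eq_zero hτ (by linarith)
  · refine tendsto_const_nhds.congr' ?_
    have h1 := eventually_mul_lt (R := R) (δ := min (b / 4) ((τ - b) / 2))
      (lt_min (by linarith [hb.1]) (by linarith [hb.2]))
    have h2 : ∀ᶠ s in 𝓝 b, s ∈ Set.Ioo (b / 2) ((b + τ) / 2) :=
      Ioo_mem_nhds (by linarith [hb.1]) (by linarith [hb.2])
    filter_upwards [(h1.and self_mem_nhdsWithin).prod_mk h2] with p ⟨⟨h3, h4⟩, h5⟩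
    rw [lt_min_iff] at h3
    exact ((hD p.1 h4).integral_contactK_self hτ (by linarith [h5.1]) (by linarith [h5.2])).symm

variable {ι : Type} {l : Filter ι} {ε t t' : ι → ℝ} {t₀ t₀' : ℝ}
  (hε : Tendsto ε l (𝓝[>] 0)) (ht : Tendsto t l (𝓝 t₀)) (ht' : Tendsto t' l (𝓝 t₀'))
  (h₀ : t₀ ∈ Set.Ioo 0 τ) (h₀' : t₀' ∈ Set.Ioo 0 τ)

omit hD hτ in
include hε ht h₀ in
theorem eventually_margin : ∀ᶠ i in l, 0 < ε i ∧ R * ε i ≤ t i ∧ t i + R * ε i ≤ τ := by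
  have h1 := hε.eventually (eventually_mul_lt (R := R) (δ := min (t₀ / 2) ((τ - t₀) / 2))
      (lt_min (by linarith [h₀.1]) (by linarith [h₀.2])))
  have h2 : ∀ᶠ i in l, t i ∈ Set.Ioo (t₀ / 2) ((t₀ + τ) / 2) :=
    ht.eventually (Ioo_mem_nhds (by linarith [h₀.1]) (by linarith [h₀.2]))
  filter_upwards [h1, h2, hε.eventually self_mem_nhdsWithin] with i h3 h4 h5
  rw [lt_min_iff] at h3
  exact ⟨h5, by linarith [h4.1], by linarith [h4.2]⟩

include hε ht h₀

theorem tendsto_tail_zero : Tendsto (fun i => tail (D (ε i)) τ (t i) 0) l (𝓝 1) := by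
  refine tendsto_const_nhds.congr' ?_
  filter_upwards [eventually_margin (R := R) hε ht h₀] with i hi
  exact ((hD _ hi.1).tail_eq_one (by linarith) hi.2.2).symm

theorem tendsto_mom : Tendsto (fun i => mom (D (ε i)) τ (t i)) l (𝓝 t₀) := by
  have h : Tendsto (fun i => mom (D (ε i)) τ (t i) - t i) l (𝓝 0) := by
    have h1 : Tendsto (fun i => R * ε i) l (𝓝 0) := by
      have := (tendsto_nhds_of_tendsto_nhdsWithin hε).const_mul R
      rwa [mul_zero] at this
    refine squeeze_zero_norm' ?_ h1
    filter_upwards [eventually_margin (R := R) hε ht h₀] with i hi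
    exact (hD _ hi.1).abs_mom_sub_le hτ hi.2.1 hi.2.2
  simpa using h.add ht

/-- For a small bump the tail is exactly the step function at every `s ≠ t₀`, and the moment tends
to `t₀`. -/
theorem tendsto_prim {s : ℝ} (hs : s ≠ t₀) :
    Tendsto (fun i => prim (D (ε i)) τ (t i) s) l (𝓝 ((if s < t₀ then 1 else 0) - t₀ / τ)) := by
  refine Tendsto.sub ?_ ((tendsto_mom hD hτ hε ht h₀).div_const τ)
  refine tendsto_const_nhds.congr' ?_
  have hd : 0 < |s - t₀| / 2 := half_pos (abs_pos.2 (sub_ne_zero.2 hs))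
  filter_upwards [eventually_margin (R := R) hε ht h₀, hε.eventually (eventually_mul_lt (R := R) hd),
    Metric.tendsto_nhds.1 ht _ hd] with i hi h2 h3
  rw [Real.dist_eq] at h3
  have h3' := abs_lt.1 h3
  split_ifs with h
  · rw [abs_of_neg (a := s - t₀) (by linarith)] at *
    exact ((hD _ hi.1).tail_eq_one (by linarith) hi.2.2).symm
  · have : t₀ < s := lt_of_le_of_ne (not_lt.1 h) hs.symm
    rw [abs_of_pos (a := s - t₀) (by linarith)] at *
    exact ((hD _ hi.1).tail_eq_zero (by linarith) hi.2.2).symm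

theorem tendsto_covVX_self : Tendsto (fun i => covVX (D (ε i)) τ (t i) (t i)) l
    (𝓝 (1 - 2 * (t₀ / τ))) := by
  refine Tendsto.congr' ?_
    ((((tendsto_mom hD hτ hε ht h₀).div_const τ).const_mul 2).const_sub 1)
  filter_upwards [eventually_margin (R := R) hε ht h₀] with i hi
  exact ((hD _ hi.1).covVX_self hτ hi.2.1 hi.2.2).symm

include ht' h₀'

theorem tendsto_covVX (h : t₀ ≠ t₀') : Tendsto (fun i => covVX (D (ε i)) τ (t i) (t' i)) l
    (𝓝 (2 * ((if t₀ < t₀' then 1 else 0) - t₀' / τ))) := by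
  refine Tendsto.congr' ?_
    ((((tendsto_mom hD hτ hε ht' h₀').div_const τ).const_sub _).const_mul 2)
  have hd : 0 < |t₀ - t₀'| / 4 := by
    have := abs_pos.2 (sub_ne_zero.2 h); linarith
  filter_upwards [eventually_margin (R := R) hε ht h₀, eventually_margin (R := R) hε ht' h₀',
    hε.eventually (eventually_mul_lt (R := R) hd), Metric.tendsto_nhds.1 ht _ hd,
    Metric.tendsto_nhds.1 ht' _ hd] with i hi hi' h2 h3 h4
  rw [Real.dist_eq] at h3 h4
  have h3' := abs_lt.1 h3
  have h4' := abs_lt.1 h4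
  split_ifs with hlt
  · rw [abs_of_neg (a := t₀ - t₀') (by linarith)] at *
    exact ((hD _ hi.1).covVX_of_lt hτ hi.2.1 (by linarith) hi'.2.2).symm
  · have : t₀' < t₀ := lt_of_le_of_ne (not_lt.1 hlt) h.symm
    rw [abs_of_pos (a := t₀ - t₀') (by linarith)] at *
    exact ((hD _ hi.1).covVX_of_gt hτ hi'.2.1 (by linarith) hi.2.2).symm

theorem tendsto_covXX [l.IsCountablyGenerated] :
    Tendsto (fun i => covXX (D (ε i)) τ (t i) (t' i)) l
    (𝓝 (2 * min t₀ t₀' - 2 * t₀ * t₀' / τ)) := by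
  have hlim : ∫ s in (0 : ℝ)..τ, ((if s < t₀ then 1 else 0) - t₀ / τ)
      * ((if s < t₀' then 1 else 0) - t₀' / τ) = min t₀ t₀' - t₀ * t₀' / τ := by
    have hind : ∀ c ∈ Set.Ioo 0 τ, IntervalIntegrable (fun s => if s < c then (1 : ℝ) else 0) volume 0 τ
        ∧ ∫ s in (0 : ℝ)..τ, (if s < c then (1 : ℝ) else 0) = c := by
      intro c hc
      have hi : ∀ a b, IntervalIntegrable (fun s => if s < c then (1 : ℝ) else 0) volume a b := by
        intro a b
        refine AntitoneOn.intervalIntegrable fun x _ y _ hxy => ?_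
        split_ifs <;> linarith
      refine ⟨hi _ _, ?_⟩
      rw [← intervalIntegral.integral_add_adjacent_intervals (hi 0 c) (hi c τ),
        intervalIntegral.integral_congr_ae (g := fun _ => 1),
        intervalIntegral.integral_congr (a := c) (g := fun _ => 0)]
      · simp
      · intro s hs
        rw [Set.uIcc_of_le hc.2.le] at hs
        simp [hs.1]
      · have : ∀ᵐ s : ℝ, s ≠ c := by simp [ae_iff, measure_singleton]
        filter_upwards [this] with s hs hs'
        rw [Set.uIoc_of_le hc.1.le] at hs'
        simp [lt_of_le_of_ne hs'.2 hs]
    have hm : min t₀ t₀' ∈ Set.Ioo 0 τ := ⟨lt_min h₀.1 h₀'.1, (min_le_left _ _).trans_lt h₀.2⟩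
    -- The product of two step functions is the step function at the minimum; this is the source of
    -- `min` in the bridge covariance.
    have : ∀ s, ((if s < t₀ then (1 : ℝ) else 0) - t₀ / τ) * ((if s < t₀' then 1 else 0) - t₀' / τ)
        = (((if s < min t₀ t₀' then 1 else 0) - (t₀' / τ) * (if s < t₀ then 1 else 0))
          - (t₀ / τ) * (if s < t₀' then 1 else 0)) + t₀ / τ * (t₀' / τ) := by
      intro s
      simp only [lt_min_iff]
      split_ifs <;> first | tauto | ring
    simp_rw [this]
    have i1 := (hind _ hm).1
    have i2 := (hind _ h₀).1.const_mul (t₀' / τ)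
    have i3 := (hind _ h₀').1.const_mul (t₀ / τ)
    rw [intervalIntegral.integral_add ((i1.sub i2).sub i3) (by simp),
      intervalIntegral.integral_sub (i1.sub i2) i3, intervalIntegral.integral_sub i1 i2,
      intervalIntegral.integral_const_mul, intervalIntegral.integral_const_mul,
      (hind _ hm).2, (hind _ h₀).2, (hind _ h₀').2]
    simp only [intervalIntegral.integral_const, sub_zero, smul_eq_mul]
    field_simp
    ring
  have hmain : Tendsto (fun i => ∫ s in (0 : ℝ)..τ, prim (D (ε i)) τ (t i) s * prim (D (ε i)) τ (t' i) s)
      l (𝓝 (min t₀ t₀' - t₀ * t₀' / τ)) := by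
    rw [← hlim]
    refine intervalIntegral.tendsto_integral_filter_of_dominated_convergence (fun _ => 1) ?_ ?_
      (by simp) ?_
    · filter_upwards [hε.eventually self_mem_nhdsWithin] with i hi
      have hc := (hD _ hi).continuous_prim (τ := τ)
      exact ((hc.comp (Continuous.prodMk_right _)).mul
        (hc.comp (Continuous.prodMk_right _))).aestronglyMeasurable
    · filter_upwards [hε.eventually self_mem_nhdsWithin] with i hi
      refine ae_of_all _ fun s hs => ?_
      rw [Set.uIoc_of_le hτ.le] at hs
      rw [Real.norm_eq_abs, abs_mul]
      exact mul_le_one₀ ((hD _ hi).abs_prim_le hτ hs.2) (abs_nonneg _)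
        ((hD _ hi).abs_prim_le hτ hs.2)
    · have h1 : ∀ᵐ s : ℝ, s ≠ t₀ := by simp [ae_iff, measure_singleton]
      have h2 : ∀ᵐ s : ℝ, s ≠ t₀' := by simp [ae_iff, measure_singleton]
      filter_upwards [h1, h2] with s hs hs' _
      exact (tendsto_prim hD hτ hε ht h₀ hs).mul (tendsto_prim hD hτ hε ht' h₀' hs')
  have h2 : 2 * min t₀ t₀' - 2 * t₀ * t₀' / τ = 2 * (min t₀ t₀' - t₀ * t₀' / τ) := by
    rw [mul_sub, mul_assoc, mul_div_assoc]
  rw [h2]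
  exact hmain.const_mul 2

end Family

/-! ### The regularised contractions -/

section ContOp

variable {X : Type} [TopologicalSpace X]

/-- Continuous families of formal derivatives. -/
def ContOp (p : X → DOp d) : Prop :=
  ∀ 𝒴 : X → (ℕ → Vert d 𝔸) → 𝔸, (∀ G, Continuous fun q => 𝒴 q G) →
    ∀ G, Continuous fun q => act (p q) (𝒴 q) G

theorem contOp_X (a : ℕ × (Fin d ⊕ Fin d)) :
    ContOp (𝔸 := 𝔸) fun _ : X => (MvPolynomial.X a : DOp d) := by
  intro 𝒴 h G
  simp only [act_X]
  exact h _

theorem ContOp.mul {p p' : X → DOp d} (h : ContOp (𝔸 := 𝔸) p)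
    (h' : ContOp (𝔸 := 𝔸) p') : ContOp (𝔸 := 𝔸) fun s => p s * p' s := by
  intro 𝒴 h𝒴 G
  simp only [act_mul]
  exact h (fun s => act (p' s) (𝒴 s)) (h' 𝒴 h𝒴) G

theorem ContOp.add {p p' : X → DOp d} (h : ContOp (𝔸 := 𝔸) p)
    (h' : ContOp (𝔸 := 𝔸) p') : ContOp (𝔸 := 𝔸) fun s => p s + p' s := by
  intro 𝒴 h𝒴 G
  simp only [act_add]
  exact (h 𝒴 h𝒴 G).add (h' 𝒴 h𝒴 G)

theorem ContOp.smul {p : X → DOp d} {c : X → ℝ} (hc : Continuous c)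
    (h : ContOp (𝔸 := 𝔸) p) : ContOp (𝔸 := 𝔸) fun s => c s • p s := by
  intro 𝒴 h𝒴 G
  simp only [act_smul]
  exact hc.smul (h 𝒴 h𝒴 G)

theorem ContOp.sum {ι : Type} (S : Finset ι) {p : ι → X → DOp d}
    (h : ∀ i, ContOp (𝔸 := 𝔸) (p i)) : ContOp (𝔸 := 𝔸) fun s => ∑ i ∈ S, p i s := by
  intro 𝒴 h𝒴 G
  simp only [act_sum, Finset.sum_apply]
  exact continuous_finsetSum _ fun i _ => h i 𝒴 h𝒴 G

theorem ContOp.pow {p : X → DOp d} (h : ContOp (𝔸 := 𝔸) p) (j : ℕ) :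
    ContOp (𝔸 := 𝔸) fun s => p s ^ j := by
  induction j with
  | zero =>
    intro 𝒴 h𝒴 G
    simp only [pow_zero, act_one]
    exact h𝒴 G
  | succ j ih => simp only [pow_succ]; exact ih.mul h

theorem contOp_quad {n : ℕ} (k : ℕ) {A B C : X → Fin n → Fin n → ℝ} (hA : Continuous A)
    (hB : Continuous B) (hC : Continuous C) :
    ContOp (𝔸 := 𝔸) fun q => quad (d := d) k n (A q) (B q) (C q) := by
  have hX : ∀ a b, ContOp (𝔸 := 𝔸) fun _ : X =>
      (MvPolynomial.X a * MvPolynomial.X b : DOp d) := fun a b =>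
    (contOp_X a).mul (contOp_X b)
  have he : ∀ {A : X → Fin n → Fin n → ℝ}, Continuous A → ∀ i l, Continuous fun q => A q i l :=
    fun hA i l => (continuous_apply l).comp ((continuous_apply i).comp hA)
  unfold quad xx wx ww
  exact ContOp.sum _ fun i => ContOp.sum _ fun l =>
    ((ContOp.smul ((he hA i l).div_const 2) (ContOp.sum _ fun _ => hX _ _)).add
    (ContOp.smul (he hB i l) (ContOp.sum _ fun _ => hX _ _))).add
    (ContOp.smul ((he hC i l).div_const 2) (ContOp.sum _ fun _ => hX _ _))

end ContOp

/-- The product of the vertices at the point `ξ`. -/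
def prodAt (τ : ℝ) (ξ : Sp d) (n : ℕ) (t : Fin n → ℝ) (G : ℕ → Vert d 𝔸) : 𝔸 :=
  (prodV τ 0 n t G).1 ξ

theorem prodAt_vanish (τ : ℝ) (ξ : Sp d) (n : ℕ) (t : Fin n → ℝ) {i : ℕ} (hi : i < n) :
    Vanish i (prodAt (𝔸 := 𝔸) τ ξ n t) := fun G hG => by
  rw [prodAt, prodV_vanish τ 0 n t (Nat.zero_le i) (by omega) G hG]; rfl

theorem continuous_prodAt (τ : ℝ) (ξ : Sp d) (n : ℕ) (G : ℕ → Vert d 𝔸) :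
    Continuous fun t : Fin n → ℝ => prodAt τ ξ n t G :=
  (contDiff_prodV τ 0 G).continuous.comp (Continuous.prodMk_right ξ)

theorem act_prodAt (τ : ℝ) (ξ : Sp d) (n : ℕ) (t : Fin n → ℝ) (p : DOp d) (G : ℕ → Vert d 𝔸) :
    act p (prodAt τ ξ n t) G = (act p (prodV τ 0 n t) G).1 ξ :=
  congrFun (act_post (Sm.ev ξ) p (prodV τ 0 n t)) G

/-- Continuity in the arrays of covariances as independent variables. It yields at once continuity
in the times, bounds by compactness, and the limit from limits of the covariances. -/
theorem continuous_act_quad (τ : ℝ) (ξ : Sp d) (n j : ℕ) (G : ℕ → Vert d 𝔸) :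
    Continuous fun q : ((Fin n → Fin n → ℝ) × (Fin n → Fin n → ℝ) × (Fin n → Fin n → ℝ)) ×
      (Fin n → ℝ) => act (dp j (quad 0 n q.1.1 q.1.2.1 q.1.2.2)) (prodAt τ ξ n q.2) G :=
  (ContOp.smul continuous_const ((contOp_quad 0 continuous_fst.fst continuous_fst.snd.fst
    continuous_fst.snd.snd).pow j)) (fun q => prodAt τ ξ n q.2)
    (fun G => (continuous_prodAt τ ξ n G).comp continuous_snd) G

theorem exists_dp_add_mul {A : Type} [CommRing A] [Algebra ℝ A] (j : ℕ) (a b : A) :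
    ∃ c, dp j (a + b) = dp j a + b * c := by
  obtain ⟨c, hc⟩ := sub_dvd_pow_sub_pow (a + b) a j
  refine ⟨((j ! : ℕ) : ℝ)⁻¹ • c, ?_⟩
  rw [add_sub_cancel_left] at hc
  rw [dp, dp, mul_smul_comm, ← hc, smul_sub, add_sub_cancel]

/-- Contractions of the velocity of a velocity-free vertex do not contribute. -/
theorem act_dp_quad_congr {n j : ℕ} {X Y Y' Z : Fin n → Fin n → ℝ} {Φ : (ℕ → Vert d 𝔸) → 𝔸}
    (hΦ : ∀ i < n, Vanish i Φ) {G : ℕ → Vert d 𝔸}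
    (h : ∀ i l, Y' i l = Y i l ∨ (G i).1 = 0) :
    act (dp j (quad 0 n X Y' Z)) Φ G = act (dp j (quad 0 n X Y Z)) Φ G := by
  have e : quad (d := d) 0 n X Y' Z = quad 0 n X Y Z +
      ∑ i : Fin n, ∑ l : Fin n, (Y' i l - Y i l) • wx (0 + i) (0 + l) := by
    simp only [quad, ← Finset.sum_add_distrib]
    refine Finset.sum_congr rfl fun i _ => Finset.sum_congr rfl fun l _ => ?_
    module
  obtain ⟨c, hc⟩ := exists_dp_add_mul j (quad (d := d) 0 n X Y Z)
    (∑ i : Fin n, ∑ l : Fin n, (Y' i l - Y i l) • wx (0 + i) (0 + l))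
  rw [e, hc, act_add, Pi.add_apply, add_eq_left]
  simp only [Finset.sum_mul, act_sum, Finset.sum_apply, smul_mul_assoc, act_smul, Pi.smul_apply, wx,
    mul_assoc]
  refine Finset.sum_eq_zero fun i _ => Finset.sum_eq_zero fun l _ => ?_
  rcases h i l with h | h
  · rw [h, sub_self, zero_smul]
  · rw [Finset.sum_eq_zero, smul_zero]
    intro α _
    exact act_w_of_fst_eq_zero (hΦ _ (by simp)) α _ (by simpa using h)

/-- The regularised contractions without the contact terms. -/
def regQuad (D : ℝ → ℝ) (τ : ℝ) (n : ℕ) (t : Fin n → ℝ) : DOp d :=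
  quad 0 n (fun i l => covXX D τ (t i) (t l)) (fun i l => covVX D τ (t i) (t l))
    fun i l => -2 / τ * (tail D τ (t i) 0 * tail D τ (t l) 0)

/-- All regularised contractions. -/
def fullQuad (D : ℝ → ℝ) (τ : ℝ) (n : ℕ) (t : Fin n → ℝ) : DOp d :=
  quad 0 n (fun i l => covXX D τ (t i) (t l)) (fun i l => covVX D τ (t i) (t l))
    fun i l => contactK D τ (t i) (t l) - 2 / τ * (tail D τ (t i) 0 * tail D τ (t l) 0)

theorem contactK_comm (D : ℝ → ℝ) (τ t t' : ℝ) : contactK D τ t t' = contactK D τ t' t := by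
  simp only [contactK, mul_comm]

theorem sum_sum_eq_diag_add {M : Type} [AddCommMonoid M] {n : ℕ} (a : Fin n → Fin n → M) :
    ∑ i, ∑ l, a i l = ∑ i, a i i + ∑ i, ∑ l, if i < l then a i l + a l i else 0 := by
  have h : ∀ i l : Fin n, a i l = (if i = l then a i l else 0) + ((if i < l then a i l else 0)
      + if l < i then a i l else 0) := by
    intro i l
    rcases lt_trichotomy i l with h | h | h
    · simp [h, h.ne, h.not_gt]
    · simp [h]
    · simp [h, h.ne', h.not_gt]
  have h2 : ∑ i : Fin n, ∑ l : Fin n, (if l < i then a i l else 0)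
      = ∑ i : Fin n, ∑ l : Fin n, (if i < l then a l i else 0) :=
    Finset.sum_comm (f := fun i l => if l < i then a i l else 0)
  calc ∑ i, ∑ l, a i l = ∑ i, ∑ l, ((if i = l then a i l else 0) + ((if i < l then a i l else 0)
      + if l < i then a i l else 0)) :=
        Finset.sum_congr rfl fun i _ => Finset.sum_congr rfl fun l _ => h i l
    _ = _ := by
        simp only [Finset.sum_add_distrib, h2, Finset.sum_ite_eq, Finset.mem_univ, if_true]
        simp only [← Finset.sum_add_distrib, ite_add_ite, add_zero]

/-- The velocity covariance splits into the contact kernel and a regular part. By symmetry, the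
off-diagonal kernel terms combine to one term for each pair `i < l`. -/
theorem fullQuad_eq (D : ℝ → ℝ) (τ : ℝ) (n : ℕ) (t : Fin n → ℝ) :
    fullQuad (d := d) D τ n t = singQuad (contactK D τ) n t + regQuad D τ n t +
      ∑ i : Fin n, (contactK D τ (t i) (t i) / 2) • ww i i := by
  have e : fullQuad (d := d) D τ n t = regQuad D τ n t +
      ∑ i : Fin n, ∑ l : Fin n, (contactK D τ (t i) (t l) / 2) • ww i l := by
    simp only [fullQuad, regQuad, quad, ← Finset.sum_add_distrib, zero_add]
    refine Finset.sum_congr rfl fun i _ => Finset.sum_congr rfl fun l _ => ?_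
    module
  have e2 : ∑ i : Fin n, ∑ l : Fin n, (if i < l then (contactK D τ (t i) (t l) / 2) • ww (d := d) i l
      + (contactK D τ (t l) (t i) / 2) • ww l i else 0) = singQuad (contactK D τ) n t := by
    refine Finset.sum_congr rfl fun i _ => Finset.sum_congr rfl fun l _ => ?_
    rw [contactK_comm D τ (t l), ww_comm l.val]
    split_ifs
    · rw [← add_smul, add_halves]
    · rfl
  rw [e, sum_sum_eq_diag_add, e2]
  abel

/-- The diagonal of the contact kernel contracts a vertex with itself through two velocities and
therefore does not act. The remaining sum is expanded by the number `r` of singular contractions. -/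
theorem act_dp_fullQuad (D : ℝ → ℝ) (τ : ℝ) (n j : ℕ) (t : Fin n → ℝ)
    {Φ : (ℕ → Vert d 𝔸) → 𝔸} (hΦ : ∀ i < n, Vanish i Φ) (G : ℕ → Vert d 𝔸) :
    act (dp j (fullQuad D τ n t)) Φ G = ∑ r ∈ Finset.range (j + 1),
      act (dp r (singQuad (contactK D τ) n t)) (act (dp (j - r) (regQuad D τ n t)) Φ) G := by
  obtain ⟨c, hc⟩ := exists_dp_add_mul j (singQuad (d := d) (contactK D τ) n t + regQuad D τ n t)
    (∑ i : Fin n, (contactK D τ (t i) (t i) / 2) • ww i i)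
  rw [fullQuad_eq, hc, act_add, Pi.add_apply]
  have : act ((∑ i : Fin n, (contactK D τ (t i) (t i) / 2) • ww (d := d) i i) * c) Φ = 0 := by
    simp only [Finset.sum_mul, act_sum, smul_mul_assoc, act_smul, ww]
    refine Finset.sum_eq_zero fun i _ => ?_
    rw [Finset.sum_eq_zero fun α _ => act_w_mul_w (hΦ i i.2) α α c, smul_zero]
  rw [this, Pi.zero_apply, add_zero, dp_add, act_sum, Finset.sum_apply]
  simp only [act_mul]

/-- The regularised integrand, by the number of contact terms. -/
def regFam (D : ℝ → ℝ) (τ : ℝ) (ξ : Sp d) (n j r : ℕ) (t : Fin n → ℝ) (G : ℕ → Vert d 𝔸) : 𝔸 :=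
  if r ≤ j then act (dp (j - r) (regQuad D τ n t)) (prodAt τ ξ n t) G else 0

theorem vanish_regFam (D : ℝ → ℝ) (τ : ℝ) (ξ : Sp d) (n j r : ℕ) (t : Fin n → ℝ) {i : ℕ}
    (hi : i < n) : Vanish i (regFam (𝔸 := 𝔸) D τ ξ n j r t) := by
  intro G hG
  rw [regFam]
  split_ifs
  · exact (prodAt_vanish τ ξ n t hi).act _ G hG
  · rfl

theorem vanish_wickFam (τ : ℝ) (ξ : Sp d) (n j r : ℕ) (t : Fin n → ℝ) {i : ℕ}
    (hi : i < n) : Vanish i fun G : ℕ → Vert d 𝔸 => (wickFam τ 0 n j r t G).1 ξ := by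
  intro G hG
  change (wickFam τ 0 n j r t G).1 ξ = 0
  rw [wickFam]
  split_ifs
  · rw [wick, (prodV_vanish τ 0 n t (Nat.zero_le i) (by omega)).act _ G hG]; rfl
  · rfl

theorem contDiff_wickFam_right [CompleteSpace 𝔸] (τ : ℝ) (ξ : Sp d) (n j r : ℕ)
    (G : ℕ → Vert d 𝔸) : ContDiff ℝ ∞ fun t : Fin n → ℝ => (wickFam τ 0 n j r t G).1 ξ :=
  (contDiff_wickFam τ 0 n j r G).comp (f := fun t : Fin n → ℝ => (ξ, t))
    (contDiff_const.prodMk contDiff_id)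

section

variable {D : ℝ → ℝ → ℝ} {R τ : ℝ} (hD : ∀ ε > 0, IsBump (D ε) (R * ε)) (hτ : 0 < τ)

include hD hτ

theorem GoodTimes.tendsto_covVX {n : ℕ} {t : Fin n → ℝ} {G : ℕ → Vert d 𝔸} (ht : GoodTimes τ t G)
    (i l : Fin n) (h : i = l ∨ t i ≠ t l) :
    Tendsto (fun p : ℝ × (Fin n → ℝ) => covVX (D p.1) τ (p.2 i) (p.2 l)) (𝓝[>] 0 ×ˢ 𝓝 t)
      (𝓝 (limY τ t i l)) := by
  have hs : ∀ i, Tendsto (fun p : ℝ × (Fin n → ℝ) => p.2 i) (𝓝[>] 0 ×ˢ 𝓝 t) (𝓝 (t i)) :=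
    fun i => ((continuous_apply i).tendsto t).comp tendsto_snd
  rcases eq_or_ne i l with rfl | hil
  · have := tendsto_covVX_self hD hτ tendsto_fst (hs i) (ht.1 i)
    convert this using 2
    simp [limY]; ring
  · have htl : t i ≠ t l := by tauto
    have := HeatExp.tendsto_covVX hD hτ tendsto_fst (hs i) (hs l) (ht.1 i) (ht.1 l) htl
    convert this using 2
    rw [limY, if_neg hil]
    rcases lt_or_gt_of_ne hil with h1 | h1
    -- Larger indices belong to smaller times, so the step in the times becomes the step in the
    -- indices in `limY`.
    · have : t l < t i := (ht.2 i l h1).resolve_right fun h2 => htl h2.1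
      rw [if_neg h1.not_gt, if_neg this.not_gt]; ring
    · have : t i < t l := (ht.2 l i h1).resolve_right fun h2 => htl h2.1.symm
      rw [if_pos h1, if_pos this]; ring

theorem GoodTimes.tendsto_covXX {n : ℕ} {t : Fin n → ℝ} {G : ℕ → Vert d 𝔸} (ht : GoodTimes τ t G)
    (i l : Fin n) :
    Tendsto (fun p : ℝ × (Fin n → ℝ) => covXX (D p.1) τ (p.2 i) (p.2 l)) (𝓝[>] 0 ×ˢ 𝓝 t)
      (𝓝 (limX τ t i l)) := by
  have hs : ∀ i, Tendsto (fun p : ℝ × (Fin n → ℝ) => p.2 i) (𝓝[>] 0 ×ˢ 𝓝 t) (𝓝 (t i)) :=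
    fun i => ((continuous_apply i).tendsto t).comp tendsto_snd
  have hm : t (max i l) = min (t i) (t l) := by
    have ha : ∀ i l : Fin n, i < l → t l ≤ t i := fun i l h =>
      (ht.2 i l h).elim le_of_lt fun h => h.1.ge
    rcases lt_trichotomy i l with h | h | h
    · rw [max_eq_right h.le, min_eq_right (ha i l h)]
    · simp [h]
    · rw [max_eq_left h.le, min_eq_left (ha l i h)]
  rw [limX, hm]
  exact HeatExp.tendsto_covXX hD hτ tendsto_fst (hs i) (hs l) (ht.1 i) (ht.1 l)

theorem continuous_regFam (ξ : Sp d) (n j : ℕ) {ε : ℝ} (hε : 0 < ε) (r : ℕ) (G : ℕ → Vert d 𝔸) :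
    Continuous fun t => regFam (D ε) τ ξ n j r t G := by
  have hB := hD ε hε
  simp only [regFam]
  split_ifs
  · refine (continuous_act_quad τ ξ n (j - r) G).comp (f := fun t : Fin n → ℝ =>
      ((fun i l => covXX (D ε) τ (t i) (t l), fun i l => covVX (D ε) τ (t i) (t l),
      fun i l => -2 / τ * (tail (D ε) τ (t i) 0 * tail (D ε) τ (t l) 0)), t)) ?_
    have h2 : ∀ i l : Fin n, Continuous fun t : Fin n → ℝ => (t i, t l) := fun i l => by fun_prop
    have h3 : ∀ i : Fin n, Continuous fun t : Fin n → ℝ => tail (D ε) τ (t i) 0 := fun i =>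
      hB.continuous_tail.comp (f := fun t : Fin n → ℝ => (t i, 0))
        ((continuous_apply i).prodMk continuous_const)
    refine ((continuous_pi fun i => continuous_pi fun l => hB.continuous_covXX.comp (h2 i l)).prodMk
      ((continuous_pi fun i => continuous_pi fun l => hB.continuous_covVX.comp (h2 i l)).prodMk
      (continuous_pi fun i => continuous_pi fun l =>
        continuous_const.mul ((h3 i).mul (h3 l))))).prodMk continuous_id
  · exact continuous_const

theorem bdd_regFam (ξ : Sp d) (n j r : ℕ) (G : ℕ → Vert d 𝔸) :
    ∃ C, ∀ᶠ ε in 𝓝[>] (0 : ℝ), ∀ t, (∀ i, t i ∈ Set.Icc 0 τ) → ‖regFam (D ε) τ ξ n j r t G‖ ≤ C := by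
  let box : ℝ → Set (Fin n → Fin n → ℝ) := fun c =>
    Set.univ.pi fun _ => Set.univ.pi fun _ => Set.Icc (-c) c
  have hbox : ∀ c, IsCompact (box c) := fun c =>
    isCompact_univ_pi fun _ => isCompact_univ_pi fun _ => isCompact_Icc
  -- The three boxes are the uniform bounds on the covariances of positions, of velocity with
  -- position, and of the regular part for velocities.
  have hK : IsCompact ((box (2 * τ) ×ˢ box 2 ×ˢ box (2 / τ)) ×ˢ
      (Set.univ.pi fun _ : Fin n => Set.Icc 0 τ)) :=
    ((hbox _).prod ((hbox _).prod (hbox _))).prod (isCompact_univ_pi fun _ => isCompact_Icc)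
  obtain ⟨C, hC⟩ := hK.exists_bound_of_continuousOn
    (continuous_act_quad τ ξ n (j - r) G).continuousOn
  refine ⟨C, ?_⟩
  have hC0 : 0 ≤ C := by
    refine (norm_nonneg _).trans (hC ((0, 0, 0), 0) ?_)
    have hb0 : ∀ c, 0 ≤ c → (0 : Fin n → Fin n → ℝ) ∈ box c := fun c hc i _ l _ => by
      simpa using hc
    exact ⟨⟨hb0 _ (by positivity), hb0 _ (by norm_num), hb0 _ (by positivity)⟩,
      fun i _ => ⟨le_rfl, hτ.le⟩⟩
  filter_upwards [self_mem_nhdsWithin] with ε hε t ht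
  have hB := hD ε hε
  simp only [regFam]
  split_ifs
  · refine hC ((fun i l => covXX (D ε) τ (t i) (t l), fun i l => covVX (D ε) τ (t i) (t l),
      fun i l => -2 / τ * (tail (D ε) τ (t i) 0 * tail (D ε) τ (t l) 0)), t)
      ⟨⟨?_, ?_, ?_⟩, fun i _ => ht i⟩
    · exact fun i _ l _ => abs_le.1 (hB.abs_covXX_le hτ _ _)
    · exact fun i _ l _ => abs_le.1 (hB.abs_covVX_le hτ _ _)
    · intro i _ l _
      refine abs_le.1 ?_
      have h0 := fun t => hB.tail_nonneg (τ := τ) (t := t) hτ.le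
      have h1 := fun t => hB.tail_le_one (τ := τ) (t := t) hτ.le
      rw [abs_mul, abs_div, abs_neg, abs_two, abs_of_pos hτ, abs_of_nonneg (mul_nonneg (h0 _) (h0 _))]
      exact mul_le_of_le_one_right (by positivity) (mul_le_one₀ (h1 _) (h0 _) (h1 _))
  · simpa using hC0

theorem tendsto_regFam (ξ : Sp d) (n j r : ℕ) (t : Fin n → ℝ) (G : ℕ → Vert d 𝔸)
    (ht : GoodTimes τ t G) : Tendsto (fun p : ℝ × (Fin n → ℝ) => regFam (D p.1) τ ξ n j r p.2 G)
      (𝓝[>] 0 ×ˢ 𝓝 t) (𝓝 ((wickFam τ 0 n j r t G).1 ξ)) := by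
  simp only [regFam, wickFam]
  split_ifs
  · have hw : (wick τ 0 n t (j - r) G).1 ξ
        = act (dp (j - r) (quad 0 n (limX τ t) (limY τ t) fun _ _ => -2 / τ)) (prodAt τ ξ n t) G := by
      rw [act_prodAt]; rfl
    rw [hw]
    -- For two different slots at coinciding times the velocity-position covariance need not have a
    -- limit. Both vertices are then velocity-free, so its value may be replaced by the expected one
    -- without changing the functional.
    let Y' : ℝ × (Fin n → ℝ) → Fin n → Fin n → ℝ := fun p i l =>
      if i = l ∨ t i ≠ t l then covVX (D p.1) τ (p.2 i) (p.2 l) else limY τ t i l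
    have hG : ∀ p : ℝ × (Fin n → ℝ), act (dp (j - r) (regQuad (D p.1) τ n p.2)) (prodAt τ ξ n p.2) G
        = act (dp (j - r) (quad 0 n (fun i l => covXX (D p.1) τ (p.2 i) (p.2 l)) (Y' p)
          fun i l => -2 / τ * (tail (D p.1) τ (p.2 i) 0 * tail (D p.1) τ (p.2 l) 0)))
          (prodAt τ ξ n p.2) G := by
      intro p
      refine act_dp_quad_congr (fun i hi => prodAt_vanish τ ξ n p.2 hi) fun i l => ?_
      by_cases h : i = l ∨ t i ≠ t l
      · left; simp only [Y', if_pos h]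
      · right
        push Not at h
        rcases lt_or_gt_of_ne h.1 with h1 | h1
        · exact ((ht.2 i l h1).resolve_left (by rw [h.2]; exact lt_irrefl _)).2.2.1
        · exact ((ht.2 l i h1).resolve_left (by rw [h.2]; exact lt_irrefl _)).2.2.2
    simp_rw [hG]
    have hs : ∀ i, Tendsto (fun p : ℝ × (Fin n → ℝ) => p.2 i) (𝓝[>] 0 ×ˢ 𝓝 t) (𝓝 (t i)) :=
      fun i => ((continuous_apply i).tendsto t).comp tendsto_snd
    have hχ : ∀ i, Tendsto (fun p : ℝ × (Fin n → ℝ) => tail (D p.1) τ (p.2 i) 0)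
        (𝓝[>] 0 ×ˢ 𝓝 t) (𝓝 1) := fun i =>
      tendsto_tail_zero hD hτ tendsto_fst (hs i) (ht.1 i)
    refine ((continuous_act_quad τ ξ n (j - r) G).tendsto
      ((limX τ t, limY τ t, fun _ _ => -2 / τ), t)).comp
      (f := fun p : ℝ × (Fin n → ℝ) => ((fun i l => covXX (D p.1) τ (p.2 i) (p.2 l), Y' p,
      fun i l => -2 / τ * (tail (D p.1) τ (p.2 i) 0 * tail (D p.1) τ (p.2 l) 0)), p.2)) ?_
    refine Tendsto.prodMk_nhds (Tendsto.prodMk_nhds ?_ (Tendsto.prodMk_nhds ?_ ?_)) tendsto_snd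
    · exact tendsto_pi_nhds.2 fun i => tendsto_pi_nhds.2 fun l => ht.tendsto_covXX hD hτ i l
    · refine tendsto_pi_nhds.2 fun i => tendsto_pi_nhds.2 fun l => ?_
      by_cases h : i = l ∨ t i ≠ t l
      · simp only [Y', if_pos h]
        exact ht.tendsto_covVX hD hτ i l h
      · simp only [Y', if_neg h]
        exact tendsto_const_nhds
    · refine tendsto_pi_nhds.2 fun i => tendsto_pi_nhds.2 fun l => ?_
      simpa using ((hχ i).mul (hχ l)).const_mul (-2 / τ)
  · exact tendsto_const_nhds

theorem isRegFam [CompleteSpace 𝔸] (ξ : Sp d) (n j : ℕ) :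
    RegFam (𝔸 := 𝔸) (d := d) τ n (fun ε => regFam (D ε) τ ξ n j)
      fun r t G => (wickFam τ 0 n j r t G).1 ξ where
  cont _ hε r G := continuous_regFam hD hτ ξ n j hε r G
  bdd r G := bdd_regFam hD hτ ξ n j r G
  vanish ε r t _ hi := vanish_regFam (D ε) τ ξ n j r t hi
  smooth r G := contDiff_wickFam_right τ ξ n j r G
  vanish₀ r t _ hi := vanish_wickFam τ ξ n j r t hi
  lim r t G ht := tendsto_regFam hD hτ ξ n j r t G ht

/-- Combines the passage from singular contractions to contacts with the evaluation of the resulting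
iterated integral; the gauge condition is used only in the latter. -/
theorem tendsto_simplexInt_fullQuad [CompleteSpace 𝔸] {f : Fin d → Sm d 𝔸} (V : Sm d 𝔸)
    (hf : ∑ μ, Sm.coord μ * f μ = 0) (n j : ℕ) (ξ : Sp d) :
    Tendsto (fun ε => simplexInt τ n fun t => act (dp j (fullQuad (D ε) τ n t)) (prodAt τ ξ n t)
      fun _ => (f, V)) (𝓝[>] 0)
      (𝓝 (∑ K ∈ Finset.range (n + j + 1), τ ^ K • (Sm.coef f V n j K).1 ξ)) := by
  have h := (isRegFam hD hτ ξ n j).tendsto_simplexInt (contactKernel_contactK hD hτ) hτ (R := j + 1)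
    (fun ε r hr => ?_) (Nat.succ_pos j) fun _ => (f, V)
  · have e := (pathInt_wick (F := fun _ => (f, V)) (k := 0) (n := n) hf hτ (fun _ _ => rfl) j).eq ξ
    rw [e] at h
    have e2 : (∑ K ∈ Finset.range (n + j + 1), τ ^ K • Sm.coef f V n j K).1 ξ =
        ∑ K ∈ Finset.range (n + j + 1), τ ^ K • (Sm.coef f V n j K).1 ξ := by
      rw [Sm.val_eq_ev, map_sum]; rfl
    rw [e2] at h
    refine h.congr fun ε => ?_
    congr 1
    funext t
    rw [act_dp_fullQuad _ _ _ _ _ fun i hi => prodAt_vanish τ ξ n t hi, Finset.sum_apply]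
    refine Finset.sum_congr rfl fun r hr => ?_
    have hr' : r ≤ j := Nat.lt_succ_iff.1 (Finset.mem_range.1 hr)
    have : regFam (D ε) τ ξ n j r t = act (dp (j - r) (regQuad (D ε) τ n t)) (prodAt (𝔸 := 𝔸) τ ξ n t) := by
      funext G; rw [regFam, if_pos hr']
    rw [this]
  · funext t G
    rw [regFam, if_neg (by omega)]; rfl

end

/-! ### Taylor operators in a noncommutative algebra -/

section TaylorN

variable {E : Type} [Ring E] [Algebra ℝ E] (c : Sm d 𝔸 →ₗ[ℝ] E) (D : Fin d → E)

/-- The sum of `c (∂_α g) D_α` over multi-indices `α` of length `k`. -/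
def taylorN : ℕ → Sm d 𝔸 → E
  | 0, g => c g
  | k + 1, g => ∑ ν, taylorN k (Sm.pdL ν g) * D ν

variable {c D}

theorem taylorN_add (k : ℕ) (g g' : Sm d 𝔸) :
    taylorN c D k (g + g') = taylorN c D k g + taylorN c D k g' := by
  induction k generalizing g g' with
  | zero => exact map_add c g g'
  | succ k ih => simp only [taylorN, map_add, ih, add_mul, Finset.sum_add_distrib]

theorem taylorN_smul (k : ℕ) (r : ℝ) (g : Sm d 𝔸) :
    taylorN c D k (r • g) = r • taylorN c D k g := by
  induction k generalizing g with
  | zero => exact map_smul c r g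
  | succ k ih => simp only [taylorN, map_smul, ih, smul_mul_assoc, Finset.smul_sum]

theorem mul_taylorN_succ (b : E) (k : ℕ) (g : Sm d 𝔸) :
    b * taylorN c D (k + 1) g = ∑ ν, b * taylorN c D k (Sm.pdL ν g) * D ν := by
  simp only [taylorN, Finset.mul_sum, ← mul_assoc]

theorem sum_mul_taylorN_mul (l : Fin d → E) (k : ℕ) (g : Sm d 𝔸) :
    ∑ ν, (∑ μ, l μ * taylorN c D k (Sm.pdL μ (Sm.pdL ν g))) * D ν =
      ∑ μ, l μ * taylorN c D (k + 1) (Sm.pdL μ g) := by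
  simp only [mul_taylorN_succ, Finset.sum_mul]
  rw [Finset.sum_comm]
  exact Finset.sum_congr rfl fun μ _ => Finset.sum_congr rfl fun ν _ => by rw [Sm.pdL_comm]

theorem sum_smul_taylorN_mul (κ : Fin d → ℝ) (k : ℕ) (g : Sm d 𝔸) :
    ∑ ν, (∑ μ, κ μ • taylorN c D k (Sm.pdL μ (Sm.pdL ν g))) * D ν =
      ∑ μ, κ μ • taylorN c D (k + 1) (Sm.pdL μ g) := by
  simpa using sum_mul_taylorN_mul (c := c) (D := D) (fun μ => κ μ • 1) k g

/-- Moving `l` past `k + 1` derivations leaves one commutator for each. The resulting terms are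
equal because partial derivatives of `g` commute. -/
theorem taylorN_mul_linear {l : E} {κ : Fin d → ℝ} (hc : ∀ g, c g * l = l * c g)
    (hD : ∀ ν, D ν * l = l * D ν + κ ν • 1) (k : ℕ) (g : Sm d 𝔸) :
    taylorN c D (k + 1) g * l = l * taylorN c D (k + 1) g +
      ((k + 1 : ℕ) : ℝ) • ∑ ν, κ ν • taylorN c D k (Sm.pdL ν g) := by
  have step : ∀ k g, taylorN c D (k + 1) g * l = ∑ ν, taylorN c D k (Sm.pdL ν g) * l * D ν +
      ∑ ν, κ ν • taylorN c D k (Sm.pdL ν g) := by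
    intro k g
    rw [taylorN, Finset.sum_mul, ← Finset.sum_add_distrib]
    refine Finset.sum_congr rfl fun ν _ => ?_
    rw [mul_assoc, hD, mul_add, mul_assoc, mul_smul_comm, mul_one]
  induction k generalizing g with
  | zero =>
    rw [step, mul_taylorN_succ, zero_add, Nat.cast_one, one_smul]
    simp only [taylorN, hc]
  | succ k ih =>
    rw [step]
    simp only [ih, add_mul, Finset.sum_add_distrib, smul_mul_assoc]
    rw [← mul_taylorN_succ, ← Finset.smul_sum, sum_smul_taylorN_mul]
    push_cast
    module

/-- Each of the `k + 2` derivations may hit `b` alone, producing `l`. Each of the `(k + 2)(k + 1)/2`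
pairs may hit it together, producing `K`. -/
theorem taylorN_mul_quadratic {b : E} {l : Fin d → E} {K : Fin d → Fin d → ℝ}
    (hc : ∀ g, c g * b = b * c g) (hD : ∀ ν, D ν * b = b * D ν + l ν)
    (hc' : ∀ g μ, c g * l μ = l μ * c g)
    (hD' : ∀ μ ν, D ν * l μ = l μ * D ν + K ν μ • 1) (k : ℕ) (g : Sm d 𝔸) :
    taylorN c D (k + 2) g * b = b * taylorN c D (k + 2) g +
      ((k + 2 : ℕ) : ℝ) • ∑ ν, l ν * taylorN c D (k + 1) (Sm.pdL ν g) +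
      (((k + 2 : ℕ) : ℝ) * ((k + 1 : ℕ) : ℝ) / 2) •
        ∑ μ, ∑ ν, K ν μ • taylorN c D k (Sm.pdL ν (Sm.pdL μ g)) := by
  have h1 : ∀ g, taylorN c D 1 g * b = b * taylorN c D 1 g + ∑ ν, l ν * taylorN c D 0 (Sm.pdL ν g) := by
    intro g
    simp only [taylorN, Finset.sum_mul, Finset.mul_sum, mul_assoc, hD, mul_add, hc',
      Finset.sum_add_distrib]
    simp only [← mul_assoc, hc]
  have step : ∀ k g, taylorN c D (k + 1) g * b = ∑ ν, (taylorN c D k (Sm.pdL ν g) * b) * D ν +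
      ∑ ν, taylorN c D k (Sm.pdL ν g) * l ν := by
    intro k g
    rw [taylorN, Finset.sum_mul, ← Finset.sum_add_distrib]
    refine Finset.sum_congr rfl fun ν _ => ?_
    rw [mul_assoc, hD, mul_add, mul_assoc]
  have hlin : ∀ k g, ∑ ν, taylorN c D (k + 1) (Sm.pdL ν g) * l ν =
      ∑ ν, l ν * taylorN c D (k + 1) (Sm.pdL ν g) +
      ((k + 1 : ℕ) : ℝ) • ∑ μ, ∑ ν, K ν μ • taylorN c D k (Sm.pdL ν (Sm.pdL μ g)) := by
    intro k g
    rw [Finset.smul_sum, ← Finset.sum_add_distrib]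
    refine Finset.sum_congr rfl fun μ _ => ?_
    rw [taylorN_mul_linear (fun g => hc' g μ) (hD' μ)]
  induction k generalizing g with
  | zero =>
    rw [step, hlin]
    simp only [h1, add_mul, Finset.sum_add_distrib]
    rw [← mul_taylorN_succ, sum_mul_taylorN_mul]
    simp only [zero_add]
    push_cast
    module
  | succ k ih =>
    rw [step, hlin]
    simp only [ih, add_mul, Finset.sum_add_distrib, smul_mul_assoc]
    have e3 : ∑ σ, (∑ μ, ∑ ν, K ν μ • taylorN c D k (Sm.pdL ν (Sm.pdL μ (Sm.pdL σ g)))) * D σ =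
        ∑ μ, ∑ ν, K ν μ • taylorN c D (k + 1) (Sm.pdL ν (Sm.pdL μ g)) := by
      simp only [Finset.sum_mul]
      rw [Finset.sum_comm]
      refine Finset.sum_congr rfl fun μ _ => ?_
      rw [Finset.sum_comm]
      refine Finset.sum_congr rfl fun ν _ => ?_
      rw [taylorN, Finset.smul_sum]
      refine Finset.sum_congr rfl fun σ _ => ?_
      rw [smul_mul_assoc, Sm.pdL_comm μ σ, Sm.pdL_comm ν σ]
    rw [← Finset.smul_sum, ← Finset.smul_sum, e3, ← mul_taylorN_succ, sum_mul_taylorN_mul]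
    generalize ∑ ν, l ν * taylorN c D (k + 2) (Sm.pdL ν g) = A
    generalize ∑ μ, ∑ ν, K ν μ • taylorN c D (k + 1) (Sm.pdL ν (Sm.pdL μ g)) = C
    push_cast
    module

end TaylorN

/-! ### Polynomial functionals -/

section PolyFun

variable {H : Type} [NormedAddCommGroup H] [NormedSpace ℝ H]

/-- Smooth functionals of degree less than `N`. -/
def Deg : ℕ → (H → 𝔸) → Prop
  | 0, q => q = 0
  | N + 1, q => ContDiff ℝ ∞ q ∧ ∀ h, Deg N fun x => fderiv ℝ q x h

theorem Deg.contDiff {N : ℕ} {q : H → 𝔸} (h : Deg N q) : ContDiff ℝ ∞ q := by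
  rcases N with - | N
  · rw [show q = 0 from h]; exact contDiff_const
  · exact h.1

theorem Deg.differentiableAt {N : ℕ} {q : H → 𝔸} (h : Deg N q) (x : H) : DifferentiableAt ℝ q x :=
  h.contDiff.differentiable (by norm_num) x

theorem Deg.zero (N : ℕ) : Deg N (0 : H → 𝔸) := by
  induction N with
  | zero => rfl
  | succ N ih =>
    refine ⟨contDiff_const, fun h => ?_⟩
    have : (fun x => fderiv ℝ (0 : H → 𝔸) x h) = 0 := by
      funext x; simp
    rw [this]; exact ih

theorem Deg.succ {N : ℕ} {q : H → 𝔸} (h : Deg N q) : Deg (N + 1) q := by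
  induction N generalizing q with
  | zero => rw [show q = 0 from h]; exact Deg.zero 1
  | succ N ih => exact ⟨h.1, fun v => ih (h.2 v)⟩

theorem Deg.mono {N M : ℕ} (hNM : N ≤ M) {q : H → 𝔸} (h : Deg N q) : Deg M q := by
  induction hNM with
  | refl => exact h
  | step _ ih => exact ih.succ

theorem Deg.fderiv {N : ℕ} {q : H → 𝔸} (h : Deg N q) (v : H) : Deg N fun x => fderiv ℝ q x v := by
  rcases N with - | N
  · rw [show q = 0 from h]
    funext x; simp
  · exact (h.2 v).succ

theorem Deg.add {N : ℕ} {q q' : H → 𝔸} (h : Deg N q) (h' : Deg N q') : Deg N (q + q') := by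
  induction N generalizing q q' with
  | zero => rw [show q = 0 from h, show q' = 0 from h']; exact add_zero _
  | succ N ih =>
    refine ⟨h.1.add h'.1, fun v => ?_⟩
    have : (fun x => _root_.fderiv ℝ (q + q') x v) =
        (fun x => _root_.fderiv ℝ q x v) + fun x => _root_.fderiv ℝ q' x v := by
      funext x
      rw [fderiv_add (h.differentiableAt x) (h'.differentiableAt x)]; rfl
    rw [this]
    exact ih (h.2 v) (h'.2 v)

theorem Deg.clm {N : ℕ} {q : H → 𝔸} (h : Deg N q) (A : 𝔸 →L[ℝ] 𝔸) : Deg N fun x => A (q x) := by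
  induction N generalizing q with
  | zero => rw [show q = 0 from h]; funext x; exact map_zero A
  | succ N ih =>
    refine ⟨A.contDiff.comp h.1, fun v => ?_⟩
    have : (fun x => _root_.fderiv ℝ (fun x => A (q x)) x v) = fun x => A (_root_.fderiv ℝ q x v) := by
      funext x
      rw [HasFDerivAt.fderiv (f := fun x => A (q x))
        (A.hasFDerivAt.comp x (h.differentiableAt x).hasFDerivAt)]; rfl
    rw [this]
    exact ih (h.2 v)

theorem fderiv_smul_apply {c : H → ℝ} {q : H → 𝔸} {x : H} (hc : DifferentiableAt ℝ c x)
    (hq : DifferentiableAt ℝ q x) (v : H) : _root_.fderiv ℝ (fun x => c x • q x) x v =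
      c x • _root_.fderiv ℝ q x v + _root_.fderiv ℝ c x v • q x := by
  rw [fderiv_fun_smul hc hq]; rfl

theorem Deg.linear_smul {N : ℕ} {q : H → 𝔸} (h : Deg N q) (l : H →L[ℝ] ℝ) :
    Deg (N + 1) fun x => l x • q x := by
  induction N generalizing q with
  | zero =>
    rw [show q = 0 from h]
    have : (fun x => l x • (0 : H → 𝔸) x) = 0 := funext fun x => smul_zero _
    rw [this]; exact Deg.zero 1
  | succ N ih =>
    refine ⟨l.contDiff.smul h.1, fun v => ?_⟩
    have : (fun x => _root_.fderiv ℝ (fun x => l x • q x) x v) =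
        (fun x => l x • _root_.fderiv ℝ q x v) + fun x => (l v • ContinuousLinearMap.id ℝ 𝔸) (q x) := by
      funext x
      rw [fderiv_smul_apply l.differentiableAt (h.differentiableAt x), l.fderiv]; rfl
    rw [this]
    exact (ih (h.2 v)).add (h.clm _)

variable (B : H →L[ℝ] H →L[ℝ] ℝ)

/-- The quadratic form `½ B(x, x)`. -/
def qform (x : H) : ℝ := 1 / 2 * B x x

theorem contDiff_qform : ContDiff ℝ ∞ (qform B) :=
  contDiff_const.mul (B.contDiff.clm_apply contDiff_id)

variable {B} (hB : ∀ x y, B x y = B y x)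

include hB in
theorem fderiv_qform (x v : H) : _root_.fderiv ℝ (qform B) x v = B v x := by
  have h : HasFDerivAt (fun x => B x x) ((B x).comp (ContinuousLinearMap.id ℝ H) +
      B.flip x) x := B.hasFDerivAt.clm_apply (hasFDerivAt_id x)
  have h2 : HasFDerivAt (qform B) _ x := h.const_mul (1 / 2)
  rw [h2.fderiv]
  simp [hB x v]
  ring

include hB in
theorem Deg.qform_smul {N : ℕ} {q : H → 𝔸} (h : Deg N q) : Deg (N + 2) fun x => qform B x • q x := by
  induction N generalizing q with
  | zero =>
    rw [show q = 0 from h]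
    have : (fun x => qform B x • (0 : H → 𝔸) x) = 0 := funext fun x => smul_zero _
    rw [this]; exact Deg.zero 2
  | succ N ih =>
    refine ⟨(contDiff_qform B).smul h.1, fun v => ?_⟩
    have : (fun x => _root_.fderiv ℝ (fun x => qform B x • q x) x v) =
        (fun x => qform B x • _root_.fderiv ℝ q x v) + fun x => B v x • q x := by
      funext x
      rw [fderiv_smul_apply ((contDiff_qform B).differentiable (by norm_num) x)
        (h.differentiableAt x), fderiv_qform hB]; rfl
    rw [this]
    exact (ih (h.2 v)).add (h.linear_smul (B v))

variable (H 𝔸) in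
/-- The polynomial functionals. -/
def PolyFun : Submodule ℝ (H → 𝔸) where
  carrier := {q | ∃ N, Deg N q}
  zero_mem' := ⟨0, rfl⟩
  add_mem' := by
    rintro q q' ⟨N, h⟩ ⟨N', h'⟩
    exact ⟨max N N', (h.mono (le_max_left _ _)).add (h'.mono (le_max_right _ _))⟩
  smul_mem' := by
    rintro r q ⟨N, h⟩
    exact ⟨N, h.clm (r • ContinuousLinearMap.id ℝ 𝔸)⟩

namespace PolyFun

theorem ext {q q' : PolyFun 𝔸 H} (h : ∀ x, q.1 x = q'.1 x) : q = q' := Subtype.ext (funext h)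

theorem differentiableAt (q : PolyFun 𝔸 H) (x : H) : DifferentiableAt ℝ q.1 x :=
  q.2.choose_spec.differentiableAt x

/-- The derivative in the direction `v`. -/
def D (v : H) : Module.End ℝ (PolyFun 𝔸 H) where
  toFun q := ⟨fun x => fderiv ℝ q.1 x v, q.2.imp fun _ h => h.fderiv v⟩
  map_add' q q' := PolyFun.ext fun x => by
    change fderiv ℝ (q.1 + q'.1) x v = fderiv ℝ q.1 x v + fderiv ℝ q'.1 x v
    rw [fderiv_add (PolyFun.differentiableAt q x) (PolyFun.differentiableAt q' x)]; rfl
  map_smul' r q := PolyFun.ext fun x => by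
    change fderiv ℝ (r • q.1) x v = r • fderiv ℝ q.1 x v
    rw [fderiv_const_smul (PolyFun.differentiableAt q x)]; rfl

/-- Left multiplication of the values. -/
def mulC : 𝔸 →ₗ[ℝ] Module.End ℝ (PolyFun 𝔸 H) where
  toFun a :=
    { toFun := fun q => ⟨fun x => a * q.1 x, q.2.imp fun _ h => h.clm (ContinuousLinearMap.mul ℝ 𝔸 a)⟩
      map_add' := fun q q' => PolyFun.ext fun x => mul_add a (q.1 x) (q'.1 x)
      map_smul' := fun r q => PolyFun.ext fun x => mul_smul_comm r a (q.1 x) }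
  map_add' a a' := LinearMap.ext fun q => PolyFun.ext fun x => add_mul a a' (q.1 x)
  map_smul' r a := LinearMap.ext fun q => PolyFun.ext fun x => smul_mul_assoc r a (q.1 x)

/-- Multiplication by a linear functional. -/
def mulLin (l : H →L[ℝ] ℝ) : Module.End ℝ (PolyFun 𝔸 H) where
  toFun q := ⟨fun x => l x • q.1 x, q.2.elim fun N h => ⟨N + 1, h.linear_smul l⟩⟩
  map_add' q q' := PolyFun.ext fun x => smul_add (l x) (q.1 x) (q'.1 x)
  map_smul' r q := PolyFun.ext fun x => smul_comm (l x) r (q.1 x)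

/-- Multiplication by the quadratic form. -/
def mulQ : Module.End ℝ (PolyFun 𝔸 H) where
  toFun q := ⟨fun x => qform B x • q.1 x, q.2.elim fun N h => ⟨N + 2, h.qform_smul hB⟩⟩
  map_add' q q' := PolyFun.ext fun x => smul_add (qform B x) (q.1 x) (q'.1 x)
  map_smul' r q := PolyFun.ext fun x => smul_comm (qform B x) r (q.1 x)

theorem mulC_mul_mulLin (a : 𝔸) (l : H →L[ℝ] ℝ) :
    mulC a * mulLin l = mulLin l * mulC (H := H) a :=
  LinearMap.ext fun q => PolyFun.ext fun x => mul_smul_comm (l x) a (q.1 x)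

theorem mulC_mul_mulQ (a : 𝔸) : mulC a * mulQ hB = mulQ hB * mulC a :=
  LinearMap.ext fun q => PolyFun.ext fun x => mul_smul_comm (qform B x) a (q.1 x)

theorem D_mul_mulLin (v : H) (l : H →L[ℝ] ℝ) :
    D v * mulLin l = mulLin (𝔸 := 𝔸) l * D v + l v • 1 :=
  LinearMap.ext fun q => PolyFun.ext fun x => by
    refine (fderiv_smul_apply l.differentiableAt (PolyFun.differentiableAt q x) v).trans ?_
    rw [l.fderiv]; rfl

theorem D_mul_mulQ (v : H) : D v * mulQ hB = mulQ (𝔸 := 𝔸) hB * D v + mulLin (B v) :=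
  LinearMap.ext fun q => PolyFun.ext fun x => by
    refine (fderiv_smul_apply ((contDiff_qform B).differentiable (by norm_num) x)
      (PolyFun.differentiableAt q x) v).trans ?_
    rw [fderiv_qform hB]; rfl

/-- The Taylor operator of order `k` at `p`, with the directions `h`. -/
def tayN (p : Sp d) (h : Fin d → H) : ℕ → Sm d 𝔸 → Module.End ℝ (PolyFun 𝔸 H) :=
  taylorN (mulC ∘ₗ Sm.ev p) fun ν => D (h ν)

/-- Every derivative lowers the degree by one. Hence the Taylor operator is a finite sum on each
polynomial functional, whatever the growth of the derivatives of `g`. -/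
theorem tayN_eq_zero (p : Sp d) (h : Fin d → H) {N k : ℕ} (hk : N ≤ k) (g : Sm d 𝔸)
    {q : PolyFun 𝔸 H} (hq : Deg N q.1) : tayN p h k g q = 0 := by
  induction k generalizing g q N with
  | zero =>
    obtain rfl := Nat.le_zero.1 hk
    rw [show q = 0 from Subtype.ext hq, map_zero]
  | succ k ih =>
    change (∑ ν, tayN p h k (Sm.pdL ν g) * D (h ν) : Module.End ℝ (PolyFun 𝔸 H)) q = 0
    rw [LinearMap.sum_apply]
    refine Finset.sum_eq_zero fun ν _ => ?_
    change tayN p h k (Sm.pdL ν g) (D (h ν) q) = 0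
    rcases N with - | N
    · rw [show q = 0 from Subtype.ext hq, map_zero, map_zero]
    · exact ih (Nat.le_of_succ_le_succ hk) _ (hq.2 (h ν))

open scoped Classical in
/-- The least bound for the degree. -/
def deg (q : PolyFun 𝔸 H) : ℕ := Nat.find q.2

theorem deg_spec (q : PolyFun 𝔸 H) : Deg (deg q) q.1 := by
  classical exact Nat.find_spec q.2

theorem deg_le {q : PolyFun 𝔸 H} {N : ℕ} (h : Deg N q.1) : (deg q) ≤ N := by
  classical exact Nat.find_min' q.2 h

theorem sum_tayN_eq (p : Sp d) (h : Fin d → H) (g : Sm d 𝔸) {q : PolyFun 𝔸 H} {N : ℕ}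
    (hN : Deg N q.1) : ∑ k ∈ Finset.range (deg q), ((k ! : ℕ) : ℝ)⁻¹ • tayN p h k g q =
      ∑ k ∈ Finset.range N, ((k ! : ℕ) : ℝ)⁻¹ • tayN p h k g q := by
  refine Finset.sum_subset (Finset.range_mono (deg_le hN)) fun k _ hk => ?_
  rw [Finset.mem_range, not_lt] at hk
  rw [tayN_eq_zero p h hk g (deg_spec q), smul_zero]

/-- The Taylor operator `g(p + ∂)`. -/
def tay (p : Sp d) (h : Fin d → H) (g : Sm d 𝔸) : Module.End ℝ (PolyFun 𝔸 H) where
  toFun q := ∑ k ∈ Finset.range (deg q), ((k ! : ℕ) : ℝ)⁻¹ • tayN p h k g q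
  -- The number of terms depends on `q`, but any common degree bound gives the same sums, which
  -- makes the operator additive.
  map_add' q q' := by
    have h1 := (deg_spec q).mono (le_max_left _ (deg q'))
    have h2 := (deg_spec q').mono (le_max_right (deg q) _)
    rw [sum_tayN_eq p h g h1, sum_tayN_eq p h g h2, sum_tayN_eq p h g (q := q + q') (h1.add h2),
      ← Finset.sum_add_distrib]
    simp only [map_add, smul_add]
  map_smul' r q := by
    have h1 : Deg (deg q) (r • q).1 := (deg_spec q).clm (r • ContinuousLinearMap.id ℝ 𝔸)
    rw [sum_tayN_eq p h g h1, Finset.smul_sum]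
    simp only [map_smul, RingHom.id_apply, smul_comm r]

theorem tay_apply (p : Sp d) (h : Fin d → H) (g : Sm d 𝔸) {q : PolyFun 𝔸 H} {N : ℕ}
    (hN : Deg N q.1) : tay p h g q = ∑ k ∈ Finset.range N, ((k ! : ℕ) : ℝ)⁻¹ • tayN p h k g q :=
  sum_tayN_eq p h g hN

theorem inv_factorial_mul (k : ℕ) : (((k + 1)! : ℕ) : ℝ)⁻¹ * ((k + 1 : ℕ) : ℝ) = ((k ! : ℕ) : ℝ)⁻¹ := by
  rw [Nat.factorial_succ]
  have : ((k ! : ℕ) : ℝ) ≠ 0 := by positivity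
  push_cast
  field_simp

/-- The Taylor operator of order `k`, divided by `k!`. -/
def tayD (p : Sp d) (h : Fin d → H) (k : ℕ) (g : Sm d 𝔸) : Module.End ℝ (PolyFun 𝔸 H) :=
  ((k ! : ℕ) : ℝ)⁻¹ • tayN p h k g

theorem tay_eq_tayD (p : Sp d) (h : Fin d → H) (g : Sm d 𝔸) {q : PolyFun 𝔸 H} {N : ℕ}
    (hN : Deg N q.1) : tay p h g q = ∑ k ∈ Finset.range N, tayD p h k g q :=
  sum_tayN_eq p h g hN

theorem tayD_mul_mulLin (p : Sp d) (h : Fin d → H) (k : ℕ) (g : Sm d 𝔸) (l : H →L[ℝ] ℝ) :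
    tayD p h (k + 1) g * mulLin l = mulLin l * tayD p h (k + 1) g +
      ∑ ν, l (h ν) • tayD p h k (Sm.pdL ν g) := by
  have := taylorN_mul_linear (E := Module.End ℝ (PolyFun 𝔸 H)) (c := mulC ∘ₗ Sm.ev p) (D := fun ν => D (h ν)) (l := mulLin l)
      (κ := fun ν => l (h ν)) (fun g => mulC_mul_mulLin (𝔸 := 𝔸) (H := H) _ l)
      (fun ν => D_mul_mulLin (𝔸 := 𝔸) (h ν) l) k g
  simp only [tayD, smul_mul_assoc, mul_smul_comm]
  rw [tayN, this, smul_add, smul_smul, inv_factorial_mul, Finset.smul_sum]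
  simp only [smul_comm (_ : ℝ)⁻¹]

theorem tayD_mul_mulQ (p : Sp d) (h : Fin d → H) (k : ℕ) (g : Sm d 𝔸) :
    tayD p h (k + 2) g * mulQ hB = mulQ hB * tayD p h (k + 2) g +
      ∑ ν, mulLin (B (h ν)) * tayD p h (k + 1) (Sm.pdL ν g) +
      (1 / 2 : ℝ) • ∑ μ, ∑ ν, B (h μ) (h ν) • tayD p h k (Sm.pdL ν (Sm.pdL μ g)) := by
  have := taylorN_mul_quadratic (E := Module.End ℝ (PolyFun 𝔸 H)) (c := mulC ∘ₗ Sm.ev p) (D := fun ν => D (h ν)) (b := mulQ hB)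
      (l := fun ν => mulLin (B (h ν)))
      (K := fun ν μ => B (h μ) (h ν)) (fun g => mulC_mul_mulQ (𝔸 := 𝔸) hB _)
      (fun ν => D_mul_mulQ hB (h ν))
      (fun g μ => mulC_mul_mulLin _ _) (fun μ ν => D_mul_mulLin (𝔸 := 𝔸) (h ν) _) k g
  have hf : (((k + 2)! : ℕ) : ℝ)⁻¹ * (((k + 2 : ℕ) : ℝ) * ((k + 1 : ℕ) : ℝ) / 2) =
      1 / 2 * ((k ! : ℕ) : ℝ)⁻¹ := by
    rw [← inv_factorial_mul k, ← inv_factorial_mul (k + 1)]; ring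
  simp only [tayD, smul_mul_assoc, mul_smul_comm]
  rw [tayN, this, smul_add, smul_add, smul_smul, smul_smul, hf, inv_factorial_mul (k + 1), mul_smul]
  simp only [Finset.smul_sum, smul_comm (_ : ℝ)⁻¹]

theorem tayD_zero_mul_mulQ (p : Sp d) (h : Fin d → H) (g : Sm d 𝔸) :
    tayD p h 0 g * mulQ hB = mulQ hB * tayD p h 0 g := by
  simp only [tayD, smul_mul_assoc, mul_smul_comm]
  congr 1
  exact mulC_mul_mulQ hB (g.1 p)

theorem tayD_one_mul_mulQ (p : Sp d) (h : Fin d → H) (g : Sm d 𝔸) :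
    tayD p h 1 g * mulQ hB = mulQ hB * tayD p h 1 g +
      ∑ ν, mulLin (B (h ν)) * tayD p h 0 (Sm.pdL ν g) := by
  have e : tayD p h 1 g = ∑ ν, mulC ((Sm.pdL ν g).1 p) * D (H := H) (h ν) := by
    rw [tayD, Nat.factorial_one, Nat.cast_one, inv_one, one_smul]; rfl
  have e0 : ∀ ν, tayD p h 0 (Sm.pdL ν g) = mulC (H := H) ((Sm.pdL ν g).1 p) := fun ν => by
    rw [tayD, Nat.factorial_zero, Nat.cast_one, inv_one, one_smul]; rfl
  simp only [e, e0, Finset.sum_mul, Finset.mul_sum, mul_assoc, D_mul_mulQ, mul_add,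
    Finset.sum_add_distrib, mulC_mul_mulLin]
  simp only [← mul_assoc, mulC_mul_mulQ]

/-- The rule `[g(p + ∂), l] = l(h_ν) (∂_ν g)(p + ∂)`: the factor `k + 1` from the commutators turns
`1/(k + 1)!` into `1/k!`. -/
theorem tay_mul_mulLin (p : Sp d) (h : Fin d → H) (g : Sm d 𝔸) (l : H →L[ℝ] ℝ) :
    tay p h g * mulLin l = mulLin l * tay p h g + ∑ ν, l (h ν) • tay p h (Sm.pdL ν g) := by
  refine LinearMap.ext fun q => ?_
  have hq := deg_spec q
  have key : ∀ k, tayD p h (k + 1) g (mulLin l q) = mulLin l (tayD p h (k + 1) g q) +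
      ∑ ν, l (h ν) • tayD p h k (Sm.pdL ν g) q := fun k => by
    have := LinearMap.congr_fun (tayD_mul_mulLin p h k g l) q
    simpa only [Module.End.mul_apply, LinearMap.add_apply, LinearMap.sum_apply,
      LinearMap.smul_apply] using this
  have key0 : tayD p h 0 g (mulLin l q) = mulLin l (tayD p h 0 g q) := by
    simp only [tayD, LinearMap.smul_apply, map_smul]
    congr 1
    exact LinearMap.congr_fun (mulC_mul_mulLin (g.1 p) l) q
  simp only [Module.End.mul_apply, LinearMap.add_apply, LinearMap.sum_apply, LinearMap.smul_apply]
  rw [tay_eq_tayD p h g (q := mulLin l q) (hq.linear_smul l), tay_eq_tayD p h g hq.succ,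
    Finset.sum_range_succ', Finset.sum_range_succ', key0]
  simp only [tay_eq_tayD p h _ hq, key, map_add, map_sum, Finset.sum_add_distrib, Finset.smul_sum]
  rw [Finset.sum_comm (γ := ℕ), add_right_comm]

/-- The second-order commutation rule of `g(p + ∂)` with a quadratic form. The degrees `0` and `1`
are separate because no pair, respectively no derivative, is available there. -/
theorem tay_mul_mulQ (p : Sp d) (h : Fin d → H) (g : Sm d 𝔸) :
    tay p h g * mulQ hB = mulQ hB * tay p h g + ∑ ν, mulLin (B (h ν)) * tay p h (Sm.pdL ν g) +
      (1 / 2 : ℝ) • ∑ μ, ∑ ν, B (h μ) (h ν) • tay p h (Sm.pdL ν (Sm.pdL μ g)) := by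
  refine LinearMap.ext fun q => ?_
  have hq := deg_spec q
  have key : ∀ k, tayD p h (k + 2) g (mulQ hB q) = mulQ hB (tayD p h (k + 2) g q) +
      ∑ ν, mulLin (B (h ν)) (tayD p h (k + 1) (Sm.pdL ν g) q) +
      (1 / 2 : ℝ) • ∑ μ, ∑ ν, B (h μ) (h ν) • tayD p h k (Sm.pdL ν (Sm.pdL μ g)) q := fun k => by
    have := LinearMap.congr_fun (tayD_mul_mulQ hB p h k g) q
    simpa only [Module.End.mul_apply, LinearMap.add_apply, LinearMap.sum_apply,
      LinearMap.smul_apply] using this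
  have key1 : tayD p h 1 g (mulQ hB q) = mulQ hB (tayD p h 1 g q) +
      ∑ ν, mulLin (B (h ν)) (tayD p h 0 (Sm.pdL ν g) q) := by
    have := LinearMap.congr_fun (tayD_one_mul_mulQ hB p h g) q
    simpa only [Module.End.mul_apply, LinearMap.add_apply, LinearMap.sum_apply] using this
  have key0 : tayD p h 0 g (mulQ hB q) = mulQ hB (tayD p h 0 g q) :=
    LinearMap.congr_fun (tayD_zero_mul_mulQ hB p h g) q
  simp only [Module.End.mul_apply, LinearMap.add_apply, LinearMap.sum_apply, LinearMap.smul_apply]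
  have e1 : ∀ ν, mulLin (B (h ν)) (tay p h (Sm.pdL ν g) q) =
      ∑ k ∈ Finset.range (deg q), mulLin (B (h ν)) (tayD p h (k + 1) (Sm.pdL ν g) q) +
        mulLin (B (h ν)) (tayD p h 0 (Sm.pdL ν g) q) := fun ν => by
    rw [tay_eq_tayD p h _ hq.succ, Finset.sum_range_succ', map_add, map_sum]
  have e2 : mulQ hB (tay p h g q) = ∑ k ∈ Finset.range (deg q), mulQ hB (tayD p h (k + 2) g q) +
      mulQ hB (tayD p h 1 g q) + mulQ hB (tayD p h 0 g q) := by
    rw [tay_eq_tayD p h _ hq.succ.succ, Finset.sum_range_succ', Finset.sum_range_succ', map_add,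
      map_add, map_sum]
  have e3 : ∑ μ, ∑ ν, B (h μ) (h ν) • tay p h (Sm.pdL ν (Sm.pdL μ g)) q =
      ∑ k ∈ Finset.range (deg q), ∑ μ, ∑ ν, B (h μ) (h ν) • tayD p h k (Sm.pdL ν (Sm.pdL μ g)) q := by
    simp only [tay_eq_tayD p h _ hq, Finset.smul_sum]
    rw [Finset.sum_comm (γ := ℕ)]
    exact Finset.sum_congr rfl fun μ _ => Finset.sum_comm
  rw [tay_eq_tayD p h g (q := mulQ hB q) (hq.qform_smul hB), Finset.sum_range_succ',
    Finset.sum_range_succ', key0, zero_add, key1, e2, e3]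
  simp only [e1, key, Finset.sum_add_distrib, ← Finset.smul_sum]
  rw [Finset.sum_comm (γ := ℕ)]
  abel

/-- The Taylor operator as a linear function of `g`. -/
def tayL (p : Sp d) (h : Fin d → H) : Sm d 𝔸 →ₗ[ℝ] Module.End ℝ (PolyFun 𝔸 H) where
  toFun := tay p h
  map_add' g g' := LinearMap.ext fun q => by
    rw [LinearMap.add_apply, tay_apply p h _ (deg_spec q), tay_apply p h _ (deg_spec q),
      tay_apply p h _ (deg_spec q), ← Finset.sum_add_distrib]
    refine Finset.sum_congr rfl fun k _ => ?_
    rw [tayN, taylorN_add, LinearMap.add_apply, smul_add]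
  map_smul' r g := LinearMap.ext fun q => by
    rw [LinearMap.smul_apply, tay_apply p h _ (deg_spec q), tay_apply p h _ (deg_spec q),
      Finset.smul_sum]
    refine Finset.sum_congr rfl fun k _ => ?_
    rw [tayN, taylorN_smul, LinearMap.smul_apply, smul_comm, RingHom.id_apply]

end PolyFun

end PolyFun

/-! ### Contractions of products of vertices -/

section Vop

variable {E : Type} [Ring E] [Algebra ℝ E]

/-- A vertex `(f, V)` at a position given by `T` and a velocity given by `D`. -/
def vop (T : Sm d 𝔸 →ₗ[ℝ] E) (D : Fin d → E) (F : Vert d 𝔸) : E := T F.2 - ∑ μ, T (F.1 μ) * D μ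

variable {T : Sm d 𝔸 →ₗ[ℝ] E} {D : Fin d → E}

theorem vop_dv (μ : Fin d) (F : Vert d 𝔸) : vop T D (Vert.dv μ F) = -T (F.1 μ) := by
  simp [vop, Vert.dv_apply]

theorem vop_dx (ν : Fin d) (F : Vert d 𝔸) : vop T D (Vert.dx ν F) =
    T (Sm.pdL ν F.2) - ∑ μ, T (Sm.pdL ν (F.1 μ)) * D μ := rfl

theorem vop_mul_linear {l : E} {κ : Fin d ⊕ Fin d → ℝ}
    (hT : ∀ g, T g * l = l * T g + ∑ ν, κ (Sum.inl ν) • T (Sm.pdL ν g))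
    (hD : ∀ μ, D μ * l = l * D μ + κ (Sum.inr μ) • 1) (F : Vert d 𝔸) :
    vop T D F * l = l * vop T D F + ∑ a, κ a • vop T D (Vert.der a F) := by
  have e : ∀ μ, T (F.1 μ) * D μ * l = l * (T (F.1 μ) * D μ) +
      ∑ ν, κ (Sum.inl ν) • (T (Sm.pdL ν (F.1 μ)) * D μ) + κ (Sum.inr μ) • T (F.1 μ) := fun μ => by
    rw [mul_assoc, hD, mul_add, ← mul_assoc, hT, add_mul, Finset.sum_mul, mul_smul_comm, mul_one,
      mul_assoc]
    simp only [smul_mul_assoc]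
  rw [Fintype.sum_sum_type]
  simp only [Vert.der, vop_dv, vop_dx]
  rw [vop, sub_mul, hT, Finset.sum_mul]
  simp only [e, Finset.sum_add_distrib, smul_sub, Finset.sum_sub_distrib, Finset.smul_sum, smul_neg,
    mul_sub, Finset.mul_sum, Finset.sum_neg_distrib]
  rw [Finset.sum_comm (f := fun ν μ => κ (Sum.inl ν) • (T (Sm.pdL ν (F.1 μ)) * D μ))]
  abel

theorem vop_mul_quadratic {b : E} {l : Fin d ⊕ Fin d → E}
    {K : Fin d ⊕ Fin d → Fin d ⊕ Fin d → ℝ} (hK : ∀ a a', K a a' = K a' a)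
    (hT : ∀ g, T g * b = b * T g + ∑ ν, l (Sum.inl ν) * T (Sm.pdL ν g) +
      (1 / 2 : ℝ) • ∑ μ, ∑ ν, K (Sum.inl μ) (Sum.inl ν) • T (Sm.pdL ν (Sm.pdL μ g)))
    (hT' : ∀ g μ, T g * l (Sum.inr μ) = l (Sum.inr μ) * T g +
      ∑ ν, K (Sum.inr μ) (Sum.inl ν) • T (Sm.pdL ν g))
    (hD : ∀ μ, D μ * b = b * D μ + l (Sum.inr μ)) (F : Vert d 𝔸) :
    vop T D F * b = b * vop T D F + ∑ a, l a * vop T D (Vert.der a F) +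
      (1 / 2 : ℝ) • ∑ a, ∑ a', K a a' • vop T D (Vert.der a' (Vert.der a F)) := by
  have e : ∀ μ, T (F.1 μ) * D μ * b = b * (T (F.1 μ) * D μ) +
      ∑ ν, l (Sum.inl ν) * (T (Sm.pdL ν (F.1 μ)) * D μ) +
      (1 / 2 : ℝ) • (∑ σ, ∑ ν, K (Sum.inl σ) (Sum.inl ν) •
        (T (Sm.pdL ν (Sm.pdL σ (F.1 μ))) * D μ)) +
      (l (Sum.inr μ) * T (F.1 μ) +
        ∑ ν, K (Sum.inr μ) (Sum.inl ν) • T (Sm.pdL ν (F.1 μ))) := fun μ => by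
    rw [mul_assoc, hD, mul_add, ← mul_assoc, hT, hT', add_mul, add_mul, Finset.sum_mul, mul_assoc]
    simp only [smul_mul_assoc, mul_assoc, Finset.sum_mul]
  have hcross : ∑ ν, ∑ μ, K (Sum.inl ν) (Sum.inr μ) • T (Sm.pdL ν (F.1 μ)) =
      ∑ μ, ∑ ν, K (Sum.inr μ) (Sum.inl ν) • T (Sm.pdL ν (F.1 μ)) := by
    rw [Finset.sum_comm]
    exact Finset.sum_congr rfl fun _ _ => Finset.sum_congr rfl fun _ _ => by rw [hK]
  have h1 : ∑ ν, l (Sum.inl ν) * ∑ μ, T (Sm.pdL ν (F.1 μ)) * D μ =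
      ∑ μ, ∑ ν, l (Sum.inl ν) * (T (Sm.pdL ν (F.1 μ)) * D μ) := by
    simp only [Finset.mul_sum]; exact Finset.sum_comm
  have h2 : ∑ σ, ∑ ν, K (Sum.inl σ) (Sum.inl ν) • ∑ μ, T (Sm.pdL ν (Sm.pdL σ (F.1 μ))) * D μ =
      ∑ μ, ∑ σ, ∑ ν, K (Sum.inl σ) (Sum.inl ν) • (T (Sm.pdL ν (Sm.pdL σ (F.1 μ))) * D μ) := by
    simp only [Finset.smul_sum]
    calc _ = ∑ σ, ∑ μ, ∑ ν, K (Sum.inl σ) (Sum.inl ν) • (T (Sm.pdL ν (Sm.pdL σ (F.1 μ))) * D μ) :=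
          Finset.sum_congr rfl fun _ _ => Finset.sum_comm
      _ = _ := Finset.sum_comm
  have hvx : ∀ μ ν, vop T D (Vert.dx ν (Vert.dv μ F)) = -T (Sm.pdL ν (F.1 μ)) := fun μ ν => by
    rw [show Vert.dx ν (Vert.dv μ F) = Vert.dv μ (Vert.dx ν F) from
      Vert.der_comm (Sum.inl ν) (Sum.inr μ) F, vop_dv]; rfl
  have hxv : ∀ μ ν, vop T D (Vert.dv μ (Vert.dx ν F)) = -T (Sm.pdL ν (F.1 μ)) := fun μ ν => vop_dv _ _
  have hvv : ∀ μ ν, vop T D (Vert.dv μ (Vert.dv ν F)) = 0 := fun μ ν => by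
    rw [vop_dv]; simp [Vert.dv_apply]
  have hxx : ∀ μ ν, vop T D (Vert.dx ν (Vert.dx μ F)) = T (Sm.pdL ν (Sm.pdL μ F.2)) -
      ∑ σ, T (Sm.pdL ν (Sm.pdL μ (F.1 σ))) * D σ := fun μ ν => rfl
  simp only [Fintype.sum_sum_type, Vert.der, hvx, hxv, hvv, hxx, smul_zero, Finset.sum_const_zero,
    add_zero]
  simp only [vop_dv, vop_dx, mul_sub, smul_sub, Finset.sum_sub_distrib, smul_neg, mul_neg,
    Finset.sum_neg_distrib, Finset.sum_add_distrib]
  rw [h1, h2, hcross, vop, sub_mul, hT, Finset.sum_mul]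
  simp only [e, Finset.sum_add_distrib, mul_sub, ← Finset.smul_sum, Finset.mul_sum]
  module

end Vop

/-! ### Contractions of ordered products of operators. -/

section VopProd

variable {E : Type} [Ring E] [Algebra ℝ E] (O : ℝ → Vert d 𝔸 → E)

/-- The ordered product of the vertices in the slots `k, …, k + n - 1`. -/
def vopProd : (k n : ℕ) → (Fin n → ℝ) → (ℕ → Vert d 𝔸) → E
  | _, 0, _ => fun _ => 1
  | k, n + 1, t => fun G => O (t 0) (G k) * vopProd (k + 1) n (Fin.tail t) G

theorem vopProd_indep (k n : ℕ) (t : Fin n → ℝ) {j : ℕ} (hj : j < k) :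
    Indep j (vopProd O k n t) := by
  induction n generalizing k with
  | zero => intro F v; rfl
  | succ n ih =>
    intro F v
    simp only [vopProd]
    rw [ih (k + 1) _ (by omega) F v, Function.update_of_ne (by omega)]

theorem act_X_vopProd (k n : ℕ) (t : Fin (n + 1) → ℝ) (a : Fin d ⊕ Fin d) (p : DOp d)
    (hp : p ∈ off k) (G : ℕ → Vert d 𝔸) :
    act (MvPolynomial.X (k, a) * p) (vopProd O k (n + 1) t) G =
      O (t 0) (Vert.der a (G k)) * act p (vopProd O (k + 1) n (Fin.tail t)) G := by
  have h1 : act p (vopProd O k (n + 1) t) = fun G => O (t 0) (G k) *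
      act p (vopProd O (k + 1) n (Fin.tail t)) G :=
    act_head_mul hp (O (t 0)) (vopProd O (k + 1) n (Fin.tail t))
  rw [act_mul, h1, act_X]
  simp only [Function.update_self]
  rw [(vopProd_indep O (k + 1) n _ (Nat.lt_succ_self k)).act p]

theorem act_off_vopProd (k n : ℕ) (t : Fin (n + 1) → ℝ) (p : DOp d)
    (hp : p ∈ off k) (G : ℕ → Vert d 𝔸) :
    act p (vopProd O k (n + 1) t) G =
      O (t 0) (G k) * act p (vopProd O (k + 1) n (Fin.tail t)) G :=
  congrFun (act_head_mul hp (O (t 0)) (vopProd O (k + 1) n (Fin.tail t))) G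

/-- The derivative along the covector `κ`. -/
def linD (κ : ℝ → Fin d ⊕ Fin d → ℝ) (k n : ℕ) (t : Fin n → ℝ) : DOp d :=
  ∑ i : Fin n, ∑ a, κ (t i) a • MvPolynomial.X (k + i.val, a)

/-- The contractions with the covariance `K`. -/
def wickD (K : ℝ → Fin d ⊕ Fin d → ℝ → Fin d ⊕ Fin d → ℝ) (k n : ℕ) (t : Fin n → ℝ) : DOp d :=
  (1 / 2 : ℝ) • ∑ i : Fin n, ∑ a, MvPolynomial.X (k + i.val, a) * linD (K (t i) a) k n t

theorem linD_mem_off (κ : ℝ → Fin d ⊕ Fin d → ℝ) {j k : ℕ} (n : ℕ) (t : Fin n → ℝ) (h : j < k) :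
    linD κ k n t ∈ off j :=
  Subalgebra.sum_mem _ fun i _ => Subalgebra.sum_mem _ fun a _ =>
    Subalgebra.smul_mem _ (X_mem_off (by dsimp only; omega)) _

theorem wickD_mem_off (K : ℝ → Fin d ⊕ Fin d → ℝ → Fin d ⊕ Fin d → ℝ) {j k : ℕ} (n : ℕ)
    (t : Fin n → ℝ) (h : j < k) : wickD K k n t ∈ off j :=
  Subalgebra.smul_mem _ (Subalgebra.sum_mem _ fun i _ => Subalgebra.sum_mem _ fun a _ =>
    Subalgebra.mul_mem _ (X_mem_off (by dsimp only; omega)) (linD_mem_off _ n t h)) _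

theorem linD_succ (κ : ℝ → Fin d ⊕ Fin d → ℝ) (k n : ℕ) (t : Fin (n + 1) → ℝ) :
    linD κ k (n + 1) t = ∑ a, κ (t 0) a • MvPolynomial.X (k, a) + linD κ (k + 1) n (Fin.tail t) := by
  simp only [linD, Fin.sum_univ_succ, Fin.val_zero, Fin.val_succ, Nat.add_zero, Fin.tail]
  congr 1
  exact Finset.sum_congr rfl fun i _ => by rw [show k + (i.val + 1) = k + 1 + i by omega]

variable {K : ℝ → Fin d ⊕ Fin d → ℝ → Fin d ⊕ Fin d → ℝ}

theorem sum_X_mul_linD (hK : ∀ s a s' a', K s a s' a' = K s' a' s a) (k n : ℕ) (t : Fin n → ℝ)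
    (s : ℝ) (k' : ℕ) : ∑ i : Fin n, ∑ a, MvPolynomial.X (k + i.val, a) *
      (∑ a', K (t i) a s a' • MvPolynomial.X (k', a') : DOp d) =
      ∑ a', MvPolynomial.X (k', a') * linD (K s a') k n t := by
  simp only [linD, Finset.mul_sum]
  calc _ = ∑ i : Fin n, ∑ a', ∑ a, MvPolynomial.X (k + i.val, a) *
        (K (t i) a s a' • MvPolynomial.X (k', a') : DOp d) :=
        Finset.sum_congr rfl fun _ _ => Finset.sum_comm
    _ = ∑ a', ∑ i : Fin n, ∑ a, MvPolynomial.X (k + i.val, a) *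
        (K (t i) a s a' • MvPolynomial.X (k', a') : DOp d) := Finset.sum_comm
    _ = _ := Finset.sum_congr rfl fun a' _ => Finset.sum_congr rfl fun i _ =>
        Finset.sum_congr rfl fun a _ => by
          rw [hK, mul_smul_comm, mul_smul_comm, mul_comm]

theorem wickD_succ (hK : ∀ s a s' a', K s a s' a' = K s' a' s a) (k n : ℕ) (t : Fin (n + 1) → ℝ) :
    wickD K k (n + 1) t = (1 / 2 : ℝ) • ∑ a, ∑ a', K (t 0) a (t 0) a' •
        (MvPolynomial.X (k, a) * MvPolynomial.X (k, a')) +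
      ∑ a, MvPolynomial.X (k, a) * linD (K (t 0) a) (k + 1) n (Fin.tail t) +
      wickD K (k + 1) n (Fin.tail t) := by
  have e : ∀ (i : Fin n) (a : Fin d ⊕ Fin d), (MvPolynomial.X (k + (i.val + 1), a) : DOp d) =
      MvPolynomial.X (k + 1 + i.val, a) := fun i a => by
    rw [show k + (i.val + 1) = k + 1 + i.val by omega]
  have h := sum_X_mul_linD hK (k + 1) n (Fin.tail t) (t 0) k
  simp only [Fin.tail] at h
  simp only [wickD, Fin.sum_univ_succ, Fin.val_zero, Fin.val_succ, Nat.add_zero, linD_succ, mul_add,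
    Finset.sum_add_distrib, e, Fin.tail]
  rw [h]
  simp only [Finset.mul_sum, mul_smul_comm]
  generalize ∑ a, MvPolynomial.X (k, a) * linD (K (t 0) a) (k + 1) n _ = A
  module

variable {O}

theorem vopProd_mul_quadratic {b : E} {l : ℝ → Fin d ⊕ Fin d → E}
    (hK : ∀ s a s' a', K s a s' a' = K s' a' s a)
    (hl : ∀ s F s' a', O s F * l s' a' = l s' a' * O s F +
      ∑ a, K s' a' s a • O s (Vert.der a F))
    (hb : ∀ s F, O s F * b = b * O s F + ∑ a, l s a * O s (Vert.der a F) +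
      (1 / 2 : ℝ) • ∑ a, ∑ a', K s a s a' • O s (Vert.der a' (Vert.der a F))) (k n : ℕ)
    (t : Fin n → ℝ) (G : ℕ → Vert d 𝔸) :
    vopProd O k n t G * b = b * vopProd O k n t G +
      ∑ i : Fin n, ∑ a, l (t i) a * act (MvPolynomial.X (k + i.val, a)) (vopProd O k n t) G +
      act (wickD K k n t) (vopProd O k n t) G := by
  induction n generalizing k with
  | zero => simp [vopProd, wickD]
  | succ n ih =>
    have hX : ∀ a, act (MvPolynomial.X (k, a)) (vopProd O k (n + 1) t) G =
        O (t 0) (Vert.der a (G k)) * vopProd O (k + 1) n (Fin.tail t) G := fun a => by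
      have := act_X_vopProd O k n t a 1 (Subalgebra.one_mem _) G
      rwa [mul_one, act_one] at this
    have hXX : ∀ a a', act (MvPolynomial.X (k, a) * MvPolynomial.X (k, a')) (vopProd O k (n + 1) t) G =
        O (t 0) (Vert.der a' (Vert.der a (G k))) * vopProd O (k + 1) n (Fin.tail t) G := fun a a' => by
      rw [act_mul, act_X]
      have := act_X_vopProd O k n t a' 1 (Subalgebra.one_mem _)
        (Function.update G k (Vert.der a (G k)))
      rw [mul_one, act_one, Function.update_self, vopProd_indep O (k + 1) n _ (Nat.lt_succ_self k)] at this
      exact this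
    have hXo : ∀ (i : Fin n) a, act (MvPolynomial.X (k + i.succ.val, a)) (vopProd O k (n + 1) t) G =
        O (t 0) (G k) * act (MvPolynomial.X (k + 1 + i.val, a)) (vopProd O (k + 1) n (Fin.tail t)) G :=
      fun i a => by
        rw [Fin.val_succ, show k + (i.val + 1) = k + 1 + i.val by omega]
        exact act_off_vopProd O k n t _ (X_mem_off (by dsimp only; omega)) G
    have hXl : ∀ a, act (MvPolynomial.X (k, a) * linD (K (t 0) a) (k + 1) n (Fin.tail t))
        (vopProd O k (n + 1) t) G = O (t 0) (Vert.der a (G k)) *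
          act (linD (K (t 0) a) (k + 1) n (Fin.tail t)) (vopProd O (k + 1) n (Fin.tail t)) G := fun a =>
      act_X_vopProd O k n t a _ (linD_mem_off _ n _ (Nat.lt_succ_self k)) G
    have hw := act_off_vopProd O k n t _ (wickD_mem_off K n (Fin.tail t) (Nat.lt_succ_self k)) G
    set P := vopProd O (k + 1) n (Fin.tail t) with hP
    have h0 : vopProd O k (n + 1) t G = O (t 0) (G k) * P G := rfl
    rw [wickD_succ hK, act_add, act_add, Pi.add_apply, Pi.add_apply, hw, act_smul, act_sum, act_sum,
      Fin.sum_univ_succ, Fin.val_zero, add_zero k, Pi.smul_apply, Finset.sum_apply, Finset.sum_apply]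
    simp only [act_sum, Finset.sum_apply, act_smul, Pi.smul_apply, hX, hXX, hXo, hXl, h0]
    rw [mul_assoc, ih, mul_add, mul_add, ← mul_assoc, hb, add_mul, add_mul]
    have e1 : O (t 0) (G k) * ∑ i : Fin n, ∑ a, l (Fin.tail t i) a *
        act (MvPolynomial.X (k + 1 + i.val, a)) P G =
        ∑ i : Fin n, ∑ a, l (t i.succ) a * (O (t 0) (G k) * act (MvPolynomial.X (k + 1 + i.val, a)) P G) +
        ∑ a, O (t 0) (Vert.der a (G k)) * act (linD (K (t 0) a) (k + 1) n (Fin.tail t)) P G := by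
      have e2 : ∑ a, O (t 0) (Vert.der a (G k)) * act (linD (K (t 0) a) (k + 1) n (Fin.tail t)) P G =
          ∑ i : Fin n, ∑ a, (∑ a', K (t i.succ) a (t 0) a' • O (t 0) (Vert.der a' (G k))) *
            act (MvPolynomial.X (k + 1 + i.val, a)) P G := by
        simp only [linD, act_sum, Finset.sum_apply, act_smul, Pi.smul_apply, Finset.mul_sum,
          Finset.sum_mul, mul_smul_comm, smul_mul_assoc, Fin.tail]
        rw [Finset.sum_comm]
        refine Finset.sum_congr rfl fun i _ => ?_
        rw [Finset.sum_comm]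
        exact Finset.sum_congr rfl fun _ _ => Finset.sum_congr rfl fun _ _ => by rw [hK]
      rw [e2, ← Finset.sum_add_distrib, Finset.mul_sum]
      refine Finset.sum_congr rfl fun i _ => ?_
      rw [← Finset.sum_add_distrib, Finset.mul_sum]
      refine Finset.sum_congr rfl fun a _ => ?_
      rw [← mul_assoc, Fin.tail, hl, add_mul, mul_assoc]
    rw [e1, smul_mul_assoc]
    simp only [Finset.sum_mul, smul_mul_assoc, mul_assoc]
    abel

end VopProd

/-! ### Contractions of operators on polynomial functionals -/

section VertOp

theorem add_smul_one_mul {E : Type} [Ring E] [Algebra ℝ E] {D l l' : E} (c : ℝ)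
    (h : D * l = l * D + l') : (D + c • 1) * l = l * (D + c • 1) + l' := by
  rw [add_mul, mul_add, h, smul_mul_assoc, mul_smul_comm, one_mul, mul_one]; abel

variable {H : Type} [NormedAddCommGroup H] [NormedSpace ℝ H]

namespace PolyFun

/-- A vertex at time `s` as an operator on functionals. -/
def vertOp (ξ : Sp d) (τ : ℝ) (h : ℝ → Fin d ⊕ Fin d → H) (s : ℝ) (F : Vert d 𝔸) :
    Module.End ℝ (PolyFun 𝔸 H) :=
  vop (tayL ((s / τ) • ξ) fun ν => h s (Sum.inl ν))
    (fun μ => D (h s (Sum.inr μ)) + (ξ μ / τ) • (1 : Module.End ℝ (PolyFun 𝔸 H))) F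

variable {ξ : Sp d} {τ : ℝ} {h : ℝ → Fin d ⊕ Fin d → H}

theorem vertOp_mul_mulLin (s : ℝ) (F : Vert d 𝔸) (l : H →L[ℝ] ℝ) :
    vertOp ξ τ h s F * mulLin l = mulLin l * vertOp ξ τ h s F +
      ∑ a, l (h s a) • vertOp ξ τ h s (Vert.der a F) :=
  vop_mul_linear (E := Module.End ℝ (PolyFun 𝔸 H)) (κ := fun a => l (h s a))
    (fun g => tay_mul_mulLin _ _ g l)
    (fun _ => add_smul_one_mul (E := Module.End ℝ (PolyFun 𝔸 H)) _ (D_mul_mulLin _ l)) F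

variable {B : H →L[ℝ] H →L[ℝ] ℝ} (hB : ∀ x y, B x y = B y x)

theorem vertOp_mul_mulQ (s : ℝ) (F : Vert d 𝔸) :
    vertOp ξ τ h s F * mulQ hB = mulQ hB * vertOp ξ τ h s F +
      ∑ a, mulLin (B (h s a)) * vertOp ξ τ h s (Vert.der a F) +
      (1 / 2 : ℝ) • ∑ a, ∑ a', B (h s a) (h s a') • vertOp ξ τ h s (Vert.der a' (Vert.der a F)) :=
  vop_mul_quadratic (E := Module.End ℝ (PolyFun 𝔸 H)) (l := fun a => mulLin (B (h s a)))
    (K := fun a a' => B (h s a) (h s a')) (fun _ _ => hB _ _)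
    (fun g => tay_mul_mulQ hB _ _ g) (fun g _ => tay_mul_mulLin _ _ g _)
    (fun _ => add_smul_one_mul (E := Module.End ℝ (PolyFun 𝔸 H)) _ (D_mul_mulQ hB _)) F

/-- The constant functional. -/
def const (a : 𝔸) : PolyFun 𝔸 H := ⟨fun _ => a, 1, contDiff_const, fun v => by
  funext x; simp⟩

theorem D_const (v : H) (a : 𝔸) : D v (const a) = 0 := PolyFun.ext fun x => by
  change fderiv ℝ (fun _ => a) x v = 0
  simp

theorem tay_const (p : Sp d) (k : Fin d → H) (g : Sm d 𝔸) (a : 𝔸) :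
    tay p k g (const a) = const (g.1 p * a) := by
  rw [tay_apply p k g (N := 1) ⟨contDiff_const, fun v => by funext x; simp [const]⟩,
    Finset.sum_range_one, Nat.factorial_zero, Nat.cast_one, inv_one, one_smul]
  rfl

/-- On constants all derivatives vanish. What remains is the vertex at the position `(s/τ)ξ` and
with the velocity `ξ/τ` of the straight path. -/
theorem vertOp_const (s : ℝ) (F : Vert d 𝔸) (a : 𝔸) :
    vertOp ξ τ h s F (const a) = const ((Vert.val (s / τ) (1 / τ) F).1 ξ * a) := by
  have e : ∀ μ, (tayL ((s / τ) • ξ) (fun ν => h s (Sum.inl ν)) (F.1 μ) *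
      (D (h s (Sum.inr μ)) + (ξ μ / τ) • 1) : Module.End ℝ (PolyFun 𝔸 H)) (const a) =
      (ξ μ / τ) • const ((F.1 μ).1 ((s / τ) • ξ) * a) := fun μ => by
    change tay _ _ (F.1 μ) (D (h s (Sum.inr μ)) (const a) + (ξ μ / τ) • const a) = _
    rw [D_const, zero_add, map_smul, tay_const]
  rw [vertOp, vop, LinearMap.sub_apply, LinearMap.sum_apply, Finset.sum_congr rfl fun μ _ => e μ]
  change tay _ _ F.2 (const a) - _ = _
  rw [tay_const]
  refine PolyFun.ext fun x => ?_
  have e2 : (∑ μ, (ξ μ / τ) • const (H := H) ((F.1 μ).1 ((s / τ) • ξ) * a) : PolyFun 𝔸 H).1 x =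
      ∑ μ, (ξ μ / τ) • ((F.1 μ).1 ((s / τ) • ξ) * a) := by
    rw [Submodule.coe_sum, Finset.sum_apply]; rfl
  have e3 : (Vert.val (s / τ) (1 / τ) F).1 ξ = F.2.1 ((s / τ) • ξ) -
      (1 / τ) • ∑ μ, ξ μ • (F.1 μ).1 ((s / τ) • ξ) := by
    rw [Sm.val_eq_ev, Vert.val_apply, map_sub, map_smul, map_sum]
    congr 2
    refine Finset.sum_congr rfl fun μ _ => ?_
    simp [Sm.ev_apply, Sm.coord, Sm.dil_apply]
  refine (congrArg (F.2.1 ((s / τ) • ξ) * a - ·) e2).trans ?_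
  change F.2.1 ((s / τ) • ξ) * a - _ = (Vert.val (s / τ) (1 / τ) F).1 ξ * a
  rw [e3, sub_mul, Finset.smul_sum, Finset.sum_mul]
  simp only [smul_smul, smul_mul_assoc, div_eq_inv_mul, mul_one]

theorem vopProd_const (k n : ℕ) (t : Fin n → ℝ) (G : ℕ → Vert d 𝔸) :
    vopProd (vertOp ξ τ h) k n t G (const 1) = const ((prodV τ k n t G).1 ξ) := by
  induction n generalizing k with
  | zero => rfl
  | succ n ih =>
    change vertOp ξ τ h (t 0) (G k) (vopProd (vertOp ξ τ h) (k + 1) n (Fin.tail t) G (const 1)) = _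
    rw [ih, vertOp_const]; rfl

/-- At the origin the quadratic form and the linear functionals vanish, so only the complete
contraction survives. Multiplication by `b` under the product thus becomes the formal operator
`wickD`. -/
theorem vopProd_mulQ_apply (n : ℕ) (t : Fin n → ℝ) (q : PolyFun 𝔸 H) :
    (fun G => (vopProd (vertOp ξ τ h) 0 n t G (mulQ hB q)).1 0) =
      act (wickD (fun s a s' a' => B (h s a) (h s' a')) 0 n t)
        fun G => (vopProd (vertOp ξ τ h) 0 n t G q).1 0 := by
  let O : Module.End ℝ (PolyFun 𝔸 H) →ₗ[ℝ] 𝔸 :=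
    { toFun := fun A => (A q).1 0
      map_add' := fun _ _ => rfl
      map_smul' := fun _ _ => rfl }
  have hO := act_post O (wickD (fun s a s' a' => B (h s a) (h s' a')) 0 n t)
    (vopProd (vertOp (𝔸 := 𝔸) ξ τ h) 0 n t)
  refine Eq.trans ?_ hO.symm
  funext G
  have := vopProd_mul_quadratic (E := Module.End ℝ (PolyFun 𝔸 H)) (O := vertOp ξ τ h)
    (l := fun s a => mulLin (B (h s a))) (K := fun s a s' a' => B (h s a) (h s' a'))
    (fun _ _ _ _ => hB _ _) (fun s F s' a' => vertOp_mul_mulLin s F _)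
    (fun s F => vertOp_mul_mulQ hB s F) 0 n t G
  have h2 := congrArg O this
  rw [map_add, map_add, map_sum] at h2
  have z1 : O (mulQ hB * vopProd (vertOp ξ τ h) 0 n t G) = 0 := by
    change qform B 0 • (_ : 𝔸) = 0
    rw [qform, map_zero, mul_zero, zero_smul]
  have z2 : ∀ i : Fin n, O (∑ a, mulLin (B (h (t i) a)) *
      act (MvPolynomial.X (0 + i.val, a)) (vopProd (vertOp ξ τ h) 0 n t) G) = 0 := fun i => by
    rw [map_sum]
    refine Finset.sum_eq_zero fun a _ => ?_
    change B (h (t i) a) 0 • (_ : 𝔸) = 0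
    rw [map_zero, zero_smul]
  rw [z1, Finset.sum_congr rfl fun i _ => z2 i, Finset.sum_const_zero, add_zero, zero_add] at h2
  exact h2

theorem vopProd_mulQ_pow_apply (n j : ℕ) (t : Fin n → ℝ) :
    (fun G : ℕ → Vert d 𝔸 => (vopProd (vertOp ξ τ h) 0 n t G ((mulQ hB ^ j) (const 1))).1 0) =
      act (wickD (fun s a s' a' => B (h s a) (h s' a')) 0 n t ^ j) (prodAt τ ξ n t) := by
  induction j with
  | zero =>
    rw [pow_zero, pow_zero, act_one]
    funext G
    change (vopProd (vertOp ξ τ h) 0 n t G (const 1)).1 0 = _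
    rw [vopProd_const]; rfl
  | succ j ih =>
    rw [pow_succ', pow_succ', act_mul, ← ih, ← vopProd_mulQ_apply hB]; rfl

end PolyFun

end VertOp

/-! ### The quadratic form of Green's function -/

theorem continuous_green (τ : ℝ) : Continuous fun p : ℝ × ℝ => green τ p.1 p.2 := by
  have h : (fun p : ℝ × ℝ => green τ p.1 p.2) =
      fun p => 2 * min p.1 p.2 / τ * (τ - max p.1 p.2) := by
    funext p
    rw [green]
    split_ifs with h
    · rw [min_eq_left h, max_eq_right h]
    · rw [min_eq_right (le_of_not_ge h), max_eq_left (le_of_not_ge h)]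
  rw [h]; fun_prop

theorem abs_green_le {τ s t : ℝ} (hs : s ∈ Set.Icc 0 τ) (ht : t ∈ Set.Icc 0 τ) :
    |green τ s t| ≤ 2 * τ := by
  have key : ∀ a b : ℝ, a ∈ Set.Icc 0 τ → b ∈ Set.Icc 0 τ → |2 * a / τ * (τ - b)| ≤ 2 * τ := by
    rintro a b ⟨h1, h2⟩ ⟨h3, h4⟩
    have h0 : 0 ≤ τ := h1.trans h2
    rw [abs_of_nonneg (mul_nonneg (by positivity) (by linarith))]
    have h5 : 2 * a / τ ≤ 2 := div_le_of_le_mul₀ h0 (by norm_num) (by linarith)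
    exact mul_le_mul h5 (by linarith) (by linarith) (by norm_num)
  rw [green]
  split_ifs
  · exact key s t hs ht
  · exact key t s ht hs

/-- The primitive of `-χ` on `[0, τ]` of mean zero. -/
def primOf (χ : ℝ → ℝ) (τ s : ℝ) : ℝ :=
  (∫ u in s..τ, χ u) - (∫ u in (0 : ℝ)..τ, u * χ u) / τ

section Scalar

variable {χ ψ : ℝ → ℝ} {τ : ℝ}

theorem hasDerivAt_integral_right (hχ : Continuous χ) (s : ℝ) :
    HasDerivAt (fun s => ∫ u in s..τ, χ u) (-χ s) s :=
  intervalIntegral.integral_hasDerivAt_left (hχ.intervalIntegrable _ _)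
    hχ.stronglyMeasurable.stronglyMeasurableAtFilter hχ.continuousAt

theorem hasDerivAt_primOf (hχ : Continuous χ) (s : ℝ) : HasDerivAt (primOf χ τ) (-χ s) s :=
  (hasDerivAt_integral_right hχ s).sub_const _

theorem continuous_primOf (hχ : Continuous χ) : Continuous (primOf χ τ) :=
  continuous_iff_continuousAt.2 fun s => (hasDerivAt_primOf hχ s).continuousAt

/-- Integration by parts against `s`. Mean zero encodes the Dirichlet conditions and removes the
constant part of the velocity covariances. -/
theorem integral_primOf (hτ : τ ≠ 0) (hχ : Continuous χ) : ∫ s in (0 : ℝ)..τ, primOf χ τ s = 0 := by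
  have h := intervalIntegral.integral_mul_deriv_eq_deriv_mul (a := 0) (b := τ)
    (u := primOf χ τ) (v := fun s => s) (u' := fun s => -χ s) (v' := fun _ => 1)
    (fun s _ => hasDerivAt_primOf hχ s) (fun s _ => hasDerivAt_id s)
    (hχ.neg.intervalIntegrable _ _) intervalIntegrable_const
  simp only [mul_one, mul_zero, neg_mul, intervalIntegral.integral_neg] at h
  rw [h, primOf, intervalIntegral.integral_same]
  have e : ∫ s in (0 : ℝ)..τ, χ s * s = ∫ s in (0 : ℝ)..τ, s * χ s :=
    intervalIntegral.integral_congr fun s _ => mul_comm _ _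
  rw [e]
  field_simp
  ring

theorem integral_green (hψ : Continuous ψ) {s : ℝ} (hs : s ∈ Set.Icc 0 τ) :
    ∫ t in (0 : ℝ)..τ, green τ s t * ψ t = 2 / τ * ((τ - s) * (∫ t in (0 : ℝ)..s, t * ψ t) +
      s * ∫ t in s..τ, (τ - t) * ψ t) := by
  have hg : Continuous fun t => green τ s t * ψ t :=
    ((continuous_green τ).comp (Continuous.prodMk_right s)).mul hψ
  rw [← intervalIntegral.integral_add_adjacent_intervals (hg.intervalIntegrable 0 s)
    (hg.intervalIntegrable s τ), mul_add, ← mul_assoc, ← mul_assoc,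
    ← intervalIntegral.integral_const_mul, ← intervalIntegral.integral_const_mul]
  congr 1
  · refine intervalIntegral.integral_congr fun t ht => ?_
    rw [Set.uIcc_of_le hs.1] at ht
    rw [green]
    split_ifs with h
    · obtain rfl := le_antisymm h ht.2
      ring
    · ring
  · refine intervalIntegral.integral_congr fun t ht => ?_
    rw [Set.uIcc_of_le hs.2] at ht
    rw [green, if_pos ht.1]
    ring

/-- The inner integral `U` solves `-½U'' = ψ`; its derivative is twice the mean-zero primitive of
`ψ`, and it vanishes at both ends. Integration by parts against the primitive of `χ` symmetrises the
form, with `2` in place of the Green kernel. -/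
theorem integral_mul_integral_green (hτ : 0 < τ) (hχ : Continuous χ) (hψ : Continuous ψ) :
    ∫ s in (0 : ℝ)..τ, χ s * ∫ t in (0 : ℝ)..τ, green τ s t * ψ t =
      2 * ∫ s in (0 : ℝ)..τ, primOf χ τ s * primOf ψ τ s := by
  let U : ℝ → ℝ := fun s => 2 / τ * ((τ - s) * (∫ t in (0 : ℝ)..s, t * ψ t) +
      s * ∫ t in s..τ, (τ - t) * ψ t)
  have h1 : Continuous fun t => t * ψ t := continuous_id.mul hψ
  have h2 : Continuous fun t => (τ - t) * ψ t := (continuous_const.sub continuous_id).mul hψ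
  have hU : ∀ s, HasDerivAt U (2 * primOf ψ τ s) s := by
    intro s
    have d1 : HasDerivAt (fun s => ∫ t in (0 : ℝ)..s, t * ψ t) (s * ψ s) s :=
      h1.integral_hasStrictDerivAt 0 s |>.hasDerivAt
    have d2 := ((((hasDerivAt_id s).const_sub τ).mul d1).add
      ((hasDerivAt_id s).mul (hasDerivAt_integral_right (τ := τ) h2 s))).const_mul (2 / τ)
    refine (show HasDerivAt U _ s from d2).congr_deriv (Eq.symm ?_)
    have e1 : ∫ t in s..τ, (τ - t) * ψ t = τ * (∫ t in s..τ, ψ t) - ∫ t in s..τ, t * ψ t := by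
      rw [← intervalIntegral.integral_const_mul, ← intervalIntegral.integral_sub
        ((hψ.const_mul τ).intervalIntegrable _ _) (h1.intervalIntegrable _ _)]
      exact intervalIntegral.integral_congr fun t _ => by ring
    have e2 := intervalIntegral.integral_add_adjacent_intervals (h1.intervalIntegrable 0 s)
      (h1.intervalIntegrable (μ := volume) s τ)
    change 2 * ((∫ t in s..τ, ψ t) - (∫ t in (0 : ℝ)..τ, t * ψ t) / τ) = 2 / τ * ((-1 * (∫ t in (0 : ℝ)..s, t * ψ t) +
      (τ - s) * (s * ψ s)) + (1 * (∫ t in s..τ, (τ - t) * ψ t) + s * -((τ - s) * ψ s)))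
    rw [e1, ← e2]
    field_simp
    ring
  have e : ∀ s ∈ Set.uIcc 0 τ, χ s * (∫ t in (0 : ℝ)..τ, green τ s t * ψ t) = χ s * U s := by
    intro s hs
    rw [Set.uIcc_of_le hτ.le] at hs
    rw [integral_green hψ hs]
  rw [intervalIntegral.integral_congr e]
  have h := intervalIntegral.integral_mul_deriv_eq_deriv_mul (a := 0) (b := τ)
    (u := primOf χ τ) (v := U) (u' := fun s => -χ s) (v' := fun s => 2 * primOf ψ τ s)
    (fun s _ => hasDerivAt_primOf hχ s) (fun s _ => hU s)
    (hχ.neg.intervalIntegrable _ _) (((continuous_primOf hψ).const_mul 2).intervalIntegrable _ _)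
  have u0 : U 0 = 0 := by simp [U]
  have u1 : U τ = 0 := by simp [U]
  simp only [u0, u1, mul_zero, sub_zero, neg_mul, intervalIntegral.integral_neg, zero_sub, neg_neg] at h
  rw [← h, ← intervalIntegral.integral_const_mul]
  exact intervalIntegral.integral_congr fun s _ => by ring

end Scalar

/-! ### The covariance as a bilinear form -/

section Covariance

open scoped BoundedContinuousFunction

/-- The covariance `∫∫ x_μ(s) g(s,t) y_μ(t)`. -/
def greenForm (τ : ℝ) (x y : ℝ → Sp d) : ℝ :=
  ∫ s in (0 : ℝ)..τ, ∫ t in (0 : ℝ)..τ, ∑ μ, x s μ * green τ s t * y t μ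

variable {τ : ℝ}

theorem continuous_coord {x : ℝ → Sp d} (hx : Continuous x) (μ : Fin d) : Continuous fun s => x s μ :=
  (EuclideanSpace.proj (𝕜 := ℝ) μ).continuous.comp hx

theorem continuous_greenForm_integrand {x y : ℝ → Sp d} (hx : Continuous x) (hy : Continuous y)
    (μ : Fin d) : Continuous fun p : ℝ × ℝ => x p.1 μ * green τ p.1 p.2 * y p.2 μ :=
  (((continuous_coord hx μ).comp continuous_fst).mul (continuous_green τ)).mul
    ((continuous_coord hy μ).comp continuous_snd)

theorem greenForm_eq (hτ : 0 < τ) {x y : ℝ → Sp d} (hx : Continuous x) (hy : Continuous y) :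
    greenForm τ x y = ∑ μ, 2 * ∫ s in (0 : ℝ)..τ, primOf (fun s => x s μ) τ s *
      primOf (fun s => y s μ) τ s := by
  have hc := fun μ => continuous_greenForm_integrand (τ := τ) hx hy μ
  have h1 : ∀ s, ∫ t in (0 : ℝ)..τ, ∑ μ, x s μ * green τ s t * y t μ =
      ∑ μ, x s μ * ∫ t in (0 : ℝ)..τ, green τ s t * y t μ := fun s => by
    have hs : ∀ μ, Continuous fun t => x s μ * green τ s t * y t μ := fun μ =>
      (hc μ).comp (Continuous.prodMk_right s)
    rw [intervalIntegral.integral_finsetSum fun μ _ => (hs μ).intervalIntegrable _ _]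
    refine Finset.sum_congr rfl fun μ _ => ?_
    rw [← intervalIntegral.integral_const_mul]
    simp only [mul_assoc]
  have h2 : ∀ μ, Continuous fun s => x s μ * ∫ t in (0 : ℝ)..τ, green τ s t * y t μ := fun μ =>
    (continuous_coord hx μ).mul
      (intervalIntegral.continuous_parametric_intervalIntegral_of_continuous'
        ((continuous_green τ).mul ((continuous_coord hy μ).comp continuous_snd)) 0 τ)
  rw [greenForm]
  simp only [h1]
  rw [intervalIntegral.integral_finsetSum fun μ _ => (h2 μ).intervalIntegrable _ _]
  exact Finset.sum_congr rfl fun μ _ =>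
    integral_mul_integral_green hτ (continuous_coord hx μ) (continuous_coord hy μ)

theorem greenForm_comm (hτ : 0 < τ) {x y : ℝ → Sp d} (hx : Continuous x) (hy : Continuous y) :
    greenForm τ x y = greenForm τ y x := by
  rw [greenForm_eq hτ hx hy, greenForm_eq hτ hy hx]
  simp only [mul_comm (primOf (fun s => x s _) τ _)]

theorem continuous_sum_greenForm {x y : ℝ → Sp d} (hx : Continuous x) (hy : Continuous y) :
    Continuous fun p : ℝ × ℝ => ∑ μ, x p.1 μ * green τ p.1 p.2 * y p.2 μ :=
  continuous_finsetSum _ fun μ _ => continuous_greenForm_integrand hx hy μ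

theorem greenForm_add_left {x x' y : ℝ → Sp d} (hx : Continuous x) (hx' : Continuous x')
    (hy : Continuous y) : greenForm τ (x + x') y = greenForm τ x y + greenForm τ x' y := by
  have c := continuous_sum_greenForm (τ := τ) hx hy
  have c' := continuous_sum_greenForm (τ := τ) hx' hy
  rw [greenForm, greenForm, greenForm, ← intervalIntegral.integral_add
    ((intervalIntegral.continuous_parametric_intervalIntegral_of_continuous' c 0 τ).intervalIntegrable _ _)
    ((intervalIntegral.continuous_parametric_intervalIntegral_of_continuous' c' 0 τ).intervalIntegrable _ _)]
  refine intervalIntegral.integral_congr fun s _ => ?_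
  have cs : Continuous fun t => ∑ μ, x s μ * green τ s t * y t μ :=
    c.comp (Continuous.prodMk_right s)
  have cs' : Continuous fun t => ∑ μ, x' s μ * green τ s t * y t μ :=
    c'.comp (Continuous.prodMk_right s)
  dsimp only
  rw [← intervalIntegral.integral_add (cs.intervalIntegrable _ _) (cs'.intervalIntegrable _ _)]
  refine intervalIntegral.integral_congr fun t _ => ?_
  simp only [Pi.add_apply, PiLp.add_apply, add_mul, Finset.sum_add_distrib]

theorem greenForm_smul_left (r : ℝ) (x y : ℝ → Sp d) :
    greenForm τ (r • x) y = r * greenForm τ x y := by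
  simp only [greenForm, ← intervalIntegral.integral_const_mul, Finset.mul_sum, Pi.smul_apply,
    PiLp.smul_apply, smul_eq_mul, mul_assoc]

theorem abs_greenForm_le (hτ : 0 < τ) (x y : ℝ →ᵇ Sp d) :
    |greenForm τ x y| ≤ d * (2 * τ) * τ * τ * ‖x‖ * ‖y‖ := by
  have hb : ∀ s ∈ Set.Icc 0 τ, ∀ t ∈ Set.Icc 0 τ, ‖∑ μ, x s μ * green τ s t * y t μ‖ ≤
      d * (2 * τ) * ‖x‖ * ‖y‖ := by
    intro s hs t ht
    refine (norm_sum_le _ _).trans ?_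
    have : ∀ μ : Fin d, ‖x s μ * green τ s t * y t μ‖ ≤ ‖x‖ * (2 * τ) * ‖y‖ := fun μ => by
      rw [norm_mul, norm_mul]
      have h1 := (PiLp.norm_apply_le (x s) μ).trans (x.norm_coe_le_norm s)
      have h2 := (PiLp.norm_apply_le (y t) μ).trans (y.norm_coe_le_norm t)
      have h3 := abs_green_le hs ht
      exact mul_le_mul (mul_le_mul h1 h3 (abs_nonneg _) (norm_nonneg _)) h2 (norm_nonneg _)
        (by positivity)
    refine (Finset.sum_le_sum fun μ _ => this μ).trans (le_of_eq ?_)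
    rw [Finset.sum_const, Finset.card_univ, Fintype.card_fin, nsmul_eq_mul]
    ring
  have h1 : ∀ s ∈ Set.uIoc 0 τ, ‖∫ t in (0 : ℝ)..τ, ∑ μ, x s μ * green τ s t * y t μ‖ ≤
      d * (2 * τ) * ‖x‖ * ‖y‖ * |τ - 0| := fun s hs => by
    rw [Set.uIoc_of_le hτ.le] at hs
    refine intervalIntegral.norm_integral_le_of_norm_le_const fun t ht => ?_
    rw [Set.uIoc_of_le hτ.le] at ht
    exact hb s ⟨hs.1.le, hs.2⟩ t ⟨ht.1.le, ht.2⟩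
  refine (intervalIntegral.norm_integral_le_of_norm_le_const h1).trans (le_of_eq ?_)
  rw [sub_zero, abs_of_pos hτ]
  ring

/-- The covariance as a bounded bilinear form. -/
def greenB (hτ : 0 < τ) : (ℝ →ᵇ Sp d) →L[ℝ] (ℝ →ᵇ Sp d) →L[ℝ] ℝ :=
  LinearMap.mkContinuous₂ (LinearMap.mk₂ ℝ (fun x y : ℝ →ᵇ Sp d => greenForm τ x y)
    (fun x x' y => greenForm_add_left x.continuous x'.continuous y.continuous)
    (fun r x y => greenForm_smul_left r x y)
    (fun x y y' => by
      rw [greenForm_comm hτ x.continuous (y + y').continuous,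
        greenForm_comm hτ x.continuous y.continuous, greenForm_comm hτ x.continuous y'.continuous]
      exact greenForm_add_left y.continuous y'.continuous x.continuous)
    (fun r x y => by
      rw [greenForm_comm hτ x.continuous (r • y).continuous,
        greenForm_comm hτ x.continuous y.continuous]
      exact greenForm_smul_left r y x)) (d * (2 * τ) * τ * τ) fun x y => abs_greenForm_le hτ x y

theorem greenB_apply (hτ : 0 < τ) (x y : ℝ →ᵇ Sp d) : greenB hτ x y = greenForm τ x y := rfl

theorem greenB_comm (hτ : 0 < τ) (x y : ℝ →ᵇ Sp d) : greenB hτ x y = greenB hτ y x :=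
  greenForm_comm hτ x.continuous y.continuous

theorem greenForm_single (hτ : 0 < τ) {χ ψ : ℝ → ℝ} (hχ : Continuous χ) (hψ : Continuous ψ)
    (μ ν : Fin d) : greenForm τ (fun s => χ s • e μ) (fun s => ψ s • e ν) =
      if μ = ν then 2 * ∫ s in (0 : ℝ)..τ, primOf χ τ s * primOf ψ τ s else 0 := by
  have hz : ∀ s, primOf (fun _ => 0) τ s = 0 := fun s => by simp [primOf]
  have key : ∀ (θ : ℝ → ℝ) (μ α : Fin d), (fun s => (θ s • e μ : Sp d) α) =
      if α = μ then θ else fun _ => 0 := by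
    intro θ μ α
    funext s
    by_cases h : α = μ <;> simp [e, h]
  have c1 : Continuous fun s => χ s • (e μ : Sp d) := hχ.smul continuous_const
  have c2 : Continuous fun s => ψ s • (e ν : Sp d) := hψ.smul continuous_const
  rw [greenForm_eq hτ c1 c2]
  simp only [key]
  rw [Finset.sum_eq_single μ]
  · by_cases h : μ = ν
    · simp [h]
    · simp [h, hz]
  · intro α _ h
    simp [h, hz]
  · simp

end Covariance

/-! ### The directions of the functional derivatives -/

section Directions

open scoped BoundedContinuousFunction

variable {χ : ℝ → ℝ}

/-- The source `χ(· - t) e_μ`. -/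
def shiftDir (hχ : Continuous χ) (hs : HasCompactSupport χ) (μ : Fin d) (t : ℝ) : ℝ →ᵇ Sp d :=
  BoundedContinuousFunction.ofNormedAddCommGroup (fun s => χ (s - t) • e μ)
    ((hχ.comp (continuous_id.sub continuous_const)).smul continuous_const)
    (hs.exists_bound_of_continuous hχ).choose fun s => by
      rw [norm_smul, e, PiLp.norm_single, norm_one, mul_one]
      exact (hs.exists_bound_of_continuous hχ).choose_spec (s - t)

/-- The derivative is smooth with compact support, hence Lipschitz. This makes the remainder
quadratic uniformly in the base point. -/
theorem exists_abs_sub_sub_le (hχ : ContDiff ℝ ∞ χ) (hs : HasCompactSupport χ) :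
    ∃ C : ℝ, 0 ≤ C ∧ ∀ u v : ℝ, |χ v - χ u - (v - u) * deriv χ u| ≤ C * (v - u) ^ 2 := by
  have h' : ContDiff ℝ ∞ (deriv χ) := (contDiff_infty_iff_deriv.1 hχ).2
  obtain ⟨C, hC⟩ := h'.lipschitzWith_of_hasCompactSupport hs.deriv (by norm_num)
  refine ⟨C, C.2, fun u v => ?_⟩
  have hd : ∀ y, HasDerivAt (fun y => χ y - y * deriv χ u) (deriv χ y - deriv χ u) y := fun y => by
    have h1 := ((hχ.differentiable (by norm_num)) y).hasDerivAt
    have h2 := (hasDerivAt_id y).mul_const (deriv χ u)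
    exact (h1.sub h2).congr_deriv (by ring)
  have := Convex.norm_image_sub_le_of_norm_hasDerivWithin_le (s := Set.uIcc u v)
    (f := fun y => χ y - y * deriv χ u) (f' := fun y => deriv χ y - deriv χ u) (C := C * |v - u|)
    (fun y _ => (hd y).hasDerivWithinAt) (fun y hy => ?_) (convex_uIcc u v) Set.left_mem_uIcc
    Set.right_mem_uIcc
  · rw [Real.norm_eq_abs, Real.norm_eq_abs, mul_assoc, abs_mul_abs_self] at this
    rw [pow_two]
    refine le_of_eq_of_le (congrArg _ ?_) this
    ring
  · refine (hC.norm_sub_le y u).trans (mul_le_mul_of_nonneg_left ?_ C.2)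
    exact Set.abs_sub_left_of_mem_uIcc hy

/-- Differentiability of the translates in the supremum norm. It allows `d/dt` to be moved from the
functional derivative to its direction. -/
theorem hasDerivAt_shiftDir (hχ : ContDiff ℝ ∞ χ) (hs : HasCompactSupport χ)
    (hχ' : Continuous fun s => -deriv χ s) (hs' : HasCompactSupport fun s => -deriv χ s)
    (μ : Fin d) (t : ℝ) :
    HasDerivAt (shiftDir hχ.continuous hs μ) (shiftDir hχ' hs' μ t) t := by
  obtain ⟨C, hC0, hC⟩ := exists_abs_sub_sub_le hχ hs
  rw [hasDerivAt_iff_isLittleO]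
  refine (Asymptotics.IsBigO.of_bound C (Eventually.of_forall fun r => ?_)).trans_isLittleO
    (Asymptotics.isLittleO_pow_sub_sub t (m := 2) (by norm_num))
  rw [BoundedContinuousFunction.norm_le (by positivity)]
  intro s
  have e1 : (shiftDir hχ.continuous hs μ r - shiftDir hχ.continuous hs μ t -
      (r - t) • shiftDir hχ' hs' μ t) s = (χ (s - r) - χ (s - t) -
        ((s - r) - (s - t)) * deriv χ (s - t)) • (e μ : Sp d) := by
    change χ (s - r) • e μ - χ (s - t) • e μ - (r - t) • (-deriv χ (s - t)) • e μ = _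
    module
  rw [e1, norm_smul, e, PiLp.norm_single, norm_one, mul_one, Real.norm_eq_abs,
    Real.norm_eq_abs, Real.norm_eq_abs, sq_abs, abs_of_nonneg (sq_nonneg (r - t))]
  refine (hC (s - t) (s - r)).trans (le_of_eq ?_)
  ring

end Directions

/-! ### Covariances of the regularised directions. -/

namespace IsBump

open scoped BoundedContinuousFunction

variable {D : ℝ → ℝ} {r : ℝ} (hD : IsBump D r)

include hD

theorem hasCompactSupport : HasCompactSupport D :=
  HasCompactSupport.intro (isCompact_Icc (a := -r) (b := r)) fun v hv => hD.supp v (by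
    by_contra h
    rw [not_le, abs_lt] at h
    exact hv ⟨h.1.le, h.2.le⟩)

theorem continuous_neg_deriv : Continuous fun s => -deriv D s :=
  ((contDiff_infty_iff_deriv.1 hD.smooth).2.continuous).neg

theorem hasCompactSupport_neg_deriv : HasCompactSupport fun s => -deriv D s :=
  hD.hasCompactSupport.deriv.comp_left (g := Neg.neg) neg_zero

/-- The directions of `δ/δη_μ(t)` and of its derivative in `t`. -/
def dir (t : ℝ) : Fin d ⊕ Fin d → ℝ →ᵇ Sp d
  | Sum.inl μ => shiftDir hD.continuous hD.hasCompactSupport μ t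
  | Sum.inr μ => shiftDir hD.continuous_neg_deriv hD.hasCompactSupport_neg_deriv μ t

theorem hasDerivAt_dir (μ : Fin d) (t : ℝ) :
    HasDerivAt (fun t => hD.dir t (Sum.inl μ)) (hD.dir t (Sum.inr μ)) t :=
  hasDerivAt_shiftDir hD.smooth hD.hasCompactSupport hD.continuous_neg_deriv
    hD.hasCompactSupport_neg_deriv μ t

variable {τ : ℝ} (hτ : 0 < τ)

include hτ

/-- The direction of the velocity is minus the derivative of the bump, so its primitive is the bump
itself, corrected to mean zero on `[0, τ]`. The boundary terms at `τ` cancel. -/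
theorem primOf_neg_deriv (t s : ℝ) :
    primOf (fun u => -deriv D (u - t)) τ s = D (s - t) - tail D τ t 0 / τ := by
  have hd : ∀ u, HasDerivAt (fun u => D (u - t)) (deriv D (u - t)) u := fun u =>
    ((hD.smooth.differentiable (by norm_num) (u - t)).hasDerivAt).comp_sub_const u t
  have hc : Continuous fun u => deriv D (u - t) :=
    (contDiff_infty_iff_deriv.1 hD.smooth).2.continuous.comp (continuous_id.sub continuous_const)
  have h1 : ∫ u in s..τ, -deriv D (u - t) = D (s - t) - D (τ - t) := by
    rw [intervalIntegral.integral_neg, intervalIntegral.integral_eq_sub_of_hasDerivAt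
      (fun u _ => hd u) (hc.intervalIntegrable _ _)]
    ring
  have h2 := intervalIntegral.integral_mul_deriv_eq_deriv_mul (a := 0) (b := τ)
    (u := fun u => u) (v := fun u => D (u - t)) (u' := fun _ => 1) (v' := fun u => deriv D (u - t))
    (fun u _ => hasDerivAt_id u) (fun u _ => hd u) intervalIntegrable_const (hc.intervalIntegrable _ _)
  simp only [zero_mul, sub_zero, one_mul] at h2
  have h3 : ∫ u in (0 : ℝ)..τ, u * -deriv D (u - t) = tail D τ t 0 - τ * D (τ - t) := by
    simp only [mul_neg, intervalIntegral.integral_neg, h2, tail]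
    ring
  rw [primOf, h1, h3]
  field_simp
  ring

theorem integral_prim (t : ℝ) : ∫ s in (0 : ℝ)..τ, prim D τ t s = 0 :=
  integral_primOf hτ.ne' (hD.continuous_sub t)

theorem integral_sub (t : ℝ) : ∫ s in (0 : ℝ)..τ, D (s - t) = tail D τ t 0 := rfl

/-- Inserts the primitives into the symmetrised Green form. In the mixed case the constant
correction drops out because the other primitive has mean zero; for two velocities it leaves the
term with `-2/τ`. -/
theorem greenB_dir (t t' : ℝ) (μ ν : Fin d) :
    greenB hτ (hD.dir t (Sum.inl μ)) (hD.dir t' (Sum.inl ν)) =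
        (if μ = ν then covXX D τ t t' else 0) ∧
      greenB hτ (hD.dir t (Sum.inr μ)) (hD.dir t' (Sum.inl ν)) =
        (if μ = ν then covVX D τ t t' else 0) ∧
      greenB hτ (hD.dir t (Sum.inr μ)) (hD.dir t' (Sum.inr ν)) =
        (if μ = ν then contactK D τ t t' - 2 / τ * (tail D τ t 0 * tail D τ t' 0) else 0) := by
  have c : ∀ t, Continuous fun s => D (s - t) := hD.continuous_sub
  have c' : ∀ t, Continuous fun s => -deriv D (s - t) := fun t =>
    hD.continuous_neg_deriv.comp (continuous_id.sub continuous_const)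
  have cp : Continuous (prim D τ t') := continuous_primOf (c t')
  refine ⟨?_, ?_, ?_⟩
  · rw [greenB_apply]
    exact greenForm_single hτ (c t) (c t') μ ν
  · rw [greenB_apply]
    refine (greenForm_single hτ (c' t) (c t') μ ν).trans ?_
    congr 1
    have e1 : ∀ s, primOf (fun s => -deriv D (s - t)) τ s * primOf (fun s => D (s - t')) τ s =
        D (s - t) * prim D τ t' s - tail D τ t 0 / τ * prim D τ t' s := fun s => by
      rw [hD.primOf_neg_deriv hτ, sub_mul]; rfl
    simp only [e1]
    have cm : Continuous fun s => D (s - t) * prim D τ t' s := (c t).mul cp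
    rw [intervalIntegral.integral_sub (cm.intervalIntegrable _ _)
      ((cp.const_mul _).intervalIntegrable _ _), intervalIntegral.integral_const_mul,
      hD.integral_prim hτ, mul_zero, sub_zero, covVX]
  · rw [greenB_apply]
    refine (greenForm_single hτ (c' t) (c' t') μ ν).trans ?_
    congr 1
    have e1 : ∀ s, primOf (fun s => -deriv D (s - t)) τ s * primOf (fun s => -deriv D (s - t')) τ s =
        D (s - t) * D (s - t') - (tail D τ t' 0 / τ * D (s - t) + tail D τ t 0 / τ * D (s - t')) +
          tail D τ t 0 / τ * (tail D τ t' 0 / τ) := fun s => by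
      rw [hD.primOf_neg_deriv hτ, hD.primOf_neg_deriv hτ]; ring
    simp only [e1]
    rw [intervalIntegral.integral_add, intervalIntegral.integral_sub, intervalIntegral.integral_add,
      intervalIntegral.integral_const_mul, intervalIntegral.integral_const_mul,
      intervalIntegral.integral_const, hD.integral_sub hτ, hD.integral_sub hτ, contactK, smul_eq_mul]
    · field_simp
      ring
    all_goals exact Continuous.intervalIntegrable (by have := hD.continuous; fun_prop) _ _

theorem wickD_greenB_dir (n : ℕ) (t : Fin n → ℝ) :
    wickD (fun s a s' a' => greenB hτ (hD.dir s a) (hD.dir s' a')) 0 n t =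
      fullQuad (d := d) D τ n t := by
  have hxx := fun t t' μ ν => (hD.greenB_dir (d := d) hτ t t' μ ν).1
  have hvx := fun t t' μ ν => (hD.greenB_dir (d := d) hτ t t' μ ν).2.1
  have hvv := fun t t' μ ν => (hD.greenB_dir (d := d) hτ t t' μ ν).2.2
  have hxv : ∀ t t' (μ ν : Fin d), greenB hτ (hD.dir t (Sum.inl μ)) (hD.dir t' (Sum.inr ν)) =
      if μ = ν then covVX D τ t' t else 0 := fun t t' μ ν => by
    rw [greenB_comm, hvx]; simp only [eq_comm]
  have key : ∀ i : Fin n, ∑ a, MvPolynomial.X (0 + i.val, a) *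
      linD (fun s' a' => greenB hτ (hD.dir (t i) a) (hD.dir s' a')) 0 n t =
      ∑ l : Fin n, (covXX D τ (t i) (t l) • xx (d := d) (0 + i) (0 + l) +
        (covVX D τ (t l) (t i) • wx (0 + l) (0 + i) + covVX D τ (t i) (t l) • wx (0 + i) (0 + l)) +
        (contactK D τ (t i) (t l) - 2 / τ * (tail D τ (t i) 0 * tail D τ (t l) 0)) •
          ww (0 + i) (0 + l)) := fun i => by
    simp only [linD, Finset.mul_sum]
    rw [Finset.sum_comm]
    refine Finset.sum_congr rfl fun l _ => ?_
    simp only [Fintype.sum_sum_type, hxx, hvx, hvv, hxv, ite_smul, zero_smul,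
      Finset.sum_add_distrib, Finset.sum_ite_eq, Finset.mem_univ, if_true, mul_smul_comm, xx, wx, ww,
      Finset.smul_sum]
    have : ∀ α : Fin d, w (0 + l.val) α * x (0 + i.val) α = x (0 + i.val) α * w (0 + l.val) α :=
      fun α => mul_comm _ _
    simp only [this]
    abel
  rw [wickD, Finset.sum_congr rfl fun i _ => key i, fullQuad, quad]
  simp only [Finset.sum_add_distrib]
  rw [Finset.sum_comm (f := fun i l : Fin n => covVX D τ (t l) (t i) • wx (d := d) (0 + l.val) (0 + i.val))]
  simp only [smul_add, Finset.smul_sum, smul_smul]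
  simp only [div_eq_inv_mul (_ : ℝ) 2, mul_one]
  have h2 : ∀ (c : ℝ) (p : DOp d), (2⁻¹ * c) • p + (2⁻¹ * c) • p = c • p := fun c p => by module
  simp only [← Finset.sum_add_distrib, h2]

end IsBump

/-! ### Taylor operators through iterated derivatives -/

section IteratedDeriv

theorem sum_snoc {M : Type} [AddCommMonoid M] {k : ℕ} (F : (Fin (k + 1) → Fin d) → M) :
    ∑ α, F α = ∑ ν : Fin d, ∑ β : Fin k → Fin d, F (Fin.snoc β ν) := by
  rw [← Fintype.sum_prod_type']
  exact (Fintype.sum_equiv (Fin.snocEquiv fun _ => Fin d) _ _ fun p => rfl).symm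

/-- Peels the last index, which is the derivative taken first. This matches the recursion of
`taylorN`, whereas the iterated functional derivatives are defined by peeling the first index. -/
theorem iteratedFDeriv_snoc (g : Sm d 𝔸) (p : Sp d) (k : ℕ) (β : Fin k → Fin d) (ν : Fin d) :
    iteratedFDeriv ℝ (k + 1) g.1 p (fun i => e ((Fin.snoc β ν : Fin (k + 1) → Fin d) i)) =
      iteratedFDeriv ℝ k (Sm.pdL ν g).1 p fun i => e (β i) := by
  have hg : ContDiff ℝ ∞ (fderiv ℝ g.1) := (contDiff_infty_iff_fderiv.1 (Sm.contDiff g)).2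
  rw [iteratedFDeriv_succ_apply_right]
  have h2 := (ContinuousLinearMap.apply ℝ 𝔸 (e ν : Sp d)).iteratedFDeriv_comp_left
    (f := fderiv ℝ g.1) (x := p) (i := k) (n := ∞) hg.contDiffAt (by exact_mod_cast le_top)
  have h3 : (⇑(ContinuousLinearMap.apply ℝ 𝔸 (e ν : Sp d)) ∘ fderiv ℝ g.1) = (Sm.pdL ν g).1 := rfl
  rw [h3] at h2
  rw [h2]
  simp [Fin.init_def]

variable {H : Type} [NormedAddCommGroup H] [NormedSpace ℝ H]

namespace PolyFun

/-- Iterated derivatives in the directions `h`. -/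
def iterD (h : Fin d → H) : (k : ℕ) → (Fin k → Fin d) → PolyFun 𝔸 H → PolyFun 𝔸 H
  | 0, _, q => q
  | k + 1, α, q => D (h (α 0)) (iterD h k (Fin.tail α) q)

theorem iterD_snoc (h : Fin d → H) (k : ℕ) (β : Fin k → Fin d) (ν : Fin d) (q : PolyFun 𝔸 H) :
    iterD h (k + 1) (Fin.snoc β ν : Fin (k + 1) → Fin d) q = iterD h k β (D (h ν) q) := by
  induction k with
  | zero =>
    have e0 : (Fin.snoc β ν : Fin 1 → Fin d) 0 = ν := Fin.snoc_last (α := fun _ => Fin d) ν β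
    change D (h ((Fin.snoc β ν : Fin 1 → Fin d) 0)) q = D (h ν) q
    rw [e0]
  | succ k ih =>
    have e1 : (Fin.snoc β ν : Fin (k + 2) → Fin d) 0 = β 0 :=
      Fin.snoc_castSucc (α := fun _ => Fin d) ν β 0
    have e2 : Fin.tail (Fin.snoc β ν : Fin (k + 2) → Fin d) = Fin.snoc (Fin.tail β) ν := by
      funext i
      refine Fin.lastCases ?_ (fun i => ?_) i
      · rw [Fin.tail, Fin.succ_last, Fin.snoc_last, Fin.snoc_last]
      · rw [Fin.tail, Fin.succ_castSucc, Fin.snoc_castSucc, Fin.snoc_castSucc]; rfl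
    change D (h ((Fin.snoc β ν : Fin (k + 2) → Fin d) 0))
      (iterD h (k + 1) (Fin.tail (Fin.snoc β ν : Fin (k + 2) → Fin d)) q) = _
    rw [e1, e2, ih]; rfl

theorem sum_iteratedFDeriv_mul (p : Sp d) (h : Fin d → H) (k : ℕ) (g : Sm d 𝔸) (q : PolyFun 𝔸 H)
    (x : H) : ∑ α : Fin k → Fin d, iteratedFDeriv ℝ k g.1 p (fun i => e (α i)) *
      (iterD h k α q).1 x = (tayN p h k g q).1 x := by
  induction k generalizing g q with
  | zero => simp [iterD, tayN, taylorN]; rfl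
  | succ k ih =>
    rw [sum_snoc]
    simp only [iteratedFDeriv_snoc, iterD_snoc, ih]
    have e1 : tayN p h (k + 1) g q = ∑ ν, tayN p h k (Sm.pdL ν g) (D (h ν) q) := by
      change (∑ ν, tayN p h k (Sm.pdL ν g) * D (h ν) : Module.End ℝ (PolyFun 𝔸 H)) q = _
      rw [LinearMap.sum_apply]; rfl
    rw [e1, Submodule.coe_sum, Finset.sum_apply]

/-- All terms beyond the degree of `q` vanish, so the infinite sum is finite and no convergence is
involved. -/
theorem tsum_taylor (p : Sp d) (h : Fin d → H) (g : Sm d 𝔸) (q : PolyFun 𝔸 H) (x : H) :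
    ∑' k : ℕ, ((k ! : ℕ) : ℝ)⁻¹ • ∑ α : Fin k → Fin d,
      iteratedFDeriv ℝ k g.1 p (fun i => e (α i)) * (iterD h k α q).1 x = (tay p h g q).1 x := by
  simp only [sum_iteratedFDeriv_mul]
  rw [tsum_eq_sum (s := Finset.range (deg q)), tay_apply p h g (deg_spec q), Submodule.coe_sum,
    Finset.sum_apply]
  · rfl
  · intro k hk
    rw [Finset.mem_range, not_lt] at hk
    rw [tayN_eq_zero p h hk g (deg_spec q)]
    exact smul_zero _

end PolyFun

end IteratedDeriv

/-! ### The integral over ordered times -/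

section OrderedTimes

theorem isClosed_orderedTimes (τ : ℝ) (n : ℕ) : IsClosed (orderedTimes τ n) := by
  have h : orderedTimes τ n = (⋂ i : Fin n, ⋂ l : Fin n, {t | i ≤ l → t l ≤ t i}) ∩
      ⋂ i : Fin n, {t | t i ∈ Set.Icc 0 τ} := by
    ext t
    simp only [orderedTimes, Antitone, Set.mem_ofPred_eq, Set.mem_inter_iff, Set.mem_iInter]
  rw [h]
  refine (isClosed_iInter fun i => isClosed_iInter fun l => ?_).inter (isClosed_iInter fun i =>
    isClosed_Icc.preimage (continuous_apply i))
  by_cases hil : i ≤ l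
  · simp only [hil, true_imp_iff]
    exact isClosed_le (continuous_apply l) (continuous_apply i)
  · simp [hil]

theorem snocR_mem_orderedTimes {τ : ℝ} (hτ : 0 ≤ τ) {n : ℕ} (t : Fin n → ℝ) (s : ℝ) :
    snocR t s ∈ orderedTimes τ (n + 1) ↔
      t ∈ orderedTimes τ n ∧ s ∈ Set.Icc 0 (lastTime τ n t) := by
  have hc : ∀ i : Fin n, snocR t s i.castSucc = t i := fun i => by simp [snocR]
  have hl : snocR t s (Fin.last n) = s := by simp [snocR]
  constructor
  · rintro ⟨h1, h2⟩
    refine ⟨⟨fun i l h => ?_, fun i => by rw [← hc]; exact h2 _⟩, ?_, ?_⟩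
    · rw [← hc i, ← hc l]; exact h1 (Fin.castSucc_le_castSucc_iff.2 h)
    · rw [← hl]; exact (h2 _).1
    · rw [← hl]
      rcases n with - | n
      · exact (h2 _).2
      · rw [lastTime, ← hc]; exact h1 (Fin.le_last _)
  · rintro ⟨⟨h1, h2⟩, h3⟩
    have h4 : lastTime τ n t ≤ τ := (lastTime_mem hτ h2).2
    refine ⟨fun i l h => ?_, snocR_mem h2 ⟨h3.1, h3.2.trans h4⟩⟩
    rcases Fin.eq_castSucc_or_eq_last l with ⟨l, rfl⟩ | rfl
    · rcases Fin.eq_castSucc_or_eq_last i with ⟨i, rfl⟩ | rfl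
      · rw [hc, hc]; exact h1 (Fin.castSucc_le_castSucc_iff.1 h)
      · exact absurd h (not_le.2 (Fin.castSucc_lt_last l))
    · rcases Fin.eq_castSucc_or_eq_last i with ⟨i, rfl⟩ | rfl
      · rw [hc, hl]
        rcases n with - | n
        · exact i.elim0
        · exact h3.2.trans (h1 (Fin.le_last i))
      · exact le_rfl

/-- Fubini with the smallest time innermost. Continuity on a compact set gives the integrability. -/
theorem setIntegral_orderedTimes [CompleteSpace 𝔸] {τ : ℝ} (hτ : 0 ≤ τ) (n : ℕ) {h : (Fin n → ℝ) → 𝔸}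
    (hh : Continuous h) : ∫ t in orderedTimes τ n, h t = simplexInt τ n h := by
  induction n with
  | zero =>
    have h1 : orderedTimes τ 0 = Set.univ :=
      Set.eq_univ_of_forall fun t => ⟨fun i => i.elim0, fun i => i.elim0⟩
    rw [h1, setIntegral_univ, Measure.volume_pi_eq_dirac Fin.elim0, integral_dirac]; rfl
  | succ n ih =>
    have hc : Continuous fun p : ℝ × (Fin n → ℝ) => h (snocR p.2 p.1) :=
      hh.comp (continuous_snocR continuous_snd continuous_fst)
    have hE := (volume_preserving_piFinSuccAbove (fun _ : Fin (n + 1) => ℝ) (Fin.last n)).symm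
    have e1 : ∀ p : ℝ × (Fin n → ℝ),
        (MeasurableEquiv.piFinSuccAbove (fun _ : Fin (n + 1) => ℝ) (Fin.last n)).symm p =
          snocR p.2 p.1 := fun p => Fin.insertNth_last (α := fun _ => ℝ) p.1 p.2
    rw [← hE.setIntegral_preimage_emb (MeasurableEquiv.measurableEmbedding _) h]
    simp only [e1]
    have e2 : (MeasurableEquiv.piFinSuccAbove (fun _ : Fin (n + 1) => ℝ) (Fin.last n)).symm ⁻¹'
        orderedTimes τ (n + 1) = {p : ℝ × (Fin n → ℝ) | snocR p.2 p.1 ∈ orderedTimes τ (n + 1)} := by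
      ext p
      rw [Set.mem_preimage, e1]; rfl
    have hcl : IsClosed {p : ℝ × (Fin n → ℝ) | snocR p.2 p.1 ∈ orderedTimes τ (n + 1)} :=
      (isClosed_orderedTimes τ (n + 1)).preimage (continuous_snocR continuous_snd continuous_fst)
    have hcp : IsCompact {p : ℝ × (Fin n → ℝ) | snocR p.2 p.1 ∈ orderedTimes τ (n + 1)} := by
      refine ((isCompact_Icc (a := 0) (b := τ)).prod (isCompact_univ_pi fun _ : Fin n =>
        isCompact_Icc (a := 0) (b := τ))).of_isClosed_subset hcl fun p hp => ?_
      obtain ⟨h1, h2⟩ := (snocR_mem_orderedTimes hτ _ _).1 hp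
      exact ⟨⟨h2.1, h2.2.trans (lastTime_mem hτ h1.2).2⟩, fun i _ => h1.2 i⟩
    have hS : ∀ s t, (s, t) ∈ {p : ℝ × (Fin n → ℝ) | snocR p.2 p.1 ∈ orderedTimes τ (n + 1)} ↔
        t ∈ orderedTimes τ n ∧ s ∈ Set.Icc 0 (lastTime τ n t) := fun s t =>
      snocR_mem_orderedTimes hτ t s
    rw [e2]
    generalize {p : ℝ × (Fin n → ℝ) | snocR p.2 p.1 ∈ orderedTimes τ (n + 1)} = S at hcl hcp hS ⊢
    rw [← integral_indicator hcl.measurableSet, Measure.volume_eq_prod, integral_prod_symm]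
    · have e3 : ∀ t : Fin n → ℝ, ∫ s, Set.indicator S (fun p => h (snocR p.2 p.1)) (s, t) =
          Set.indicator (orderedTimes τ n) (fun t => ∫ s in (0 : ℝ)..lastTime τ n t, h (snocR t s)) t := by
        intro t
        by_cases ht : t ∈ orderedTimes τ n
        · rw [Set.indicator_of_mem ht, intervalIntegral.integral_of_le (lastTime_mem hτ ht.2).1,
            ← integral_Icc_eq_integral_Ioc, ← integral_indicator measurableSet_Icc]
          congr 1
          funext s
          by_cases hs : s ∈ Set.Icc 0 (lastTime τ n t)
          · rw [Set.indicator_of_mem ((hS s t).2 ⟨ht, hs⟩), Set.indicator_of_mem hs]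
          · rw [Set.indicator_of_notMem fun h => hs ((hS s t).1 h).2, Set.indicator_of_notMem hs]
        · rw [Set.indicator_of_notMem ht]
          exact integral_eq_zero_of_ae (Eventually.of_forall fun s =>
            Set.indicator_of_notMem (fun h => ht ((hS s t).1 h).1) _)
      simp only [e3]
      rw [integral_indicator (isClosed_orderedTimes τ n).measurableSet, ih]
      · rfl
      · refine intervalIntegral.continuous_parametric_intervalIntegral_of_continuous
          (f := fun t s => h (snocR t s)) ?_ (contDiff_lastTime τ n).continuous
        exact hh.comp (continuous_snocR continuous_fst continuous_snd)
    · rw [← Measure.volume_eq_prod, integrable_indicator_iff hcl.measurableSet]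
      exact hc.continuousOn.integrableOn_compact hcp

theorem IsBump.continuous_act_fullQuad {D : ℝ → ℝ} {r τ : ℝ} (hD : IsBump D r) (ξ : Sp d) (n j : ℕ)
    (G : ℕ → Vert d 𝔸) :
    Continuous fun t => act (dp j (fullQuad D τ n t)) (prodAt τ ξ n t) G := by
  refine (continuous_act_quad τ ξ n j G).comp (f := fun t : Fin n → ℝ =>
    ((fun i l => covXX D τ (t i) (t l), fun i l => covVX D τ (t i) (t l),
    fun i l => contactK D τ (t i) (t l) - 2 / τ * (tail D τ (t i) 0 * tail D τ (t l) 0)), t)) ?_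
  have h2 : ∀ i l : Fin n, Continuous fun t : Fin n → ℝ => (t i, t l) := fun i l => by fun_prop
  have h3 : ∀ i : Fin n, Continuous fun t : Fin n → ℝ => tail D τ (t i) 0 := fun i =>
    hD.continuous_tail.comp (f := fun t : Fin n → ℝ => (t i, 0))
      ((continuous_apply i).prodMk continuous_const)
  exact ((continuous_pi fun i => continuous_pi fun l => hD.continuous_covXX.comp (h2 i l)).prodMk
    ((continuous_pi fun i => continuous_pi fun l => hD.continuous_covVX.comp (h2 i l)).prodMk
    (continuous_pi fun i => continuous_pi fun l => (hD.continuous_contactK.comp (h2 i l)).sub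
      (continuous_const.mul ((h3 i).mul (h3 l)))))).prodMk continuous_id

end OrderedTimes

/-! ### Ordered exponentials depending smoothly on parameters -/

section Volterra

/-- The terms of the ordered exponential of `-A p`, up to the time `s`. -/
def volt (A : Sp d → ℝ → 𝔸) : ℕ → Sp d → ℝ → 𝔸
  | 0, _, _ => 1
  | k + 1, p, s => -∫ r in (0 : ℝ)..s, A p r * volt A k p r

/-- The ordered exponential of `-A p`. -/
def orderedExp (A : Sp d → ℝ → 𝔸) (p : Sp d) : 𝔸 := ∑' k, volt A k p 1

theorem contDiff_volt {A : Sp d → ℝ → 𝔸} (hA : ContDiff ℝ ∞ (Function.uncurry A)) (k : ℕ) :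
    ContDiff ℝ ∞ (Function.uncurry (volt A k)) := by
  induction k with
  | zero => exact contDiff_const
  | succ k ih =>
    have h := contDiff_integral_zero_to (E := Sp d × ℝ) (h := fun q r => A q.1 r * volt A k q.1 r)
      (b := Prod.snd) ?_ contDiff_snd
    · exact h.neg
    · have h2 : ContDiff ℝ ∞ fun z : (Sp d × ℝ) × ℝ => (z.1.1, z.2) :=
        contDiff_fst.fst.prodMk contDiff_snd
      exact (hA.comp h2).mul (ih.comp h2)

theorem contDiff_volt_left {A : Sp d → ℝ → 𝔸} (hA : ContDiff ℝ ∞ (Function.uncurry A)) (k : ℕ) (s : ℝ) :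
    ContDiff ℝ ∞ fun p => volt A k p s :=
  (contDiff_volt hA k).comp (contDiff_id.prodMk contDiff_const)

theorem contDiff_volt_right {A : Sp d → ℝ → 𝔸} (hA : ContDiff ℝ ∞ (Function.uncurry A)) (k : ℕ) (p : Sp d) :
    ContDiff ℝ ∞ fun s => volt A k p s :=
  (contDiff_volt hA k).comp (contDiff_const.prodMk contDiff_id)

/-- The volume of the simplex supplies the factorial. The norm of `1` is kept as a factor because
the norm is not assumed to be one there. -/
theorem norm_volt_le {A : Sp d → ℝ → 𝔸} {p : Sp d} {M : ℝ}
    (hM : ∀ r ∈ Set.Icc (0 : ℝ) 1, ‖A p r‖ ≤ M) (k : ℕ) {s : ℝ} (hs : s ∈ Set.Icc (0 : ℝ) 1) :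
    ‖volt A k p s‖ ≤ ‖(1 : 𝔸)‖ * (M ^ k * s ^ k / (k ! : ℕ)) := by
  have hM0 : 0 ≤ M := (norm_nonneg _).trans (hM 0 ⟨le_rfl, zero_le_one⟩)
  induction k generalizing s with
  | zero => simp [volt]
  | succ k ih =>
    rw [volt, norm_neg]
    have h := intervalIntegral.norm_integral_le_of_norm_le (f := fun r => A p r * volt A k p r)
      (g := fun r => M * (‖(1 : 𝔸)‖ * (M ^ k * r ^ k / (k ! : ℕ)))) (μ := volume) hs.1
      (Eventually.of_forall fun r hr => ?_) (Continuous.intervalIntegrable (by fun_prop) _ _)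
    · refine h.trans (le_of_eq ?_)
      have e1 : ∀ r : ℝ, M * (‖(1 : 𝔸)‖ * (M ^ k * r ^ k / (k ! : ℕ))) =
          (‖(1 : 𝔸)‖ * M ^ (k + 1) / (k ! : ℕ)) * r ^ k := fun r => by rw [pow_succ]; ring
      simp only [e1]
      rw [intervalIntegral.integral_const_mul, integral_pow, Nat.factorial_succ]
      have : ((k ! : ℕ) : ℝ) ≠ 0 := by positivity
      push_cast
      field_simp
      simp
    · have hr' : r ∈ Set.Icc (0 : ℝ) 1 := ⟨hr.1.le, hr.2.trans hs.2⟩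
      exact (norm_mul_le _ _).trans (mul_le_mul (hM r hr') (ih hr') (norm_nonneg _) hM0)

variable [CompleteSpace 𝔸]

theorem summable_volt {A : Sp d → ℝ → 𝔸} (hA : ContDiff ℝ ∞ (Function.uncurry A)) (p : Sp d) {s : ℝ}
    (hs : s ∈ Set.Icc (0 : ℝ) 1) : Summable fun k => volt A k p s := by
  have hc : Continuous (A p) := hA.continuous.comp (Continuous.prodMk_right p)
  obtain ⟨M, hM⟩ := (isCompact_Icc (a := (0 : ℝ)) (b := 1)).exists_bound_of_continuousOn hc.continuousOn
  refine Summable.of_norm_bounded (((Real.summable_pow_div_factorial (M * s)).mul_left ‖(1 : 𝔸)‖))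
    fun k => (norm_volt_le hM k hs).trans (le_of_eq (by rw [mul_pow]))

variable (𝔸) in
/-- The inclusion of the reduced part. -/
def inlL : 𝔸 →L[ℝ] TrivSqZeroExt 𝔸 𝔸 where
  toFun := TrivSqZeroExt.inl
  map_add' := TrivSqZeroExt.inl_add 𝔸
  map_smul' := TrivSqZeroExt.inl_smul 𝔸
  cont := TrivSqZeroExt.continuous_inl

variable (𝔸) in
/-- The inclusion of the nilpotent part. -/
def inrL : 𝔸 →L[ℝ] TrivSqZeroExt 𝔸 𝔸 where
  toFun := TrivSqZeroExt.inr
  map_add' := TrivSqZeroExt.inr_add 𝔸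
  map_smul' := TrivSqZeroExt.inr_smul 𝔸
  cont := TrivSqZeroExt.continuous_inr

variable (𝔸) in
/-- The projection to the nilpotent part. -/
def sndL : TrivSqZeroExt 𝔸 𝔸 →L[ℝ] 𝔸 where
  toFun := TrivSqZeroExt.snd
  map_add' _ _ := rfl
  map_smul' _ _ := rfl
  cont := TrivSqZeroExt.continuous_snd

/-- The derivative of `A` in the direction `v`, as the nilpotent part. -/
def jet (A : Sp d → ℝ → 𝔸) (v : Sp d) (p : Sp d) (r : ℝ) : TrivSqZeroExt 𝔸 𝔸 :=
  TrivSqZeroExt.inl (A p r) + TrivSqZeroExt.inr (fderiv ℝ (fun p => A p r) p v)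

theorem contDiff_inl_add_inr {E : Type} [NormedAddCommGroup E] [NormedSpace ℝ E] {g h : E → 𝔸}
    (hg : ContDiff ℝ ∞ g) (hh : ContDiff ℝ ∞ h) : ContDiff ℝ ∞ fun x =>
      (TrivSqZeroExt.inl (g x) + TrivSqZeroExt.inr (h x) : TrivSqZeroExt 𝔸 𝔸) :=
  ((inlL 𝔸).contDiff.comp hg).add
    ((inrL 𝔸).contDiff.comp hh)

theorem contDiff_jet {A : Sp d → ℝ → 𝔸} (hA : ContDiff ℝ ∞ (Function.uncurry A)) (v : Sp d) :
    ContDiff ℝ ∞ (Function.uncurry (jet A v)) :=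
  contDiff_inl_add_inr hA ((contDiff_fderiv_left hA).clm_apply contDiff_const)

/-- Products of dual numbers obey the Leibniz rule, so the terms built from the jet of `A` are the
jets of the terms built from `A`. Derivatives of the terms then inherit the factorial estimate
without further computation. -/
theorem volt_jet {A : Sp d → ℝ → 𝔸} (hA : ContDiff ℝ ∞ (Function.uncurry A)) (v : Sp d) (k : ℕ)
    (p : Sp d) (s : ℝ) : volt (jet A v) k p s =
      TrivSqZeroExt.inl (volt A k p s) +
        TrivSqZeroExt.inr (fderiv ℝ (fun p => volt A k p s) p v) := by
  induction k generalizing s with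
  | zero =>
    simp only [volt, fderiv_fun_const, Pi.zero_apply, _root_.zero_apply,
      TrivSqZeroExt.inr_zero, add_zero, TrivSqZeroExt.inl_one]
  | succ k ih =>
    have hint : ContDiff ℝ ∞ (Function.uncurry fun p r => A p r * volt A k p r) :=
      hA.mul (contDiff_volt hA k)
    have hj : Continuous fun r => jet A v p r * volt (jet A v) k p r :=
      ((contDiff_jet hA v).mul (contDiff_volt (contDiff_jet hA v) k)).continuous.comp
        (Continuous.prodMk_right p)
    have e1 : ∀ r, jet A v p r * volt (jet A v) k p r =
        TrivSqZeroExt.inl (A p r * volt A k p r) +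
          TrivSqZeroExt.inr (fderiv ℝ (fun p => A p r * volt A k p r) p v) := fun r => by
      have d1 : DifferentiableAt ℝ (fun p => A p r) p :=
        (hA.comp (contDiff_id.prodMk contDiff_const)).differentiable (by norm_num) p
      have d2 : DifferentiableAt ℝ (fun p => volt A k p r) p :=
        (contDiff_volt_left hA k r).differentiable (by norm_num) p
      rw [ih, jet, fderiv_fun_mul' d1 d2]
      ext
      · simp
      · simp
    have hd : ContDiff ℝ ∞ (Function.uncurry fun p r => fderiv ℝ (fun p => A p r * volt A k p r) p) :=
      contDiff_fderiv_left hint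
    have c1 : Continuous fun r => A p r * volt A k p r :=
      hint.continuous.comp (Continuous.prodMk_right p)
    have c2 : Continuous fun r => fderiv ℝ (fun p => A p r * volt A k p r) p :=
      hd.continuous.comp (Continuous.prodMk_right p)
    have c3 : Continuous fun r => fderiv ℝ (fun p => A p r * volt A k p r) p v :=
      c2.clm_apply continuous_const
    have e2 : fderiv ℝ (fun p => volt A (k + 1) p s) p v =
        -∫ r in (0 : ℝ)..s, fderiv ℝ (fun p => A p r * volt A k p r) p v := by
      simp only [volt]
      rw [fderiv_fun_neg, fderiv_integral_zero_to hint, neg_apply,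
        ContinuousLinearMap.intervalIntegral_apply (c2.intervalIntegrable _ _)]
    have e3 : ∫ r in (0 : ℝ)..s, (TrivSqZeroExt.inl (A p r * volt A k p r) : TrivSqZeroExt 𝔸 𝔸) =
        TrivSqZeroExt.inl (∫ r in (0 : ℝ)..s, A p r * volt A k p r) :=
      (inlL 𝔸).intervalIntegral_comp_comm (c1.intervalIntegrable _ _)
    have e4 : ∫ r in (0 : ℝ)..s, (TrivSqZeroExt.inr (fderiv ℝ (fun p => A p r * volt A k p r) p v) :
        TrivSqZeroExt 𝔸 𝔸) =
        TrivSqZeroExt.inr (∫ r in (0 : ℝ)..s, fderiv ℝ (fun p => A p r * volt A k p r) p v) :=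
      (inrL 𝔸).intervalIntegral_comp_comm (c3.intervalIntegrable _ _)
    rw [e2, volt, volt]
    simp only [e1]
    rw [intervalIntegral.integral_add, e3, e4, neg_add, TrivSqZeroExt.inl_neg, TrivSqZeroExt.inr_neg]
    · exact ((inlL 𝔸).continuous.comp c1).intervalIntegrable _ _
    · exact ((inrL 𝔸).continuous.comp c3).intervalIntegrable _ _

theorem norm_clm_le_sum (L : Sp d →L[ℝ] 𝔸) : ‖L‖ ≤ ∑ μ, ‖L (e μ)‖ := by
  refine L.opNorm_le_bound (Finset.sum_nonneg fun _ _ => norm_nonneg _) fun x => ?_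
  have hx : x = ∑ μ, x μ • (e μ : Sp d) := by
    ext ν
    simp [e, Pi.single_apply]
  calc ‖L x‖ = ‖∑ μ, x μ • L (e μ)‖ := by
        conv_lhs => rw [hx]
        rw [map_sum]; simp only [map_smul]
    _ ≤ ∑ μ, ‖L (e μ)‖ * ‖x‖ := (norm_sum_le _ _).trans (Finset.sum_le_sum fun μ _ => by
        rw [norm_smul, mul_comm]
        exact mul_le_mul_of_nonneg_left (PiLp.norm_apply_le x μ) (norm_nonneg _))
    _ = _ := by rw [Finset.sum_mul]

theorem hasFDerivAt_orderedExp {A : Sp d → ℝ → 𝔸} (hA : ContDiff ℝ ∞ (Function.uncurry A)) (p : Sp d) :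
    -- The derivatives are bounded on a ball by the norms of the dual-number terms, one basis
    -- direction at a time, and this majorant is summable.
    HasFDerivAt (orderedExp A) (∑' k, fderiv ℝ (fun p => volt A k p 1) p) p ∧
      Summable fun k => fderiv ℝ (fun p => volt A k p 1) p := by
  have hM : ∀ μ : Fin d, ∃ M, ∀ q ∈ Metric.closedBall p 1 ×ˢ Set.Icc (0 : ℝ) 1,
      ‖jet A (e μ) q.1 q.2‖ ≤ M := fun μ =>
    ((isCompact_closedBall p 1).prod isCompact_Icc).exists_bound_of_continuousOn
      (contDiff_jet hA (e μ)).continuous.continuousOn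
  choose M hM using hM
  let u : ℕ → ℝ := fun k => ∑ μ, ‖(1 : TrivSqZeroExt 𝔸 𝔸)‖ * (M μ ^ k / (k ! : ℕ))
  have hu : Summable u := summable_sum fun μ _ => (Real.summable_pow_div_factorial (M μ)).mul_left _
  have hb : ∀ k q, q ∈ Metric.ball p 1 → ‖fderiv ℝ (fun p => volt A k p 1) q‖ ≤ u k := fun k q hq => by
    refine (norm_clm_le_sum _).trans (Finset.sum_le_sum fun μ _ => ?_)
    have h1 := norm_volt_le (A := jet A (e μ)) (p := q) (M := M μ)
      (fun r hr => hM μ (q, r) ⟨Metric.ball_subset_closedBall hq, hr⟩) k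
      (s := 1) ⟨zero_le_one, le_rfl⟩
    rw [volt_jet hA, one_pow, mul_one] at h1
    refine le_trans ?_ h1
    rw [TrivSqZeroExt.norm_def]
    simp
  have hp : p ∈ Metric.ball p 1 := Metric.mem_ball_self one_pos
  exact ⟨hasFDerivAt_tsum_of_isPreconnected hu Metric.isOpen_ball (convex_ball p 1).isPreconnected
    (fun k q _ => ((contDiff_volt_left hA k 1).differentiable (by norm_num) q).hasFDerivAt) hb hp
    (summable_volt hA p ⟨zero_le_one, le_rfl⟩) hp, Summable.of_norm_bounded hu fun k => hb k p hp⟩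

theorem hasSum_fderiv_volt {A : Sp d → ℝ → 𝔸} (hA : ContDiff ℝ ∞ (Function.uncurry A)) (p v : Sp d) :
    HasSum (fun k => fderiv ℝ (fun p => volt A k p 1) p v) (fderiv ℝ (orderedExp A) p v) := by
  obtain ⟨h1, h2⟩ := hasFDerivAt_orderedExp hA p
  rw [h1.fderiv]
  exact (ContinuousLinearMap.apply ℝ 𝔸 v).hasSum h2.hasSum

theorem orderedExp_jet {A : Sp d → ℝ → 𝔸} (hA : ContDiff ℝ ∞ (Function.uncurry A)) (v p : Sp d) :
    (orderedExp (jet A v) p).snd = fderiv ℝ (orderedExp A) p v := by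
  have h := (sndL 𝔸).hasSum
    (summable_volt (contDiff_jet hA v) p (s := 1) ⟨zero_le_one, le_rfl⟩).hasSum
  refine h.unique (((hasSum_fderiv_volt hA p v)).congr_fun fun k => ?_)
  change (volt (jet A v) k p 1).snd = _
  rw [volt_jet hA, TrivSqZeroExt.snd_add, TrivSqZeroExt.snd_inl, TrivSqZeroExt.snd_inr, zero_add]

/-- Each differentiation passes to the dual numbers over the previous algebra, so the algebra is
quantified inside the induction. -/
theorem contDiff_nat_orderedExp (n : ℕ) : ∀ {𝔸 : Type} [NormedRing 𝔸] [NormedAlgebra ℝ 𝔸]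
    [CompleteSpace 𝔸] {A : Sp d → ℝ → 𝔸}, ContDiff ℝ ∞ (Function.uncurry A) →
    ContDiff ℝ n (orderedExp A) := by
  induction n with
  | zero =>
    intro 𝔸 _ _ _ A hA
    exact contDiff_zero.2 (continuous_iff_continuousAt.2 fun p =>
      (hasFDerivAt_orderedExp hA p).1.continuousAt)
  | succ n ih =>
    intro 𝔸 _ _ _ A hA
    rw [Nat.cast_succ, contDiff_succ_iff_fderiv_apply]
    refine ⟨fun p => (hasFDerivAt_orderedExp hA p).1.differentiableAt, by simp, fun v => ?_⟩
    have h := (sndL 𝔸).contDiff.comp (ih (contDiff_jet hA v))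
    have e : (fun x => fderiv ℝ (orderedExp A) x v) = ⇑(sndL 𝔸) ∘ orderedExp (jet A v) :=
      funext fun p => (orderedExp_jet hA v p).symm
    rw [e]
    exact h

theorem contDiff_orderedExp {A : Sp d → ℝ → 𝔸} (hA : ContDiff ℝ ∞ (Function.uncurry A)) :
    ContDiff ℝ ∞ (orderedExp A) := contDiff_infty.2 fun n => contDiff_nat_orderedExp n hA

end Volterra

end Generic

section Matrices

variable {d m : ℕ}

open DOp

/-! ### Functionals of the source and polynomial functionals -/

section Represents

open scoped BoundedContinuousFunction

/-- The functional is given on bounded continuous sources by a polynomial functional. -/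
def Represents (P : Functional d m) (q : PolyFun (Mat m) (ℝ →ᵇ Sp d)) : Prop :=
  ∀ x : ℝ →ᵇ Sp d, P ⇑x = q.1 x

variable {ρ : ℝ → ℝ} {ε r : ℝ} (hD : IsBump (approxDelta ρ ε) r) {P : Functional d m}
  {q : PolyFun (Mat m) (ℝ →ᵇ Sp d)}

namespace Represents

/-- A line derivative at a bounded continuous source uses only values on a line of such sources. The
space of all sources thus needs no topology, and the calculus takes place in the supremum norm. -/
theorem funDeriv (h : Represents P q) (μ : Fin d) (t : ℝ) :
    Represents (funDeriv ρ ε μ t P) (PolyFun.D (hD.dir t (Sum.inl μ)) q) := fun x => by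
  have h1 : (fun s : ℝ => P (⇑x + s • fun u => approxDelta ρ ε (u - t) • e μ)) =
      fun s : ℝ => q.1 (x + s • hD.dir t (Sum.inl μ)) := funext fun s =>
    h (x + s • hD.dir t (Sum.inl μ))
  change deriv (fun s : ℝ => P (⇑x + s • fun u => approxDelta ρ ε (u - t) • e μ)) 0 = _
  rw [h1]
  exact (PolyFun.differentiableAt q x).lineDeriv_eq_fderiv

theorem dtFunDeriv (h : Represents P q) (μ : Fin d) (t : ℝ) :
    Represents (dtFunDeriv ρ ε μ t P) (PolyFun.D (hD.dir t (Sum.inr μ)) q) := fun x => by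
  have h1 : (fun r => HeatExp.funDeriv ρ ε μ r P x) = fun r => fderiv ℝ q.1 x (hD.dir r (Sum.inl μ)) :=
    funext fun r => h.funDeriv hD μ r x
  change deriv (fun r => HeatExp.funDeriv ρ ε μ r P x) t = fderiv ℝ q.1 x (hD.dir t (Sum.inr μ))
  rw [h1]
  exact ((fderiv ℝ q.1 x).hasFDerivAt.comp_hasDerivAt t (hD.hasDerivAt_dir μ t)).deriv

theorem funDerivIter (h : Represents P q) (t : ℝ) (k : ℕ) (α : Fin k → Fin d) :
    Represents (funDerivIter ρ ε t k α P)
      (PolyFun.iterD (fun μ => hD.dir t (Sum.inl μ)) k α q) := by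
  induction k with
  | zero => exact h
  | succ k ih => exact (ih (Fin.tail α)).funDeriv hD (α 0) t

theorem taylorOp (h : Represents P q) (t : ℝ) (g : Sm d (Mat m)) (p : Sp d) :
    Represents (taylorOp ρ ε t g.1 p P)
      (PolyFun.tay p (fun μ => hD.dir t (Sum.inl μ)) g q) := fun x => by
  have h1 := PolyFun.tsum_taylor p (fun μ => hD.dir t (Sum.inl μ)) g q x
  rw [← h1, HeatExp.taylorOp]
  refine tsum_congr fun k => ?_
  congr 1
  refine Finset.sum_congr rfl fun α _ => ?_
  rw [h.funDerivIter hD t k α x]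

theorem add_smul {P' : Functional d m} {q' : PolyFun (Mat m) (ℝ →ᵇ Sp d)} (h : Represents P q)
    (h' : Represents P' q') (c : ℝ) : Represents (fun η => P η + c • P' η) (q + c • q') := fun x => by
  change P x + c • P' x = q.1 x + c • q'.1 x
  rw [h x, h' x]

variable {f : Fin d → Sm d (Mat m)} {V : Sm d (Mat m)} {ξ : Sp d} {τ : ℝ}

theorem opM (h : Represents P q) (t : ℝ) :
    Represents (opM (fun μ => (f μ).1) V.1 ρ ε ξ τ t P)
      (PolyFun.vertOp ξ τ hD.dir t (f, V) q) := fun x => by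
  have h1 : ∀ μ, HeatExp.taylorOp ρ ε t (f μ).1 ((t / τ) • ξ)
      (fun η' => HeatExp.dtFunDeriv ρ ε μ t P η' + (ξ μ / τ) • P η') x =
      (PolyFun.tay ((t / τ) • ξ) (fun μ => hD.dir t (Sum.inl μ)) (f μ)
        (PolyFun.D (hD.dir t (Sum.inr μ)) q + (ξ μ / τ) • q)).1 x := fun μ =>
    ((h.dtFunDeriv hD μ t).add_smul h (ξ μ / τ)).taylorOp hD t (f μ) _ x
  have h2 : HeatExp.taylorOp ρ ε t V.1 ((t / τ) • ξ) P x =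
      (PolyFun.tay ((t / τ) • ξ) (fun μ => hD.dir t (Sum.inl μ)) V q).1 x := h.taylorOp hD t V _ x
  have h3 : (∑ μ, PolyFun.tay ((t / τ) • ξ) (fun μ => hD.dir t (Sum.inl μ)) (f μ)
        (PolyFun.D (hD.dir t (Sum.inr μ)) q + (ξ μ / τ) • q)).1 x =
      ∑ μ, (PolyFun.tay ((t / τ) • ξ) (fun μ => hD.dir t (Sum.inl μ)) (f μ)
        (PolyFun.D (hD.dir t (Sum.inr μ)) q + (ξ μ / τ) • q)).1 x := by
    rw [Submodule.coe_sum, Finset.sum_apply]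
  have h4 : PolyFun.vertOp ξ τ hD.dir t (f, V) q =
      PolyFun.tay ((t / τ) • ξ) (fun μ => hD.dir t (Sum.inl μ)) V q -
      ∑ μ, PolyFun.tay ((t / τ) • ξ) (fun μ => hD.dir t (Sum.inl μ)) (f μ)
        (PolyFun.D (hD.dir t (Sum.inr μ)) q + (ξ μ / τ) • q) := by
    rw [PolyFun.vertOp, vop, LinearMap.sub_apply, LinearMap.sum_apply]; rfl
  rw [h4, HeatExp.opM, Finset.sum_congr rfl fun μ _ => h1 μ, h2, ← h3, neg_add_eq_sub]
  rfl

theorem opMProd (h : Represents P q) (k n : ℕ) (t : Fin n → ℝ) :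
    Represents (opMProd (fun μ => (f μ).1) V.1 ρ ε ξ τ n t P)
      (vopProd (PolyFun.vertOp ξ τ hD.dir) k n t (fun _ => (f, V)) q) := by
  induction n generalizing k with
  | zero => exact h
  | succ n ih => exact (ih (k + 1) (Fin.tail t)).opM hD (t 0)

end Represents

/-- Wick's theorem at positive `ε`: the analytic operators on functionals are replaced, without
error, by formal contractions of vertices along the straight path. -/
theorem opMProd_eq (hD : IsBump (approxDelta ρ ε) r) (f : Fin d → Sm d (Mat m)) (V : Sm d (Mat m))
    (ξ : Sp d) {τ : ℝ} (hτ : 0 < τ) (n j : ℕ) (t : Fin n → ℝ) :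
    opMProd (fun μ => (f μ).1) V.1 ρ ε ξ τ n t
        (fun η => (bFun τ η ^ j / (j ! : ℕ)) • (1 : Mat m)) 0 =
      act (dp j (fullQuad (approxDelta ρ ε) τ n t)) (prodAt τ ξ n t) fun _ => (f, V) := by
  have hpow : ∀ (j : ℕ) (x : ℝ →ᵇ Sp d), ((PolyFun.mulQ (𝔸 := Mat m) (greenB_comm (d := d) hτ) ^ j) (PolyFun.const 1)).1 x =
      bFun τ x ^ j • (1 : Mat m) := by
    intro j x
    induction j with
    | zero => rw [pow_zero, pow_zero, one_smul]; rfl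
    | succ j ih =>
      rw [pow_succ', pow_succ', mul_smul, ← ih]; rfl
  have hR : Represents (fun η : Source d => (bFun τ η ^ j / (j ! : ℕ)) • (1 : Mat m))
      (((j ! : ℕ) : ℝ)⁻¹ • (PolyFun.mulQ (greenB_comm hτ) ^ j) (PolyFun.const 1)) := fun x => by
    change _ = ((j ! : ℕ) : ℝ)⁻¹ • ((PolyFun.mulQ (𝔸 := Mat m) (greenB_comm hτ) ^ j) (PolyFun.const 1)).1 x
    rw [hpow, smul_smul, ← div_eq_inv_mul]
  have h1 := hR.opMProd hD (f := f) (V := V) (ξ := ξ) (τ := τ) 0 n t 0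
  refine h1.trans ?_
  rw [map_smul, dp, act_smul, ← hD.wickD_greenB_dir hτ n t]
  have h2 := congrFun (PolyFun.vopProd_mulQ_pow_apply (𝔸 := Mat m) (ξ := ξ) (τ := τ) (h := hD.dir)
    (greenB_comm hτ) n j t) fun _ => (f, V)
  exact congrArg (((j ! : ℕ) : ℝ)⁻¹ • ·) h2

end Represents

/-! ### Globally smooth vertices in the Fock-Schwinger gauge -/

section Global

variable (f : Fin d → Sm d (Mat m)) (V : Sm d (Mat m))

theorem expTerm_eq {ρ : ℝ → ℝ} {ε r : ℝ} (hD : IsBump (approxDelta ρ ε) r) (ξ : Sp d) {τ : ℝ}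
    (hτ : 0 < τ) (n j : ℕ) : expTerm (fun μ => (f μ).1) V.1 ρ ε ξ τ n j =
      simplexInt τ n fun t => act (dp j (fullQuad (approxDelta ρ ε) τ n t)) (prodAt τ ξ n t)
        fun _ => (f, V) := by
  rw [← setIntegral_orderedTimes hτ.le n (hD.continuous_act_fullQuad ξ n j _), expTerm]
  exact integral_congr_ae (Eventually.of_forall fun t => opMProd_eq hD f V ξ hτ n j t)

theorem tendsto_expTerm (hf : ∑ μ, Sm.coord μ * f μ = 0) {ρ : ℝ → ℝ} (hρ : IsMollifier ρ) (ξ : Sp d)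
    {τ : ℝ} (hτ : 0 < τ) (n j : ℕ) :
    Tendsto (fun ε => expTerm (fun μ => (f μ).1) V.1 ρ ε ξ τ n j) (𝓝[>] 0)
      (𝓝 (∑ K ∈ Finset.range (n + j + 1), τ ^ K • (Sm.coef f V n j K).1 ξ)) := by
  obtain ⟨R, -, hR⟩ := hρ.exists_isBump
  refine (tendsto_simplexInt_fullQuad hR hτ V hf n j ξ).congr' ?_
  filter_upwards [self_mem_nhdsWithin] with ε hε
  exact (expTerm_eq f V (hR ε hε) ξ hτ n j).symm

/-- The expansion `(∂ + f)² ψ = Δψ + 2∂_μ(f_μ ψ) - (∂_μ f_μ)ψ + f_μ f_μ ψ` identifies the operator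
assembled from the contractions. -/
theorem lap_eq (ψ : Sm d (Mat m)) (x : Sp d) :
    lap (fun μ => (f μ).1) V.1 ψ.1 x = -(Sm.opA f V ψ).1 x := by
  have h1 : ∀ μ, covD (fun μ => (f μ).1) μ ψ.1 = (Sm.pdL μ ψ + f μ * ψ).1 := fun μ => rfl
  have h2 : ∀ μ, covD (fun μ => (f μ).1) μ (covD (fun μ => (f μ).1) μ ψ.1) x =
      (Sm.pdL μ (Sm.pdL μ ψ + f μ * ψ) + f μ * (Sm.pdL μ ψ + f μ * ψ)).1 x := fun μ => by
    rw [h1]; rfl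
  rw [lap, Finset.sum_congr rfl fun μ _ => h2 μ]
  have h3 : Sm.opA f V ψ = ∑ μ, (Sm.pdL μ (Sm.pdL μ ψ + f μ * ψ) +
      f μ * (Sm.pdL μ ψ + f μ * ψ)) + V * ψ := by
    simp only [Sm.opA, Sm.opN, Sm.opQ, LinearMap.add_apply, LinearMap.mulLeft_apply, map_add,
      Sm.pdL_mul, mul_add, Finset.sum_add_distrib, Sm.lapl_apply, LinearMap.sum_apply, LinearMap.sub_apply,
      LinearMap.comp_apply, two_smul, Finset.sum_sub_distrib,
      Finset.sum_mul, mul_assoc]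
    abel
  have h4 : (Sm.opA f V ψ).1 x = ∑ μ, (Sm.pdL μ (Sm.pdL μ ψ + f μ * ψ) +
      f μ * (Sm.pdL μ ψ + f μ * ψ)).1 x + V.1 x * ψ.1 x := by
    rw [h3, Sm.val_eq_ev, map_add, map_sum]; rfl
  rw [h4, neg_add, sub_eq_add_neg]

/-- Both sequences start at `1` and obey the same recursion by radial means. -/
theorem heatCoeff_eq (K : ℕ) :
    heatCoeff (fun μ => (f μ).1) V.1 K = (Sm.coefSum f V K).1 := by
  induction K with
  | zero => rw [Sm.coefSum_zero]; rfl
  | succ K ih =>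
    funext ξ
    rw [heatCoeff, ih, Sm.coefSum_succ, Sm.rad_apply]
    simp only [lap_eq, smul_neg, intervalIntegral.integral_neg, neg_neg, Sm.radW]
    simp

theorem orderedExpEqSeries_of_smooth (hf : ∑ μ, Sm.coord μ * f μ = 0) (ξ : Sp d) :
    OrderedExpEqSeries (fun μ => (f μ).1) V.1 ξ
      fun k => heatCoeff (fun μ => (f μ).1) V.1 k ξ := by
  refine ⟨fun n j k => (Sm.coef f V n j k).1 ξ, fun n j k h => Sm.coef_ne_zero f V fun h0 => h (congrArg (fun ψ => ψ.1 ξ) h0),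
    fun τ hτ ρ hρ n j => tendsto_expTerm f V hf hρ ξ hτ n j, fun k => ?_⟩
  simp only
  rw [heatCoeff_eq, Sm.coefSum, Sm.val_eq_ev, map_sum]
  refine Finset.sum_congr rfl fun n _ => ?_
  rw [map_sum]; rfl

end Global

/-! ### The Fock-Schwinger gauge of a globally smooth connection -/

section Gauge

variable {B : Fin d → Sp d → Mat m}

theorem sum_apply_smul_e (x : Sp d) : ∑ μ, x μ • (e μ : Sp d) = x := by
  ext ν
  simp [e, Pi.single_apply]

theorem sum_smul_pd (ψ : Sp d → Mat m) (v x : Sp d) : ∑ μ, v μ • pd μ ψ x = fderiv ℝ ψ x v := by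
  conv_rhs => rw [← sum_apply_smul_e v, map_sum]
  simp only [map_smul, pd]

theorem wilsonTerm_eq_volt_left (x y : Sp d) (k : ℕ) (s : ℝ) : wilsonTerm B x y k s =
    volt (fun x r => ∑ μ, (x - y) μ • B μ ((1 - r) • y + r • x)) k x s := by
  induction k generalizing s with
  | zero => rfl
  | succ k ih => simp only [wilsonTerm, volt, ih]

theorem wilsonTerm_eq_volt_right (x y : Sp d) (k : ℕ) (s : ℝ) : wilsonTerm B y x k s =
    volt (fun x r => ∑ μ, (y - x) μ • B μ ((1 - r) • x + r • y)) k x s := by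
  induction k generalizing s with
  | zero => rfl
  | succ k ih => simp only [wilsonTerm, volt, ih]

theorem contDiff_apply_coord (μ : Fin d) : ContDiff ℝ ∞ fun x : Sp d => x μ :=
  (EuclideanSpace.proj (𝕜 := ℝ) μ).contDiff

theorem contDiff_segment_left (hB : ∀ μ, ContDiff ℝ ∞ (B μ)) (y : Sp d) :
    ContDiff ℝ ∞ (Function.uncurry fun x (r : ℝ) =>
      ∑ μ, (x - y) μ • B μ ((1 - r) • y + r • x)) :=
  ContDiff.sum fun μ _ => ContDiff.smul
    ((contDiff_apply_coord μ).comp (contDiff_fst.sub contDiff_const))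
    ((hB μ).comp (((contDiff_const.sub contDiff_snd).smul contDiff_const).add
      (contDiff_snd.smul contDiff_fst)))

theorem contDiff_segment_right (hB : ∀ μ, ContDiff ℝ ∞ (B μ)) (y : Sp d) :
    ContDiff ℝ ∞ (Function.uncurry fun x (r : ℝ) =>
      ∑ μ, (y - x) μ • B μ ((1 - r) • x + r • y)) :=
  ContDiff.sum fun μ _ => ContDiff.smul
    ((contDiff_apply_coord μ).comp (contDiff_const.sub contDiff_fst))
    ((hB μ).comp (((contDiff_const.sub contDiff_snd).smul contDiff_fst).add
      (contDiff_snd.smul contDiff_const)))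

theorem wilson_eq_orderedExp_left (x y : Sp d) : wilson B x y =
    orderedExp (fun x r => ∑ μ, (x - y) μ • B μ ((1 - r) • y + r • x)) x :=
  tsum_congr fun k => wilsonTerm_eq_volt_left x y k 1

theorem contDiff_wilson_left (hB : ∀ μ, ContDiff ℝ ∞ (B μ)) (y : Sp d) :
    ContDiff ℝ ∞ fun x => wilson B x y := by
  simp only [wilson_eq_orderedExp_left]
  exact contDiff_orderedExp (contDiff_segment_left hB y)

theorem contDiff_wilson_right (hB : ∀ μ, ContDiff ℝ ∞ (B μ)) (y : Sp d) :
    ContDiff ℝ ∞ fun x => wilson B y x := by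
  simp only [wilson, wilsonTerm_eq_volt_right]
  exact contDiff_orderedExp (contDiff_segment_right hB y)

theorem contDiff_gaugeConn (hB : ∀ μ, ContDiff ℝ ∞ (B μ)) (y : Sp d) (μ : Fin d) :
    ContDiff ℝ ∞ (gaugeConn B y μ) := by
  have ht : ContDiff ℝ ∞ fun ξ : Sp d => y + ξ := contDiff_const.add contDiff_id
  have hl := contDiff_wilson_left hB y
  have hp : ContDiff ℝ ∞ (pd μ fun x => wilson B x y) :=
    (hl.fderiv_right (m := ∞) (by simp)).clm_apply contDiff_const
  exact ((contDiff_wilson_right hB y).comp ht).mul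
    ((hp.comp ht).add (((hB μ).comp ht).mul (hl.comp ht)))

theorem contDiff_gaugePot (hB : ∀ μ, ContDiff ℝ ∞ (B μ)) {v : Sp d → Mat m} (hv : ContDiff ℝ ∞ v)
    (y : Sp d) : ContDiff ℝ ∞ (gaugePot B v y) := by
  have ht : ContDiff ℝ ∞ fun ξ : Sp d => y + ξ := contDiff_const.add contDiff_id
  exact (((contDiff_wilson_right hB y).comp ht).mul (hv.comp ht)).mul
    ((contDiff_wilson_left hB y).comp ht)

/-- Moving the end point along the ray is a reparametrisation of the segment, so the radial
dependence of `Φ` becomes the dependence on the upper limit of integration. -/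
theorem wilsonTerm_add_smul (y ξ : Sp d) (a : ℝ) (k : ℕ) (s : ℝ) :
    wilsonTerm B (y + a • ξ) y k s = wilsonTerm B (y + ξ) y k (a * s) := by
  induction k generalizing s with
  | zero => rfl
  | succ k ih =>
    have h1 : ∀ r : ℝ, (∑ μ, (y + a • ξ - y) μ • B μ ((1 - r) • y + r • (y + a • ξ))) *
        wilsonTerm B (y + a • ξ) y k r =
        a • ((∑ μ, (y + ξ - y) μ • B μ ((1 - a * r) • y + (a * r) • (y + ξ))) *
          wilsonTerm B (y + ξ) y k (a * r)) := fun r => by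
      have e1 : (1 - r) • y + r • (y + a • ξ) = (1 - a * r) • y + (a * r) • (y + ξ) := by module
      rw [ih, e1, ← smul_mul_assoc, Finset.smul_sum]
      simp only [add_sub_cancel_left, PiLp.smul_apply, smul_eq_mul, smul_smul]
    simp only [wilsonTerm, h1]
    rw [intervalIntegral.integral_smul, intervalIntegral.smul_integral_comp_mul_left
      (fun r => (∑ μ, (y + ξ - y) μ • B μ ((1 - r) • y + r • (y + ξ))) *
        wilsonTerm B (y + ξ) y k r), mul_zero]

/-- Parallel transport along the ray. After the reparametrisation the fundamental theorem of
calculus differentiates the outermost integral of each term; the series may be differentiated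
termwise. -/
theorem fderiv_wilson_left (hB : ∀ μ, ContDiff ℝ ∞ (B μ)) (y ξ : Sp d) :
    fderiv ℝ (fun x => wilson B x y) (y + ξ) ξ =
      -((∑ μ, ξ μ • B μ (y + ξ)) * wilson B (y + ξ) y) := by
  have hA := contDiff_segment_left hB y
  have hs := hasSum_fderiv_volt hA (y + ξ) ξ
  have hΦ : (fun x => wilson B x y) = _ := funext fun x => wilson_eq_orderedExp_left x y
  rw [← hΦ] at hs
  simp only [← wilsonTerm_eq_volt_left] at hs
  have hterm : ∀ k, fderiv ℝ (fun x => wilsonTerm B x y (k + 1) 1) (y + ξ) ξ =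
      -((∑ μ, ξ μ • B μ (y + ξ)) * wilsonTerm B (y + ξ) y k 1) := fun k => by
    have hd : DifferentiableAt ℝ (fun x => wilsonTerm B x y (k + 1) 1) (y + (1 : ℝ) • ξ) := by
      simp only [wilsonTerm_eq_volt_left]
      exact (contDiff_volt_left hA (k + 1) 1).differentiable (by norm_num) _
    have h1 : HasDerivAt (fun a : ℝ => wilsonTerm B (y + a • ξ) y (k + 1) 1)
        (fderiv ℝ (fun x => wilsonTerm B x y (k + 1) 1) (y + (1 : ℝ) • ξ) ((1 : ℝ) • ξ)) 1 := by
      have hg : HasDerivAt (fun a : ℝ => y + a • ξ) ((1 : ℝ) • ξ) 1 :=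
        ((hasDerivAt_id' (1 : ℝ)).smul_const ξ).const_add y
      exact HasFDerivAt.comp_hasDerivAt (f := fun a : ℝ => y + a • ξ) (1 : ℝ) hd.hasFDerivAt hg
    have hc : Continuous fun r => (∑ μ, (y + ξ - y) μ • B μ ((1 - r) • y + r • (y + ξ))) *
        wilsonTerm B (y + ξ) y k r := by
      simp only [wilsonTerm_eq_volt_left]
      exact (hA.continuous.comp (Continuous.prodMk_right (y + ξ))).mul
        (contDiff_volt_right hA k (y + ξ)).continuous
    have h2 := (hc.integral_hasStrictDerivAt 0 1).hasDerivAt.neg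
    have h3 : (fun a : ℝ => wilsonTerm B (y + a • ξ) y (k + 1) 1) = fun a => -∫ r in (0 : ℝ)..a,
        (∑ μ, (y + ξ - y) μ • B μ ((1 - r) • y + r • (y + ξ))) * wilsonTerm B (y + ξ) y k r :=
      funext fun a => by rw [wilsonTerm_add_smul, mul_one]; rfl
    rw [h3] at h1
    have h4 := h1.unique h2
    simpa only [one_smul, add_sub_cancel_left, sub_self, zero_smul, zero_add] using h4
  have hw : HasSum (fun k => wilsonTerm B (y + ξ) y k 1) (wilson B (y + ξ) y) := by
    have := (summable_volt hA (y + ξ) (s := 1) ⟨zero_le_one, le_rfl⟩).hasSum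
    simp only [← wilsonTerm_eq_volt_left] at this
    exact this
  have hw' := (hw.mul_left (∑ μ, ξ μ • B μ (y + ξ))).neg
  have hs' := (hasSum_nat_add_iff' (f := fun k => fderiv ℝ (fun x => wilsonTerm B x y k 1) (y + ξ) ξ) 1).2 hs
  simp only [hterm] at hs'
  have h0 : fderiv ℝ (fun x => wilsonTerm B x y 0 1) (y + ξ) ξ = 0 := by
    change fderiv ℝ (fun _ => (1 : Mat m)) _ _ = _
    simp
  rw [Finset.sum_range_one, h0, sub_zero] at hs'
  exact hs'.unique hw'

/-- The radial covariant derivative of `Φ` vanishes. The left factor `Φ(y, x)` plays no role, so it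
need not be known to be the inverse. -/
theorem sum_smul_gaugeConn (hB : ∀ μ, ContDiff ℝ ∞ (B μ)) (y ξ : Sp d) :
    ∑ μ, ξ μ • gaugeConn B y μ ξ = 0 := by
  have h : ∀ μ, ξ μ • gaugeConn B y μ ξ = wilson B y (y + ξ) *
      (ξ μ • pd μ (fun x => wilson B x y) (y + ξ) +
        (ξ μ • B μ (y + ξ)) * wilson B (y + ξ) y) := fun μ => by
    rw [gaugeConn, ← mul_smul_comm, smul_add, smul_mul_assoc]
  rw [Finset.sum_congr rfl fun μ _ => h μ, ← Finset.mul_sum, Finset.sum_add_distrib, sum_smul_pd,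
    ← Finset.sum_mul, fderiv_wilson_left hB, neg_add_cancel, mul_zero]

/-- The theorem for globally smooth vertices. -/
theorem orderedExpEqSeries_of_contDiff {f : Fin d → Sp d → Mat m} {V : Sp d → Mat m}
    (hf : ∀ μ, ContDiff ℝ ∞ (f μ)) (hV : ContDiff ℝ ∞ V) (h0 : ∀ ξ, ∑ μ, ξ μ • f μ ξ = 0)
    (ξ : Sp d) : OrderedExpEqSeries f V ξ fun k => heatCoeff f V k ξ :=
  orderedExpEqSeries_of_smooth (fun μ => (⟨f μ, hf μ⟩ : Sm d (Mat m))) ⟨V, hV⟩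
    (Sm.ext fun x => by
      rw [Sm.val_eq_ev, map_sum]
      refine Eq.trans ?_ (h0 x)
      refine Finset.sum_congr rfl fun μ _ => ?_
      change (x μ • (1 : Mat m)) * f μ x = _
      rw [smul_mul_assoc, one_mul]) ξ

end Gauge

/-! ### Locality -/

section Locality

variable {W : Set (Sp d)} {f f' : Fin d → Sp d → Mat m} {V V' : Sp d → Mat m}

theorem pd_eqOn (hW : IsOpen W) {ψ ψ' : Sp d → Mat m} (h : Set.EqOn ψ ψ' W) (μ : Fin d) :
    Set.EqOn (pd μ ψ) (pd μ ψ') W := fun x hx => by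
  rw [pd, pd, (h.eventuallyEq_of_mem (hW.mem_nhds hx)).fderiv_eq]

theorem covD_eqOn (hW : IsOpen W) (hf : ∀ μ, Set.EqOn (f μ) (f' μ) W) {ψ ψ' : Sp d → Mat m}
    (h : Set.EqOn ψ ψ' W) (μ : Fin d) : Set.EqOn (covD f μ ψ) (covD f' μ ψ') W := fun x hx => by
  rw [covD, covD, pd_eqOn hW h μ hx, hf μ hx, h hx]

theorem lap_eqOn (hW : IsOpen W) (hf : ∀ μ, Set.EqOn (f μ) (f' μ) W) (hV : Set.EqOn V V' W)
    {ψ ψ' : Sp d → Mat m} (h : Set.EqOn ψ ψ' W) : Set.EqOn (lap f V ψ) (lap f' V' ψ') W :=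
  fun x hx => by
    rw [lap, lap, hV hx, h hx, Finset.sum_congr rfl fun μ _ =>
      covD_eqOn hW hf (covD_eqOn hW hf h μ) μ hx]

theorem smul_mem_of_convex (hc : Convex ℝ W) (h0 : 0 ∈ W) {ξ : Sp d} (hξ : ξ ∈ W) {s : ℝ}
    (hs : s ∈ Set.Icc (0 : ℝ) 1) : s • ξ ∈ W :=
  (hc.starConvex h0).smul_mem hξ hs.1 hs.2

theorem heatCoeff_eqOn (hW : IsOpen W) (hc : Convex ℝ W) (h0 : 0 ∈ W)
    (hf : ∀ μ, Set.EqOn (f μ) (f' μ) W) (hV : Set.EqOn V V' W) (n : ℕ) :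
    Set.EqOn (heatCoeff f V n) (heatCoeff f' V' n) W := by
  induction n with
  | zero => exact fun _ _ => rfl
  | succ n ih =>
    intro ξ hξ
    rw [heatCoeff, heatCoeff, intervalIntegral.integral_congr fun s hs => ?_]
    rw [Set.uIcc_of_le zero_le_one] at hs
    exact congrArg (s ^ n • ·) (lap_eqOn hW hf hV ih (smul_mem_of_convex hc h0 hξ hs))

/-- The operator sees only the Taylor coefficients of `h` at `p`. Hence `M(t)` depends only on germs
at points of the segment from `0` to `ξ`. -/
theorem taylorOp_congr {h h' : Sp d → Mat m} {p : Sp d} (hh : h =ᶠ[𝓝 p] h') (ρ : ℝ → ℝ) (ε t : ℝ)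
    (P : Functional d m) : taylorOp ρ ε t h p P = taylorOp ρ ε t h' p P := by
  funext η
  simp only [taylorOp]
  exact tsum_congr fun j => by rw [(hh.iteratedFDeriv ℝ j).eq_of_nhds]

theorem opMProd_congr (hW : IsOpen W) (hf : ∀ μ, Set.EqOn (f μ) (f' μ) W) (hV : Set.EqOn V V' W)
    (ρ : ℝ → ℝ) (ε : ℝ) {ξ : Sp d} {τ : ℝ} {n : ℕ} {t : Fin n → ℝ}
    (ht : ∀ i, (t i / τ) • ξ ∈ W) (P : Functional d m) :
    opMProd f V ρ ε ξ τ n t P = opMProd f' V' ρ ε ξ τ n t P := by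
  induction n with
  | zero => rfl
  | succ n ih =>
    have hn := hW.mem_nhds (ht 0)
    rw [opMProd, opMProd, ih (t := Fin.tail t) fun i => ht i.succ]
    funext η
    rw [opM, opM, taylorOp_congr (hV.eventuallyEq_of_mem hn)]
    simp only [fun μ => taylorOp_congr ((hf μ).eventuallyEq_of_mem hn)]

theorem OrderedExpEqSeries.congr (hW : IsOpen W) (hc : Convex ℝ W) (h0 : 0 ∈ W)
    (hf : ∀ μ, Set.EqOn (f μ) (f' μ) W) (hV : Set.EqOn V V' W) {ξ : Sp d} (hξ : ξ ∈ W)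
    (h : OrderedExpEqSeries f' V' ξ fun k => heatCoeff f' V' k ξ) :
    OrderedExpEqSeries f V ξ fun k => heatCoeff f V k ξ := by
  obtain ⟨c, h1, h2, h3⟩ := h
  refine ⟨c, h1, fun τ hτ ρ hρ n j => ?_, fun k =>
    (h3 k).trans (heatCoeff_eqOn hW hc h0 hf hV k hξ).symm⟩
  have he : ∀ ε, expTerm f V ρ ε ξ τ n j = expTerm f' V' ρ ε ξ τ n j := fun ε =>
    setIntegral_congr_fun (isClosed_orderedTimes τ n).measurableSet fun t ht => congrFun
      (opMProd_congr hW hf hV ρ ε (fun i => smul_mem_of_convex hc h0 hξ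
        ⟨div_nonneg (ht.2 i).1 hτ.le, div_le_one_of_le₀ (ht.2 i).2 hτ.le⟩) _) 0
  simp only [he]
  exact h2 τ hτ ρ hρ n j

/-- The segment is compact and has thickenings inside `U`. Taking `W` as a thickening keeps it
convex, which the radial integrals and the ordered exponentials require. -/
theorem exists_cutoff {U : Set (Sp d)} (hU : IsOpen U) (hc : Convex ℝ U) {a b : Sp d} (ha : a ∈ U)
    (hb : b ∈ U) : ∃ W : Set (Sp d), IsOpen W ∧ Convex ℝ W ∧ a ∈ W ∧ b ∈ W ∧ W ⊆ U ∧
      ∃ χ : Sp d → ℝ, (∀ x ∈ W, χ x = 1) ∧ (∀ x ∉ U, χ x = 0) ∧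
        ∀ g : Sp d → Mat m, ContDiffOn ℝ ∞ g U → ContDiff ℝ ∞ fun x => χ x • g x := by
  have hK : IsCompact (segment ℝ a b) := by
    rw [segment_eq_image_lineMap]
    exact isCompact_Icc.image AffineMap.lineMap_continuous
  obtain ⟨δ, hδ, hδU⟩ := hK.exists_cthickening_subset_open hU (hc.segment_subset ha hb)
  have hsub : segment ℝ a b ⊆ Metric.thickening (δ / 2) (segment ℝ a b) :=
    Metric.self_subset_thickening (half_pos hδ) _
  obtain ⟨χ, h0, h1, -⟩ := exists_contMDiffMap_zero_one_of_isClosed (n := ⊤)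
    (modelWithCornersSelf ℝ (Sp d))
    (Metric.isOpen_thickening (δ := δ) (E := segment ℝ a b)).isClosed_compl
    (Metric.isClosed_cthickening (δ := δ / 2) (E := segment ℝ a b))
    (Set.disjoint_left.2 fun x hx hx' => hx
      (Metric.cthickening_subset_thickening' hδ (half_lt_self hδ) _ hx'))
  have hχ0 : ∀ x ∉ Metric.cthickening δ (segment ℝ a b), χ x = 0 := fun x hx =>
    h0 fun hx' => hx (Metric.thickening_subset_cthickening _ _ hx')
  refine ⟨Metric.thickening (δ / 2) (segment ℝ a b), Metric.isOpen_thickening,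
    (convex_segment a b).thickening _, hsub (left_mem_segment ℝ a b),
    hsub (right_mem_segment ℝ a b), fun x hx => hδU (Metric.thickening_subset_cthickening _ _
      (Metric.thickening_mono (half_le_self hδ.le) _ hx)), χ,
    fun x hx => h1 (Metric.thickening_subset_cthickening _ _ hx),
    fun x hx => hχ0 x fun hx' => hx (hδU hx'), fun g hg => contDiff_iff_contDiffAt.2 fun x => ?_⟩
  by_cases hx : x ∈ U
  · exact χ.contMDiff.contDiff.contDiffAt.smul (hg.contDiffAt (hU.mem_nhds hx))
  · have hn := Metric.isClosed_cthickening.isOpen_compl.mem_nhds fun hx' => hx (hδU hx')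
    refine (contDiffAt_const (c := 0)).congr_of_eventuallyEq ?_
    filter_upwards [hn] with z hz
    rw [hχ0 z hz, zero_smul]

theorem wilson_congr (hc : Convex ℝ W) (hf : ∀ μ, Set.EqOn (f μ) (f' μ) W) {x y : Sp d}
    (hx : x ∈ W) (hy : y ∈ W) : wilson f x y = wilson f' x y := by
  have h : ∀ k, ∀ s ∈ Set.Icc (0 : ℝ) 1, wilsonTerm f x y k s = wilsonTerm f' x y k s := fun k => by
    induction k with
    | zero => exact fun _ _ => rfl
    | succ k ih =>
      intro s hs
      rw [wilsonTerm, wilsonTerm, intervalIntegral.integral_congr fun r hr => ?_]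
      rw [Set.uIcc_of_le hs.1] at hr
      have hr1 := hr.2.trans hs.2
      have hm := hc hy hx (sub_nonneg.2 hr1) hr.1 (sub_add_cancel 1 r)
      simp only [ih r ⟨hr.1, hr1⟩, fun μ => hf μ hm]
  exact tsum_congr fun k => h k 1 ⟨zero_le_one, le_rfl⟩

end Locality

/-! ### The covariant Taylor series -/

section Series

variable {B : Fin d → Sp d → Mat m}

theorem fieldStrength_antisymm (μ ν : Fin d) :
    fieldStrength B μ ν = fun x => -fieldStrength B ν μ x := by
  funext x
  simp only [fieldStrength]
  abel

theorem pd_neg (μ : Fin d) (G : Sp d → Mat m) (x : Sp d) :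
    pd μ (fun x => -G x) x = -pd μ G x := by
  have h : fderiv ℝ (fun x => -G x) x = -fderiv ℝ G x := fderiv_fun_neg
  exact congrArg (fun L => L (e μ)) h

theorem nablaIter_neg (k : ℕ) (α : Fin k → Fin d) (G : Sp d → Mat m) :
    nablaIter B k α (fun x => -G x) = fun x => -nablaIter B k α G x := by
  induction k with
  | zero => rfl
  | succ k ih =>
    funext x
    rw [nablaIter, ih, nablaIter]
    simp only [nabla, pd_neg, mul_neg, neg_mul]
    abel

/-- The innermost factor `F_{μ_{k+1} μ}` is antisymmetric, also after covariant derivatives, and is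
contracted with the symmetric `ξ^{μ_{k+1}} ξ^μ`. -/
theorem sum_smul_radialTerm (y ξ : Sp d) (k : ℕ) : ∑ μ, ξ μ • radialTerm B y μ ξ k = 0 := by
  let N : (Fin k → Fin d) → Fin d → Fin d → Mat m := fun β ν μ =>
    nablaIter B k β (fieldStrength B ν μ) y
  have hN : ∀ β ν μ, N β ν μ = -N β μ ν := fun β ν μ => by
    simp only [N]
    rw [fieldStrength_antisymm, nablaIter_neg]
  have hS : ∀ β, ∑ μ, ∑ ν, (ξ μ * ξ ν) • N β ν μ = 0 := fun β => by
    have h1 : ∑ μ, ∑ ν, (ξ μ * ξ ν) • N β ν μ = -∑ μ, ∑ ν, (ξ μ * ξ ν) • N β ν μ := by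
      conv_lhs => rw [Finset.sum_comm]
      simp only [← Finset.sum_neg_distrib]
      refine Finset.sum_congr rfl fun μ _ => Finset.sum_congr rfl fun ν _ => ?_
      rw [hN, smul_neg, mul_comm]
    rw [eq_neg_iff_add_eq_zero, ← two_smul ℝ] at h1
    exact (smul_eq_zero.1 h1).resolve_left two_ne_zero
  have h2 : ∀ μ, ξ μ • radialTerm B y μ ξ k = (((k + 2)! : ℕ) : ℝ)⁻¹ •
      ∑ β : Fin k → Fin d, (∏ i, ξ (β i)) • ∑ ν, (ξ μ * ξ ν) • N β ν μ := fun μ => by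
    rw [radialTerm, sum_snoc, Finset.sum_comm, smul_comm, Finset.smul_sum]
    congr 1
    refine Finset.sum_congr rfl fun β _ => ?_
    simp only [Finset.smul_sum, smul_smul, Fin.prod_univ_castSucc, Fin.snoc_castSucc,
      Fin.snoc_last, N]
    refine Finset.sum_congr rfl fun ν _ => ?_
    congr 1
    ring
  simp only [h2, ← Finset.smul_sum]
  rw [Finset.sum_comm]
  simp only [← Finset.smul_sum, hS, smul_zero, Finset.sum_const_zero]

theorem sum_smul_radialConn {y ξ : Sp d} (h : ∀ μ, Summable (radialTerm B y μ ξ)) :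
    ∑ μ, ξ μ • radialConn B y μ ξ = 0 := by
  have h1 : HasSum (fun k => ∑ μ, ξ μ • radialTerm B y μ ξ k) (∑ μ, ξ μ • radialConn B y μ ξ) :=
    hasSum_sum fun μ _ => (h μ).hasSum.const_smul (ξ μ)
  simp only [sum_smul_radialTerm] at h1
  exact h1.unique hasSum_zero

theorem seriesConn_eq (y : Sp d) (μ : Fin d) (ξ : Sp d) :
    seriesConn B y μ ξ = fderiv ℝ (radialConn B y μ) ξ ξ := sum_smul_pd _ _ _

theorem contDiffOn_seriesConn {U : Set (Sp d)} (hU : IsOpen U) {y : Sp d} {μ : Fin d}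
    (h : ContDiffOn ℝ ∞ (radialConn B y μ) U) : ContDiffOn ℝ ∞ (seriesConn B y μ) U := by
  rw [funext (seriesConn_eq y μ)]
  exact (h.fderiv_of_isOpen hU (m := ∞) (by simp)).clm_apply contDiffOn_id

/-- Along the ray the identity `(aξ)^μ f_μ(aξ) = 0` may be divided by `a`, so `ξ^μ f_μ(aξ)` vanishes
near `a = 1`; its derivative there is the claim. -/
theorem sum_smul_seriesConn {U : Set (Sp d)} (hU : IsOpen U) {y : Sp d}
    (hs : ∀ ξ ∈ U, ∀ μ, Summable (radialTerm B y μ ξ))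
    (h : ∀ μ, ContDiffOn ℝ ∞ (radialConn B y μ) U) {ξ : Sp d} (hξ : ξ ∈ U) :
    ∑ μ, ξ μ • seriesConn B y μ ξ = 0 := by
  have hg : HasDerivAt (fun a : ℝ => a • ξ) ((1 : ℝ) • ξ) 1 := (hasDerivAt_id' (1 : ℝ)).smul_const ξ
  have hU1 : U ∈ 𝓝 ((1 : ℝ) • ξ) := by rw [one_smul]; exact hU.mem_nhds hξ
  have h1 : HasDerivAt (fun a : ℝ => ∑ μ, ξ μ • radialConn B y μ (a • ξ))
      (∑ μ, ξ μ • fderiv ℝ (radialConn B y μ) ((1 : ℝ) • ξ) ((1 : ℝ) • ξ)) 1 :=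
    HasDerivAt.fun_sum fun μ _ => HasDerivAt.const_smul (ξ μ)
      (HasFDerivAt.comp_hasDerivAt (f := fun a : ℝ => a • ξ) (1 : ℝ)
        (((h μ).contDiffAt hU1).differentiableAt (by simp)).hasFDerivAt hg)
  have h2 : (fun a : ℝ => ∑ μ, ξ μ • radialConn B y μ (a • ξ)) =ᶠ[𝓝 1] fun _ => 0 := by
    filter_upwards [hg.continuousAt hU1, eventually_ne_nhds one_ne_zero] with a ha ha0
    have h3 := sum_smul_radialConn (hs _ ha)
    simp only [PiLp.smul_apply, smul_eq_mul, mul_smul, ← Finset.smul_sum] at h3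
    exact (smul_eq_zero.1 h3).resolve_left ha0
  have h4 := h1.unique ((hasDerivAt_const (1 : ℝ) (0 : Mat m)).congr_of_eventuallyEq h2)
  simpa only [seriesConn_eq, one_smul] using h4

end Series

/-! ### The exponential formula -/

theorem orderedExpEqSeries_gauge {Ω : Set (Sp d)} (hΩo : IsOpen Ω) (hΩc : Convex ℝ Ω)
    {B : Fin d → Sp d → Mat m} (hB : ∀ μ, ContDiffOn ℝ ∞ (B μ) Ω) {v : Sp d → Mat m}
    (hv : ContDiffOn ℝ ∞ v Ω) {x y : Sp d} (hx : x ∈ Ω) (hy : y ∈ Ω) :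
    OrderedExpEqSeries (gaugeConn B y) (gaugePot B v y) (x - y)
      fun k => heatCoeff (gaugeConn B y) (gaugePot B v y) k (x - y) := by
  obtain ⟨W, hWo, hWc, hyW, hxW, -, χ, hχ, -, hg⟩ := exists_cutoff (m := m) hΩo hΩc hy hx
  -- The cutoff is applied to `B` and `v` before passing to the gauge, so that the gauge condition
  -- holds globally for the connection obtained from `B'`.
  let B' : Fin d → Sp d → Mat m := fun μ x => χ x • B μ x
  have hB' : ∀ μ, ContDiff ℝ ∞ (B' μ) := fun μ => hg _ (hB μ)
  have hBW : ∀ μ, Set.EqOn (B μ) (B' μ) W := fun μ z hz => by simp only [B', hχ z hz, one_smul]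
  have hl : Set.EqOn (fun z => wilson B z y) (fun z => wilson B' z y) W := fun z hz =>
    wilson_congr hWc hBW hz hyW
  refine OrderedExpEqSeries.congr (W := (fun ξ => y + ξ) ⁻¹' W)
    (hWo.preimage (continuous_const_add y)) (hWc.translate_preimage_right y) (by simpa using hyW)
    (f' := gaugeConn B' y) (V' := gaugePot B' (fun x => χ x • v x) y) (fun μ ξ hξ => ?_)
    (fun ξ hξ => ?_) (by simpa using hxW)
    (orderedExpEqSeries_of_contDiff (contDiff_gaugeConn hB' y) (contDiff_gaugePot hB' (hg v hv) y)
      (sum_smul_gaugeConn hB' y) _)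
  · rw [gaugeConn, gaugeConn, pd_eqOn hWo hl μ hξ, hBW μ hξ, wilson_congr hWc hBW hyW hξ,
      wilson_congr hWc hBW hξ hyW]
  · rw [gaugePot, gaugePot, wilson_congr hWc hBW hyW hξ, wilson_congr hWc hBW hξ hyW, hχ _ hξ,
      one_smul]

theorem orderedExpEqSeries_series {B : Fin d → Sp d → Mat m} {v : Sp d → Mat m} {y ξ : Sp d}
    {U : Set (Sp d)} (hUo : IsOpen U) (hUc : Convex ℝ U) (h0 : 0 ∈ U) (hξ : ξ ∈ U)
    (hs : ∀ ξ ∈ U, ∀ μ, Summable (radialTerm B y μ ξ))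
    (hf : ∀ μ, ContDiffOn ℝ ∞ (radialConn B y μ) U) (hV : ContDiffOn ℝ ∞ (seriesPot B v y) U) :
    OrderedExpEqSeries (seriesConn B y) (seriesPot B v y) ξ
      fun k => heatCoeff (seriesConn B y) (seriesPot B v y) k ξ := by
  obtain ⟨W, hWo, hWc, h0W, hξW, -, χ, hχ, hχ0, hg⟩ := exists_cutoff (m := m) hUo hUc h0 hξ
  -- Here the cutoff multiplies the connection itself; a scalar factor respects the gauge condition,
  -- which outside `U` holds because the cutoff is zero.
  refine OrderedExpEqSeries.congr hWo hWc h0W (f' := fun μ ζ => χ ζ • seriesConn B y μ ζ)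
    (V' := fun ζ => χ ζ • seriesPot B v y ζ) (fun μ ζ hζ => by simp only [hχ ζ hζ, one_smul])
    (fun ζ hζ => by simp only [hχ ζ hζ, one_smul]) hξW
    (orderedExpEqSeries_of_contDiff (fun μ => hg _ (contDiffOn_seriesConn hUo (hf μ))) (hg _ hV)
      (fun ζ => ?_) _)
  by_cases hζ : ζ ∈ U
  · simp only [smul_comm (ζ _) (χ ζ), ← Finset.smul_sum, sum_smul_seriesConn hUo hs hf hζ, smul_zero]
  · simp only [hχ0 ζ hζ, zero_smul, smul_zero, Finset.sum_const_zero]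

end Matrices

end HeatExp

end

theorem mainTheorem3 {d m : ℕ} (Ω : Set (HeatExp.Sp d)) (hΩo : IsOpen Ω) (hΩc : Convex ℝ Ω)
    (B : Fin d → HeatExp.Sp d → HeatExp.Mat m) (hB : ∀ μ, ContDiffOn ℝ ∞ (B μ) Ω)
    (v : HeatExp.Sp d → HeatExp.Mat m) (hv : ContDiffOn ℝ ∞ v Ω)
    (x y : HeatExp.Sp d) (hx : x ∈ Ω) (hy : y ∈ Ω) :
    HeatExp.OrderedExpEqSeries (HeatExp.gaugeConn B y) (HeatExp.gaugePot B v y) (x - y)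
      (fun k => HeatExp.heatCoeff (HeatExp.gaugeConn B y) (HeatExp.gaugePot B v y) k (x - y)) ∧
    ∀ U : Set (HeatExp.Sp d), IsOpen U → Convex ℝ U → 0 ∈ U → x - y ∈ U →
      (∀ ξ ∈ U, (∀ μ, Summable (HeatExp.radialTerm B y μ ξ)) ∧
        Summable (HeatExp.potTerm B v y ξ)) →
      (∀ μ, ContDiffOn ℝ ∞ (HeatExp.radialConn B y μ) U) →
      ContDiffOn ℝ ∞ (HeatExp.seriesPot B v y) U →
      HeatExp.OrderedExpEqSeries (HeatExp.seriesConn B y) (HeatExp.seriesPot B v y) (x - y)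
        (fun k => HeatExp.heatCoeff (HeatExp.seriesConn B y) (HeatExp.seriesPot B v y) k
          (x - y)) :=
  ⟨HeatExp.orderedExpEqSeries_gauge hΩo hΩc hB hv hx hy, fun _ hUo hUc h0 hξ hs hf hV =>
    HeatExp.orderedExpEqSeries_series hUo hUc h0 hξ (fun ζ hζ => (hs ζ hζ).1) hf hV⟩
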